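/- Let $2\le a\le M$ be integers with $M>4$. **Walks and labels.** Order the labels $(x,i)$, $x\in\mathbb Z$, $1\le i\le a-1$, lexicographically, and let $Y_{x,i}$ be independent continuous-time simple symmetric random walks on $\mathbb Z$ of total jump rate $2$ with $Y_{x,i}(0)=x$. **Auxiliary front.** For $r\in\mathbb Z$ and $k\ge1$ let $\nu_k$ be the first time at which one of the walks whose label $(x,i)$ satisfies $x\ge r$ and is among the $M$ largest labels not exceeding $(r+k-1,a-1)$ visits $r+k$. Put $\tilde r^{\,r}_t=r+n$ for $\nu_1+\dots+\nu_n\le t<\nu_1+\dots+\nu_{n+1}$. **Labelled combustion process.** A state consists of a rightmost visited site $r$, a set of live labels $(x,i)$ with $x\le r$ (at least one of them with $x=r$), and positions $\le r$ of the live particles, with at most $M$ particles per site. A live particle with label $(x,i)$, activated at time $s$ at position $z$, follows $Z_{x,i}(t)=Y_{x,i}(t-s)+z-x$. When a particle jumps from the rightmost visited site $r$ to $r+1$, the site $r+1$ becomes the rightmost visited site and $a-1$ new particles with labels $(r+1,1),\dots,(r+1,a-1)$ are activated there. When a particle jumps to a site containing $M$ particles, the particle with the smallest label among the $M+1$ particles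 then at that site is killed. Let $r_t$ be the rightmost visited site at time $t$, $r_\infty=\infty$, and $T_y=\inf\{t\ge0:r_t\ge y\}$. Write $\mathbb P_{a\delta_0}$ for the law of the process started with $r_0=0$ and exactly $a$ particles, all at site $0$, among them those with labels $(0,1),\dots,(0,a-1)$ (the remaining one has an arbitrary label $(x,i)$ with $x<0$). **Regeneration time.** Given $\alpha'>0$, let $$U\circ\theta_s=\inf\{t\ge0:\tilde r^{\,r_s}_t-r_s<\lfloor\alpha't\rfloor\},\qquad U=U\circ\theta_0,$$ where $\tilde r^{\,r_s}$ is the auxiliary front started from $r_s$. Let $V\circ\theta_s$ be the first $t\ge0$ at which one of the particles alive at time $s$ and located at time $s$ strictly to the left of $r_s$, each followed along its walk $Z_{x,i}$ regardless of killing after time $s$, is at time $s+t$ at a site $\ge r_s+\lfloor\alpha't\rfloor$. Put $D\circ\theta_s=\min\{U\circ\theta_s,V\circ\theta_s\}$. With $R_0=r_0$ and $L=M$ define, for $k\ge0$, $$S_{k+1}=T_{R_k+L},\qquad D_{k+1}=S_{k+1}+D\circ\theta_{S_{k+1}},\qquad R_{k+1}=r_{D_{k+1}},$$ $K=\inf\{k\ge1:S_k<\infty,\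 D_k=\infty\}$, and let $\kappa_1=S_K$ be the first regeneration time ($\kappa_1=\infty$ if $K=\infty$). **Theorem.** There is $\alpha>0$ such that, for every $r\in\mathbb Z$, $\tilde r^{\,r}_t/t\to\alpha$ almost surely as $t\to\infty$; and for every $\alpha'$ with $0<\alpha'<\alpha$ the following hold. 1. $\mathbb P_{a\delta_0}[U=\infty]>0$, and for every $p$ with $0\le p<M/2$ there is $C<\infty$ such that, for all $t>0$, $$\mathbb P_{a\delta_0}[\kappa_1>t\mid U=\infty]\le C\,t^{-p/2}.$$ 2. $\kappa_1$ and $r_{\kappa_1}$ are measurable up to null sets, $\mathbb E_{a\delta_0}[\kappa_1\mid U=\infty]<\infty$ and $\mathbb E_{a\delta_0}[\,|r_{\kappa_1}|\mid U=\infty]<\infty$. 3. If $M>8$, then $\mathbb E_{a\delta_0}[\kappa_1^2\mid U=\infty]<\infty$ and $\mathbb E_{a\delta_0}[r_{\kappa_1}^2\mid U=\infty]<\infty$. -/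

import Mathlib

open MeasureTheory ProbabilityTheory Filter Topology
open scoped NNReal ENNReal

noncomputable section

namespace Combustion

/-! ### Labels and random walks -/

/-- Particle labels `(x, i)`, ordered lexicographically. The second coordinate ranges over a set
with `a - 1` elements. -/
abbrev Label (a : ℕ) : Type := ℤ ×ₗ Fin (a - 1)

/-- The label `(x, i)`. -/
abbrev mkLabel {a : ℕ} (x : ℤ) (i : Fin (a - 1)) : Label a := toLex (x, i)

/-- The site `x` of a label `(x, i)`. -/
abbrev Label.site {a : ℕ} (l : Label a) : ℤ := (ofLex l).1

/-- A family of paths `t ↦ Y_{x,i}(t)`, one for each label. -/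
abbrev Walks (a : ℕ) : Type := Label a → ℝ≥0 → ℤ

/-- The sample space: for every label and every `n`, the `n`-th holding time and the `n`-th step of
the walk with that label. -/
abbrev Sample (a : ℕ) : Type := Label a × ℕ → ℝ × ℤ

/-- The law of one step of the simple symmetric random walk: `±1` with probability `1/2` each. -/
def stepLaw : Measure ℤ :=
  (2⁻¹ : ℝ≥0∞) • Measure.dirac 1 + (2⁻¹ : ℝ≥0∞) • Measure.dirac (-1)

/-- The law under which all holding times are exponential of rate `2`, all steps are symmetric, and
all these variables are independent. -/
def walkMeasure (a : ℕ) : Measure (Sample a) :=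
  Measure.infinitePi fun _ => (expMeasure 2).prod stepLaw

instance : IsProbabilityMeasure stepLaw :=
  ⟨by simp [stepLaw, ENNReal.inv_two_add_inv_two]⟩

instance (a : ℕ) : IsProbabilityMeasure (walkMeasure a) := by
  have : IsProbabilityMeasure (expMeasure 2) := isProbabilityMeasure_expMeasure (by norm_num)
  unfold walkMeasure
  infer_instance

/-- The time of the `n`-th jump. -/
def jumpInstant {a : ℕ} (ω : Sample a) (l : Label a) (n : ℕ) : ℝ :=
  ∑ j ∈ Finset.range n, (ω (l, j)).1

/-- The number of jumps up to time `t`. -/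
def jumpCount {a : ℕ} (ω : Sample a) (l : Label a) (t : ℝ≥0) : ℕ :=
  sSup {n : ℕ | jumpInstant ω l n ≤ t}

/-- The independent continuous time simple symmetric random walks `Y_{x,i}` of total jump rate `2`,
with `Y_{x,i}(0) = x`. -/
def walks {a : ℕ} (ω : Sample a) : Walks a := fun l t =>
  l.site + ∑ j ∈ Finset.range (jumpCount ω l t), (ω (l, j)).2

/-! ### The auxiliary process -/

/-- The set `A_{r,z}`: the labels `(x, i)` with `x ≥ r` that belong to the `M` largest labels
not exceeding `(z, a - 1)`. -/
def auxLabels (M : ℕ) {a : ℕ} (r z : ℤ) : Set (Label a) :=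
  {l | r ≤ l.site ∧ l.site ≤ z ∧ {l' : Label a | l < l' ∧ l'.site ≤ z}.encard < M}

/-- The waiting time `ν_k`, `k ≥ 1`: the first time one of the walks with label in
`A_{r,r+k-1}` visits `r + k`. -/
def auxWait (M : ℕ) {a : ℕ} (Y : Walks a) (r : ℤ) (k : ℕ) : ℝ≥0∞ :=
  ⨅ (t : ℝ≥0) (_ : ∃ l ∈ auxLabels M r (r + k - 1), Y l t = r + k), (t : ℝ≥0∞)

/-- The auxiliary front started from `r`: it equals `r + n` while
`ν_1 + ⋯ + ν_n ≤ t < ν_1 + ⋯ + ν_{n+1}`. -/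
def auxFront (M : ℕ) {a : ℕ} (Y : Walks a) (r : ℤ) (t : ℝ≥0) : ℤ :=
  r + (sSup {n : ℕ | ∑ k ∈ Finset.Icc 1 n, auxWait M Y r k ≤ t} : ℕ)

/-- The time `U` for the auxiliary front started from `r`: the first time that its displacement is
smaller than `⌊α' t⌋`. -/
def timeU (M : ℕ) {a : ℕ} (α' : ℝ) (Y : Walks a) (r : ℤ) : ℝ≥0∞ :=
  ⨅ (t : ℝ≥0) (_ : auxFront M Y r t - r < ⌊α' * t⌋), (t : ℝ≥0∞)

/-! ### The labelled process -/

/-- A state of the labelled process with finitely many live particles: the rightmost visited site,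
the labels of the live particles and their positions (only the values on live labels matter). -/
structure State (a : ℕ) where
  front : ℤ
  live : Finset (Label a)
  pos : Label a → ℤ

/-- The number of live particles at site `y`. -/
def State.count {a : ℕ} (w : State a) (y : ℤ) : ℕ := (w.live.filter fun l => w.pos l = y).card

/-- The states allowed in the model: the largest site of a live label is the rightmost visited
site, no live particle is to the right of it, and there are at most `M` particles per site. -/
def State.Admissible {a : ℕ} (M : ℕ) (w : State a) : Prop :=
  (∀ l ∈ w.live, l.site ≤ w.front ∧ w.pos l ≤ w.front) ∧
    (∃ l ∈ w.live, l.site = w.front) ∧ ∀ y, w.count y ≤ M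

/-- The state `w` is a labelling of `a δ_0`: the rightmost visited site is `0`, the labels
`(0, 1), …, (0, a - 1)` are live with position `0`, and the particle count is `a` at `0` and `0`
elsewhere. -/
def State.IsInitial {a : ℕ} (M : ℕ) (w : State a) : Prop :=
  w.Admissible M ∧ w.front = 0 ∧
    (∀ i : Fin (a - 1), mkLabel 0 i ∈ w.live ∧ w.pos (mkLabel 0 i) = 0) ∧
    ∀ y, w.count y = if y = 0 then a else 0

/-- The labelled process right after one of its jumps: the time of the jump, the state, and for
every activated label its activation time and its position at activation. -/
structure Config (a : ℕ) extends State a where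
  time : ℝ≥0∞
  birth : Label a → ℝ≥0
  start : Label a → ℤ

/-- The trajectory `Z_{x,i}(t) = Y_{x,i}(t - s) + z - x` of a particle with label `(x, i)`, where
`s` is its activation time and `z` its position at activation. It ignores killing. -/
def Config.traj {a : ℕ} (Y : Walks a) (c : Config a) (l : Label a) (t : ℝ≥0) : ℤ :=
  Y l (t - c.birth l) + c.start l - l.site

/-- The first time after the last jump at which the particle with label `l` moves. -/
def Config.moveTime {a : ℕ} (Y : Walks a) (c : Config a) (l : Label a) : ℝ≥0∞ :=
  ⨅ (t : ℝ≥0) (_ : c.time < t ∧ c.traj Y l t ≠ c.traj Y l c.time.toNNReal), (t : ℝ≥0∞)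

/-- The time of the next jump of a live particle. -/
def Config.nextTime {a : ℕ} (Y : Walks a) (c : Config a) : ℝ≥0∞ :=
  ⨅ l ∈ c.live, c.moveTime Y l

/-- Update of the configuration when the particle `l` jumps to `y` at time `τ`. A jump beyond the
front moves the front by one and activates `a - 1` new particles there. If the particle
jumps to a site with `M` particles, the one with the smallest label, among the `M + 1` that are then
there, is killed. -/
def Config.update {a : ℕ} (M : ℕ) (c : Config a) (l : Label a) (y : ℤ) (τ : ℝ≥0) : Config a :=
  if c.front < y then
    { front := c.front + 1
      live := c.live ∪ Finset.univ.image (mkLabel (c.front + 1))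
      pos := fun l' => if l' = l ∨ l'.site = c.front + 1 then c.front + 1 else c.pos l'
      time := τ
      birth := fun l' => if l'.site = c.front + 1 then τ else c.birth l'
      start := fun l' => if l'.site = c.front + 1 then c.front + 1 else c.start l' }
  else
    { front := c.front
      live :=
        if c.count y = M then
          c.live.filter fun l' =>
            ¬ ((l' = l ∨ c.pos l' = y) ∧ ∀ l'' ∈ c.live, l'' = l ∨ c.pos l'' = y → l' ≤ l'')
        else c.live
      pos := fun l' => if l' = l then y else c.pos l'
      time := τ
      birth := c.birth
      start := c.start }

open Classical in
/-- One jump of the labelled process. Almost surely exactly one live particle moves at the next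
jump time. -/
def Config.next {a : ℕ} (M : ℕ) (Y : Walks a) (c : Config a) : Config a :=
  match (c.live.filter fun l => c.moveTime Y l = c.nextTime Y).min with
  | ⊤ => { c with time := ⊤ }
  | (l : Label a) =>
    if c.nextTime Y = ⊤ then { c with time := ⊤ }
    else c.update M l (c.traj Y l (c.nextTime Y).toNNReal) (c.nextTime Y).toNNReal

/-- The labelled process after its `n`-th jump, started from `w`. -/
def config (M : ℕ) {a : ℕ} (Y : Walks a) (w : State a) : ℕ → Config a
  | 0 => { w with time := 0, birth := fun _ => 0, start := w.pos }
  | n + 1 => (config M Y w n).next M Y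

/-- The configuration at time `t`, that is, after the last jump up to time `t`. -/
def configAt (M : ℕ) {a : ℕ} (Y : Walks a) (w : State a) (t : ℝ≥0) : Config a :=
  config M Y w (sSup {n : ℕ | (config M Y w n).time ≤ t})

/-- The rightmost visited site `r_t`. -/
def front (M : ℕ) {a : ℕ} (Y : Walks a) (w : State a) (t : ℝ≥0) : ℤ :=
  (configAt M Y w t).front

/-- The rightmost visited site at a possibly infinite time, with `r_∞ = ∞`. -/
def frontExt (M : ℕ) {a : ℕ} (Y : Walks a) (w : State a) (s : ℝ≥0∞) : WithTop ℤ :=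
  if s = ⊤ then ⊤ else (front M Y w s.toNNReal : ℤ)

/-- The hitting time `T_y` of `y` by the rightmost visited site. -/
def hitTime (M : ℕ) {a : ℕ} (Y : Walks a) (w : State a) (y : WithTop ℤ) : ℝ≥0∞ :=
  ⨅ (t : ℝ≥0) (_ : y ≤ (front M Y w t : ℤ)), (t : ℝ≥0∞)

/-! ### The regeneration time -/

/-- The time `V ∘ θ_s`: the first time `t` such that one of the particles alive at time `s` at a
position to the left of `r_s`, moving from then on without killing, is at time `s + t`
at a position at least `r_s + ⌊α' t⌋`. -/
def timeV (M : ℕ) {a : ℕ} (α' : ℝ) (Y : Walks a) (w : State a) (s : ℝ≥0) : ℝ≥0∞ :=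
  ⨅ (t : ℝ≥0)
    (_ : ∃ l ∈ (configAt M Y w s).live,
      (configAt M Y w s).pos l < front M Y w s ∧
        front M Y w s + ⌊α' * t⌋ ≤ (configAt M Y w s).traj Y l (s + t)), (t : ℝ≥0∞)

/-- The time `s + D ∘ θ_s` with `D ∘ θ_s = min (U ∘ θ_s) (V ∘ θ_s)`; it is infinite for `s = ∞`.
It is used for times `s` at which a new site is visited, when the particles with labels
`(r_s, i)` have just been activated, so that `U ∘ θ_s` is the time `U` for the
auxiliary front started from `r_s`. -/
def timeD (M : ℕ) {a : ℕ} (α' : ℝ) (Y : Walks a) (w : State a) (s : ℝ≥0∞) : ℝ≥0∞ :=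
  s + min (timeU M α' Y (front M Y w s.toNNReal)) (timeV M α' Y w s.toNNReal)

/-- The sequence `R_0 = r_0`, `R_{k+1} = r_{D_{k+1}}`, where `S_{k+1} = T_{R_k + L}` and
`D_{k+1} = S_{k+1} + D ∘ θ_{S_{k+1}}`, with `L = M`. -/
def seqR (M : ℕ) {a : ℕ} (α' : ℝ) (Y : Walks a) (w : State a) : ℕ → WithTop ℤ
  | 0 => (w.front : ℤ)
  | k + 1 =>
    frontExt M Y w (timeD M α' Y w (hitTime M Y w (seqR M α' Y w k + ((M : ℤ) : WithTop ℤ))))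

/-- The sequence `S_0 = 0`, `S_{k+1} = T_{R_k + L}`, with `L = M`. -/
def seqS (M : ℕ) {a : ℕ} (α' : ℝ) (Y : Walks a) (w : State a) : ℕ → ℝ≥0∞
  | 0 => 0
  | k + 1 => hitTime M Y w (seqR M α' Y w k + ((M : ℤ) : WithTop ℤ))

/-- The set of `k ≥ 1` with `S_k < ∞` and `D_k = ∞`. -/
def regenIndices (M : ℕ) {a : ℕ} (α' : ℝ) (Y : Walks a) (w : State a) : Set ℕ :=
  {k | 1 ≤ k ∧ seqS M α' Y w k < ⊤ ∧ timeD M α' Y w (seqS M α' Y w k) = ⊤}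

open Classical in
/-- The first regeneration time `κ_1 = S_K`, where `K` is the least `k ≥ 1` with `S_k < ∞` and
`D_k = ∞`; it is infinite if there is no such `k`. -/
def regenTime (M : ℕ) {a : ℕ} (α' : ℝ) (Y : Walks a) (w : State a) : ℝ≥0∞ :=
  if (regenIndices M α' Y w).Nonempty then seqS M α' Y w (sInf (regenIndices M α' Y w)) else ⊤

/-- The absolute value of `r_{κ_1}`, as an extended nonnegative number. -/
def regenFront (M : ℕ) {a : ℕ} (α' : ℝ) (Y : Walks a) (w : State a) : ℝ≥0∞ :=
  WithTop.recTopCoe ⊤ (fun n : ℤ => (n.natAbs : ℝ≥0∞)) (frontExt M Y w (regenTime M α' Y w))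

/-- The event `U = ∞` for the process started from the front `0`. -/
def eventU (M a : ℕ) (α' : ℝ) : Set (Sample a) := {ω | timeU M α' (walks ω) 0 = ⊤}

end Combustion

end

/-!
The regeneration time is reached after a number of trials. A trial starts when the front reaches a new
site `z`, and it fails if `U ∘ θ` or `V ∘ θ` is finite. The proof bounds, uniformly in the past, the
probability that a trial fails and the number of sites that the front visits during a failed trial.

*The auxiliary front.* The Laplace transform of the hitting times of one walk is explicit (`laplace_hit`):
it is `z ^ j` for the site `j` at the argument `(1 - z) ^ 2 / z`. Hence the probability that the site `j`
has not been visited at time `t` is of order `t ^ (-1 / 2)`. The time `wait` that the auxiliary front needs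
for one step is the minimum over `M` independent walks, and so has a tail of order `t ^ (-M / 2)`
(`measure_lt_wait_le`). As `M > 4`, it has a finite second moment. The waiting times are stationary and
`M`-dependent, so that the law of large numbers along residue classes modulo `M` gives the speed
`α = 1 / meanWait M a` (`ae_tendsto_auxFront`). For `α' < α`, the front stays ahead of the line of speed
`α'` with positive probability (`measure_timeU_eq_top_pos`). A Chernoff bound for the waiting times,
truncated at a power of the number of steps, shows that `U` is finite and larger than `t` with probability
`O(t ^ (-M / 4))` (`exists_timeU_bound`).

*The labelled process.* The walks of all activated particles, including the killed ones, are explored jump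
by jump. The exponential holding times have no memory, so that the walks that remain after any number of
jumps are independent of the history and have the law of the original ones (`lintegral_exploration`,
`lintegral_strong_markov`). Almost surely, this exploration gives the labelled process
(`GoodRun.configAt_eq`). Whenever a particle has been killed, at least `M` larger labels have been
activated (`Sound`). Therefore the `M` largest activated labels are live, and the front moves at least as
fast as the auxiliary one (`Run.hitTime_succ_le`).

*One trial.* The walks that determine `U ∘ θ` are independent of those of the particles to the left of the
front. There are at most `M` of these per site, and each of them keeps behind the line of speed `α'` with
a probability that is bounded from below and tends to one exponentially fast in its distance from the
front. Hence a trial fails with probability at most `q < 1`, whatever the past (`exists_failure_le`), and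
if it fails because of `V`, it does so early, up to an exponentially small probability
(`exists_crossing_tail`). The Laplace transform of the time that the live particles need to move the front
by one site is small at a large argument, so that the front is unlikely to be fast (`exists_fast_le`). Together, the front visits at least `j` sites
during a failed trial with probability `O(j ^ (-M / 4))` (`exists_late_failure_le`).

*All trials.* The event that the trial number `k + 1` starts at `z` is determined by the history up to the
time when `z` is reached (`determinedAt_stage`). So the moment of order `s < M / 4` of the starting site,
on the event that the trial takes place, contracts from one trial to the next up to a summable error
(`exists_trial_moment_le`), and its sum over all trials is finite (`exists_tsum_stage_le`). This bounds the
moments of `r_{κ₁}`. On the event `U = ∞`, the front has at least the speed `α'`, and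
`κ₁ ≤ r_{κ₁} / α'` (`Run.regenTime_le`). Thus both have finite moments of every order less than `M / 4`
given `U = ∞` (`exists_moments_le`). The order `p / 2` gives the tail by Markov's inequality, the order `1`
the means, and the order `2`, for `M > 8`, the second moments.
-/

noncomputable section

namespace Combustion

variable {a : ℕ}

/-! ### A single walk -/

/-- The holding times and the steps of one walk. -/
abbrev WalkSeq : Type := ℕ → ℝ × ℤ

/-- The time of the `n`-th jump of one walk. -/
def jumpSum (s : WalkSeq) (n : ℕ) : ℝ := ∑ j ∈ Finset.range n, (s j).1

/-- The displacement of one walk after `n` jumps. -/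
def stepSum (s : WalkSeq) (n : ℕ) : ℤ := ∑ j ∈ Finset.range n, (s j).2

/-- The number of jumps of one walk up to time `t`. -/
def jumpsUpTo (s : WalkSeq) (t : ℝ≥0) : ℕ := sSup {n : ℕ | jumpSum s n ≤ t}

/-- The displacement of one walk at time `t`. -/
def path (s : WalkSeq) (t : ℝ≥0) : ℤ := stepSum s (jumpsUpTo s t)

/-- The data of the walk with label `l`. -/
def seqOf {a : ℕ} (ω : Sample a) (l : Label a) : WalkSeq := fun n => ω (l, n)

theorem walks_eq {a : ℕ} (ω : Sample a) (l : Label a) (t : ℝ≥0) :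
    walks ω l t = l.site + path (seqOf ω l) t := rfl

/-- The time at which a walk first has displacement `j`; it is read off from the jump times. -/
def hit (s : WalkSeq) (j : ℤ) : ℝ≥0∞ :=
  ⨅ (n : ℕ) (_ : stepSum s n = j), ENNReal.ofReal (jumpSum s n)

/-- The properties of a walk that hold almost surely and that make its path a step function with
nearest neighbour steps which reaches every site to the right. -/
structure GoodSeq (s : WalkSeq) : Prop where
  pos : ∀ n, 0 < (s n).1
  step : ∀ n, (s n).2 = 1 ∨ (s n).2 = -1
  div : ∀ C : ℝ, ∃ n, C < jumpSum s n
  hits : ∀ j : ℕ, ∃ n, stepSum s n = j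

@[simp] theorem jumpSum_zero (s : WalkSeq) : jumpSum s 0 = 0 := by simp [jumpSum]
@[simp] theorem stepSum_zero (s : WalkSeq) : stepSum s 0 = 0 := by simp [stepSum]

theorem jumpSum_succ (s : WalkSeq) (n : ℕ) : jumpSum s (n + 1) = jumpSum s n + (s n).1 := by
  simp [jumpSum, Finset.sum_range_succ]

theorem stepSum_succ (s : WalkSeq) (n : ℕ) : stepSum s (n + 1) = stepSum s n + (s n).2 := by
  simp [stepSum, Finset.sum_range_succ]

theorem jumpSum_succ' (s : WalkSeq) (n : ℕ) :
    jumpSum s (n + 1) = (s 0).1 + jumpSum (fun k => s (k + 1)) n := by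
  simp [jumpSum, Finset.sum_range_succ', add_comm]

theorem stepSum_succ' (s : WalkSeq) (n : ℕ) :
    stepSum s (n + 1) = (s 0).2 + stepSum (fun k => s (k + 1)) n := by
  simp [stepSum, Finset.sum_range_succ', add_comm]

theorem GoodSeq.strictMono {s : WalkSeq} (h : GoodSeq s) : StrictMono (jumpSum s) :=
  strictMono_nat_of_lt_succ fun n => by rw [jumpSum_succ]; linarith [h.pos n]

theorem GoodSeq.jumpSum_nonneg {s : WalkSeq} (h : GoodSeq s) (n : ℕ) : 0 ≤ jumpSum s n := by
  have := h.strictMono.monotone (Nat.zero_le n)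
  simpa using this

theorem GoodSeq.jumpsUpTo_eq {s : WalkSeq} (h : GoodSeq s) {t : ℝ≥0} {n : ℕ}
    (h1 : jumpSum s n ≤ t) (h2 : (t : ℝ) < jumpSum s (n + 1)) : jumpsUpTo s t = n := by
  have : {n : ℕ | jumpSum s n ≤ t} = Set.Iic n := by
    ext m
    simp only [Set.mem_ofPred_eq, Set.mem_Iic]
    constructor
    · intro hm
      by_contra hlt
      have := h.strictMono.monotone (show n + 1 ≤ m by omega)
      linarith
    · intro hm
      exact (h.strictMono.monotone hm).trans h1
  rw [jumpsUpTo, this]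
  exact csSup_Iic

theorem GoodSeq.exists_jumpsUpTo {s : WalkSeq} (h : GoodSeq s) (t : ℝ≥0) :
    ∃ n, jumpSum s n ≤ t ∧ (t : ℝ) < jumpSum s (n + 1) := by
  classical
  have hex := h.div t
  obtain ⟨m, hm⟩ : ∃ m, Nat.find hex = m + 1 := by
    refine Nat.exists_eq_succ_of_ne_zero fun h0 => ?_
    have := Nat.find_spec hex
    rw [h0, jumpSum_zero] at this
    exact absurd t.2 (not_le.2 this)
  refine ⟨m, ?_, ?_⟩
  · exact not_lt.1 (Nat.find_min hex (by omega))
  · rw [← hm]; exact Nat.find_spec hex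

theorem GoodSeq.jumpsUpTo_spec {s : WalkSeq} (h : GoodSeq s) (t : ℝ≥0) :
    jumpSum s (jumpsUpTo s t) ≤ t ∧ (t : ℝ) < jumpSum s (jumpsUpTo s t + 1) := by
  obtain ⟨n, h1, h2⟩ := h.exists_jumpsUpTo t
  rw [h.jumpsUpTo_eq h1 h2]
  exact ⟨h1, h2⟩

theorem GoodSeq.path_eq {s : WalkSeq} (h : GoodSeq s) {t : ℝ≥0} {n : ℕ}
    (h1 : jumpSum s n ≤ t) (h2 : (t : ℝ) < jumpSum s (n + 1)) : path s t = stepSum s n := by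
  rw [path, h.jumpsUpTo_eq h1 h2]

theorem GoodSeq.path_jumpSum {s : WalkSeq} (h : GoodSeq s) (n : ℕ) :
    path s (jumpSum s n).toNNReal = stepSum s n := by
  apply h.path_eq
  · rw [Real.coe_toNNReal _ (h.jumpSum_nonneg n)]
  · rw [Real.coe_toNNReal _ (h.jumpSum_nonneg n)]
    exact h.strictMono (Nat.lt_succ_self n)

/-- Before the first jump a walk does not move. -/
theorem GoodSeq.path_eq_zero {s : WalkSeq} (h : GoodSeq s) {t : ℝ≥0} (ht : (t : ℝ) < (s 0).1) :
    path s t = 0 := by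
  rw [h.path_eq (n := 0) (by simp) (by simpa [jumpSum_succ] using ht), stepSum_zero]

theorem GoodSeq.path_zero {s : WalkSeq} (h : GoodSeq s) : path s 0 = 0 :=
  h.path_eq_zero (by simpa using h.pos 0)

/-- A path after its first jump is the path of the remaining jumps. -/
theorem GoodSeq.path_tail {s : WalkSeq} (h : GoodSeq s) (h' : GoodSeq fun k => s (k + 1))
    (u : ℝ≥0) :
    path s ((s 0).1.toNNReal + u) = (s 0).2 + path (fun k => s (k + 1)) u := by
  obtain ⟨h1, h2⟩ := h'.jumpsUpTo_spec u
  rw [h.path_eq (n := jumpsUpTo (fun k => s (k + 1)) u + 1), stepSum_succ', path]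
  · rw [jumpSum_succ', NNReal.coe_add, Real.coe_toNNReal _ (h.pos 0).le]; linarith
  · rw [jumpSum_succ', NNReal.coe_add, Real.coe_toNNReal _ (h.pos 0).le]; linarith

/-- The data of a walk whose clock has advanced by `τ` without a jump. -/
def delay (s : WalkSeq) (τ : ℝ) : WalkSeq := fun n => if n = 0 then ((s 0).1 - τ, (s 0).2) else s n

theorem stepSum_delay (s : WalkSeq) (τ : ℝ) (n : ℕ) : stepSum (delay s τ) n = stepSum s n := by
  refine Finset.sum_congr rfl fun j _ => ?_
  unfold delay; split_ifs with h <;> simp [h]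

theorem jumpSum_delay (s : WalkSeq) (τ : ℝ) (n : ℕ) :
    jumpSum (delay s τ) (n + 1) = jumpSum s (n + 1) - τ := by
  rw [jumpSum_succ', jumpSum_succ']
  simp [delay]; ring

theorem GoodSeq.path_delay {s : WalkSeq} {τ : ℝ≥0} (h : GoodSeq s) (h' : GoodSeq (delay s τ))
    (u : ℝ≥0) : path s (τ + u) = path (delay s τ) u := by
  obtain ⟨h1, h2⟩ := h'.jumpsUpTo_spec u
  rw [h.path_eq (n := jumpsUpTo (delay s τ) u), path, stepSum_delay] <;> push_cast
  · rcases Nat.eq_zero_or_pos (jumpsUpTo (delay s τ) u) with h0 | h0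
    · rw [h0]; simp; positivity
    · obtain ⟨m, hm⟩ := Nat.exists_eq_succ_of_ne_zero h0.ne'
      rw [hm, jumpSum_delay] at h1
      rw [hm]; simp only [Nat.succ_eq_add_one]; linarith
  · rw [jumpSum_delay] at h2; linarith

theorem GoodSeq.hit_le {s : WalkSeq} (h : GoodSeq s) {t : ℝ≥0} {j : ℤ} (ht : path s t = j) :
    hit s j ≤ t := by
  obtain ⟨h1, -⟩ := h.jumpsUpTo_spec t
  refine (iInf₂_le (jumpsUpTo s t) ht).trans ?_
  rw [← ENNReal.ofReal_coe_nnreal]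
  exact ENNReal.ofReal_le_ofReal h1

theorem GoodSeq.hit_eq {s : WalkSeq} (h : GoodSeq s) (j : ℤ) :
    hit s j = ⨅ (t : ℝ≥0) (_ : path s t = j), (t : ℝ≥0∞) := by
  apply le_antisymm
  · exact le_iInf₂ fun t ht => h.hit_le ht
  · refine le_iInf₂ fun n hn => ?_
    refine (iInf₂_le (jumpSum s n).toNNReal (by rw [h.path_jumpSum, hn])).trans ?_
    exact le_of_eq rfl

theorem GoodSeq.hit_ne_top {s : WalkSeq} (h : GoodSeq s) (j : ℕ) : hit s j ≠ ⊤ := by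
  obtain ⟨n, hn⟩ := h.hits j
  exact ne_top_of_le_ne_top ENNReal.ofReal_ne_top (iInf₂_le n hn)

/-- The first hitting time is attained. -/
theorem GoodSeq.path_hit {s : WalkSeq} (h : GoodSeq s) {j : ℤ} (hj : hit s j ≠ ⊤) :
    path s (hit s j).toNNReal = j := by
  classical
  have hex : ∃ n, stepSum s n = j := by
    by_contra hne
    push Not at hne
    exact hj (by simp [hit, hne])
  have : hit s j = ENNReal.ofReal (jumpSum s (Nat.find hex)) := by
    refine le_antisymm (iInf₂_le (Nat.find hex) (Nat.find_spec hex)) ?_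
    refine le_iInf₂ fun n hn => ENNReal.ofReal_le_ofReal ?_
    exact h.strictMono.monotone (Nat.find_min' hex hn)
  rw [this]
  have h2 := h.path_jumpSum (Nat.find hex)
  rw [Nat.find_spec hex] at h2
  exact h2

theorem hit_zero (s : WalkSeq) : hit s 0 = 0 := by
  refine le_antisymm ((iInf₂_le 0 (by simp)).trans (by simp)) zero_le

theorem measurable_jumpSum (n : ℕ) : Measurable fun s : WalkSeq => jumpSum s n := by
  unfold jumpSum; fun_prop

theorem measurable_stepSum (n : ℕ) : Measurable fun s : WalkSeq => stepSum s n := by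
  unfold stepSum; fun_prop

theorem measurable_hit (j : ℤ) : Measurable fun s : WalkSeq => hit s j := by
  refine Measurable.iInf fun n => ?_
  have : (fun s : WalkSeq => ⨅ (_ : stepSum s n = j), ENNReal.ofReal (jumpSum s n)) =
      fun s => if stepSum s n = j then ENNReal.ofReal (jumpSum s n) else ⊤ := by
    ext s; split_ifs with h <;> simp [h]
  rw [this]
  exact Measurable.ite ((measurable_stepSum n) (MeasurableSet.singleton j))
    (ENNReal.measurable_ofReal.comp (measurable_jumpSum n)) measurable_const

/-- First step decomposition of a hitting time. -/
theorem hit_cons {s : WalkSeq} (h : ∀ n, 0 < (s n).1) {j : ℤ} (hj : j ≠ 0) :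
    hit s j = ENNReal.ofReal (s 0).1 + hit (fun k => s (k + 1)) (j - (s 0).2) := by
  have key : ∀ n, ENNReal.ofReal (jumpSum s (n + 1)) = ENNReal.ofReal (s 0).1 +
      ENNReal.ofReal (jumpSum (fun k => s (k + 1)) n) := fun n => by
    rw [jumpSum_succ', ENNReal.ofReal_add (h 0).le]
    exact Finset.sum_nonneg fun j _ => (h _).le
  apply le_antisymm
  · rw [hit, hit, ENNReal.add_iInf]
    refine le_iInf fun n => ?_
    by_cases hn : stepSum (fun k => s (k + 1)) n = j - (s 0).2
    · simp only [hn, iInf_pos]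
      rw [← key]
      exact iInf₂_le (n + 1) (by rw [stepSum_succ', hn]; ring)
    · simp [hn]
  · refine le_iInf₂ fun n hn => ?_
    cases n with
    | zero => simp at hn; exact absurd hn.symm hj
    | succ n =>
      rw [key]
      gcongr
      exact iInf₂_le n (by rw [stepSum_succ'] at hn; linarith)

/-! ### The exponential law and the law of a single walk -/

instance : IsProbabilityMeasure (expMeasure 2) := isProbabilityMeasure_expMeasure (by norm_num)

theorem lintegral_expMeasure {f : ℝ → ℝ≥0∞} (hf : Measurable f) :
    ∫⁻ x, f x ∂(expMeasure 2) =
      ∫⁻ x in Set.Ioi (0 : ℝ), ENNReal.ofReal (2 * Real.exp (-(2 * x))) * f x := by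
  have h0 : expMeasure 2 = volume.withDensity (exponentialPDF 2) := rfl
  have hm : Measurable (exponentialPDF 2) :=
    ENNReal.measurable_ofReal.comp (measurable_exponentialPDFReal 2)
  rw [h0, lintegral_withDensity_eq_lintegral_mul _ hm hf, ← lintegral_indicator measurableSet_Ioi]
  apply lintegral_congr_ae
  filter_upwards [(Measure.ae_ne volume (0 : ℝ))] with x hx
  by_cases hx0 : 0 < x
  · simp [Set.indicator, hx0, exponentialPDF_eq, hx0.le]
  · simp [Set.indicator, hx0, exponentialPDF_eq, not_le.2 (lt_of_le_of_ne (not_lt.1 hx0) hx)]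

/-- Lack of memory of the exponential law. -/
theorem map_restrict_expMeasure {u : ℝ} (hu : 0 ≤ u) :
    ((expMeasure 2).restrict (Set.Ioi u)).map (fun x => x - u) =
      ENNReal.ofReal (Real.exp (-(2 * u))) • expMeasure 2 := by
  ext B hB
  rw [Measure.map_apply (by fun_prop) hB,
    Measure.restrict_apply ((by fun_prop : Measurable fun x : ℝ => x - u) hB),
    Measure.smul_apply, smul_eq_mul, ← lintegral_indicator_one hB,
    ← lintegral_indicator_one (((by fun_prop : Measurable fun x : ℝ => x - u) hB).inter
      measurableSet_Ioi), lintegral_expMeasure (measurable_one.indicator hB),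
    lintegral_expMeasure (measurable_one.indicator
      (((by fun_prop : Measurable fun x : ℝ => x - u) hB).inter measurableSet_Ioi)),
    ← lintegral_const_mul _ (by fun_prop (disch := assumption)), ← lintegral_indicator measurableSet_Ioi,
    ← lintegral_indicator measurableSet_Ioi, ← lintegral_add_right_eq_self _ u]
  refine lintegral_congr fun x => ?_
  simp only [Set.indicator, Set.mem_Ioi, Pi.one_apply]
  have hmem : x + u ∈ (fun x => x - u) ⁻¹' B ∩ Set.Ioi u ↔ x ∈ B ∧ 0 < x := by
    simp
  by_cases hx : 0 < x
  · have h1 : 0 < x + u := by linarith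
    simp only [h1, hmem, hx, if_true, and_true]
    by_cases hxB : x ∈ B
    · rw [if_pos (hmem.2 ⟨hxB, hx⟩), if_pos hxB, mul_one, mul_one, ← ENNReal.ofReal_mul (by positivity)]
      congr 1
      rw [show -(2 * (x + u)) = -(2 * u) + -(2 * x) by ring, Real.exp_add]; ring
    · rw [if_neg fun h => hxB (hmem.1 h).1, if_neg hxB]; simp
  · rw [if_neg fun h => hx (hmem.1 h).2]; simp [hx]

theorem expMeasure_Ioi {u : ℝ} (hu : 0 ≤ u) :
    expMeasure 2 (Set.Ioi u) = ENNReal.ofReal (Real.exp (-(2 * u))) := by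
  have := congrArg (fun m => m Set.univ) (map_restrict_expMeasure hu)
  simpa [Measure.map_apply (by fun_prop : Measurable fun x : ℝ => x - u)] using this

instance : NullSingletonClass (expMeasure 2) := by
  have h0 : expMeasure 2 = volume.withDensity (exponentialPDF 2) := rfl
  rw [h0]; infer_instance

theorem ae_expMeasure_pos : ∀ᵐ x ∂(expMeasure 2), (0 : ℝ) < x := by
  have h := expMeasure_Ioi (le_refl 0)
  simp only [mul_zero, neg_zero, Real.exp_zero, ENNReal.ofReal_one] at h
  exact (prob_compl_eq_zero_iff measurableSet_Ioi).2 h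

theorem expMeasure_Iic_pos {ε : ℝ} (hε : 0 < ε) : 0 < expMeasure 2 (Set.Iic ε) := by
  rw [← Set.compl_Ioi, prob_compl_eq_one_sub measurableSet_Ioi, expMeasure_Ioi hε.le, tsub_pos_iff_lt,
    ← ENNReal.ofReal_one]
  exact (ENNReal.ofReal_lt_ofReal_iff one_pos).2 (Real.exp_lt_one_iff.2 (by linarith))

theorem laplace_expMeasure {β : ℝ} (hβ : 0 ≤ β) :
    ∫⁻ x, ENNReal.ofReal (Real.exp (-(β * x))) ∂(expMeasure 2) = ENNReal.ofReal (2 / (2 + β)) := by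
  rw [lintegral_expMeasure (by fun_prop)]
  have : ∀ x : ℝ, ENNReal.ofReal (2 * Real.exp (-(2 * x))) * ENNReal.ofReal (Real.exp (-(β * x))) =
      ENNReal.ofReal (2 * Real.exp (-(2 + β) * x)) := fun x => by
    rw [← ENNReal.ofReal_mul (by positivity), mul_assoc, ← Real.exp_add]; congr 3; ring
  simp_rw [this]
  rw [← ofReal_integral_eq_lintegral_ofReal]
  · rw [integral_const_mul, integral_exp_mul_Ioi (by linarith)]
    congr 1
    have : -(2 + β) ≠ 0 := by linarith
    have h2 : 2 + β ≠ 0 := by linarith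
    simp only [mul_zero, Real.exp_zero]; field_simp
  · exact (integrableOn_exp_mul_Ioi (by linarith) 0).const_mul 2
  · exact Eventually.of_forall fun x => by positivity

/-- The law of one holding time and one step. -/
abbrev jumpLaw : Measure (ℝ × ℤ) := (expMeasure 2).prod stepLaw

/-- The law of the data of a single walk. -/
def seqLaw : Measure WalkSeq := Measure.infinitePi fun _ => jumpLaw

instance : IsProbabilityMeasure seqLaw := by unfold seqLaw; infer_instance

theorem lintegral_stepLaw (f : ℤ → ℝ≥0∞) : ∫⁻ x, f x ∂stepLaw = 2⁻¹ * f 1 + 2⁻¹ * f (-1) := by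
  simp [stepLaw, lintegral_add_measure, lintegral_smul_measure]

theorem ae_stepLaw : ∀ᵐ x ∂stepLaw, x = 1 ∨ x = -1 := by
  rw [ae_iff, ← lintegral_indicator_one (by exact MeasurableSet.of_discrete), lintegral_stepLaw]
  simp [Set.indicator]

theorem ae_jumpLaw : ∀ᵐ x ∂jumpLaw, 0 < x.1 ∧ (x.2 = 1 ∨ x.2 = -1) := by
  have h1 : ∀ᵐ x ∂jumpLaw, 0 < x.1 := Measure.quasiMeasurePreserving_fst.ae ae_expMeasure_pos
  have h2 : ∀ᵐ x ∂jumpLaw, x.2 = 1 ∨ x.2 = -1 := Measure.quasiMeasurePreserving_snd.ae ae_stepLaw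
  filter_upwards [h1, h2] with x a b using ⟨a, b⟩

/-- The walk with first jump `x` and later jumps `s`. -/
def consSeq (x : ℝ × ℤ) (s : WalkSeq) : WalkSeq
  | 0 => x
  | n + 1 => s n

@[simp] theorem consSeq_zero (x : ℝ × ℤ) (s : WalkSeq) : consSeq x s 0 = x := rfl
@[simp] theorem consSeq_succ (x : ℝ × ℤ) (s : WalkSeq) (n : ℕ) : consSeq x s (n + 1) = s n := rfl

theorem measurable_consSeq : Measurable fun p : (ℝ × ℤ) × WalkSeq => consSeq p.1 p.2 := by
  refine measurable_pi_lambda _ fun n => ?_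
  cases n with
  | zero => exact measurable_fst
  | succ n => exact (measurable_pi_apply n).comp measurable_snd

/-- The first jump and the later jumps of a walk are independent, and the later jumps have the law
of a walk. -/
theorem map_cons_seqLaw :
    (jumpLaw.prod seqLaw).map (fun p : (ℝ × ℤ) × WalkSeq => consSeq p.1 p.2) =
      seqLaw := by
  refine Measure.eq_infinitePi _ fun s t ht => ?_
  rw [Measure.map_apply measurable_consSeq (.pi s.countable_toSet fun _ _ => ht _)]
  classical
  have : (fun p : (ℝ × ℤ) × WalkSeq => consSeq p.1 p.2) ⁻¹'
      Set.pi s t = (if 0 ∈ s then t 0 else Set.univ) ×ˢ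
        Set.pi ((s.preimage Nat.succ (Nat.succ_injective.injOn) : Finset ℕ) : Set ℕ)
          (fun n => t (n + 1)) := by
    ext ⟨x, v⟩
    simp only [Set.mem_preimage, Set.mem_pi, Set.mem_prod, Finset.mem_coe, Finset.mem_preimage]
    constructor
    · intro h
      refine ⟨?_, fun n hn => h (n + 1) hn⟩
      split_ifs with h0
      · exact h 0 h0
      · trivial
    · rintro ⟨h1, h2⟩ n hn
      cases n with
      | zero => simpa [hn] using h1
      | succ n => exact h2 n hn
  rw [this, Measure.prod_prod, seqLaw, Measure.infinitePi_pi _ (fun i _ => ht _)]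
  have h2 : ∏ i ∈ s.preimage Nat.succ (Nat.succ_injective.injOn), jumpLaw (t (i + 1)) =
      ∏ i ∈ s.erase 0, jumpLaw (t i) := by
    refine Finset.prod_bij (fun i _ => i + 1) (by simp) (by simp) ?_ (by simp)
    intro b hb
    rw [Finset.mem_erase] at hb
    exact ⟨b - 1, by simp only [Finset.mem_preimage, Nat.succ_eq_add_one]; rw [Nat.sub_add_cancel (by omega)]; exact hb.2, by omega⟩
  rw [h2]
  split_ifs with h0
  · rw [← Finset.mul_prod_erase s _ h0]
  · simp [Finset.erase_eq_of_notMem h0]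

theorem lintegral_seqLaw {f : WalkSeq → ℝ≥0∞} (hf : Measurable f) :
    ∫⁻ s, f s ∂seqLaw =
      ∫⁻ x, ∫⁻ s, f (consSeq x s) ∂seqLaw ∂jumpLaw := by
  conv_lhs => rw [← map_cons_seqLaw]
  rw [lintegral_map hf measurable_consSeq]
  exact lintegral_prod _ (hf.comp measurable_consSeq).aemeasurable

theorem ae_seqLaw_basic : ∀ᵐ s ∂seqLaw, ∀ n, 0 < (s n).1 ∧ ((s n).2 = 1 ∨ (s n).2 = -1) := by
  rw [ae_all_iff]
  intro n
  exact (measurePreserving_eval_infinitePi (fun _ : ℕ => jumpLaw) n).quasiMeasurePreserving.ae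
    ae_jumpLaw

/-- Expectations of products over the first jumps. -/
theorem lintegral_prod_seqLaw {g : ℝ × ℤ → ℝ≥0∞} (hg : Measurable g) (n : ℕ) :
    ∫⁻ s, ∏ j ∈ Finset.range n, g (s j) ∂seqLaw = (∫⁻ x, g x ∂jumpLaw) ^ n := by
  induction n with
  | zero => simp
  | succ n ih =>
    have hm : Measurable fun s : WalkSeq => ∏ j ∈ Finset.range (n + 1), g (s j) := by fun_prop
    have hm' : Measurable fun s : WalkSeq => ∏ j ∈ Finset.range n, g (s j) := by fun_prop
    rw [lintegral_seqLaw hm]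
    simp only [Finset.prod_range_succ', consSeq_succ, consSeq_zero]
    simp_rw [lintegral_mul_const _ hm', ih]
    rw [lintegral_const_mul _ hg, pow_succ]

/-- The Laplace functional `x ↦ e^{-λ x}` with value `0` at infinity. -/
def expNeg (lam : ℝ) (x : ℝ≥0∞) : ℝ≥0∞ :=
  if x = ⊤ then 0 else ENNReal.ofReal (Real.exp (-(lam * x.toReal)))

theorem measurable_expNeg (lam : ℝ) : Measurable (expNeg lam) :=
  Measurable.ite (measurableSet_singleton _) measurable_const (by fun_prop)

theorem expNeg_add (lam : ℝ) {h : ℝ} (hh : 0 ≤ h) (x : ℝ≥0∞) :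
    expNeg lam (ENNReal.ofReal h + x) = ENNReal.ofReal (Real.exp (-(lam * h))) * expNeg lam x := by
  unfold expNeg
  by_cases hx : x = ⊤
  · simp [hx]
  · rw [if_neg hx, if_neg (by simp [hx]), ← ENNReal.ofReal_mul (by positivity), ← Real.exp_add,
      ENNReal.toReal_add ENNReal.ofReal_ne_top hx, ENNReal.toReal_ofReal hh]
    congr 2; ring

theorem expNeg_le_one {lam : ℝ} (hl : 0 ≤ lam) (x : ℝ≥0∞) : expNeg lam x ≤ 1 := by
  unfold expNeg
  split_ifs
  · exact zero_le
  · rw [← ENNReal.ofReal_one]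
    apply ENNReal.ofReal_le_ofReal
    rw [Real.exp_le_one_iff]
    have : 0 ≤ x.toReal := ENNReal.toReal_nonneg
    nlinarith

theorem expNeg_antitone {lam : ℝ} (hl : 0 ≤ lam) : Antitone (expNeg lam) := by
  intro x y hxy
  by_cases hy : y = ⊤
  · simp [expNeg, hy]
  · have hx : x ≠ ⊤ := ne_top_of_le_ne_top hy hxy
    unfold expNeg
    rw [if_neg hx, if_neg hy]
    apply ENNReal.ofReal_le_ofReal
    rw [Real.exp_le_exp]
    have := ENNReal.toReal_mono hy hxy
    nlinarith

/-- Bounded solutions of the first step recursion are geometric. -/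
theorem eq_pow_of_recursion {u : ℕ → ℝ} {z : ℝ} (hz0 : 0 < z) (hz1 : z < 1) (h0 : u 0 = 1)
    (hb : ∀ j, 0 ≤ u j ∧ u j ≤ 1)
    (hrec : ∀ j, u (j + 1) = z / (1 + z ^ 2) * (u j + u (j + 2))) (j : ℕ) : u j = z ^ j := by
  set c := 2 * z / (1 + z ^ 2) with hc
  have hc0 : 0 ≤ c := by positivity
  have hc1 : c < 1 := by rw [hc, div_lt_one (by positivity)]; nlinarith [sq_nonneg (1 - z), mul_pos (sub_pos.2 hz1) (sub_pos.2 hz1)]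
  have key : ∀ k j, |u j - z ^ j| ≤ c ^ k := by
    intro k
    induction k with
    | zero =>
      intro j
      have h1 : 0 ≤ z ^ j := by positivity
      have h2 : z ^ j ≤ 1 := pow_le_one₀ hz0.le hz1.le
      rw [pow_zero, abs_le]
      constructor <;> linarith [(hb j).1, (hb j).2]
    | succ k ih =>
      intro j
      cases j with
      | zero => simp [h0]; positivity
      | succ j =>
        have e : u (j + 1) - z ^ (j + 1) =
            c / 2 * ((u j - z ^ j) + (u (j + 2) - z ^ (j + 2))) := by
          rw [hrec, hc]; field_simp; ring
        rw [e, abs_mul, abs_of_nonneg (by positivity : 0 ≤ c / 2), pow_succ]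
        have := abs_add_le (u j - z ^ j) (u (j + 2) - z ^ (j + 2))
        calc c / 2 * |u j - z ^ j + (u (j + 2) - z ^ (j + 2))|
            ≤ c / 2 * (c ^ k + c ^ k) := by
              gcongr
              exact this.trans (add_le_add (ih j) (ih (j + 2)))
          _ = c ^ k * c := by ring
  have hlim : Tendsto (fun k => c ^ k) atTop (𝓝 0) := tendsto_pow_atTop_nhds_zero_of_lt_one hc0 hc1
  have : |u j - z ^ j| ≤ 0 := ge_of_tendsto' hlim fun k => key k j
  linarith [abs_nonpos_iff.1 this]

/-- The Laplace transform of the hitting times of simple random walk. -/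
theorem laplace_hit {z : ℝ} (hz0 : 0 < z) (hz1 : z < 1) (j : ℕ) :
    ∫⁻ s, expNeg ((1 - z) ^ 2 / z) (hit s j) ∂seqLaw = ENNReal.ofReal (z ^ j) := by
  set lam := (1 - z) ^ 2 / z with hlam
  have hl : 0 ≤ lam := by positivity
  have hle : ∀ j : ℤ, ∫⁻ s, expNeg lam (hit s j) ∂seqLaw ≤ 1 := fun j =>
    (lintegral_mono fun s => expNeg_le_one hl _).trans (by simp)
  have hrec : ∀ j : ℕ, ∫⁻ s, expNeg lam (hit s ((j + 1 : ℕ) : ℤ)) ∂seqLaw =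
      ENNReal.ofReal (z / (1 + z ^ 2)) * (∫⁻ s, expNeg lam (hit s (j : ℤ)) ∂seqLaw +
        ∫⁻ s, expNeg lam (hit s ((j + 2 : ℕ) : ℤ)) ∂seqLaw) := by
    intro j
    have hm : ∀ j : ℤ, Measurable fun s => expNeg lam (hit s j) := fun j =>
      (measurable_expNeg lam).comp (measurable_hit j)
    rw [lintegral_seqLaw (hm _)]
    have : ∀ᵐ x ∂jumpLaw,
        ∫⁻ s, expNeg lam (hit (consSeq x s) ((j + 1 : ℕ) : ℤ)) ∂seqLaw =
        ENNReal.ofReal (Real.exp (-(lam * x.1))) *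
          ∫⁻ s, expNeg lam (hit s (((j + 1 : ℕ) : ℤ) - x.2)) ∂seqLaw := by
      filter_upwards [ae_jumpLaw] with x hx
      rw [← lintegral_const_mul _ (hm _)]
      apply lintegral_congr_ae
      filter_upwards [ae_seqLaw_basic] with s hs
      rw [hit_cons (fun n => by cases n; exacts [hx.1, (hs _).1]) (by positivity)]
      simp only [consSeq_succ, consSeq_zero]
      rw [expNeg_add _ hx.1.le]
    rw [lintegral_congr_ae this, lintegral_prod_mul (f := fun x => ENNReal.ofReal (Real.exp (-(lam * x))))
      (g := fun y : ℤ => ∫⁻ s, expNeg lam (hit s (((j + 1 : ℕ) : ℤ) - y)) ∂seqLaw) (by fun_prop)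
      (Measurable.of_discrete).aemeasurable, laplace_expMeasure hl, lintegral_stepLaw, ← mul_add,
      ← mul_assoc]
    congr 1
    · rw [← ENNReal.ofReal_ofNat 2, ← ENNReal.ofReal_inv_of_pos (by norm_num), ← ENNReal.ofReal_mul (by positivity)]
      congr 1
      rw [hlam]; field_simp; ring_nf
    · congr 5
      push_cast; ring_nf
  have h := eq_pow_of_recursion (u := fun j => (∫⁻ s, expNeg lam (hit s (j : ℤ)) ∂seqLaw).toReal)
    hz0 hz1 ?_ ?_ ?_ j
  · rw [← h, ENNReal.ofReal_toReal (ne_top_of_le_ne_top ENNReal.one_ne_top (hle _))]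
  · simp [hit_zero, expNeg]
  · intro j
    refine ⟨ENNReal.toReal_nonneg, ?_⟩
    have := ENNReal.toReal_mono ENNReal.one_ne_top (hle j)
    simpa using this
  · intro j
    rw [hrec, ENNReal.toReal_mul, ENNReal.toReal_ofReal (by positivity),
      ENNReal.toReal_add (ne_top_of_le_ne_top ENNReal.one_ne_top (hle _)) (ne_top_of_le_ne_top ENNReal.one_ne_top (hle _))]

/-- The hitting time of a site at distance `j` has a tail of order `t ^ (-1/2)`: its Laplace transform
at `λ = (1 - z)² / z` is `z ^ j`, and `z = 1 - 1 / √t` gives `λ ≥ 1 / t`. -/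
theorem measure_lt_hit_le (j : ℕ) {t : ℝ} (ht : 0 < t) :
    seqLaw {s | ENNReal.ofReal t < hit s j} ≤ ENNReal.ofReal (2 * j / √t) := by
  rcases Nat.eq_zero_or_pos j with rfl | hj
  · simp [hit_zero]
  have hj1 : (1 : ℝ) ≤ j := by exact_mod_cast hj
  have hst : 0 < √t := Real.sqrt_pos.2 ht
  by_cases ht4 : t < 4
  · refine (prob_le_one).trans ?_
    rw [← ENNReal.ofReal_one]
    apply ENNReal.ofReal_le_ofReal
    rw [le_div_iff₀ hst]
    have : √t ≤ 2 := by rw [Real.sqrt_le_left (by norm_num)]; linarith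
    linarith
  push Not at ht4
  -- The Laplace transform at `λ ≥ 1 / t` is at least `1 - j / √t`.
  set e := 1 / √t with he
  have hs2 : 2 ≤ √t := Real.le_sqrt_of_sq_le (by linarith)
  have he0 : 0 < e := by positivity
  have he1 : e ≤ 1 / 2 := by rw [he]; exact one_div_le_one_div_of_le (by norm_num) hs2
  set z := 1 - e with hz
  have hz0 : 0 < z := by linarith
  have hz1 : z < 1 := by linarith
  set lam := (1 - z) ^ 2 / z with hlam
  have hlt : 1 ≤ lam * t := by
    have h1 : e ^ 2 * t = 1 := by rw [he, div_pow, Real.sq_sqrt ht.le]; field_simp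
    have h2 : e ^ 2 ≤ lam := by
      rw [hlam, le_div_iff₀ hz0, show 1 - z = e by rw [hz]; ring]
      nlinarith [sq_nonneg e]
    nlinarith
  have hl : 0 ≤ lam := by positivity
  set A := {s : WalkSeq | ENNReal.ofReal t < hit s j} with hA
  have hAm : MeasurableSet A := measurableSet_lt measurable_const (measurable_hit j)
  have hbound : ∫⁻ s, expNeg lam (hit s j) ∂seqLaw ≤
      seqLaw Aᶜ + ENNReal.ofReal (1 / 2) * seqLaw A := by
    rw [← lintegral_add_compl _ hAm, add_comm]
    refine add_le_add ?_ ?_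
    · calc _ ≤ ∫⁻ s in Aᶜ, 1 ∂seqLaw := lintegral_mono fun s => expNeg_le_one hl _
        _ = _ := by simp
    · calc _ ≤ ∫⁻ s in A, ENNReal.ofReal (1 / 2) ∂seqLaw := by
            refine setLIntegral_mono measurable_const fun s hs => ?_
            refine (expNeg_antitone hl (le_of_lt hs)).trans ?_
            rw [expNeg, if_neg ENNReal.ofReal_ne_top, ENNReal.toReal_ofReal ht.le]
            apply ENNReal.ofReal_le_ofReal
            calc Real.exp (-(lam * t)) ≤ Real.exp (-1) := by
                  rw [Real.exp_le_exp]; linarith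
              _ ≤ 1 / 2 := by
                  rw [Real.exp_neg, inv_eq_one_div]
                  exact one_div_le_one_div_of_le (by norm_num) (by linarith [Real.add_one_le_exp (1 : ℝ)])
        _ = _ := by simp
  rw [laplace_hit hz0 hz1, prob_compl_eq_one_sub hAm] at hbound
  have hfin : seqLaw A ≠ ⊤ := measure_ne_top _ _
  have hp1 : (seqLaw A).toReal ≤ 1 := by
    have := ENNReal.toReal_mono ENNReal.one_ne_top (prob_le_one (μ := seqLaw) (s := A)); simpa using this
  have hreal : z ^ j ≤ 1 - (seqLaw A).toReal + 1 / 2 * (seqLaw A).toReal := by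
    have := ENNReal.toReal_mono (by finiteness) hbound
    rwa [ENNReal.toReal_ofReal (by positivity), ENNReal.toReal_add (by finiteness) (by finiteness),
      ENNReal.toReal_sub_of_le prob_le_one ENNReal.one_ne_top, ENNReal.toReal_mul,
      ENNReal.toReal_ofReal (by norm_num), ENNReal.toReal_one] at this
  have hbern : 1 - j * e ≤ z ^ j := by
    have := one_add_mul_le_pow (show (-2 : ℝ) ≤ -e by linarith) j
    rw [show 1 - j * e = 1 + j * -e by ring, hz, sub_eq_add_neg]
    exact this
  rw [← ENNReal.ofReal_toReal hfin]
  apply ENNReal.ofReal_le_ofReal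
  have : 2 * (j : ℝ) / √t = 2 * (j * e) := by rw [he]; ring
  rw [this]; linarith

/-- Almost surely the jump times diverge and every site to the right of the start is visited. -/
theorem ae_goodSeq : ∀ᵐ s ∂seqLaw, GoodSeq s := by
  -- The jump times are unbounded since `E exp (-τ_n) = (2/3) ^ n`.
  have hdiv : ∀ᵐ s ∂seqLaw, ∀ C : ℕ, ∃ n, (C : ℝ) < jumpSum s n := by
    rw [ae_all_iff]
    intro C
    rw [ae_iff]
    push Not
    have hb : ∀ n, seqLaw {s | ∀ n, jumpSum s n ≤ C} ≤
        ENNReal.ofReal (Real.exp C) * ENNReal.ofReal (2 / 3) ^ n := by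
      intro n
      have h1 : ∫⁻ x, ENNReal.ofReal (Real.exp (-(1 * x.1))) ∂jumpLaw = ENNReal.ofReal (2 / 3) := by
        have := lintegral_prod_mul (μ := expMeasure 2) (ν := stepLaw) (f := fun x => ENNReal.ofReal (Real.exp (-(1 * x))))
          (g := fun _ => 1) (by fun_prop) (by fun_prop)
        rw [laplace_expMeasure (by norm_num)] at this
        simp only [mul_one, lintegral_one, measure_univ] at this
        rw [this]; norm_num
      rw [← h1, ← lintegral_prod_seqLaw (by fun_prop), ← lintegral_const_mul _ (by fun_prop),
        ← lintegral_indicator_one₀]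
      · refine lintegral_mono fun s => ?_
        by_cases hs : s ∈ {s : WalkSeq | ∀ n, jumpSum s n ≤ C}
        · rw [Set.indicator_of_mem hs, ← ENNReal.ofReal_prod_of_nonneg (by intros; positivity),
            ← Real.exp_sum, ← ENNReal.ofReal_mul (by positivity), ← Real.exp_add, Pi.one_apply,
            ← ENNReal.ofReal_one]
          apply ENNReal.ofReal_le_ofReal
          rw [Real.one_le_exp_iff]
          have := hs n
          simp only [one_mul, Finset.sum_neg_distrib]
          unfold jumpSum at this
          linarith
        · rw [Set.indicator_of_notMem hs]; exact zero_le
      · refine MeasurableSet.nullMeasurableSet ?_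
        simp only [Set.ofPred_forall]
        exact MeasurableSet.iInter fun n => measurableSet_le (measurable_jumpSum n) measurable_const
    have hlim : Tendsto (fun n : ℕ => ENNReal.ofReal (Real.exp C) * ENNReal.ofReal (2 / 3) ^ n) atTop
        (𝓝 (ENNReal.ofReal (Real.exp C) * 0)) := by
      refine ENNReal.Tendsto.const_mul (ENNReal.tendsto_pow_atTop_nhds_zero_of_lt_one ?_) (by right; finiteness)
      rw [← ENNReal.ofReal_one]
      exact (ENNReal.ofReal_lt_ofReal_iff one_pos).2 (by norm_num)
    rw [mul_zero] at hlim
    exact le_antisymm (ge_of_tendsto' hlim hb) zero_le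
  have hhit : ∀ᵐ s ∂seqLaw, ∀ j : ℕ, hit s j ≠ ⊤ := by
    rw [ae_all_iff]
    intro j
    rw [ae_iff]
    push Not
    have hb : ∀ n : ℕ, seqLaw {s | hit s j = ⊤} ≤ ENNReal.ofReal (2 * j / √((n : ℝ) + 1)) := fun n =>
      (measure_mono fun s hs => by
        simp only [Set.mem_ofPred_eq] at hs ⊢
        rw [hs]; exact ENNReal.ofReal_lt_top).trans (measure_lt_hit_le j (t := (n : ℝ) + 1) (by positivity))
    have hlim : Tendsto (fun n : ℕ => ENNReal.ofReal (2 * j / √((n : ℝ) + 1))) atTop (𝓝 0) := by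
      rw [← ENNReal.ofReal_zero]
      refine ENNReal.tendsto_ofReal (Tendsto.div_atTop tendsto_const_nhds ?_)
      exact Real.tendsto_sqrt_atTop.comp (tendsto_atTop_add_const_right _ _ tendsto_natCast_atTop_atTop)
    exact le_antisymm (ge_of_tendsto' hlim hb) zero_le
  filter_upwards [ae_seqLaw_basic, hdiv, hhit] with s h1 h2 h3
  refine ⟨fun n => (h1 n).1, fun n => (h1 n).2, fun C => ?_, fun j => ?_⟩
  · obtain ⟨m, hm⟩ := exists_nat_gt C
    obtain ⟨n, hn⟩ := h2 m
    exact ⟨n, hm.trans hn⟩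
  · by_contra hne
    push Not at hne
    exact h3 j (by simp [hit, hne])

/-! ### A single walk and a moving line -/

/-- The first time at which the walk reaches the line `j + ⌊α' t⌋`; since the line does not
decrease, this happens at a jump time. -/
def crossTime (α' : ℝ) (s : WalkSeq) (j : ℤ) : ℝ≥0∞ :=
  ⨅ (n : ℕ) (_ : j + ⌊α' * jumpSum s n⌋ ≤ stepSum s n), ENNReal.ofReal (jumpSum s n)

theorem GoodSeq.crossTime_eq {s : WalkSeq} (h : GoodSeq s) {α' : ℝ} (hα : 0 < α') (j : ℤ) :
    crossTime α' s j = ⨅ (t : ℝ≥0) (_ : j + ⌊α' * t⌋ ≤ path s t), (t : ℝ≥0∞) := by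
  apply le_antisymm
  · refine le_iInf₂ fun t ht => ?_
    obtain ⟨h1, -⟩ := h.jumpsUpTo_spec t
    refine (iInf₂_le (jumpsUpTo s t) ?_).trans ?_
    · refine le_trans ?_ ht
      gcongr
    · rw [← ENNReal.ofReal_coe_nnreal]
      exact ENNReal.ofReal_le_ofReal h1
  · refine le_iInf₂ fun n hn => ?_
    refine (iInf₂_le (jumpSum s n).toNNReal ?_).trans (le_of_eq rfl)
    rw [h.path_jumpSum, Real.coe_toNNReal _ (h.jumpSum_nonneg n)]
    exact hn

theorem measurableSet_cross (α' : ℝ) (j : ℤ) (n : ℕ) :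
    MeasurableSet {s : WalkSeq | j + ⌊α' * jumpSum s n⌋ ≤ stepSum s n} :=
  measurableSet_le (measurable_const.add
    (Int.measurable_floor.comp (measurable_const.mul (measurable_jumpSum n)))) (measurable_stepSum n)

theorem measurable_crossTime (α' : ℝ) (j : ℤ) : Measurable fun s : WalkSeq => crossTime α' s j := by
  refine Measurable.iInf fun n => ?_
  have : (fun s : WalkSeq => ⨅ (_ : j + ⌊α' * jumpSum s n⌋ ≤ stepSum s n),
      ENNReal.ofReal (jumpSum s n)) =
      fun s => if j + ⌊α' * jumpSum s n⌋ ≤ stepSum s n then ENNReal.ofReal (jumpSum s n) else ⊤ := by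
    ext s; split_ifs with h <;> simp [h]
  rw [this]
  exact Measurable.ite (measurableSet_cross α' j n)
    (ENNReal.measurable_ofReal.comp (measurable_jumpSum n)) measurable_const

/-- A walk reaches a line of positive speed at a late time, or a line far ahead, only with an
exponentially small probability: by the union bound over the jumps, since for small `θ` the
expectation of `exp (θ S_n - β τ_n)` decays geometrically in `n`. -/
theorem exists_crossing_bound {α' : ℝ} (hα : 0 < α') :
    ∃ C θ c : ℝ, 0 < C ∧ 0 < θ ∧ 0 < c ∧ ∀ (j : ℤ) (t : ℝ),
      seqLaw {s | ∃ n, t ≤ jumpSum s n ∧ j + ⌊α' * jumpSum s n⌋ ≤ stepSum s n} ≤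
        ENNReal.ofReal (C * Real.exp (-(θ * j)) * Real.exp (-(c * t))) := by
  -- The drift `α' θ / 2` beats `log cosh θ ≤ θ² / 2` for this `θ`, and half of the speed `α'` is left
  -- to pay for the decay in `t`.
  set θ := min 1 (α' / 8) with hθ
  have hθ0 : 0 < θ := by rw [hθ]; positivity
  have hθ1 : θ ≤ 1 := min_le_left _ _
  have hθ2 : θ ≤ α' / 8 := min_le_right _ _
  set β := θ * α' / 2 with hβ
  have hβ0 : 0 < β := by positivity
  set r := 2 / (2 + β) * Real.cosh θ with hr
  have hr0 : 0 ≤ r := by have := Real.cosh_pos θ; positivity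
  have hr1 : r < 1 := by
    have h1 : Real.cosh θ ≤ Real.exp (θ ^ 2 / 2) := Real.cosh_le_exp_half_sq θ
    have h2 := Real.abs_exp_sub_one_sub_id_le (x := θ ^ 2 / 2) (by rw [abs_of_nonneg (by positivity)]; nlinarith)
    have h3 := (abs_le.1 h2).2
    have h4 : Real.cosh θ < 1 + β / 2 := by
      have h5 : θ ^ 2 ≤ 1 := pow_le_one₀ hθ0.le hθ1
      have : (θ ^ 2 / 2) ^ 2 ≤ θ ^ 2 / 4 := by nlinarith [sq_nonneg θ]
      have : θ ^ 2 ≤ θ * α' / 8 := by nlinarith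
      have : 0 < θ * α' := by positivity
      nlinarith
    rw [hr, div_mul_eq_mul_div, div_lt_one (by positivity)]; linarith
  set g : ℝ × ℤ → ℝ≥0∞ := fun x => ENNReal.ofReal (Real.exp (-(β * x.1))) * ENNReal.ofReal (Real.exp (θ * x.2)) with hg
  have hgm : Measurable g := by
    refine Measurable.mul (f := fun x : ℝ × ℤ => ENNReal.ofReal (Real.exp (-(β * x.1)))) (by fun_prop) ?_
    exact (Measurable.of_discrete (f := fun x : ℤ => ENNReal.ofReal (Real.exp (θ * x)))).comp measurable_snd
  have hgint : ∫⁻ x, g x ∂jumpLaw = ENNReal.ofReal r := by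
    rw [hg, lintegral_prod_mul (f := fun x => ENNReal.ofReal (Real.exp (-(β * x))))
      (g := fun x : ℤ => ENNReal.ofReal (Real.exp (θ * x))) (by fun_prop) (Measurable.of_discrete).aemeasurable,
      laplace_expMeasure hβ0.le, lintegral_stepLaw, ← mul_add, ← ENNReal.ofReal_add (by positivity) (by positivity),
      ← ENNReal.ofReal_ofNat 2, ← ENNReal.ofReal_inv_of_pos (by norm_num), ← ENNReal.ofReal_mul (by positivity),
      ← ENNReal.ofReal_mul (by positivity), hr, Real.cosh_eq]
    congr 1; push_cast; ring_nf
  refine ⟨Real.exp θ * (1 - r)⁻¹, θ, θ * α' / 2, by have := sub_pos.2 hr1; positivity, hθ0, by positivity, fun j t => ?_⟩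
  have hkey : ∀ n, seqLaw {s | t ≤ jumpSum s n ∧ j + ⌊α' * jumpSum s n⌋ ≤ stepSum s n} ≤
      ENNReal.ofReal (Real.exp θ * Real.exp (-(θ * j)) * Real.exp (-(θ * α' / 2 * t))) * ENNReal.ofReal r ^ n := by
    intro n
    rw [← hgint, ← lintegral_prod_seqLaw hgm, ← lintegral_const_mul _ (by fun_prop),
      show {s | t ≤ jumpSum s n ∧ j + ⌊α' * jumpSum s n⌋ ≤ stepSum s n} =
        {s : WalkSeq | t ≤ jumpSum s n} ∩ {s | j + ⌊α' * jumpSum s n⌋ ≤ stepSum s n} from rfl,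
      ← lintegral_indicator_one ((measurableSet_le measurable_const (measurable_jumpSum n)).inter (measurableSet_cross α' j n))]
    refine lintegral_mono fun s => ?_
    by_cases hs : s ∈ {s : WalkSeq | t ≤ jumpSum s n} ∩ {s | j + ⌊α' * jumpSum s n⌋ ≤ stepSum s n}
    · rw [Set.indicator_of_mem hs, hg]
      simp only
      rw [Finset.prod_mul_distrib, ← ENNReal.ofReal_prod_of_nonneg (by intros; positivity),
        ← ENNReal.ofReal_prod_of_nonneg (by intros; positivity), ← Real.exp_sum, ← Real.exp_sum,
        ← ENNReal.ofReal_mul (by positivity), ← ENNReal.ofReal_mul (by positivity), ← Real.exp_add, ← Real.exp_add, ← Real.exp_add, ← Real.exp_add,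
        Pi.one_apply, ← ENNReal.ofReal_one]
      apply ENNReal.ofReal_le_ofReal
      rw [Real.one_le_exp_iff, Finset.sum_neg_distrib, ← Finset.mul_sum, ← Finset.mul_sum]
      have h1 : t ≤ jumpSum s n := hs.1
      have h2 : ((j + ⌊α' * jumpSum s n⌋ : ℤ) : ℝ) ≤ (stepSum s n : ℝ) := by exact_mod_cast hs.2
      have h3 : (stepSum s n : ℝ) = ∑ i ∈ Finset.range n, ((s i).2 : ℝ) := by simp [stepSum]
      have h4 := Int.lt_floor_add_one (α' * jumpSum s n)
      push_cast at h2
      rw [← h3]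
      change 0 ≤ θ + -(θ * ↑j) + -(θ * α' / 2 * t) + (-(β * jumpSum s n) + θ * (stepSum s n : ℝ))
      have h5 : θ * (j + α' * jumpSum s n - 1) ≤ θ * stepSum s n := by gcongr; linarith
      have h6 : θ * α' / 2 * t ≤ θ * α' / 2 * jumpSum s n := by gcongr
      rw [hβ]; linarith
    · rw [show ({s : WalkSeq | t ≤ jumpSum s n} ∩ {s | j + ⌊α' * jumpSum s n⌋ ≤ stepSum s n}).indicator 1 s = (0 : ℝ≥0∞) from
        Set.indicator_of_notMem hs _]; exact zero_le
  -- The bounds for the single jumps sum to a geometric series.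
  have hU : {s | ∃ n, t ≤ jumpSum s n ∧ j + ⌊α' * jumpSum s n⌋ ≤ stepSum s n} =
      ⋃ n, {s | t ≤ jumpSum s n ∧ j + ⌊α' * jumpSum s n⌋ ≤ stepSum s n} := by
    ext s; simp
  rw [hU]
  refine (measure_iUnion_le _).trans ((ENNReal.tsum_le_tsum hkey).trans ?_)
  rw [ENNReal.tsum_mul_left, ENNReal.tsum_geometric, ← ENNReal.ofReal_one, ← ENNReal.ofReal_sub _ hr0,
    ← ENNReal.ofReal_inv_of_pos (by linarith), ← ENNReal.ofReal_mul (by positivity)]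
  apply ENNReal.ofReal_le_ofReal
  apply le_of_eq; ring

theorem crossTime_ne_top_iff (α' : ℝ) (s : WalkSeq) (j : ℤ) :
    crossTime α' s j ≠ ⊤ ↔ ∃ n, j + ⌊α' * jumpSum s n⌋ ≤ stepSum s n := by
  simp [crossTime, iInf_eq_top]

/-- A walk started to the left of the line has a positive probability never to reach it: it may
first move far to the left. -/
theorem measure_crossTime_eq_top_pos {α' : ℝ} (hα : 0 < α') {j : ℤ} (hj : 1 ≤ j) :
    0 < seqLaw {s | crossTime α' s j = ⊤} := by
  have hm : ∀ j, MeasurableSet {s | crossTime α' s j = ⊤} := fun j =>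
    measurable_crossTime α' j (measurableSet_singleton _)
  obtain ⟨C, θ, c, hC, hθ, hc, hb⟩ := exists_crossing_bound hα
  -- Far from the line the previous bound is less than `1`.
  have hfar : ∃ J : ℕ, ∀ j : ℤ, J ≤ j → 0 < seqLaw {s | crossTime α' s j = ⊤} := by
    obtain ⟨J, hJ⟩ : ∃ J : ℕ, C * Real.exp (-(θ * J)) < 1 := by
      have : Tendsto (fun n : ℕ => C * Real.exp (-(θ * n))) atTop (𝓝 (C * 0)) := by
        refine Tendsto.const_mul _ (Real.tendsto_exp_atBot.comp ?_)
        exact tendsto_neg_atTop_atBot.comp (tendsto_natCast_atTop_atTop.const_mul_atTop hθ)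
      rw [mul_zero] at this
      exact (this.eventually (gt_mem_nhds one_pos)).exists
    refine ⟨J, fun j hj => ?_⟩
    rw [← compl_compl {s | crossTime α' s j = ⊤}, prob_compl_eq_one_sub (hm j).compl, tsub_pos_iff_lt]
    have hle : seqLaw {s | crossTime α' s j = ⊤}ᶜ ≤ ENNReal.ofReal (C * Real.exp (-(θ * j)) * Real.exp (-(c * 0))) := by
      refine le_trans (measure_mono_ae ?_) (hb j 0)
      filter_upwards [ae_goodSeq] with s hs h
      obtain ⟨n, hn⟩ := (crossTime_ne_top_iff α' s j).1 h
      exact ⟨n, hs.jumpSum_nonneg n, hn⟩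
    refine hle.trans_lt ?_
    rw [← ENNReal.ofReal_one]
    refine (ENNReal.ofReal_lt_ofReal_iff one_pos).2 ?_
    simp only [mul_zero, neg_zero, Real.exp_zero, mul_one]
    refine lt_of_le_of_lt ?_ hJ
    gcongr
    exact_mod_cast hj
  -- A first step to the left moves the walk away from the line, which only moves on meanwhile.
  have hstep : ∀ j : ℤ, 1 ≤ j → 0 < seqLaw {s | crossTime α' s (j + 1) = ⊤} →
      0 < seqLaw {s | crossTime α' s j = ⊤} := by
    intro j hj h
    rw [← lintegral_indicator_one (hm j), lintegral_seqLaw (measurable_one.indicator (hm j))]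
    have h1 : ∀ᵐ x ∂jumpLaw, (Set.indicator {x : ℝ × ℤ | x.2 = -1} 1 x) * seqLaw {s | crossTime α' s (j + 1) = ⊤} ≤
        ∫⁻ s, Set.indicator {s | crossTime α' s j = ⊤} 1 (consSeq x s) ∂seqLaw := by
      filter_upwards [ae_jumpLaw] with x hx
      by_cases h2 : x.2 = -1
      · rw [Set.indicator_of_mem (show x ∈ {x : ℝ × ℤ | x.2 = -1} from h2), Pi.one_apply, one_mul, ← lintegral_indicator_one (hm _)]
        refine lintegral_mono fun s => ?_
        by_cases hs : s ∈ {s | crossTime α' s (j + 1) = ⊤}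
        · rw [Set.indicator_of_mem hs, Set.indicator_of_mem]
          · rfl
          change _ = _
          by_contra hne
          obtain ⟨n, hn⟩ := (crossTime_ne_top_iff α' _ j).1 hne
          have hs' : ¬ ∃ n, j + 1 + ⌊α' * jumpSum s n⌋ ≤ stepSum s n := fun hh =>
            (crossTime_ne_top_iff α' s (j + 1)).2 hh hs
          cases n with
          | zero => simp at hn; omega
          | succ n =>
            apply hs'
            refine ⟨n, ?_⟩
            rw [stepSum_succ', jumpSum_succ'] at hn
            simp only [consSeq_zero, consSeq_succ, h2] at hn
            have : ⌊α' * jumpSum s n⌋ ≤ ⌊α' * (x.1 + jumpSum s n)⌋ := by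
              gcongr; linarith [hx.1]
            change j + ⌊α' * (x.1 + jumpSum s n)⌋ ≤ -1 + stepSum s n at hn
            linarith
        · rw [Set.indicator_of_notMem hs]; exact zero_le
      · rw [Set.indicator_of_notMem (show x ∉ {x : ℝ × ℤ | x.2 = -1} from h2)]; simp
    refine lt_of_lt_of_le ?_ (lintegral_mono_ae h1)
    have hm1 : MeasurableSet {x : ℝ × ℤ | x.2 = -1} := measurable_snd (measurableSet_singleton _)
    rw [lintegral_mul_const _ (measurable_one.indicator hm1), lintegral_indicator_one hm1]
    refine ENNReal.mul_pos ?_ h.ne'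
    have : {x : ℝ × ℤ | x.2 = -1} = Set.univ ×ˢ {-1} := by ext; simp
    rw [this, Measure.prod_prod]
    simp [stepLaw]
  obtain ⟨J, hJ⟩ := hfar
  have : ∀ k : ℕ, ∀ j : ℤ, 1 ≤ j → J ≤ j + k → 0 < seqLaw {s | crossTime α' s j = ⊤} := by
    intro k
    induction k with
    | zero => intro j _ h; exact hJ j (by simpa using h)
    | succ k ih =>
      intro j h1 h2
      exact hstep j h1 (ih (j + 1) (by omega) (by push_cast at h2 ⊢; linarith))
  exact this J j hj (by omega)

/-! ### Independence of disjoint families of walks -/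

section Product

variable {ι X : Type*} [MeasurableSpace X] (μ : Measure X) [IsProbabilityMeasure μ]

open Classical in
/-- The family that agrees with the first argument on `S` and with the second one off `S`. -/
def splice (S : Set ι) (p : (ι → X) × (ι → X)) : ι → X := fun i => if i ∈ S then p.1 i else p.2 i

theorem measurable_splice (S : Set ι) : Measurable (splice (X := X) S) := by
  refine measurable_pi_lambda _ fun i => ?_
  unfold splice
  split_ifs <;> fun_prop

/-- Replacing the coordinates off `S` by independent copies does not change a product law. -/
theorem map_splice (S : Set ι) :
    ((Measure.infinitePi fun _ : ι => μ).prod (Measure.infinitePi fun _ : ι => μ)).map (splice S) =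
      Measure.infinitePi fun _ : ι => μ := by
  classical
  refine Measure.eq_infinitePi _ fun s t ht => ?_
  rw [Measure.map_apply (measurable_splice S) (.pi s.countable_toSet fun _ _ => ht _)]
  have : splice S ⁻¹' Set.pi s t = Set.pi ((s.filter (· ∈ S) : Finset ι) : Set ι) t ×ˢ
      Set.pi ((s.filter (· ∉ S) : Finset ι) : Set ι) t := by
    ext ⟨x, y⟩
    simp only [Set.mem_preimage, Set.mem_pi, Set.mem_prod, Finset.mem_coe, Finset.mem_filter, splice]
    constructor
    · intro h
      exact ⟨fun i hi => by simpa [hi.2] using h i hi.1, fun i hi => by simpa [hi.2] using h i hi.1⟩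
    · rintro ⟨h1, h2⟩ i hi
      by_cases hS : i ∈ S
      · simpa [hS] using h1 i ⟨hi, hS⟩
      · simpa [hS] using h2 i ⟨hi, hS⟩
  rw [this, Measure.prod_prod, Measure.infinitePi_pi _ (fun i _ => ht _),
    Measure.infinitePi_pi _ (fun i _ => ht _), Finset.prod_filter_mul_prod_filter_not]

/-- Functions of disjoint sets of coordinates are independent, stated for functions that are only
almost everywhere measurable. -/
theorem lintegral_mul_of_dependsOn (S : Set ι) {F G : (ι → X) → ℝ≥0∞}
    (hF : AEMeasurable F (Measure.infinitePi fun _ => μ))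
    (hG : AEMeasurable G (Measure.infinitePi fun _ => μ))
    (hFS : DependsOn F S) (hGS : DependsOn G Sᶜ) :
    ∫⁻ ω, F ω * G ω ∂(Measure.infinitePi fun _ => μ) =
      (∫⁻ ω, F ω ∂(Measure.infinitePi fun _ => μ)) * ∫⁻ ω, G ω ∂(Measure.infinitePi fun _ => μ) := by
  have hFG : AEMeasurable (fun ω => F ω * G ω) (Measure.infinitePi fun _ => μ) := hF.mul hG
  rw [← lintegral_prod_mul hF hG]
  conv_lhs => rw [← map_splice μ S]
  rw [lintegral_map' (by rwa [map_splice]) (measurable_splice S).aemeasurable]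
  refine lintegral_congr fun p => ?_
  rw [hFS (y := p.1) (fun i hi => by simp [splice, hi]),
    hGS (y := p.2) (fun i hi => by simp only [Set.mem_compl_iff] at hi; simp [splice, hi])]

theorem measure_inter_of_dependsOn (S : Set ι) {A B : Set (ι → X)}
    (hA : NullMeasurableSet A (Measure.infinitePi fun _ => μ))
    (hB : NullMeasurableSet B (Measure.infinitePi fun _ => μ))
    (hAS : DependsOn (fun ω => ω ∈ A) S) (hBS : DependsOn (fun ω => ω ∈ B) Sᶜ) :
    Measure.infinitePi (fun _ => μ) (A ∩ B) =
      Measure.infinitePi (fun _ => μ) A * Measure.infinitePi (fun _ => μ) B := by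
  classical
  have := lintegral_mul_of_dependsOn μ S (F := A.indicator 1) (G := B.indicator 1)
    (aemeasurable_const.indicator₀ hA) (aemeasurable_const.indicator₀ hB)
    (fun x y h => by
      have : (x ∈ A) = (y ∈ A) := hAS h
      simp [Set.indicator, this])
    (fun x y h => by
      have : (x ∈ B) = (y ∈ B) := hBS h
      simp [Set.indicator, this])
  rw [lintegral_indicator_one₀ hA, lintegral_indicator_one₀ hB] at this
  rw [← this, ← lintegral_indicator_one₀ (hA.inter hB)]
  refine lintegral_congr fun ω => ?_
  simp only [Set.indicator, Set.mem_inter_iff, Pi.one_apply]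
  by_cases h1 : ω ∈ A <;> by_cases h2 : ω ∈ B <;> simp [h1, h2]

end Product


instance : Countable (Label a) := inferInstanceAs (Countable (ℤ × Fin (a - 1)))

theorem measurable_seqOf (l : Label a) : Measurable fun ω : Sample a => seqOf ω l := by
  unfold seqOf; fun_prop

theorem map_seqOf (l : Label a) : (walkMeasure a).map (fun ω => seqOf ω l) = seqLaw :=
  Measure.map_infinitePi_infinitePi_of_inj (f := fun n : ℕ => (l, n)) (P := fun _ : Label a × ℕ => jumpLaw)
    fun m n h => by simpa using h

theorem measurePreserving_seqOf (l : Label a) :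
    MeasurePreserving (fun ω : Sample a => seqOf ω l) (walkMeasure a) seqLaw :=
  ⟨measurable_seqOf l, map_seqOf l⟩

theorem map_seqOf_all :
    (walkMeasure a).map (fun ω l => seqOf ω l) = Measure.infinitePi fun _ : Label a => seqLaw :=
  Measure.infinitePi_map_curry (fun (_ : Label a) (_ : ℕ) => jumpLaw)

/-- The walks of finitely many labels are independent. -/
theorem walkMeasure_forall_mem (F : Finset (Label a)) (A : Label a → Set WalkSeq)
    (hA : ∀ l, MeasurableSet (A l)) :
    walkMeasure a {ω | ∀ l ∈ F, seqOf ω l ∈ A l} = ∏ l ∈ F, seqLaw (A l) := by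
  rw [← Measure.infinitePi_pi (fun _ : Label a => seqLaw) (fun i _ => hA i), ← map_seqOf_all,
    Measure.map_apply (measurable_pi_lambda _ measurable_seqOf) (.pi F.countable_toSet fun _ _ => hA _)]
  rfl

/-- The properties of the sample that hold almost surely: all walks are regular, and the first
holding times are pairwise different. -/
structure GoodSample (ω : Sample a) : Prop where
  seq : ∀ l, GoodSeq (seqOf ω l)
  ties : ∀ l k, l ≠ k → (ω (l, 0)).1 ≠ (ω (k, 0)).1

theorem ae_goodSample : ∀ᵐ ω ∂(walkMeasure a), GoodSample ω := by
  have h1 : ∀ᵐ ω ∂(walkMeasure a), ∀ l, GoodSeq (seqOf ω l) := by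
    rw [ae_all_iff]
    exact fun l => (measurePreserving_seqOf l).quasiMeasurePreserving.ae ae_goodSeq
  have h2 : ∀ᵐ ω ∂(walkMeasure a), ∀ l k, l ≠ k → (ω (l, 0)).1 ≠ (ω (k, 0)).1 := by
    rw [ae_all_iff]; intro l
    rw [ae_all_iff]; intro k
    by_cases hlk : l = k
    · simp [hlk]
    suffices h : ∀ᵐ ω ∂(walkMeasure a), (ω (l, 0)).1 ≠ (ω (k, 0)).1 by
      filter_upwards [h] with ω hω _ using hω
    have hms : MeasurableSet {ω : Sample a | (ω (l, 0)).1 ≠ (ω (k, 0)).1} :=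
      (measurableSet_eq_fun (by fun_prop) (by fun_prop)).compl
    have hw : walkMeasure a = ((walkMeasure a).prod (walkMeasure a)).map (splice {(l, 0)}) :=
      (map_splice jumpLaw _).symm
    rw [hw, ae_map_iff (measurable_splice _).aemeasurable hms]
    have hms' : MeasurableSet {p : Sample a × Sample a | (p.1 (l, 0)).1 ≠ (p.2 (k, 0)).1} :=
      (measurableSet_eq_fun (by fun_prop) (by fun_prop)).compl
    have hae : ∀ᵐ p ∂(walkMeasure a).prod (walkMeasure a), (p.1 (l, 0)).1 ≠ (p.2 (k, 0)).1 := by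
      rw [Measure.ae_prod_iff_ae_ae hms']
      refine Eventually.of_forall fun x => ?_
      have hq : MeasurePreserving (Function.eval ((k, 0) : Label a × ℕ)) (walkMeasure a) jumpLaw :=
        measurePreserving_eval_infinitePi (fun _ : Label a × ℕ => jumpLaw) (k, 0)
      have := hq.quasiMeasurePreserving.ae
        ((Measure.quasiMeasurePreserving_fst (μ := expMeasure 2) (ν := stepLaw)).ae (Measure.ae_ne (expMeasure 2) (x (l, 0)).1))
      filter_upwards [this] with y hy using hy.symm
    filter_upwards [hae] with p hp
    have hne : ((k, 0) : Label a × ℕ) ∉ ({(l, 0)} : Set (Label a × ℕ)) := by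
      simp [Ne.symm hlk]
    simpa [splice, hne, Ne.symm hlk] using hp
  filter_upwards [h1, h2] with ω a b using ⟨a, b⟩

/-- The label moved by `r` sites. -/
def moveLabel (r : ℤ) (l : Label a) : Label a := mkLabel (l.site + r) (ofLex l).2

theorem moveLabel_injective (r : ℤ) : Function.Injective (moveLabel (a := a) r) := by
  intro l k h
  have h' := congrArg ofLex h
  simp only [moveLabel, ofLex_toLex, Prod.mk.injEq, add_left_inj] at h'
  exact ofLex.injective (Prod.ext h'.1 h'.2)

/-- Translation of the walks by `r` sites. -/
def translate (r : ℤ) (ω : Sample a) : Sample a := fun p => ω (moveLabel r p.1, p.2)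

theorem measurePreserving_translate (r : ℤ) :
    MeasurePreserving (translate r) (walkMeasure a) (walkMeasure a) := by
  refine ⟨measurable_pi_lambda _ fun p => measurable_pi_apply _, ?_⟩
  refine Measure.map_infinitePi_infinitePi_of_inj (f := fun p : Label a × ℕ => (moveLabel r p.1, p.2))
    (P := fun _ : Label a × ℕ => jumpLaw) fun p q h => ?_
  simp only [Prod.mk.injEq] at h
  exact Prod.ext (moveLabel_injective r h.1) h.2

theorem walks_translate (r : ℤ) (ω : Sample a) (l : Label a) (t : ℝ≥0) :
    walks (translate r ω) l t = walks ω (moveLabel r l) t - r := by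
  rw [walks_eq, walks_eq]
  change _ = l.site + r + _ - r
  have : seqOf (translate r ω) l = seqOf ω (moveLabel r l) := rfl
  rw [this]; ring


/-! ### The waiting times of the auxiliary front -/

theorem label_lt_iff {l k : Label a} :
    l < k ↔ l.site < k.site ∨ l.site = k.site ∧ (ofLex l).2 < (ofLex k).2 := by
  rw [Prod.Lex.lt_iff]

theorem moveLabel_lt_iff (r : ℤ) {l k : Label a} : moveLabel r l < moveLabel r k ↔ l < k := by
  rw [label_lt_iff, label_lt_iff]
  change l.site + r < k.site + r ∨ l.site + r = k.site + r ∧ (ofLex l).2 < (ofLex k).2 ↔ _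
  simp only [add_lt_add_iff_right, add_left_inj]

theorem moveLabel_site (r : ℤ) (l : Label a) : (moveLabel r l).site = l.site + r := rfl

theorem moveLabel_surjective (r : ℤ) : Function.Surjective (moveLabel (a := a) r) := fun l =>
  ⟨moveLabel (-r) l, ofLex.injective (Prod.ext (by change l.site + -r + r = l.site; ring) rfl)⟩

theorem moveLabel_mem_auxLabels {M : ℕ} (r s z : ℤ) {l : Label a} :
    moveLabel r l ∈ auxLabels M (s + r) (z + r) ↔ l ∈ auxLabels M s z := by
  have : {l' : Label a | moveLabel r l < l' ∧ l'.site ≤ z + r} =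
      moveLabel r '' {l' : Label a | l < l' ∧ l'.site ≤ z} := by
    ext k
    obtain ⟨k, rfl⟩ := moveLabel_surjective r k
    simp only [Set.mem_ofPred_eq, moveLabel_lt_iff, moveLabel_site, add_le_add_iff_right,
      (moveLabel_injective r).mem_set_image]
  simp only [auxLabels, Set.mem_ofPred_eq, moveLabel_site, add_le_add_iff_right, this,
    (moveLabel_injective r).encard_image]

theorem auxLabels_anti {M : ℕ} {r s z : ℤ} (h : s ≤ r) :
    (auxLabels M r z : Set (Label a)) ⊆ auxLabels M s z := fun _ hl => ⟨h.trans hl.1, hl.2⟩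

/-- The largest label at a site. -/
def lastLabel (ha : 2 ≤ a) (x : ℤ) : Label a := mkLabel x ⟨a - 2, by omega⟩

theorem lastLabel_mem_auxLabels {M : ℕ} (ha : 2 ≤ a) (hM : 0 < M) {r z : ℤ} (h : r ≤ z) :
    lastLabel ha z ∈ auxLabels M r z := by
  refine ⟨h, le_rfl, ?_⟩
  have : {l' : Label a | lastLabel ha z < l' ∧ l'.site ≤ z} = ∅ := by
    ext k
    simp only [Set.mem_ofPred_eq, Set.mem_empty_iff_false, iff_false, label_lt_iff, not_and]
    rintro (h1 | ⟨h1, h2⟩) h3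
    · change z < _ at h1; omega
    · have h4 : a - 2 < ((ofLex k).2 : ℕ) := h2
      have := (ofLex k).2.isLt
      omega
  rw [this]; simpa using hM

/-- The labels among the `M` largest ones not exceeding `(z, a - 1)` have sites above `z - M`. -/
theorem lt_site_of_mem_auxLabels {M : ℕ} (ha : 2 ≤ a) {r z : ℤ} {l : Label a}
    (hl : l ∈ auxLabels M r z) : z - M < l.site := by
  by_contra hlt
  push Not at hlt
  have hsub : (((Finset.Ioc l.site z).image (lastLabel ha) : Finset (Label a)) : Set (Label a)) ⊆
      {l' : Label a | l < l' ∧ l'.site ≤ z} := by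
    intro k hk
    rw [Finset.mem_coe, Finset.mem_image] at hk
    obtain ⟨x, hx, rfl⟩ := hk
    rw [Finset.mem_Ioc] at hx
    exact ⟨label_lt_iff.2 (Or.inl hx.1), hx.2⟩
  have h1 := (Set.encard_le_encard hsub).trans_lt hl.2.2
  rw [Set.encard_coe_eq_coe_finsetCard, Finset.card_image_of_injective, Int.card_Ioc] at h1
  · have : (z - l.site).toNat < M := by exact_mod_cast h1
    omega
  · intro x y hxy
    exact congrArg (fun l : Label a => l.site) hxy

theorem auxLabels_eq_of_le {M : ℕ} (ha : 2 ≤ a) {r s z : ℤ} (hr : r ≤ z - M + 1) (hs : s ≤ z - M + 1) :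
    (auxLabels M r z : Set (Label a)) = auxLabels M s z := by
  ext l
  constructor <;> intro hl
  · exact ⟨by have := lt_site_of_mem_auxLabels ha hl; omega, hl.2⟩
  · exact ⟨by have := lt_site_of_mem_auxLabels ha hl; omega, hl.2⟩

/-- Away from its starting point the auxiliary front has the full number `M` of walks. -/
theorem exists_finset_auxLabels {M : ℕ} (ha : 2 ≤ a) {r z : ℤ} (hr : r ≤ z - M + 1) :
    ∃ B : Finset (Label a), B.card = M ∧ ∀ l ∈ B, l ∈ auxLabels M r z := by
  obtain ⟨b, rfl⟩ : ∃ b, a = b + 2 := ⟨a - 2, by omega⟩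
  -- An enumeration of the labels not exceeding `(z, a - 1)` in decreasing order.
  let e : ℕ → Label (b + 2) := fun j =>
    mkLabel (z - (j / (b + 1) : ℕ)) ⟨b - j % (b + 1), by omega⟩
  have he : ∀ j k, e j = e k → j = k := by
    intro j k h
    have h' := congrArg ofLex h
    simp only [e, ofLex_toLex, Prod.mk.injEq, Fin.mk.injEq] at h'
    have h1 : j / (b + 1) = k / (b + 1) := by have := h'.1; omega
    have h2 := Nat.mod_lt j (show 0 < b + 1 by omega)
    have h3 := Nat.mod_lt k (show 0 < b + 1 by omega)
    have h4 : j % (b + 1) = k % (b + 1) := by have := h'.2; omega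
    rw [← Nat.div_add_mod j (b + 1), ← Nat.div_add_mod k (b + 1), h1, h4]
  have hup : ∀ j, {l' : Label (b + 2) | e j < l' ∧ l'.site ≤ z} ⊆
      (((Finset.range j).image e : Finset (Label (b + 2))) : Set (Label (b + 2))) := by
    rintro j k ⟨hk1, hk2⟩
    rw [Finset.mem_coe, Finset.mem_image]
    have hi := (ofLex k).2.isLt
    obtain ⟨q, hq⟩ : ∃ q : ℕ, (q : ℤ) = z - k.site := ⟨(z - k.site).toNat, by omega⟩
    refine ⟨q * (b + 1) + (b - (ofLex k).2), ?_, ?_⟩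
    · rw [Finset.mem_range]
      have h2 := Nat.mod_lt j (show 0 < b + 1 by omega)
      have h3 := Nat.div_add_mod j (b + 1)
      rcases label_lt_iff.1 hk1 with h | ⟨h, h'⟩
      · change z - _ < _ at h
        have : q + 1 ≤ j / (b + 1) := by omega
        have : (q + 1) * (b + 1) ≤ (b + 1) * (j / (b + 1)) := by rw [mul_comm]; gcongr
        rw [add_mul] at this; omega
      · change z - _ = _ at h
        have h' : b - j % (b + 1) < ((ofLex k).2 : ℕ) := h'
        have : q = j / (b + 1) := by omega
        have : q * (b + 1) = (b + 1) * (j / (b + 1)) := by rw [mul_comm, this]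
        omega
    · have h1 : (q * (b + 1) + (b - ((ofLex k).2 : ℕ))) / (b + 1) = q := by
        rw [add_comm, Nat.add_mul_div_right _ _ (by omega), Nat.div_eq_of_lt (by omega), zero_add]
      have h2 : (q * (b + 1) + (b - ((ofLex k).2 : ℕ))) % (b + 1) = b - (ofLex k).2 := by
        rw [add_comm, Nat.add_mul_mod_self_right, Nat.mod_eq_of_lt (by omega)]
      refine ofLex.injective (Prod.ext ?_ (Fin.ext ?_))
      · change z - ((_ / _ : ℕ) : ℤ) = _
        rw [h1, hq]; simp
      · change b - _ % _ = _
        rw [h2]; omega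
  refine ⟨(Finset.range M).image e, ?_, ?_⟩
  · rw [Finset.card_image_of_injective _ fun j k => he j k, Finset.card_range]
  · intro l hl
    rw [Finset.mem_image] at hl
    obtain ⟨j, hj, rfl⟩ := hl
    rw [Finset.mem_range] at hj
    have h : {l' : Label (b + 2) | e j < l' ∧ l'.site ≤ z}.encard < M := by
      refine (Set.encard_le_encard (hup j)).trans_lt ?_
      rw [Set.encard_coe_eq_coe_finsetCard]
      exact_mod_cast (Finset.card_image_le.trans (by simp)).trans_lt hj
    have hz : (e j).site ≤ z := sub_le_self _ (Int.natCast_nonneg _)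
    have hm : e j ∈ auxLabels M (min r (e j).site) z := ⟨min_le_right _ _, hz, h⟩
    rw [auxLabels_eq_of_le ha hr (s := min r (e j).site) (by omega)]
    exact hm

/-- The waiting time of the auxiliary front started from `r` at the site `z`, read off from the
jump times. -/
def wait (M : ℕ) (r z : ℤ) (ω : Sample a) : ℝ≥0∞ :=
  ⨅ l ∈ (auxLabels M r z : Set (Label a)), hit (seqOf ω l) (z + 1 - l.site)

theorem GoodSample.auxWait_eq {M : ℕ} {ω : Sample a} (h : GoodSample ω) (r : ℤ) (k : ℕ) :
    auxWait M (walks ω) r k = wait M r (r + k - 1) ω := by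
  have key : ∀ l : Label a, ∀ t, walks ω l t = r + k ↔ path (seqOf ω l) t = r + k - 1 + 1 - l.site := by
    intro l t; rw [walks_eq]; constructor <;> intro h <;> linarith
  unfold wait auxWait
  simp only [(h.seq _).hit_eq]
  apply le_antisymm
  · refine le_iInf₂ fun l hl => le_iInf₂ fun t ht => iInf₂_le t ⟨l, hl, (key l t).2 ht⟩
  · refine le_iInf₂ fun t ⟨l, hl, ht⟩ => (iInf₂_le l hl).trans (iInf₂_le t ((key l t).1 ht))

theorem measurable_wait (M : ℕ) (r z : ℤ) : Measurable (wait (a := a) M r z) := by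
  classical
  refine Measurable.iInf fun l => Measurable.iInf fun _ => ?_
  exact (measurable_hit _).comp (measurable_seqOf l)

theorem dependsOn_wait (M : ℕ) (r z : ℤ) (ha : 2 ≤ a) :
    DependsOn (wait (a := a) M r z) {p | r ≤ p.1.site ∧ z - M < p.1.site ∧ p.1.site ≤ z} := by
  intro ω ω' h
  unfold wait
  refine iInf_congr fun l => iInf_congr fun hl => ?_
  have : seqOf ω l = seqOf ω' l := funext fun n => h (l, n) ⟨hl.1, lt_site_of_mem_auxLabels ha hl, hl.2.1⟩
  rw [this]

theorem wait_translate (M : ℕ) (r s z : ℤ) (ω : Sample a) :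
    wait M s z (translate r ω) = wait M (s + r) (z + r) ω := by
  unfold wait
  symm
  rw [← (moveLabel_surjective (a := a) r).iInf_comp]
  refine iInf_congr fun l => iInf_congr_Prop (moveLabel_mem_auxLabels r s z) fun _ => ?_
  change _ = hit (seqOf ω (moveLabel r l)) _
  congr 1
  rw [moveLabel_site]; ring

theorem auxWait_translate (M : ℕ) (r : ℤ) (k : ℕ) (ω : Sample a) :
    auxWait M (walks (translate r ω)) 0 k = auxWait M (walks ω) r k := by
  unfold auxWait
  refine iInf_congr fun t => iInf_congr_Prop ?_ fun _ => rfl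
  constructor
  · rintro ⟨l, hl, h⟩
    refine ⟨moveLabel r l, ?_, ?_⟩
    · have := (moveLabel_mem_auxLabels (M := M) r 0 (0 + k - 1) (l := l)).2 hl
      convert this using 1; simp; ring_nf
    · rw [walks_translate] at h; linarith
  · rintro ⟨l', hl, h⟩
    obtain ⟨l, rfl⟩ := moveLabel_surjective r l'
    refine ⟨l, ?_, ?_⟩
    · refine (moveLabel_mem_auxLabels (M := M) r 0 (0 + k - 1) (l := l)).1 ?_
      convert hl using 1; simp; ring_nf
    · rw [walks_translate]; linarith

theorem auxFront_translate (M : ℕ) (r : ℤ) (t : ℝ≥0) (ω : Sample a) :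
    auxFront M (walks (translate r ω)) 0 t = auxFront M (walks ω) r t - r := by
  simp only [auxFront, auxWait_translate]; ring

theorem timeU_translate (M : ℕ) (α' : ℝ) (r : ℤ) (ω : Sample a) :
    timeU M α' (walks (translate r ω)) 0 = timeU M α' (walks ω) r := by
  simp only [timeU, auxFront_translate, sub_zero]

theorem wait_mono {M : ℕ} {r s z : ℤ} (h : s ≤ r) (ω : Sample a) : wait M s z ω ≤ wait M r z ω :=
  biInf_mono (auxLabels_anti h)

theorem wait_eq_of_le {M : ℕ} (ha : 2 ≤ a) {r s z : ℤ} (hr : r ≤ z - M + 1) (hs : s ≤ z - M + 1)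
    (ω : Sample a) : wait M r z ω = wait M s z ω := by
  unfold wait; rw [auxLabels_eq_of_le ha hr hs]

theorem wait_le_hit {M : ℕ} (ha : 2 ≤ a) (hM : 0 < M) {r z : ℤ} (h : r ≤ z) (ω : Sample a) :
    wait M r z ω ≤ hit (seqOf ω (lastLabel ha z)) 1 :=
  (iInf₂_le _ (lastLabel_mem_auxLabels ha hM h)).trans
    (le_of_eq (by congr 1; change z + 1 - z = 1; ring))

theorem GoodSample.wait_ne_top {M : ℕ} (ha : 2 ≤ a) (hM : 0 < M) {r z : ℤ} (h : r ≤ z) {ω : Sample a}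
    (hω : GoodSample ω) : wait M r z ω ≠ ⊤ :=
  ne_top_of_le_ne_top ((hω.seq _).hit_ne_top 1) (wait_le_hit ha hM h ω)

/-- The waiting time is the minimum of `M` independent hitting times, so it has the tail
`t ^ (-M / 2)`. -/
theorem measure_lt_wait_le {M : ℕ} (ha : 2 ≤ a) {r z : ℤ} (hr : r ≤ z - M + 1) {t : ℝ} (ht : 0 < t) :
    walkMeasure a {ω | ENNReal.ofReal t < wait M r z ω} ≤
      ENNReal.ofReal ((2 * M) ^ M * t ^ (-((M : ℝ) / 2))) := by
  obtain ⟨B, hB, hBl⟩ := exists_finset_auxLabels (M := M) ha hr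
  calc walkMeasure a {ω | ENNReal.ofReal t < wait M r z ω}
      ≤ walkMeasure a {ω | ∀ l ∈ B, seqOf ω l ∈ {s | ENNReal.ofReal t < hit s (z + 1 - l.site)}} := by
        refine measure_mono fun ω hω l hl => ?_
        exact lt_of_lt_of_le (show ENNReal.ofReal t < wait M r z ω from hω) (iInf₂_le l (hBl l hl))
    _ = ∏ l ∈ B, seqLaw {s | ENNReal.ofReal t < hit s (z + 1 - l.site)} :=
        walkMeasure_forall_mem B _ fun l => measurableSet_lt measurable_const (measurable_hit _)
    _ ≤ ∏ _l ∈ B, ENNReal.ofReal (2 * M / √t) := by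
        refine Finset.prod_le_prod' fun l hl => ?_
        have h1 := lt_site_of_mem_auxLabels ha (hBl l hl)
        have h2 : l.site ≤ z := (hBl l hl).2.1
        obtain ⟨j, hj⟩ : ∃ j : ℕ, (j : ℤ) = z + 1 - l.site := ⟨(z + 1 - l.site).toNat, by omega⟩
        rw [← hj]
        refine (measure_lt_hit_le j ht).trans ?_
        gcongr
        omega
    _ = _ := by
        rw [Finset.prod_const, hB, ← ENNReal.ofReal_pow (by positivity), div_pow]
        congr 1
        rw [Real.sqrt_eq_rpow, ← Real.rpow_natCast (t ^ (1 / 2 : ℝ)), ← Real.rpow_mul ht.le, Real.rpow_neg ht.le,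
          div_eq_mul_inv]
        congr 3
        ring

theorem identDistrib_wait (M : ℕ) (ha : 2 ≤ a) {r s z y : ℤ} (hr : r ≤ z - M + 1) (hs : s ≤ y - M + 1) :
    IdentDistrib (wait (a := a) M r z) (wait M s y) (walkMeasure a) (walkMeasure a) := by
  have h1 : wait (a := a) M s y = wait M (r + (y - z)) y := by
    ext ω; exact wait_eq_of_le ha hs (by omega) ω
  have h2 : wait (a := a) M (r + (y - z)) y = wait M r z ∘ translate (y - z) := by
    ext ω; rw [Function.comp, wait_translate]; congr 1; ring
  refine ⟨(measurable_wait M r z).aemeasurable, (measurable_wait M s y).aemeasurable, ?_⟩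
  rw [h1, h2, ← Measure.map_map (measurable_wait M r z) (measurePreserving_translate _).measurable,
    (measurePreserving_translate _).map_eq]

/-- A power moment is finite, with an explicit bound, when the tail decays fast enough along powers
of two. -/
theorem exists_lintegral_rpow_le {s q C : ℝ} (hs : 0 ≤ s) (hq : s < q) (hC : 0 ≤ C) :
    ∃ K : ℝ, 0 ≤ K ∧ ∀ {Ω : Type} [MeasurableSpace Ω] (μ : Measure Ω) (X : Ω → ℝ≥0∞) (m : ℝ≥0∞),
      AEMeasurable X μ →
      (∀ i : ℕ, μ {ω | 2 ^ i < X ω} ≤ m * ENNReal.ofReal (C * 2 ^ (-(q * i)))) →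
      ∫⁻ ω, X ω ^ s ∂μ ≤ μ Set.univ + m * ENNReal.ofReal K := by
  have hr1 : (2 : ℝ) ^ (s - q) < 1 := Real.rpow_lt_one_of_one_lt_of_neg (by norm_num) (by linarith)
  have hr0 : (0 : ℝ) < (2 : ℝ) ^ (s - q) := by positivity
  refine ⟨C * 2 ^ s * (1 - 2 ^ (s - q))⁻¹, by have := sub_pos.2 hr1; positivity, ?_⟩
  intro Ω _ μ X m hX htail
  -- If `2 ^ n < x ≤ 2 ^ (n + 1)`, then the term with index `n` alone dominates `x ^ s`.
  have hpt : ∀ x : ℝ≥0∞, x ^ s ≤ 1 + ∑' i : ℕ, ENNReal.ofReal (2 ^ (s * (i + 1))) *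
      (if 2 ^ i < x then 1 else 0) := by
    intro x
    rcases le_or_gt x 1 with hx | hx
    · exact (ENNReal.rpow_le_one hx hs).trans le_self_add
    by_cases hxt : x = ⊤
    · have : ∑' i : ℕ, ENNReal.ofReal (2 ^ (s * (i + 1))) * (if (2 : ℝ≥0∞) ^ i < x then 1 else 0) = ⊤ := by
        rw [eq_top_iff, ← ENNReal.tsum_const_eq_top_of_ne_zero (α := ℕ) (c := 1) one_ne_zero]
        refine ENNReal.tsum_le_tsum fun i => ?_
        rw [if_pos (by rw [hxt]; exact ENNReal.pow_lt_top (by norm_num)), mul_one, ← ENNReal.ofReal_one]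
        exact ENNReal.ofReal_le_ofReal (Real.one_le_rpow (by norm_num) (by positivity))
      rw [this]; simp
    · obtain ⟨n, hn1, hn2⟩ : ∃ n : ℕ, (2 : ℝ≥0∞) ^ n < x ∧ x ≤ 2 ^ (n + 1) := by
        have hex : ∃ n : ℕ, x ≤ 2 ^ n := by
          obtain ⟨n, hn⟩ := pow_unbounded_of_one_lt x.toReal (show (1 : ℝ) < 2 by norm_num)
          refine ⟨n, ?_⟩
          rw [← ENNReal.ofReal_toReal hxt]
          refine (ENNReal.ofReal_le_ofReal hn.le).trans ?_
          rw [ENNReal.ofReal_pow (by norm_num)]; simp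
        classical
        obtain ⟨m, hm⟩ : ∃ m, Nat.find hex = m + 1 := by
          refine Nat.exists_eq_succ_of_ne_zero fun h0 => ?_
          have := Nat.find_spec hex
          rw [h0, pow_zero] at this
          exact absurd hx (not_lt.2 this)
        exact ⟨m, not_le.1 (Nat.find_min hex (by omega)), hm ▸ Nat.find_spec hex⟩
      refine le_trans ?_ (le_trans (ENNReal.le_tsum n) le_add_self)
      rw [if_pos hn1, mul_one]
      refine (ENNReal.rpow_le_rpow hn2 hs).trans (le_of_eq ?_)
      rw [← ENNReal.rpow_natCast, ← ENNReal.rpow_mul, ← ENNReal.ofReal_ofNat 2,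
        ENNReal.ofReal_rpow_of_pos (by norm_num)]
      congr 2; push_cast; ring
  have hmeas : ∀ i : ℕ, NullMeasurableSet {ω | 2 ^ i < X ω} μ := fun i =>
    nullMeasurableSet_lt aemeasurable_const hX
  calc ∫⁻ ω, X ω ^ s ∂μ
      ≤ ∫⁻ ω, (1 + ∑' i : ℕ, ENNReal.ofReal (2 ^ (s * (i + 1))) *
          {ω | 2 ^ i < X ω}.indicator 1 ω) ∂μ := lintegral_mono fun ω => by
        refine (hpt (X ω)).trans (le_of_eq ?_)
        simp [Set.indicator]
    _ = μ Set.univ + ∑' i : ℕ, ENNReal.ofReal (2 ^ (s * (i + 1))) * μ {ω | 2 ^ i < X ω} := by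
        have hm' : ∀ i : ℕ, AEMeasurable (fun ω => ENNReal.ofReal (2 ^ (s * (i + 1))) * {ω | 2 ^ i < X ω}.indicator (1 : Ω → ℝ≥0∞) ω) μ := fun i =>
          (aemeasurable_const.indicator₀ (hmeas i)).const_mul _
        rw [lintegral_add_left measurable_const, lintegral_tsum hm']
        simp only [lintegral_one]
        congr 2
        ext i
        have hi : AEMeasurable ({ω | 2 ^ i < X ω}.indicator (1 : Ω → ℝ≥0∞)) μ :=
          aemeasurable_const.indicator₀ (hmeas i)
        rw [lintegral_const_mul'' _ hi, lintegral_indicator_one₀ (hmeas i)]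
    _ ≤ μ Set.univ + ∑' i : ℕ, m * ENNReal.ofReal (C * 2 ^ s) * ENNReal.ofReal (2 ^ (s - q)) ^ i := by
        refine add_le_add le_rfl (ENNReal.tsum_le_tsum fun i => ?_)
        refine (mul_le_mul_right (htail i) _).trans (le_of_eq ?_)
        rw [mul_left_comm, mul_assoc, ← ENNReal.ofReal_mul (by positivity), ← ENNReal.ofReal_pow (by positivity),
          ← ENNReal.ofReal_mul (by positivity)]
        congr 2
        rw [← Real.rpow_natCast (2 ^ (s - q)), ← Real.rpow_mul (by norm_num)]
        rw [show (2:ℝ) ^ (s * ((i:ℝ) + 1)) * (C * 2 ^ (-(q * i))) = C * (2 ^ (s * ((i:ℝ) + 1)) * 2 ^ (-(q * i))) by ring,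
          mul_assoc, ← Real.rpow_add (by norm_num), ← Real.rpow_add (by norm_num)]
        congr 2; ring
    _ = _ := by
        rw [ENNReal.tsum_mul_left, ENNReal.tsum_geometric, mul_assoc, ← ENNReal.ofReal_one,
          ← ENNReal.ofReal_sub _ hr0.le, ← ENNReal.ofReal_inv_of_pos (by linarith), ← ENNReal.ofReal_mul (by positivity)]


/-! ### The law of large numbers for the auxiliary front -/

/-- Convergence of the averages along all residue classes gives convergence of the averages. -/
theorem tendsto_average_of_residues {x : ℕ → ℝ} (hx : ∀ i, 0 ≤ x i) {m : ℕ} (hm : 0 < m) {L : ℝ}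
    (h : ∀ c < m, Tendsto (fun q : ℕ => (∑ i ∈ Finset.range q, x (c + m * i)) / q) atTop (𝓝 L)) :
    Tendsto (fun n : ℕ => (∑ i ∈ Finset.range n, x i) / n) atTop (𝓝 L) := by
  have hm' : (0 : ℝ) < m := by exact_mod_cast hm
  set S : ℕ → ℝ := fun n => ∑ i ∈ Finset.range n, x i with hS
  have hSmono : Monotone S := by
    refine monotone_nat_of_le_succ fun n => ?_
    simp only [hS, Finset.sum_range_succ]; linarith [hx n]
  have hblock : ∀ q, S (m * q) = ∑ c ∈ Finset.range m, ∑ i ∈ Finset.range q, x (c + m * i) := by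
    intro q
    induction q with
    | zero => simp [hS]
    | succ q ih =>
      have : S (m * (q + 1)) = S (m * q) + ∑ c ∈ Finset.range m, x (m * q + c) := by
        simp only [hS]; rw [mul_add, mul_one, Finset.sum_range_add]
      rw [this, ih, ← Finset.sum_add_distrib]
      refine Finset.sum_congr rfl fun c _ => ?_
      rw [Finset.sum_range_succ, add_comm (m * q) c]
  have hA : Tendsto (fun q : ℕ => S (m * q) / q) atTop (𝓝 (m * L)) := by
    have : Tendsto (fun q : ℕ => ∑ c ∈ Finset.range m, (∑ i ∈ Finset.range q, x (c + m * i)) / q) atTop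
        (𝓝 (∑ _c ∈ Finset.range m, L)) :=
      tendsto_finsetSum _ fun c hc => h c (Finset.mem_range.1 hc)
    simp only [Finset.sum_const, Finset.card_range, nsmul_eq_mul] at this
    refine this.congr fun q => ?_
    rw [hblock, Finset.sum_div]
  have hq : Tendsto (fun n : ℕ => n / m) atTop atTop := Nat.tendsto_div_const_atTop hm.ne'
  have hq1 : Tendsto (fun n : ℕ => n / m + 1) atTop atTop := (tendsto_add_atTop_nat 1).comp hq
  have hr : Tendsto (fun n : ℕ => ((n / m : ℕ) : ℝ) / n) atTop (𝓝 (1 / m)) := by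
    have := (tendsto_nat_floor_mul_div_atTop (a := (1 / m : ℝ)) (by positivity)).comp tendsto_natCast_atTop_atTop
    refine this.congr fun n => ?_
    simp only [Function.comp]
    rw [one_div_mul_eq_div, Nat.floor_div_natCast, Nat.floor_natCast]
  have hr1 : Tendsto (fun n : ℕ => ((n / m + 1 : ℕ) : ℝ) / n) atTop (𝓝 (1 / m)) := by
    have := hr.add tendsto_one_div_atTop_nhds_zero_nat
    rw [add_zero] at this
    refine this.congr fun n => ?_
    push_cast; ring
  have hlow : Tendsto (fun n : ℕ => S (m * (n / m)) / (n / m : ℕ) * (((n / m : ℕ) : ℝ) / n)) atTop (𝓝 L) := by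
    have := (hA.comp hq).mul hr
    rwa [mul_one_div, mul_div_cancel_left₀ _ hm'.ne'] at this
  have hupp : Tendsto (fun n : ℕ => S (m * (n / m + 1)) / (n / m + 1 : ℕ) * (((n / m + 1 : ℕ) : ℝ) / n)) atTop (𝓝 L) := by
    have := (hA.comp hq1).mul hr1
    rwa [mul_one_div, mul_div_cancel_left₀ _ hm'.ne'] at this
  refine tendsto_of_tendsto_of_tendsto_of_le_of_le' hlow hupp ?_ ?_
  · filter_upwards [eventually_ge_atTop m] with n hn
    have h1 : 0 < n / m := Nat.div_pos hn hm
    have h2 : (0 : ℝ) < (n / m : ℕ) := by exact_mod_cast h1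
    have h3 : (0 : ℝ) < n := by exact_mod_cast (hm.trans_le hn)
    rw [div_mul_div_cancel₀ h2.ne']
    gcongr
    exact hSmono (Nat.mul_div_le n m)
  · filter_upwards [eventually_ge_atTop m] with n hn
    have h2 : (0 : ℝ) < (n / m + 1 : ℕ) := by positivity
    have h3 : (0 : ℝ) < n := by exact_mod_cast (hm.trans_le hn)
    rw [div_mul_div_cancel₀ h2.ne']
    gcongr
    exact hSmono (Nat.lt_mul_div_succ n hm).le

/-- The strong law of large numbers for `m`-dependent nonnegative variables. -/
theorem strong_law_of_dependent {Ω : Type*} [MeasurableSpace Ω] {μ : Measure Ω} {X : ℕ → Ω → ℝ} {m : ℕ}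
    (hm : 0 < m) (hint : Integrable (X 0) μ) (h0 : ∀ i ω, 0 ≤ X i ω)
    (hind : ∀ i j, i + m ≤ j → IndepFun (X i) (X j) μ)
    (hid : ∀ i, IdentDistrib (X i) (X 0) μ μ) :
    ∀ᵐ ω ∂μ, Tendsto (fun n : ℕ => (∑ i ∈ Finset.range n, X i ω) / n) atTop (𝓝 (∫ ω, X 0 ω ∂μ)) := by
  have h : ∀ c : ℕ, ∀ᵐ ω ∂μ, Tendsto (fun q : ℕ => (∑ i ∈ Finset.range q, X (c + m * i) ω) / q) atTop
      (𝓝 (∫ ω, X 0 ω ∂μ)) := by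
    intro c
    rw [← (hid c).integral_eq]
    have := strong_law_ae_real (μ := μ) (fun i => X (c + m * i)) ((hid c).symm.integrable_snd hint) ?_ ?_
    · simpa using this
    · intro i j hij
      rcases lt_or_gt_of_ne hij with hlt | hlt
      · refine hind _ _ ?_
        have : m * (i + 1) ≤ m * j := Nat.mul_le_mul_left m hlt
        rw [mul_add] at this; omega
      · refine (hind _ _ ?_).symm
        have : m * (j + 1) ≤ m * i := Nat.mul_le_mul_left m hlt
        rw [mul_add] at this; omega
    · intro i
      simpa using (hid (c + m * i)).trans (hid c).symm
  filter_upwards [ae_all_iff.2 h] with ω hω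
  exact tendsto_average_of_residues (fun i => h0 i ω) hm fun c _ => hω c

/-- The waiting time at `z` of an auxiliary front that has started far to the left of `z`. -/
def kap (M : ℕ) (z : ℤ) : Sample a → ℝ≥0∞ := wait M (z - M + 1) z

theorem measurable_kap (M : ℕ) (z : ℤ) : Measurable (kap (a := a) M z) := measurable_wait _ _ _

theorem dependsOn_kap {M : ℕ} (ha : 2 ≤ a) (z : ℤ) :
    DependsOn (kap (a := a) M z) {p | z - M < p.1.site ∧ p.1.site ≤ z} :=
  (dependsOn_wait M _ z ha).mono fun _ hp => hp.2

theorem kap_translate (M : ℕ) (r z : ℤ) (ω : Sample a) : kap M z (translate r ω) = kap M (z + r) ω := by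
  unfold kap; rw [wait_translate]; congr 1; ring

theorem identDistrib_kap {M : ℕ} (ha : 2 ≤ a) (z y : ℤ) :
    IdentDistrib (kap (a := a) M z) (kap M y) (walkMeasure a) (walkMeasure a) :=
  identDistrib_wait M ha le_rfl le_rfl

theorem GoodSample.kap_ne_top {M : ℕ} (ha : 2 ≤ a) (hM : 0 < M) (z : ℤ) {ω : Sample a}
    (hω : GoodSample ω) : kap M z ω ≠ ⊤ :=
  hω.wait_ne_top ha hM (by omega)

theorem indepFun_kap {M : ℕ} (ha : 2 ≤ a) {y z : ℤ} (h : y + M ≤ z) :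
    IndepFun (kap (a := a) M y) (kap M z) (walkMeasure a) := by
  rw [indepFun_iff_measure_inter_preimage_eq_mul]
  intro s t hs ht
  refine measure_inter_of_dependsOn jumpLaw {p | p.1.site ≤ y}
    (measurable_kap M y hs).nullMeasurableSet (measurable_kap M z ht).nullMeasurableSet ?_ ?_
  · intro ω ω' hω
    have := (dependsOn_kap (M := M) ha y).mono (t := {p | p.1.site ≤ y}) (fun p hp => hp.2) hω
    simp [Set.mem_preimage, this]
  · intro ω ω' hω
    have := (dependsOn_kap (M := M) ha z).mono (t := {p | p.1.site ≤ y}ᶜ) (fun p hp => by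
      have := hp.1; simp only [Set.mem_compl_iff, Set.mem_ofPred_eq]; omega) hω
    simp [Set.mem_preimage, this]

theorem lintegral_kap_sq_lt_top {M : ℕ} (ha : 2 ≤ a) (hM : 4 < M) :
    ∫⁻ ω, kap M 0 ω ^ 2 ∂(walkMeasure a) < ⊤ := by
  have hM' : (4 : ℝ) < M := by exact_mod_cast hM
  obtain ⟨K, -, hK⟩ := exists_lintegral_rpow_le (s := 2) (q := (M : ℝ) / 2) (C := (2 * M) ^ M) (by norm_num)
    (by linarith) (by positivity)
  have := hK (walkMeasure a) (kap M 0) 1 (measurable_kap M 0).aemeasurable fun i => by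
    have h := measure_lt_wait_le (M := M) ha (r := 0 - M + 1) (z := 0) le_rfl (t := 2 ^ i) (by positivity)
    rw [ENNReal.ofReal_pow (by norm_num), ENNReal.ofReal_ofNat] at h
    rw [one_mul]
    refine h.trans (le_of_eq ?_)
    rw [← Real.rpow_natCast 2 i, ← Real.rpow_mul (by norm_num)]
    congr 3; ring
  simp only [measure_univ, one_mul, ENNReal.rpow_ofNat] at this
  exact this.trans_lt (by finiteness)

/-- The mean waiting time of the stationary auxiliary front. -/
def meanWait (M a : ℕ) : ℝ := ∫ ω, (kap (a := a) M 0 ω).toReal ∂(walkMeasure a)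

theorem integrable_kap {M : ℕ} (ha : 2 ≤ a) (hM : 4 < M) :
    Integrable (fun ω => (kap (a := a) M 0 ω).toReal) (walkMeasure a) := by
  refine integrable_toReal_of_lintegral_ne_top (measurable_kap M 0).aemeasurable ?_
  refine ne_top_of_le_ne_top (b := 1 + ∫⁻ ω, kap M 0 ω ^ 2 ∂(walkMeasure a)) ?_ ?_
  · have := (lintegral_kap_sq_lt_top ha hM).ne; finiteness
  · have : (1 : ℝ≥0∞) = ∫⁻ _ω : Sample a, 1 ∂(walkMeasure a) := by simp
    rw [this, ← lintegral_add_left measurable_const]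
    refine lintegral_mono fun ω => ?_
    rcases le_total (kap M 0 ω) 1 with h | h
    · exact h.trans le_self_add
    · refine le_trans ?_ le_add_self
      rw [pow_two]
      exact le_mul_of_one_le_left' h

theorem GoodSeq.hit_pos {s : WalkSeq} (h : GoodSeq s) {j : ℤ} (hj : j ≠ 0) :
    ENNReal.ofReal (s 0).1 ≤ hit s j := by
  rw [hit_cons h.pos hj]; exact le_self_add

theorem GoodSample.kap_pos {M : ℕ} (ha : 2 ≤ a) (z : ℤ) {ω : Sample a} (hω : GoodSample ω) :
    0 < kap M z ω := by
  set B : Finset (Label a) := (Finset.Ioc (z - M) z ×ˢ Finset.univ).image fun p => mkLabel p.1 p.2 with hB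
  have h1 : 0 < B.inf fun l => ENNReal.ofReal (ω (l, 0)).1 := by
    rw [Finset.lt_inf_iff (by simp)]
    exact fun l _ => ENNReal.ofReal_pos.2 ((hω.seq l).pos 0)
  refine h1.trans_le (le_iInf₂ fun l hl => ?_)
  have hlB : l ∈ B := by
    rw [hB, Finset.mem_image]
    exact ⟨ofLex l, by simp [lt_site_of_mem_auxLabels ha hl, hl.2.1], rfl⟩
  refine (Finset.inf_le hlB).trans ((hω.seq l).hit_pos ?_)
  have := hl.2.1; omega

theorem meanWait_pos {M : ℕ} (ha : 2 ≤ a) (hM : 4 < M) : 0 < meanWait M a := by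
  unfold meanWait
  rw [integral_pos_iff_support_of_nonneg (fun ω => ENNReal.toReal_nonneg) (integrable_kap ha hM)]
  have : walkMeasure a (Function.support fun ω => (kap (a := a) M 0 ω).toReal) = 1 := by
    rw [← measure_univ (μ := walkMeasure a)]
    refine measure_congr (eventuallyEq_univ.2 ?_)
    filter_upwards [ae_goodSample (a := a)] with ω hω
    exact (ENNReal.toReal_pos (hω.kap_pos ha 0).ne' (hω.kap_ne_top ha (by omega) 0)).ne'
  rw [this]; exact one_pos

theorem ae_tendsto_kap {M : ℕ} (ha : 2 ≤ a) (hM : 4 < M) :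
    ∀ᵐ ω ∂(walkMeasure a), Tendsto (fun n : ℕ => (∑ i ∈ Finset.range n, (kap M (i : ℤ) ω).toReal) / n)
      atTop (𝓝 (meanWait M a)) := by
  have := strong_law_of_dependent (μ := walkMeasure a) (X := fun i ω => (kap (a := a) M (i : ℤ) ω).toReal)
    (m := M) (by omega) (by simpa using integrable_kap ha hM) (fun _ _ => ENNReal.toReal_nonneg)
    (fun i j hij => (indepFun_kap (a := a) (M := M) ha (y := i) (z := j) (by exact_mod_cast hij)).comp
      ENNReal.measurable_toReal ENNReal.measurable_toReal)
    (fun i => (identDistrib_kap ha _ _).comp ENNReal.measurable_toReal)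
  simpa [meanWait] using this

/-- The time at which the auxiliary front started from `r` has advanced by `n`. -/
def auxTime (M : ℕ) (r : ℤ) (n : ℕ) (ω : Sample a) : ℝ≥0∞ :=
  ∑ k ∈ Finset.Icc 1 n, auxWait M (walks ω) r k

theorem auxTime_zero (M : ℕ) (r : ℤ) (ω : Sample a) : auxTime M r 0 ω = 0 := by simp [auxTime]

theorem auxTime_succ (M : ℕ) (r : ℤ) (n : ℕ) (ω : Sample a) :
    auxTime M r (n + 1) ω = auxTime M r n ω + auxWait M (walks ω) r (n + 1) := by
  rw [auxTime, Finset.sum_Icc_succ_top (by omega)]; rfl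

theorem auxTime_mono (M : ℕ) (r : ℤ) (ω : Sample a) : Monotone fun n => auxTime M r n ω :=
  monotone_nat_of_le_succ fun n => by rw [auxTime_succ]; exact le_self_add

theorem auxTime_translate (M : ℕ) (r : ℤ) (n : ℕ) (ω : Sample a) :
    auxTime M 0 n (translate r ω) = auxTime M r n ω := by
  simp only [auxTime, auxWait_translate]

theorem GoodSample.auxTime_eq {M : ℕ} {ω : Sample a} (h : GoodSample ω) (r : ℤ) (n : ℕ) :
    auxTime M r n ω = ∑ i ∈ Finset.range n, wait M r (r + i) ω := by
  induction n with
  | zero => simp [auxTime]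
  | succ n ih =>
    rw [auxTime_succ, ih, Finset.sum_range_succ, h.auxWait_eq]
    congr 2; push_cast; ring

theorem GoodSample.auxTime_ne_top {M : ℕ} (ha : 2 ≤ a) (hM : 0 < M) {ω : Sample a} (h : GoodSample ω)
    (r : ℤ) (n : ℕ) : auxTime M r n ω ≠ ⊤ := by
  rw [h.auxTime_eq]
  exact ENNReal.sum_ne_top.2 fun i _ => h.wait_ne_top ha hM (by omega)

theorem ae_tendsto_auxTime {M : ℕ} (ha : 2 ≤ a) (hM : 4 < M) :
    ∀ᵐ ω ∂(walkMeasure a), Tendsto (fun n : ℕ => (auxTime M 0 n ω).toReal / n) atTop (𝓝 (meanWait M a)) := by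
  filter_upwards [ae_tendsto_kap ha hM, ae_goodSample (a := a)] with ω h hω
  have hx : ∀ i : ℕ, wait M 0 (0 + i) ω ≠ ⊤ := fun i => hω.wait_ne_top ha (by omega) (by omega)
  -- From `M` on, the two sums have the same increments.
  have hd : ∀ n, (auxTime M 0 (M + n) ω).toReal = (auxTime M 0 M ω).toReal -
      (∑ i ∈ Finset.range M, (kap M (i : ℤ) ω).toReal) + ∑ i ∈ Finset.range (M + n), (kap M (i : ℤ) ω).toReal := by
    intro n
    induction n with
    | zero => simp
    | succ n ih =>
      rw [← add_assoc, Finset.sum_range_succ, hω.auxTime_eq, Finset.sum_range_succ, ← hω.auxTime_eq,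
        ENNReal.toReal_add (hω.auxTime_ne_top ha (by omega) _ _) (hx _), ih]
      have : wait M 0 (0 + ((M + n : ℕ) : ℤ)) ω = kap M ((M + n : ℕ) : ℤ) ω := by
        rw [zero_add, kap]; exact wait_eq_of_le ha (by push_cast; omega) le_rfl ω
      rw [this]; ring
  have hc : Tendsto (fun n : ℕ => ((auxTime M 0 M ω).toReal -
      (∑ i ∈ Finset.range M, (kap M (i : ℤ) ω).toReal)) / (n : ℝ)) atTop (𝓝 0) :=
    tendsto_const_nhds.div_atTop tendsto_natCast_atTop_atTop
  have := hc.add h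
  rw [zero_add] at this
  refine this.congr' ?_
  filter_upwards [eventually_ge_atTop M] with n hn
  obtain ⟨k, rfl⟩ := Nat.exists_eq_add_of_le hn
  rw [hd, add_div]

/-- The auxiliary front does not explode. -/
def NoExplosion (M : ℕ) (r : ℤ) (ω : Sample a) : Prop := ∀ C : ℝ≥0, ∃ n, (C : ℝ≥0∞) < auxTime M r n ω

theorem NoExplosion.auxFront_iff {M : ℕ} {r : ℤ} {ω : Sample a} (h : NoExplosion M r ω) (t : ℝ≥0) (n : ℕ) :
    (n : ℤ) ≤ auxFront M (walks ω) r t - r ↔ auxTime M r n ω ≤ t := by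
  obtain ⟨m, hm⟩ := h t
  have hbdd : BddAbove {n : ℕ | auxTime M r n ω ≤ t} := ⟨m, fun k hk => by
    by_contra hlt
    push Not at hlt
    exact absurd ((auxTime_mono M r ω hlt.le).trans hk) (not_le.2 hm)⟩
  have hne : {n : ℕ | auxTime M r n ω ≤ t}.Nonempty := ⟨0, by simp [auxTime_zero]⟩
  have hmem := Nat.sSup_mem hne hbdd
  have hf : auxFront M (walks ω) r t - r = (sSup {n : ℕ | auxTime M r n ω ≤ t} : ℕ) := by
    unfold auxFront auxTime; ring
  rw [hf, Nat.cast_le]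
  constructor
  · intro hle
    exact (auxTime_mono M r ω hle).trans hmem
  · intro hle
    exact le_csSup hbdd hle

theorem ae_noExplosion {M : ℕ} (ha : 2 ≤ a) (hM : 4 < M) (r : ℤ) :
    ∀ᵐ ω ∂(walkMeasure a), NoExplosion M r ω := by
  have h0 : ∀ᵐ ω ∂(walkMeasure a), NoExplosion M 0 ω := by
    filter_upwards [ae_tendsto_auxTime ha hM, ae_goodSample (a := a)] with ω h hω C
    have hlim : Tendsto (fun n : ℕ => (auxTime M 0 n ω).toReal) atTop atTop := by
      refine (h.pos_mul_atTop (meanWait_pos ha hM) tendsto_natCast_atTop_atTop).congr' ?_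
      filter_upwards [eventually_gt_atTop 0] with n hn
      field_simp
    obtain ⟨n, hn⟩ := (hlim.eventually_gt_atTop (C : ℝ)).exists
    refine ⟨n, ?_⟩
    rw [← ENNReal.ofReal_toReal (hω.auxTime_ne_top ha (by omega) 0 n), ← ENNReal.ofReal_coe_nnreal]
    exact (ENNReal.ofReal_lt_ofReal_iff (lt_of_le_of_lt C.2 hn)).2 hn
  filter_upwards [(measurePreserving_translate r).quasiMeasurePreserving.ae h0] with ω hω C
  obtain ⟨n, hn⟩ := hω C
  exact ⟨n, by rwa [auxTime_translate] at hn⟩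

theorem ae_tendsto_auxFront {M : ℕ} (ha : 2 ≤ a) (hM : 4 < M) (r : ℤ) :
    ∀ᵐ ω ∂(walkMeasure a), Tendsto (fun t : ℝ≥0 => (auxFront M (walks ω) r t : ℝ) / (t : ℝ)) atTop
      (𝓝 (1 / meanWait M a)) := by
  have hmu := meanWait_pos ha hM
  have h0 : ∀ᵐ ω ∂(walkMeasure a), Tendsto (fun t : ℝ≥0 => (auxFront M (walks ω) 0 t : ℝ) / (t : ℝ)) atTop
      (𝓝 (1 / meanWait M a)) := by
    filter_upwards [ae_tendsto_auxTime ha hM, ae_noExplosion ha hM 0, ae_goodSample (a := a)] with ω h hne hω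
    obtain ⟨N, hN⟩ : ∃ N : ℝ≥0 → ℕ, ∀ t, auxFront M (walks ω) 0 t = N t :=
      ⟨fun t => (sSup {n : ℕ | ∑ k ∈ Finset.Icc 1 n, auxWait M (walks ω) 0 k ≤ t} : ℕ), fun t => by simp [auxFront]⟩
    have hiff : ∀ t n, n ≤ N t ↔ auxTime M 0 n ω ≤ t := fun t n => by
      rw [← hne.auxFront_iff, hN]; simp
    have hfin := fun n => hω.auxTime_ne_top ha (show 0 < M by omega) 0 n
    have hNlim : Tendsto N atTop atTop := by
      refine tendsto_atTop.2 fun n => ?_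
      filter_upwards [eventually_ge_atTop (auxTime M 0 n ω).toNNReal] with t ht
      rw [hiff, ← ENNReal.coe_toNNReal (hfin n)]
      exact_mod_cast ht
    set A : ℕ → ℝ := fun n => (auxTime M 0 n ω).toReal with hA
    -- `A (N t) ≤ t < A (N t + 1)` squeezes `N t / t`.
    have hA1 : ∀ t, A (N t) ≤ t := fun t => by
      have := ENNReal.toReal_mono ENNReal.coe_ne_top ((hiff t (N t)).1 le_rfl)
      simpa using this
    have hA2 : ∀ t : ℝ≥0, (t : ℝ) < A (N t + 1) := fun t => by
      have h1 : ¬ auxTime M 0 (N t + 1) ω ≤ t := fun hle => by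
        have := (hiff t (N t + 1)).2 hle; omega
      have := (ENNReal.toReal_lt_toReal ENNReal.coe_ne_top (hfin _)).2 (not_le.1 h1)
      simpa using this
    have hi : Tendsto (fun n : ℕ => (n : ℝ) / A n) atTop (𝓝 (1 / meanWait M a)) := by
      have := h.inv₀ hmu.ne'
      rw [one_div]
      refine this.congr fun n => ?_
      rw [inv_div]
    have hupp : Tendsto (fun t => (N t : ℝ) / A (N t)) atTop (𝓝 (1 / meanWait M a)) := hi.comp hNlim
    have hlow : Tendsto (fun t => (N t : ℝ) / A (N t + 1)) atTop (𝓝 (1 / meanWait M a)) := by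
      have h1 : Tendsto (fun t => ((N t + 1 : ℕ) : ℝ) / A (N t + 1)) atTop (𝓝 (1 / meanWait M a)) :=
        hi.comp ((tendsto_add_atTop_nat 1).comp hNlim)
      have h2 : Tendsto (fun t => 1 / A (N t + 1)) atTop (𝓝 0) := by
        refine tendsto_const_nhds.div_atTop ?_
        refine tendsto_atTop_mono (fun t => (hA2 t).le) ?_
        exact NNReal.tendsto_coe_atTop.2 tendsto_id
      have := h1.sub h2
      rw [sub_zero] at this
      refine this.congr fun t => ?_
      push_cast; ring
    refine tendsto_of_tendsto_of_tendsto_of_le_of_le' hlow hupp ?_ ?_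
    · filter_upwards [eventually_gt_atTop 0] with t ht
      have : (0 : ℝ) < t := by exact_mod_cast ht
      rw [hN, Int.cast_natCast]
      gcongr
      exact (hA2 t).le
    · have hApos : ∀ᶠ t in atTop, 0 < A (N t) := by
        have h1 := hNlim.eventually (eventually_gt_atTop 0)
        filter_upwards [h1] with t ht
        have h2 : 0 < A 1 := by
          refine ENNReal.toReal_pos ?_ (hfin 1)
          have h3 : kap M 0 ω ≤ auxTime M 0 1 ω := by
            rw [hω.auxTime_eq]
            simp only [Finset.range_one, Finset.sum_singleton, Nat.cast_zero, add_zero]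
            exact wait_mono (by omega) ω
          exact ((hω.kap_pos ha 0).trans_le h3).ne'
        exact h2.trans_le (ENNReal.toReal_mono (hfin _) (auxTime_mono M 0 ω ht))
      filter_upwards [hApos] with t ht
      rw [hN, Int.cast_natCast]
      gcongr
      exact hA1 t
  filter_upwards [(measurePreserving_translate r).quasiMeasurePreserving.ae h0] with ω hω
  have h1 : Tendsto (fun t : ℝ≥0 => (r : ℝ) / (t : ℝ)) atTop (𝓝 0) :=
    tendsto_const_nhds.div_atTop (NNReal.tendsto_coe_atTop.2 tendsto_id)
  have := hω.add h1
  rw [add_zero] at this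
  refine this.congr fun t => ?_
  rw [auxFront_translate]; push_cast; ring

/-- The time `U` in terms of the times at which the auxiliary front advances. -/
theorem NoExplosion.timeU_eq {M : ℕ} {r : ℤ} {ω : Sample a} (h : NoExplosion M r ω) {α' : ℝ} (hα : 0 < α') :
    timeU M α' (walks ω) r =
      ⨅ (n : ℕ) (_ : ENNReal.ofReal (n / α') < auxTime M r n ω), ENNReal.ofReal (n / α') := by
  apply le_antisymm
  · refine le_iInf₂ fun n hn => ?_
    refine (iInf₂_le (n / α' : ℝ).toNNReal ?_).trans (le_of_eq rfl)
    rw [Real.coe_toNNReal _ (by positivity), mul_div_cancel₀ _ hα.ne', Int.floor_natCast, ← not_le,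
      h.auxFront_iff]
    exact not_le.2 hn
  · refine le_iInf₂ fun t ht => ?_
    obtain ⟨n, hn⟩ : ∃ n : ℕ, ⌊α' * t⌋ = n := ⟨⌊α' * t⌋.toNat, by
      have : 0 ≤ ⌊α' * (t : ℝ)⌋ := Int.floor_nonneg.2 (by positivity)
      omega⟩
    rw [hn, ← not_le, h.auxFront_iff, not_le] at ht
    have h1 : (n : ℝ) / α' ≤ t := by
      rw [div_le_iff₀ hα, mul_comm]
      have := Int.floor_le (α' * (t : ℝ))
      rw [hn] at this
      exact_mod_cast this
    have h2 : ENNReal.ofReal (n / α') ≤ t := by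
      rw [← ENNReal.ofReal_coe_nnreal]; exact ENNReal.ofReal_le_ofReal h1
    exact (iInf₂_le n (h2.trans_lt ht)).trans h2

theorem NoExplosion.timeU_eq_top_iff {M : ℕ} {r : ℤ} {ω : Sample a} (h : NoExplosion M r ω) {α' : ℝ}
    (hα : 0 < α') :
    timeU M α' (walks ω) r = ⊤ ↔ ∀ n : ℕ, auxTime M r n ω ≤ ENNReal.ofReal (n / α') := by
  rw [h.timeU_eq hα]
  simp [iInf_eq_top]

theorem dependsOn_auxTime (M : ℕ) (r : ℤ) (n : ℕ) :
    DependsOn (auxTime (a := a) M r n) {p | r ≤ p.1.site} := by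
  intro ω ω' h
  unfold auxTime
  refine Finset.sum_congr rfl fun k _ => ?_
  unfold auxWait
  refine iInf_congr fun t => iInf_congr_Prop ?_ fun _ => rfl
  refine exists_congr fun l => and_congr_right fun hl => ?_
  have : seqOf ω l = seqOf ω' l := funext fun n => h (l, n) hl.1
  rw [walks_eq, walks_eq, this]

/-- The auxiliary front started from `r`, and hence `U`, only uses walks with labels `(x, i)`, `x ≥ r`. -/
theorem dependsOn_timeU (M : ℕ) (α' : ℝ) (r : ℤ) :
    DependsOn (fun ω : Sample a => timeU M α' (walks ω) r) {p | r ≤ p.1.site} := by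
  intro ω ω' h
  have h1 : ∀ n, auxTime M r n ω = auxTime M r n ω' := fun n => dependsOn_auxTime M r n h
  simp only [timeU, auxFront]
  unfold auxTime at h1
  simp only [h1]

theorem aemeasurable_auxTime (M : ℕ) (r : ℤ) (n : ℕ) : AEMeasurable (auxTime (a := a) M r n) (walkMeasure a) := by
  refine AEMeasurable.congr (f := fun ω => ∑ i ∈ Finset.range n, wait M r (r + i) ω)
    (Finset.measurable_sum _ fun i _ => measurable_wait M _ _).aemeasurable ?_
  filter_upwards [ae_goodSample (a := a)] with ω hω using (hω.auxTime_eq r n).symm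

theorem aemeasurable_timeU {M : ℕ} (ha : 2 ≤ a) (hM : 4 < M) {α' : ℝ} (hα : 0 < α') (r : ℤ) :
    AEMeasurable (fun ω : Sample a => timeU M α' (walks ω) r) (walkMeasure a) := by
  classical
  have h : (fun ω : Sample a => timeU M α' (walks ω) r) =ᵐ[walkMeasure a] fun ω =>
      ⨅ n : ℕ, if ENNReal.ofReal (n / α') < auxTime M r n ω then ENNReal.ofReal (n / α') else ⊤ := by
    filter_upwards [ae_noExplosion ha hM r] with ω hω
    rw [hω.timeU_eq hα]
    refine iInf_congr fun n => ?_
    split_ifs with h <;> simp [h]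
  refine AEMeasurable.congr (AEMeasurable.iInf fun n => ?_) h.symm
  have hm := aemeasurable_auxTime (a := a) M r n
  have : (fun ω : Sample a => if ENNReal.ofReal (n / α') < auxTime M r n ω then ENNReal.ofReal (n / α') else ⊤) =
      (fun x : ℝ≥0∞ => if ENNReal.ofReal (n / α') < x then ENNReal.ofReal (n / α') else ⊤) ∘ auxTime M r n := rfl
  rw [this]
  exact (Measurable.ite (measurableSet_lt measurable_const measurable_id) measurable_const measurable_const).comp_aemeasurable hm


/-! ### The time `U` -/

theorem measure_timeU_eq_top (M : ℕ) (ha : 2 ≤ a) (hM : 4 < M) {α' : ℝ} (hα : 0 < α') (r : ℤ) :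
    walkMeasure a {ω | timeU M α' (walks ω) r = ⊤} = walkMeasure a {ω | timeU M α' (walks ω) 0 = ⊤} := by
  have h := (measurePreserving_translate (a := a) r).measure_preimage
    (s := {ω | timeU M α' (walks ω) 0 = ⊤})
    (nullMeasurableSet_eq_fun (aemeasurable_timeU ha hM hα 0) aemeasurable_const)
  rw [← h]
  congr 1
  ext ω
  simp [timeU_translate]

/-- Restarting the auxiliary front at `N` delays it, since walks with labels below `N` are
discarded. -/
theorem auxTime_add_le {M : ℕ} {ω : Sample a} (hω : GoodSample ω) (N n : ℕ) :
    auxTime M 0 (N + n) ω ≤ auxTime M 0 N ω + auxTime M N n ω := by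
  rw [hω.auxTime_eq, hω.auxTime_eq, hω.auxTime_eq, Finset.sum_range_add]
  gcongr with i hi
  push_cast
  rw [zero_add]
  exact wait_mono (by positivity) ω

/-- The event `U = ∞` has positive probability: the law of large numbers leaves a delay of any
large size `N / (2 α')` before the front started from `N` is too late, and independently the front
may move quickly from `0` to `N`. -/
theorem measure_timeU_eq_top_pos {M : ℕ} (ha : 2 ≤ a) (hM : 4 < M) {α' : ℝ} (hα : 0 < α')
    (hα1 : α' < 1 / meanWait M a) : 0 < walkMeasure a {ω | timeU M α' (walks ω) 0 = ⊤} := by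
  have hmu := meanWait_pos (M := M) ha hM
  have hb : meanWait M a < 1 / α' := by rwa [lt_one_div hmu hα]
  -- `H N`: the front is never later than the line of speed `α'` with the delay `N / (2 α')`.
  set H : ℕ → Set (Sample a) := fun N => {ω | ∀ n : ℕ, auxTime M 0 n ω ≤ ENNReal.ofReal (n / α' + N / (2 * α'))} with hH
  have hHm : ∀ N, NullMeasurableSet (H N) (walkMeasure a) := fun N => by
    simp only [hH, Set.ofPred_forall]
    exact NullMeasurableSet.iInter fun n => nullMeasurableSet_le (aemeasurable_auxTime M 0 n) aemeasurable_const
  -- By the law of large numbers almost every sample lies in some `H N`.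
  obtain ⟨N, hN⟩ : ∃ N, walkMeasure a (H N) ≠ 0 := by
    by_contra hne
    push Not at hne
    have h0 := measure_iUnion_null hne
    have h1 : ∀ᵐ ω ∂(walkMeasure a), ω ∈ ⋃ N, H N := by
      filter_upwards [ae_tendsto_auxTime ha hM, ae_goodSample (a := a)] with ω h hω
      have hfin := fun n => hω.auxTime_ne_top ha (show 0 < M by omega) 0 n
      obtain ⟨n0, hn0⟩ := eventually_atTop.1 ((h.eventually (gt_mem_nhds hb)).and (eventually_gt_atTop 0))
      obtain ⟨N, hN⟩ := exists_nat_gt ((auxTime M 0 n0 ω).toReal * (2 * α'))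
      rw [Set.mem_iUnion]
      refine ⟨N, fun n => ?_⟩
      rw [← ENNReal.ofReal_toReal (hfin n)]
      apply ENNReal.ofReal_le_ofReal
      rcases le_total n0 n with hn | hn
      · obtain ⟨h2, h3⟩ := hn0 n hn
        have h3' : (0 : ℝ) < n := by exact_mod_cast h3
        rw [div_lt_iff₀ h3'] at h2
        have : (0 : ℝ) ≤ N / (2 * α') := by positivity
        have : 1 / α' * n = n / α' := by ring
        linarith
      · have h2 := ENNReal.toReal_mono (hfin n0) (auxTime_mono M 0 ω hn)
        have h3 : (auxTime M 0 n0 ω).toReal < N / (2 * α') := by rwa [lt_div_iff₀ (by positivity)]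
        have : (0 : ℝ) ≤ n / α' := by positivity
        simp only at h2
        linarith
    have h2 : walkMeasure a (⋃ N, H N)ᶜ = 0 := h1
    have h3 := measure_univ (μ := walkMeasure a)
    rw [← Set.union_compl_self (⋃ N, H N)] at h3
    have h4 := measure_union_le (μ := walkMeasure a) (⋃ N, H N) (⋃ N, H N)ᶜ
    rw [h3, h0, h2] at h4
    simp at h4
  have hNpos : 0 < walkMeasure a (translate (N : ℤ) ⁻¹' H N) := by
    rw [(measurePreserving_translate (a := a) N).measure_preimage (hHm N)]
    exact pos_iff_ne_zero.2 hN
  -- `G`: the last walk of each of the first `N` sites steps to the right within time `ε`, which takes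
  -- the front to `N` in half of the allowed time `N / α'`.
  set ε := 1 / (2 * α') with hε
  have hε0 : 0 < ε := by positivity
  set F : Finset (Label a) := (Finset.range N).image fun i : ℕ => lastLabel ha (i : ℤ) with hF
  set B : Set (ℝ × ℤ) := Set.Iic ε ×ˢ {1} with hB
  have hBm : MeasurableSet B := measurableSet_Iic.prod (measurableSet_singleton _)
  set G : Set (Sample a) := {ω | ∀ l ∈ F, seqOf ω l ∈ {s : WalkSeq | s 0 ∈ B}} with hG
  have hGm : MeasurableSet G := by
    simp only [hG, Set.ofPred_forall]
    exact MeasurableSet.iInter fun l => MeasurableSet.iInter fun _ =>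
      measurable_seqOf l (measurable_pi_apply 0 hBm)
  have hGpos : 0 < walkMeasure a G := by
    rw [hG, walkMeasure_forall_mem F (fun _ => {s : WalkSeq | s 0 ∈ B}) fun l => measurable_pi_apply 0 hBm]
    rw [pos_iff_ne_zero, Finset.prod_ne_zero_iff]
    intro l _
    have h1 : seqLaw {s : WalkSeq | s 0 ∈ B} = jumpLaw B :=
      (measurePreserving_eval_infinitePi (fun _ : ℕ => jumpLaw) 0).measure_preimage hBm.nullMeasurableSet
    rw [h1, hB, Measure.prod_prod]
    refine mul_ne_zero (expMeasure_Iic_pos hε0).ne' ?_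
    simp [stepLaw]
  have hind : walkMeasure a (G ∩ translate (N : ℤ) ⁻¹' H N) =
      walkMeasure a G * walkMeasure a (translate (N : ℤ) ⁻¹' H N) := by
    refine measure_inter_of_dependsOn jumpLaw {p : Label a × ℕ | p.1.site < N} hGm.nullMeasurableSet
      ((hHm N).preimage (measurePreserving_translate (a := a) N).quasiMeasurePreserving) ?_ ?_
    · intro ω ω' h
      simp only [hG, Set.mem_ofPred_eq, eq_iff_iff]
      refine forall₂_congr fun l hl => ?_
      rw [hF, Finset.mem_image] at hl
      obtain ⟨i, hi, rfl⟩ := hl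
      have : seqOf ω (lastLabel ha i) 0 = seqOf ω' (lastLabel ha i) 0 := h (_, 0) (by
        rw [Finset.mem_range] at hi
        change (i : ℤ) < N; exact_mod_cast hi)
      rw [this]
    · intro ω ω' h
      simp only [hH, Set.mem_preimage, Set.mem_ofPred_eq, auxTime_translate, eq_iff_iff]
      refine forall_congr' fun n => ?_
      rw [dependsOn_auxTime M N n (fun p hp => h p (by simp only [Set.mem_compl_iff, Set.mem_ofPred_eq, not_lt]; exact hp))]
  refine (ENNReal.mul_pos hGpos.ne' hNpos.ne').trans_le ?_
  rw [← hind]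
  refine measure_mono_ae ?_
  filter_upwards [ae_goodSample (a := a), ae_noExplosion ha hM 0] with ω hω hne h
  change timeU M α' (walks ω) 0 = ⊤
  rw [hne.timeU_eq_top_iff hα]
  have hfast : ∀ n ≤ N, auxTime M 0 n ω ≤ ENNReal.ofReal (n * ε) := by
    intro n hn
    rw [hω.auxTime_eq]
    calc ∑ i ∈ Finset.range n, wait M 0 (0 + i) ω ≤ ∑ _i ∈ Finset.range n, ENNReal.ofReal ε := by
          refine Finset.sum_le_sum fun i hi => ?_
          rw [Finset.mem_range] at hi
          rw [zero_add]
          refine (wait_le_hit ha (by omega) (by positivity) ω).trans ?_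
          have h1 : seqOf ω (lastLabel ha (i : ℤ)) 0 ∈ B := h.1 _ (by
            rw [hF, Finset.mem_image]; exact ⟨i, Finset.mem_range.2 (by omega), rfl⟩)
          refine (iInf₂_le 1 (by rw [stepSum_succ, stepSum_zero, zero_add]; exact h1.2)).trans ?_
          apply ENNReal.ofReal_le_ofReal
          rw [jumpSum_succ, jumpSum_zero, zero_add]; exact h1.1
      _ = _ := by
          rw [Finset.sum_const, Finset.card_range, nsmul_eq_mul, ENNReal.ofReal_mul (by positivity), ENNReal.ofReal_natCast]
  intro n
  rcases le_total n N with hn | hn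
  · refine (hfast n hn).trans (ENNReal.ofReal_le_ofReal ?_)
    rw [hε, mul_one_div]
    gcongr; linarith
  · obtain ⟨k, rfl⟩ := Nat.exists_eq_add_of_le hn
    refine (auxTime_add_le hω N k).trans ?_
    have h2 := h.2 k
    rw [auxTime_translate] at h2
    refine (add_le_add (hfast N le_rfl) h2).trans ?_
    rw [← ENNReal.ofReal_add (by positivity) (by positivity)]
    apply ENNReal.ofReal_le_ofReal
    apply le_of_eq
    rw [hε]; push_cast; field_simp; ring

/-! ### Large deviations of the auxiliary front -/

/-- Expectations of products over sites at distance `M` from each other factorize. -/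
theorem lintegral_prod_kap {M : ℕ} (ha : 2 ≤ a) {g : ℝ≥0∞ → ℝ≥0∞} (hg : Measurable g) (c q : ℕ) :
    ∫⁻ ω, ∏ i ∈ Finset.range q, g (kap M ((c + M * i : ℕ) : ℤ) ω) ∂(walkMeasure a) =
      (∫⁻ ω, g (kap M 0 ω) ∂(walkMeasure a)) ^ q := by
  induction q with
  | zero => simp
  | succ q ih =>
    have hm : ∀ z, Measurable fun ω : Sample a => g (kap M z ω) := fun z => hg.comp (measurable_kap M z)
    simp only [Finset.prod_range_succ]
    have h1 : ∫⁻ ω, g (kap (a := a) M ((c + M * q : ℕ) : ℤ) ω) ∂(walkMeasure a) = ∫⁻ ω, g (kap M 0 ω) ∂(walkMeasure a) :=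
      ((identDistrib_kap ha _ 0).comp hg).lintegral_eq
    rw [pow_succ, ← ih, ← h1]
    refine lintegral_mul_of_dependsOn jumpLaw {p : Label a × ℕ | p.1.site ≤ c + M * q - M}
      (Finset.measurable_fun_prod _ fun i _ => hm _).aemeasurable (hm _).aemeasurable ?_ ?_
    · intro ω ω' h
      refine Finset.prod_congr rfl fun i hi => ?_
      rw [dependsOn_kap ha _ fun p hp => h p ?_]
      have h2 := hp.2
      rw [Finset.mem_range] at hi
      have h3 : M * (i + 1) ≤ M * q := Nat.mul_le_mul_left M hi
      zify at h3
      push_cast at h2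
      simp only [Set.mem_ofPred_eq]
      linarith
    · intro ω ω' h
      simp only
      rw [dependsOn_kap ha _ fun p hp => h p ?_]
      have h2 := hp.1
      push_cast at h2
      simp only [Set.mem_compl_iff, Set.mem_ofPred_eq, not_le]
      exact h2

/-- Chernoff bound for the waiting times truncated at the level `B`, along one residue class. -/
theorem measure_truncated_sum_le {M : ℕ} (ha : 2 ≤ a) (hM : 4 < M) {B : ℝ} (hB : 0 < B) (x : ℝ) (c q : ℕ) :
    walkMeasure a {ω | x ≤ ∑ i ∈ Finset.range q, min (kap M ((c + M * i : ℕ) : ℤ) ω).toReal B} ≤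
      ENNReal.ofReal (Real.exp (-(x / B) + q * (meanWait M a / B +
        (∫⁻ ω, kap (a := a) M 0 ω ^ 2 ∂(walkMeasure a)).toReal / B ^ 2))) := by
  set K2 := (∫⁻ ω, kap (a := a) M 0 ω ^ 2 ∂(walkMeasure a)).toReal with hK2
  have hK2' : ∫⁻ ω, kap (a := a) M 0 ω ^ 2 ∂(walkMeasure a) = ENNReal.ofReal K2 :=
    (ENNReal.ofReal_toReal (lintegral_kap_sq_lt_top ha hM).ne).symm
  set g : ℝ≥0∞ → ℝ≥0∞ := fun y => ENNReal.ofReal (Real.exp (min y.toReal B / B)) with hg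
  have hgm : Measurable g := by
    have : Measurable fun y : ℝ≥0∞ => min y.toReal B := ENNReal.measurable_toReal.min measurable_const
    fun_prop
  have hg1 : ∫⁻ ω, g (kap (a := a) M 0 ω) ∂(walkMeasure a) ≤ ENNReal.ofReal (Real.exp (meanWait M a / B + K2 / B ^ 2)) := by
    -- `exp v ≤ 1 + v + v²` for `0 ≤ v ≤ 1`.
    have hpt : ∀ y : ℝ≥0∞, g y ≤ 1 + ENNReal.ofReal (y.toReal / B) + ENNReal.ofReal (1 / B ^ 2) * y ^ 2 := by
      intro y
      by_cases hy : y = ⊤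
      · have : ENNReal.ofReal (1 / B ^ 2) * y ^ 2 = ⊤ := by
          rw [hy, ENNReal.top_pow (by norm_num), ENNReal.mul_top]; simp; positivity
        rw [this]; simp
      have e1 : y ^ 2 = ENNReal.ofReal (y.toReal ^ 2) := by
        rw [ENNReal.ofReal_pow ENNReal.toReal_nonneg, ENNReal.ofReal_toReal hy]
      have hy0 : 0 ≤ y.toReal := ENNReal.toReal_nonneg
      rw [e1, ← ENNReal.ofReal_one, ← ENNReal.ofReal_mul (by positivity), ← ENNReal.ofReal_add (by positivity) (by positivity),
        ← ENNReal.ofReal_add (by positivity) (by positivity)]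
      apply ENNReal.ofReal_le_ofReal
      set v := min y.toReal B / B with hv
      have hm0 : 0 ≤ min y.toReal B := le_min hy0 hB.le
      have hv0 : 0 ≤ v := by positivity
      have hv1 : v ≤ 1 := by rw [hv, div_le_one hB]; exact min_le_right _ _
      have hv2 : v ≤ y.toReal / B := by rw [hv]; gcongr; exact min_le_left _ _
      have h1 := (abs_le.1 (Real.abs_exp_sub_one_sub_id_le (x := v) (by rwa [abs_of_nonneg hv0]))).2
      have h2 : v ^ 2 ≤ (y.toReal / B) ^ 2 := by gcongr
      have h3 : (y.toReal / B) ^ 2 = 1 / B ^ 2 * y.toReal ^ 2 := by ring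
      linarith
    calc ∫⁻ ω, g (kap (a := a) M 0 ω) ∂(walkMeasure a)
        ≤ ∫⁻ ω, (1 + ENNReal.ofReal ((kap M 0 ω).toReal / B) + ENNReal.ofReal (1 / B ^ 2) * kap M 0 ω ^ 2) ∂(walkMeasure a) :=
          lintegral_mono fun ω => hpt _
      _ = 1 + ENNReal.ofReal (meanWait M a / B) + ENNReal.ofReal (1 / B ^ 2) * ENNReal.ofReal K2 := by
          have m1 : Measurable fun ω : Sample a => ENNReal.ofReal ((kap M 0 ω).toReal / B) := by
            have := measurable_kap (a := a) M 0; fun_prop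
          have m2 : Measurable fun ω : Sample a => kap M 0 ω ^ 2 := (measurable_kap M 0).pow_const 2
          rw [lintegral_add_right _ (m2.const_mul _), lintegral_add_left measurable_const, lintegral_const_mul _ m2, hK2',
            ← ofReal_integral_eq_lintegral_ofReal ((integrable_kap ha hM).div_const B) (Eventually.of_forall fun ω => by positivity), integral_div]
          simp [meanWait]
      _ ≤ _ := by
          have hmu := meanWait_pos (M := M) ha hM
          have hK0 : 0 ≤ K2 := ENNReal.toReal_nonneg
          rw [← ENNReal.ofReal_one, ← ENNReal.ofReal_mul (by positivity), ← ENNReal.ofReal_add (by positivity) (by positivity),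
            ← ENNReal.ofReal_add (by positivity) (by positivity)]
          apply ENNReal.ofReal_le_ofReal
          have := Real.add_one_le_exp (meanWait M a / B + K2 / B ^ 2)
          have h3 : 1 / B ^ 2 * K2 = K2 / B ^ 2 := by ring
          linarith
  have hm : ∀ z, Measurable fun ω : Sample a => min (kap M z ω).toReal B := fun z =>
    (ENNReal.measurable_toReal.comp (measurable_kap M z)).min measurable_const
  rw [← lintegral_indicator_one (measurableSet_le measurable_const (Finset.measurable_fun_sum _ fun i _ => hm _))]
  calc _ ≤ ∫⁻ ω, ENNReal.ofReal (Real.exp (-(x / B))) * ∏ i ∈ Finset.range q, g (kap (a := a) M ((c + M * i : ℕ) : ℤ) ω) ∂(walkMeasure a) := by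
        refine lintegral_mono fun ω => ?_
        by_cases hω : ω ∈ {ω : Sample a | x ≤ ∑ i ∈ Finset.range q, min (kap M ((c + M * i : ℕ) : ℤ) ω).toReal B}
        · rw [Set.indicator_of_mem hω, Pi.one_apply, hg]
          simp only
          rw [← ENNReal.ofReal_prod_of_nonneg (by intros; positivity), ← Real.exp_sum, ← ENNReal.ofReal_mul (by positivity),
            ← Real.exp_add, ← ENNReal.ofReal_one, ← Finset.sum_div]
          apply ENNReal.ofReal_le_ofReal
          rw [Real.one_le_exp_iff]
          have : x / B ≤ (∑ i ∈ Finset.range q, min (kap M ((c + M * i : ℕ) : ℤ) ω).toReal B) / B := by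
            gcongr; exact hω
          linarith
        · rw [Set.indicator_of_notMem hω]; exact zero_le
    _ = ENNReal.ofReal (Real.exp (-(x / B))) * (∫⁻ ω, g (kap (a := a) M 0 ω) ∂(walkMeasure a)) ^ q := by
        have hgm' : Measurable fun ω : Sample a => ∏ i ∈ Finset.range q, g (kap (a := a) M ((c + M * i : ℕ) : ℤ) ω) :=
          Finset.measurable_fun_prod _ fun i _ => hgm.comp (measurable_kap M _)
        rw [lintegral_const_mul _ hgm', lintegral_prod_kap ha hgm]
    _ ≤ ENNReal.ofReal (Real.exp (-(x / B))) * ENNReal.ofReal (Real.exp (meanWait M a / B + K2 / B ^ 2)) ^ q := by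
        gcongr
    _ = _ := by
        rw [← ENNReal.ofReal_pow (by positivity), ← Real.exp_nat_mul, ← ENNReal.ofReal_mul (by positivity), ← Real.exp_add]

/-- A stretched exponential decays faster than every power. -/
theorem exp_neg_rpow_le {c : ℝ} (hc : 0 < c) (k : ℕ) :
    ∃ C : ℝ, 0 ≤ C ∧ ∀ n : ℕ, 1 ≤ n → Real.exp (-(c * (n : ℝ) ^ (1 / 20 : ℝ))) ≤ C * (n : ℝ) ^ (-(k : ℝ)) := by
  refine ⟨(20 * k).factorial / c ^ (20 * k), by positivity, fun n hn => ?_⟩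
  have hn' : (0 : ℝ) < n := by exact_mod_cast hn
  set y := c * (n : ℝ) ^ (1 / 20 : ℝ) with hy
  have hy0 : 0 < y := by positivity
  have h := Real.pow_div_factorial_le_exp y hy0.le (20 * k)
  have e : y ^ (20 * k) = c ^ (20 * k) * (n : ℝ) ^ (k : ℝ) := by
    rw [hy, mul_pow, ← Real.rpow_natCast ((n : ℝ) ^ (1 / 20 : ℝ)), ← Real.rpow_mul hn'.le]
    congr 2; push_cast; ring
  rw [e] at h
  rw [Real.exp_neg, Real.rpow_neg hn'.le]
  have hp : 0 < c ^ (20 * k) * (n : ℝ) ^ (k : ℝ) / (20 * k).factorial := by positivity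
  refine (inv_anti₀ hp h).trans (le_of_eq ?_)
  field_simp

/-- The stationary auxiliary front is late at some site beyond `N` with a probability of order at
most `N ^ (-M / 4)`. Either some waiting time at a site `z` exceeds `max z N ^ (19/20)`, or the
truncated waiting times have a large deviation, to which the Chernoff bound applies. -/
theorem exists_late_bound {M : ℕ} (ha : 2 ≤ a) (hM : 4 < M) {b : ℝ} (hb : meanWait M a < b) :
    ∃ C : ℝ, 0 ≤ C ∧ ∀ N : ℕ, 1 ≤ N →
      walkMeasure a {ω | ∃ n ≥ N, n * b < ∑ i ∈ Finset.range n, (kap M (i : ℤ) ω).toReal} ≤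
        ENNReal.ofReal (C * (N : ℝ) ^ (-((M : ℝ) / 4))) := by
  have hM' : (5 : ℝ) ≤ M := by exact_mod_cast hM
  have hmu := meanWait_pos (M := M) ha hM
  set K2 := (∫⁻ ω, kap (a := a) M 0 ω ^ 2 ∂(walkMeasure a)).toReal with hK2
  have hK0 : 0 ≤ K2 := ENNReal.toReal_nonneg
  set c := (b - meanWait M a) / M with hc
  have hc0 : 0 < c := by have := sub_pos.2 hb; positivity
  obtain ⟨C2, hC2, hexp⟩ := exp_neg_rpow_le hc0 (M + 2)
  set D := (M : ℝ) * Real.exp (meanWait M a + 2 * K2) * C2 with hD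
  have hD0 : 0 ≤ D := by positivity
  set s1 := ∑' z : ℕ, ((max z 1 : ℕ) : ℝ) ^ (-(9 / 8) : ℝ) with hs1
  have hsum1 : Summable fun z : ℕ => ((max z 1 : ℕ) : ℝ) ^ (-(9 / 8) : ℝ) := by
    have h := (Real.summable_nat_rpow (p := -(9 / 8))).2 (by norm_num)
    rw [← summable_nat_add_iff 1] at h ⊢
    refine h.congr fun z => ?_
    rw [max_eq_left (by omega)]
  set C0 : ℝ := (2 * M) ^ M with hC0
  refine ⟨C0 * s1 + D * s1, by have : 0 ≤ s1 := tsum_nonneg fun _ => by positivity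
                               positivity, fun N hN => ?_⟩
  have hN' : (1 : ℝ) ≤ N := by exact_mod_cast hN
  set E1 : ℕ → Set (Sample a) := fun z => {ω | ENNReal.ofReal (((max z N : ℕ) : ℝ) ^ (19 / 20 : ℝ)) < kap M (z : ℤ) ω} with hE1
  set E2 : ℕ → Set (Sample a) := fun n => {ω | N ≤ n ∧ n * b < ∑ i ∈ Finset.range n, min (kap M (i : ℤ) ω).toReal ((n : ℝ) ^ (19 / 20 : ℝ))} with hE2
  have hsub : {ω : Sample a | ∃ n ≥ N, n * b < ∑ i ∈ Finset.range n, (kap M (i : ℤ) ω).toReal} ⊆ (⋃ z, E1 z) ∪ ⋃ n, E2 n := by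
    rintro ω ⟨n, hn, hlt⟩
    by_cases h1 : ω ∈ ⋃ z, E1 z
    · exact Or.inl h1
    right
    rw [Set.mem_iUnion]
    refine ⟨n, hn, hlt.trans_le (Finset.sum_le_sum fun i hi => le_min le_rfl ?_)⟩
    rw [Finset.mem_range] at hi
    simp only [Set.mem_iUnion, hE1, Set.mem_ofPred_eq, not_exists, not_lt] at h1
    refine (ENNReal.toReal_le_of_le_ofReal (by positivity) (h1 i)).trans ?_
    gcongr
    omega
  -- Both bounds are of this form, and summable over `x`.
  have hpow : ∀ x : ℕ, 1 ≤ x → N ≤ x → ∀ p : ℝ, M / 4 + 9 / 8 ≤ p →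
      (x : ℝ) ^ (-p) ≤ (N : ℝ) ^ (-((M : ℝ) / 4)) * ((max x 1 : ℕ) : ℝ) ^ (-(9 / 8) : ℝ) := by
    intro x hx hNx p hp
    have hx' : (1 : ℝ) ≤ x := by exact_mod_cast hx
    rw [max_eq_left hx]
    calc (x : ℝ) ^ (-p) ≤ (x : ℝ) ^ (-((M : ℝ) / 4) + -(9 / 8)) :=
          Real.rpow_le_rpow_of_exponent_le hx' (by linarith)
      _ = (x : ℝ) ^ (-((M : ℝ) / 4)) * (x : ℝ) ^ (-(9 / 8) : ℝ) := Real.rpow_add (by linarith) _ _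
      _ ≤ _ := by
          gcongr ?_ * _
          exact Real.rpow_le_rpow_of_nonpos (by linarith) (by exact_mod_cast hNx) (by linarith)
  -- The exponent `19/20` leaves a summable bound: `19/20 * M/2 ≥ M/4 + 9/8` if `M ≥ 5`.
  have hb1 : ∀ z, walkMeasure a (E1 z) ≤ ENNReal.ofReal (C0 * (N : ℝ) ^ (-((M : ℝ) / 4)) * ((max z 1 : ℕ) : ℝ) ^ (-(9 / 8) : ℝ)) := by
    intro z
    have hx : 1 ≤ max z N := hN.trans (le_max_right _ _)
    have hx' : (1 : ℝ) ≤ (max z N : ℕ) := by exact_mod_cast hx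
    refine (measure_lt_wait_le ha (r := (z : ℤ) - M + 1) (z := z) le_rfl (by positivity)).trans ?_
    apply ENNReal.ofReal_le_ofReal
    rw [← Real.rpow_mul (by positivity), mul_assoc]
    gcongr
    have h1 := hpow (max z N) hx (le_max_right _ _) (19 / 20 * (M / 2)) (by nlinarith)
    rw [show (19 / 20 : ℝ) * -((M : ℝ) / 2) = -(19 / 20 * (M / 2)) by ring]
    refine h1.trans ?_
    gcongr ?_ * ?_
    refine Real.rpow_le_rpow_of_nonpos (by positivity) ?_ (by norm_num)
    exact_mod_cast (by omega : max z 1 ≤ max (max z N) 1)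
  have hb2 : ∀ n, walkMeasure a (E2 n) ≤ ENNReal.ofReal (D * (N : ℝ) ^ (-((M : ℝ) / 4)) * ((max n 1 : ℕ) : ℝ) ^ (-(9 / 8) : ℝ)) := by
    intro n
    by_cases hNn : N ≤ n
    swap
    · have : E2 n = ∅ := by ext ω; simp [hE2, hNn]
      rw [this]; simp
    have hn1 : 1 ≤ n := hN.trans hNn
    have hn' : (1 : ℝ) ≤ n := by exact_mod_cast hn1
    set B : ℝ := (n : ℝ) ^ (19 / 20 : ℝ) with hB
    have hB1 : 1 ≤ B := Real.one_le_rpow hn' (by norm_num)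
    have hB0 : 0 < B := by linarith
    have hnB : (n : ℝ) / B = (n : ℝ) ^ (1 / 20 : ℝ) := by
      rw [hB, div_eq_iff (by positivity), ← Real.rpow_add (by linarith)]; norm_num
    have hnB2 : (n : ℝ) ≤ B ^ 2 := by
      rw [hB, ← Real.rpow_natCast, ← Real.rpow_mul (by linarith)]
      calc (n : ℝ) = (n : ℝ) ^ (1 : ℝ) := (Real.rpow_one _).symm
        _ ≤ _ := Real.rpow_le_rpow_of_exponent_le hn' (by norm_num)
    set q := n / M + 1 with hq
    have hq1 : n ≤ M * q := (Nat.lt_mul_div_succ n (by omega)).le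
    have hq2 : (q : ℝ) ≤ n / M + 1 := by rw [hq]; push_cast; gcongr; exact Nat.cast_div_le
    -- One of the `M` residue classes has at least its share of the sum.
    have hblock : ∀ (x : ℕ → ℝ) (q : ℕ), ∑ i ∈ Finset.range (M * q), x i = ∑ d ∈ Finset.range M, ∑ i ∈ Finset.range q, x (d + M * i) := by
      intro x q
      induction q with
      | zero => simp
      | succ q ih =>
        rw [mul_add, mul_one, Finset.sum_range_add, ih, ← Finset.sum_add_distrib]
        refine Finset.sum_congr rfl fun d _ => ?_
        rw [Finset.sum_range_succ, add_comm (M * q) d]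
    have hsub2 : E2 n ⊆ ⋃ d ∈ Finset.range M, {ω | n * b / M ≤ ∑ i ∈ Finset.range q, min (kap M ((d + M * i : ℕ) : ℤ) ω).toReal B} := by
      rintro ω ⟨-, hlt⟩
      by_contra hne
      simp only [Set.mem_iUnion, Set.mem_ofPred_eq, not_exists, not_le] at hne
      have h1 : ∑ i ∈ Finset.range n, min (kap M (i : ℤ) ω).toReal B ≤ ∑ i ∈ Finset.range (M * q), min (kap M (i : ℤ) ω).toReal B :=
        Finset.sum_le_sum_of_subset_of_nonneg (by simpa using hq1)
          fun i _ _ => le_min ENNReal.toReal_nonneg hB0.le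
      rw [hblock (fun i => min (kap M (i : ℤ) ω).toReal B)] at h1
      have h2 : ∑ d ∈ Finset.range M, ∑ i ∈ Finset.range q, min (kap M ((d + M * i : ℕ) : ℤ) ω).toReal B ≤ ∑ _d ∈ Finset.range M, n * b / M :=
        Finset.sum_le_sum fun d hd => (hne d hd).le
      rw [Finset.sum_const, Finset.card_range, nsmul_eq_mul, mul_div_cancel₀ _ (by positivity)] at h2
      linarith
    have hexpo : Real.exp (-(n * b / M / B) + q * (meanWait M a / B + K2 / B ^ 2)) ≤ Real.exp (meanWait M a + 2 * K2) * Real.exp (-(c * (n : ℝ) ^ (1 / 20 : ℝ))) := by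
      rw [← Real.exp_add, Real.exp_le_exp, ← hnB]
      have h1 : (q : ℝ) * (meanWait M a / B + K2 / B ^ 2) ≤ (n / M + 1) * (meanWait M a / B + K2 / B ^ 2) := by gcongr
      have h2 : ((n : ℝ) / M + 1) * (meanWait M a / B + K2 / B ^ 2) = n * meanWait M a / M / B + meanWait M a / B + K2 * (n / B ^ 2) / M + K2 / B ^ 2 := by ring
      have h3 : meanWait M a / B ≤ meanWait M a := div_le_self hmu.le hB1
      have h4 : K2 / B ^ 2 ≤ K2 := div_le_self hK0 (one_le_pow₀ hB1)
      have h5 : K2 * (n / B ^ 2) / M ≤ K2 := by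
        refine (div_le_self (by positivity) (by linarith)).trans ?_
        refine mul_le_of_le_one_right hK0 ((div_le_one (by positivity)).2 hnB2)
      have h6 : c * (n / B) = n * b / M / B - n * meanWait M a / M / B := by rw [hc]; ring
      rw [h6]
      linarith
    refine (measure_mono hsub2).trans ((measure_biUnion_finset_le _ _).trans ?_)
    refine (Finset.sum_le_sum fun d _ => measure_truncated_sum_le ha hM hB0 (n * b / M) d q).trans ?_
    rw [Finset.sum_const, Finset.card_range, nsmul_eq_mul, ← ENNReal.ofReal_natCast, ← ENNReal.ofReal_mul (by positivity)]
    apply ENNReal.ofReal_le_ofReal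
    have h1 := hpow n hn1 hNn ((M + 2 : ℕ) : ℝ) (by push_cast; linarith)
    calc (M : ℝ) * Real.exp (-(n * b / M / B) + q * (meanWait M a / B + K2 / B ^ 2))
        ≤ M * (Real.exp (meanWait M a + 2 * K2) * (C2 * (n : ℝ) ^ (-((M + 2 : ℕ) : ℝ)))) := by
          gcongr
          exact hexpo.trans (by gcongr; exact hexp n hn1)
      _ = D * (n : ℝ) ^ (-((M + 2 : ℕ) : ℝ)) := by rw [hD]; ring
      _ ≤ D * ((N : ℝ) ^ (-((M : ℝ) / 4)) * ((max n 1 : ℕ) : ℝ) ^ (-(9 / 8) : ℝ)) := by gcongr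
      _ = _ := by ring
  have htsum : ∀ C : ℝ, 0 ≤ C → ∑' z : ℕ, ENNReal.ofReal (C * (N : ℝ) ^ (-((M : ℝ) / 4)) * ((max z 1 : ℕ) : ℝ) ^ (-(9 / 8) : ℝ)) =
      ENNReal.ofReal (C * s1 * (N : ℝ) ^ (-((M : ℝ) / 4))) := by
    intro C hC
    rw [← ENNReal.ofReal_tsum_of_nonneg (fun z => by positivity) (hsum1.mul_left _), tsum_mul_left, hs1]
    congr 1; ring
  refine (measure_mono hsub).trans ((measure_union_le _ _).trans ?_)
  refine (add_le_add ((measure_iUnion_le _).trans (ENNReal.tsum_le_tsum hb1)) ((measure_iUnion_le _).trans (ENNReal.tsum_le_tsum hb2))).trans ?_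
  have hs0 : 0 ≤ s1 := tsum_nonneg fun _ => by positivity
  rw [htsum _ (by positivity), htsum _ hD0, ← ENNReal.ofReal_add (by positivity) (by positivity), ← add_mul]

/-- The time `U` is finite and larger than `t` with a probability of order at most
`t ^ (-M / 4)`. -/
theorem exists_timeU_bound {M : ℕ} (ha : 2 ≤ a) (hM : 4 < M) {α' : ℝ} (hα : 0 < α')
    (hα1 : α' < 1 / meanWait M a) :
    ∃ C : ℝ, 0 ≤ C ∧ ∀ (r : ℤ) (t : ℝ), 0 < t →
      walkMeasure a {ω | ENNReal.ofReal t < timeU M α' (walks ω) r ∧ timeU M α' (walks ω) r < ⊤} ≤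
        ENNReal.ofReal (C * t ^ (-((M : ℝ) / 4))) := by
  have hmu := meanWait_pos (M := M) ha hM
  have hb : meanWait M a < 1 / α' := by rwa [lt_one_div hmu hα]
  have hM' : (5 : ℝ) ≤ M := by exact_mod_cast hM
  obtain ⟨C, hC, hbound⟩ := exists_late_bound ha hM hb
  -- The first term makes the bound trivial for `t < 2 M / α'`.
  refine ⟨(2 * M / α') ^ ((M : ℝ) / 4) + C * (α' / 2) ^ (-((M : ℝ) / 4)), by positivity, fun r t ht => ?_⟩
  have htr : walkMeasure a {ω | ENNReal.ofReal t < timeU M α' (walks ω) r ∧ timeU M α' (walks ω) r < ⊤} =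
      walkMeasure a {ω | ENNReal.ofReal t < timeU M α' (walks ω) 0 ∧ timeU M α' (walks ω) 0 < ⊤} := by
    have hU := aemeasurable_timeU (a := a) ha hM hα 0
    have h := (measurePreserving_translate (a := a) r).measure_preimage
      (s := {ω | ENNReal.ofReal t < timeU M α' (walks ω) 0 ∧ timeU M α' (walks ω) 0 < ⊤})
      ((nullMeasurableSet_lt aemeasurable_const hU).inter (nullMeasurableSet_lt hU aemeasurable_const))
    rw [← h]; congr 1; ext ω; simp [timeU_translate]
  rw [htr]
  by_cases hsmall : α' * t < 2 * M
  · refine prob_le_one.trans ?_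
    rw [← ENNReal.ofReal_one]
    apply ENNReal.ofReal_le_ofReal
    have h1 : 1 ≤ (2 * M / α') ^ ((M : ℝ) / 4) * t ^ (-((M : ℝ) / 4)) := by
      rw [Real.rpow_neg ht.le, ← div_eq_mul_inv, ← Real.div_rpow (by positivity) ht.le]
      refine Real.one_le_rpow ?_ (by positivity)
      rw [le_div_iff₀ ht, le_div_iff₀ hα]; linarith
    have h2 : 0 ≤ C * (α' / 2) ^ (-((M : ℝ) / 4)) * t ^ (-((M : ℝ) / 4)) := by positivity
    rw [add_mul]; linarith
  push Not at hsmall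
  set N := ⌈α' * t / 2⌉₊ with hN
  have hN1 : 1 ≤ N := Nat.one_le_ceil_iff.2 (by positivity)
  have hNle : α' * t / 2 ≤ N := Nat.le_ceil _
  -- From `M` on the waiting times are stationary; the front moved to start there must be late at a
  -- site beyond `α' t - M ≥ α' t / 2`.
  have hsub : walkMeasure a {ω | ENNReal.ofReal t < timeU M α' (walks ω) 0 ∧ timeU M α' (walks ω) 0 < ⊤} ≤
      walkMeasure a (translate (M : ℤ) ⁻¹' {ω | ∃ n ≥ N, n * (1 / α') < ∑ i ∈ Finset.range n, (kap M (i : ℤ) ω).toReal}) := by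
    refine measure_mono_ae ?_
    filter_upwards [ae_goodSample (a := a), ae_noExplosion ha hM 0] with ω hω hne h
    obtain ⟨h1, h2⟩ := h
    have hfin := fun n => hω.auxTime_ne_top ha (show 0 < M by omega) 0 n
    -- `U > t` bounds the time needed for the first `M` sites
    have hearly : ∀ n : ℕ, (n : ℝ) ≤ α' * t → (auxTime M 0 n ω).toReal ≤ n / α' := by
      intro n hn
      refine ENNReal.toReal_le_of_le_ofReal (by positivity) ?_
      by_contra hlt
      rw [hne.timeU_eq hα] at h1
      have h3 : ENNReal.ofReal t < ENNReal.ofReal (n / α') := h1.trans_le (iInf₂_le (f := fun (n : ℕ) (_ : ENNReal.ofReal (n / α') < auxTime M 0 n ω) => ENNReal.ofReal (n / α')) n (not_le.1 hlt))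
      have h4 := (ENNReal.ofReal_lt_ofReal_iff_of_nonneg ht.le).1 h3
      rw [lt_div_iff₀ hα] at h4
      linarith
    obtain ⟨n, hn⟩ : ∃ n : ℕ, ENNReal.ofReal (n / α') < auxTime M 0 n ω := by
      by_contra hno
      push Not at hno
      exact h2.ne ((hne.timeU_eq_top_iff hα).2 hno)
    have hn' : (n : ℝ) / α' < (auxTime M 0 n ω).toReal := (ENNReal.ofReal_lt_iff_lt_toReal (by positivity) (hfin n)).1 hn
    have hlate : α' * t < n := by
      by_contra hle
      push Not at hle
      linarith [hearly n hle]
    have hMn : M ≤ n := by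
      have : (M : ℝ) < n := by linarith
      exact_mod_cast this.le
    obtain ⟨k, rfl⟩ := Nat.exists_eq_add_of_le hMn
    refine ⟨k, ?_, ?_⟩
    · rw [ge_iff_le, hN, Nat.ceil_le]
      push_cast at hlate
      linarith
    · have hsplit : (auxTime M 0 (M + k) ω).toReal = (auxTime M 0 M ω).toReal + ∑ i ∈ Finset.range k, (kap M (i : ℤ) (translate (M : ℤ) ω)).toReal := by
        have hx : ∀ i : ℕ, wait M 0 (0 + i) ω ≠ ⊤ := fun i => hω.wait_ne_top ha (by omega) (by omega)
        rw [hω.auxTime_eq, hω.auxTime_eq, Finset.sum_range_add, ENNReal.toReal_add (ENNReal.sum_ne_top.2 fun i _ => hx i) (ENNReal.sum_ne_top.2 fun i _ => hx _),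
          ENNReal.toReal_sum (f := fun i : ℕ => wait M 0 (0 + ((M + i : ℕ) : ℤ)) ω) (fun i _ => hx _)]
        congr 1
        refine Finset.sum_congr rfl fun i _ => ?_
        rw [kap_translate, kap, zero_add]
        rw [wait_eq_of_le ha (r := 0) (s := (i : ℤ) + M - M + 1) (by push_cast; omega) (by push_cast; omega)]
        congr 2; push_cast; ring
      have h3 := hearly M (by linarith)
      rw [hsplit] at hn'
      push_cast at hn'
      have h4 : ((M : ℝ) + k) / α' = M / α' + k * (1 / α') := by ring
      linarith
  refine hsub.trans ?_
  have hms : MeasurableSet {ω : Sample a | ∃ n ≥ N, n * (1 / α') < ∑ i ∈ Finset.range n, (kap M (i : ℤ) ω).toReal} := by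
    simp only [Set.ofPred_exists, ge_iff_le, Set.ofPred_and]
    refine MeasurableSet.iUnion fun n => (MeasurableSet.const _).inter (measurableSet_lt measurable_const ?_)
    exact Finset.measurable_fun_sum _ fun i _ => ENNReal.measurable_toReal.comp (measurable_kap M _)
  rw [(measurePreserving_translate (a := a) M).measure_preimage hms.nullMeasurableSet]
  refine (hbound N hN1).trans (ENNReal.ofReal_le_ofReal ?_)
  have h1 : (N : ℝ) ^ (-((M : ℝ) / 4)) ≤ (α' * t / 2) ^ (-((M : ℝ) / 4)) :=
    Real.rpow_le_rpow_of_nonpos (by positivity) hNle (by linarith)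
  have h2 : (α' * t / 2) ^ (-((M : ℝ) / 4)) = (α' / 2) ^ (-((M : ℝ) / 4)) * t ^ (-((M : ℝ) / 4)) := by
    rw [← Real.mul_rpow (by positivity) ht.le]; congr 1; ring
  have h3 : 0 ≤ (2 * M / α') ^ ((M : ℝ) / 4) * t ^ (-((M : ℝ) / 4)) := by positivity
  calc C * (N : ℝ) ^ (-((M : ℝ) / 4)) ≤ C * ((α' / 2) ^ (-((M : ℝ) / 4)) * t ^ (-((M : ℝ) / 4))) := by
        rw [← h2]; gcongr
    _ ≤ _ := by rw [add_mul]; linarith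

/-! ### Exploring the walks jump by jump -/


/-- All walks with labels in `F` have the time until their first jump shortened by `u`. -/
def lower (F : Finset (Label a)) (u : ℝ) (ρ : Sample a) : Sample a := fun p =>
  if p.1 ∈ F ∧ p.2 = 0 then ((ρ p).1 - u, (ρ p).2) else ρ p

theorem measurable_lower (F : Finset (Label a)) :
    Measurable fun q : ℝ × Sample a => lower F q.1 q.2 := by
  refine measurable_pi_lambda _ fun p => ?_
  unfold lower
  split_ifs <;> fun_prop

/-- Lack of memory for one jump: given that the holding time exceeds `u`, the remaining holding time
and the step are distributed as at the beginning. -/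
theorem jumpLaw_shift {u : ℝ} (hu : 0 ≤ u) {B : Set (ℝ × ℤ)} (hB : MeasurableSet B) :
    jumpLaw {x | u < x.1 ∧ (x.1 - u, x.2) ∈ B} = ENNReal.ofReal (Real.exp (-(2 * u))) * jumpLaw B := by
  have hm : Measurable fun x : ℝ × ℤ => (x.1 - u, x.2) := by fun_prop
  have hS : MeasurableSet {x : ℝ × ℤ | u < x.1 ∧ (x.1 - u, x.2) ∈ B} :=
    (measurableSet_lt measurable_const measurable_fst).inter (hm hB)
  have e : ∀ z : ℤ, (expMeasure 2) ((fun x => (x, z)) ⁻¹' {x : ℝ × ℤ | u < x.1 ∧ (x.1 - u, x.2) ∈ B}) =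
      ENNReal.ofReal (Real.exp (-(2 * u))) * (expMeasure 2) ((fun x => (x, z)) ⁻¹' B) := by
    intro z
    have hz : MeasurableSet ((fun x : ℝ => (x, z)) ⁻¹' B) := (by fun_prop : Measurable fun x : ℝ => (x, z)) hB
    have := congrArg (fun m => m ((fun x => (x, z)) ⁻¹' B)) (map_restrict_expMeasure hu)
    simp only [Measure.smul_apply, smul_eq_mul] at this
    rw [← this, Measure.map_apply (by fun_prop) hz,
      Measure.restrict_apply ((by fun_prop : Measurable fun x : ℝ => x - u) hz)]
    congr 1; ext x; simp [and_comm]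
  unfold jumpLaw
  rw [Measure.prod_apply_symm hS, Measure.prod_apply_symm hB]
  simp_rw [e]
  rw [lintegral_const_mul]
  exact measurable_measure_prodMk_right hB

/-- The memoryless property for finitely many walks. -/
theorem map_lower (F : Finset (Label a)) {u : ℝ} (hu : 0 ≤ u) :
    ((walkMeasure a).restrict {ρ | ∀ k ∈ F, u < (ρ (k, 0)).1}).map (lower F u) =
      ENNReal.ofReal (Real.exp (-(2 * u))) ^ F.card • walkMeasure a := by
  classical
  set e := ENNReal.ofReal (Real.exp (-(2 * u))) with he
  have he0 : e ≠ 0 := by simp [he, Real.exp_pos]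
  have het : e ≠ ⊤ := ENNReal.ofReal_ne_top
  have hE : MeasurableSet {ρ : Sample a | ∀ k ∈ F, u < (ρ (k, 0)).1} := by
    have : {ρ : Sample a | ∀ k ∈ F, u < (ρ (k, 0)).1} = ⋂ k ∈ F, {ρ : Sample a | u < (ρ (k, 0)).1} := by
      ext; simp
    rw [this]
    exact Finset.measurableSet_biInter _ fun k _ => measurableSet_lt measurable_const (by fun_prop)
  have hlow : Measurable (lower (a := a) F u) := (measurable_lower F).comp measurable_prodMk_left
  -- The normalized image measure is a product measure, since it has the right values on boxes.
  have key : (e ^ F.card)⁻¹ • ((walkMeasure a).restrict {ρ | ∀ k ∈ F, u < (ρ (k, 0)).1}).map (lower F u) =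
      walkMeasure a := by
    refine Measure.eq_infinitePi (fun _ : Label a × ℕ => jumpLaw) fun s t ht => ?_
    have hbox : MeasurableSet (Set.pi (s : Set (Label a × ℕ)) t) := .pi s.countable_toSet fun _ _ => ht _
    rw [Measure.smul_apply, smul_eq_mul, Measure.map_apply hlow hbox, Measure.restrict_apply (hlow hbox)]
    set F0 : Finset (Label a × ℕ) := F.image fun k => (k, 0) with hF0
    have hF0' : ∀ p : Label a × ℕ, p ∈ F0 ↔ p.1 ∈ F ∧ p.2 = 0 := by
      rintro ⟨k, j⟩
      simp only [hF0, Finset.mem_image, Prod.mk.injEq]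
      constructor
      · rintro ⟨x, hx, rfl, rfl⟩; exact ⟨hx, rfl⟩
      · rintro ⟨h1, rfl⟩; exact ⟨k, h1, rfl, rfl⟩
    set t' : Label a × ℕ → Set (ℝ × ℤ) := fun p => if p ∈ s then t p else Set.univ with ht'
    have ht'm : ∀ p, MeasurableSet (t' p) := fun p => by
      simp only [ht']; split_ifs; exacts [ht p, .univ]
    -- The preimage of a box is a box, with the factors `(k, 0)`, `k ∈ F`, shifted by `u`.
    have hset : lower F u ⁻¹' (Set.pi (s : Set (Label a × ℕ)) t) ∩ {ρ | ∀ k ∈ F, u < (ρ (k, 0)).1} =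
        Set.pi ((s ∪ F0 : Finset (Label a × ℕ)) : Set (Label a × ℕ)) fun p =>
          if p ∈ F0 then {x | u < x.1 ∧ (x.1 - u, x.2) ∈ t' p} else t' p := by
      ext ρ
      simp only [Set.mem_inter_iff, Set.mem_preimage, Set.mem_pi, Finset.mem_coe, Set.mem_ofPred_eq, Finset.mem_union]
      constructor
      · rintro ⟨h1, h2⟩ p hp
        by_cases hpF : p ∈ F0
        · rw [if_pos hpF]
          have hpF' := (hF0' p).1 hpF
          refine ⟨?_, ?_⟩
          · have := h2 p.1 hpF'.1
            rwa [← hpF'.2] at this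
          · by_cases hps : p ∈ s
            · have := h1 p hps
              simp only [lower, if_pos hpF'] at this
              simpa [ht', hps] using this
            · simp [ht', hps]
        · rw [if_neg hpF]
          have hps : p ∈ s := by tauto
          have := h1 p hps
          simp only [lower, if_neg (fun h => hpF ((hF0' p).2 h))] at this
          simpa [ht', hps] using this
      · intro h
        refine ⟨fun p hp => ?_, fun k hk => ?_⟩
        · have := h p (Or.inl hp)
          by_cases hpF : p ∈ F0
          · rw [if_pos hpF] at this
            simp only [lower, if_pos ((hF0' p).1 hpF)]
            simpa [ht', hp] using this.2
          · rw [if_neg hpF] at this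
            simp only [lower, if_neg (fun h => hpF ((hF0' p).2 h))]
            simpa [ht', hp] using this
        · have hk0 : ((k, 0) : Label a × ℕ) ∈ F0 := (hF0' _).2 ⟨hk, rfl⟩
          have := h (k, 0) (Or.inr hk0)
          rw [if_pos hk0] at this
          exact this.1
    have hprod : walkMeasure a (Set.pi ((s ∪ F0 : Finset (Label a × ℕ)) : Set (Label a × ℕ)) fun p =>
          if p ∈ F0 then {x | u < x.1 ∧ (x.1 - u, x.2) ∈ t' p} else t' p) =
        ∏ p ∈ s ∪ F0, ((if p ∈ F0 then e else 1) * jumpLaw (t' p)) := by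
      have hm : ∀ p, MeasurableSet (if p ∈ F0 then {x : ℝ × ℤ | u < x.1 ∧ (x.1 - u, x.2) ∈ t' p} else t' p) := by
        intro p
        split_ifs
        · exact (measurableSet_lt measurable_const measurable_fst).inter
            ((by fun_prop : Measurable fun x : ℝ × ℤ => (x.1 - u, x.2)) (ht'm p))
        · exact ht'm p
      refine (Measure.infinitePi_pi (fun _ : Label a × ℕ => jumpLaw) (fun i _ => hm i)).trans ?_
      refine Finset.prod_congr rfl fun p _ => ?_
      by_cases hp : p ∈ F0
      · rw [if_pos hp, if_pos hp, jumpLaw_shift hu (ht'm p)]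
      · rw [if_neg hp, if_neg hp, one_mul]
    rw [hset, hprod, Finset.prod_mul_distrib]
    have h1 : ∏ p ∈ s ∪ F0, (if p ∈ F0 then e else 1) = e ^ F.card := by
      rw [Finset.prod_ite_mem, Finset.union_inter_cancel_right, Finset.prod_const, hF0,
        Finset.card_image_of_injective _ (fun x y h => by simpa using h)]
    have h2 : ∏ p ∈ s ∪ F0, jumpLaw (t' p) = ∏ p ∈ s, jumpLaw (t p) := by
      rw [← Finset.prod_subset Finset.subset_union_left (f := fun p => jumpLaw (t' p))]
      · exact Finset.prod_congr rfl fun p hp => by simp [ht', hp]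
      · intro p _ hp; simp [ht', hp]
    rw [h1, h2, ← mul_assoc, ENNReal.inv_mul_cancel (pow_ne_zero _ he0) (ENNReal.pow_ne_top het), one_mul]
  conv_rhs => rw [← key]
  rw [smul_smul, ENNReal.mul_inv_cancel (pow_ne_zero _ he0) (ENNReal.pow_ne_top het), one_smul]

/-- The walk with label `l` is the first one among those with labels in `L` to jump. -/
def IsFirst (L : Finset (Label a)) (l : Label a) (ρ : Sample a) : Prop :=
  l ∈ L ∧ ∀ k ∈ L, k ≠ l → (ρ (l, 0)).1 < (ρ (k, 0)).1

/-- What remains of the walks after the first jump of a walk with label in `L`, if this is the walk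
with label `l`. The walks with labels outside `L` are not started yet. -/
def residual (L : Finset (Label a)) (l : Label a) (ρ : Sample a) : Sample a := fun p =>
  if p.1 = l then ρ (l, p.2 + 1)
  else if p.1 ∈ L ∧ p.2 = 0 then ((ρ p).1 - (ρ (l, 0)).1, (ρ p).2) else ρ p

theorem IsFirst.unique {L : Finset (Label a)} {l k : Label a} {ρ : Sample a} (h : IsFirst L l ρ)
    (h' : IsFirst L k ρ) : l = k := by
  by_contra hlk
  exact lt_asymm (h.2 k h'.1 (Ne.symm hlk)) (h'.2 l h.1 hlk)

theorem GoodSample.exists_isFirst {ρ : Sample a} (hρ : GoodSample ρ) {L : Finset (Label a)}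
    (hL : L.Nonempty) : ∃ l, IsFirst L l ρ := by
  obtain ⟨l, hl, hmin⟩ := L.exists_min_image (fun l => (ρ (l, 0)).1) hL
  exact ⟨l, hl, fun k hk hkl => lt_of_le_of_ne (hmin k hk) (hρ.ties l k (Ne.symm hkl))⟩

theorem measurableSet_isFirst (L : Finset (Label a)) (l : Label a) :
    MeasurableSet {ρ : Sample a | IsFirst L l ρ} := by
  unfold IsFirst
  simp only [Set.ofPred_and, Set.ofPred_forall]
  refine (MeasurableSet.const _).inter ?_
  refine Finset.measurableSet_biInter _ fun k _ => MeasurableSet.iInter fun _ => ?_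
  exact measurableSet_lt (by fun_prop) (by fun_prop)

theorem measurable_residual (L : Finset (Label a)) (l : Label a) : Measurable (residual L l) := by
  refine measurable_pi_lambda _ fun p => ?_
  unfold residual
  split_ifs <;> fun_prop

/-- If the walk with label `l` is the first one to jump, then what remains after the jump is
independent of the jump, and distributed as at the beginning. -/
theorem lintegral_residual {L : Finset (Label a)} {l : Label a} (hl : l ∈ L)
    {g : ℝ × ℤ → Sample a → ℝ≥0∞} (hg : Measurable (Function.uncurry g)) :
    ∫⁻ ρ, {ρ : Sample a | IsFirst L l ρ}.indicator (fun ρ => g (ρ (l, 0)) (residual L l ρ)) ρ ∂(walkMeasure a) =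
      ∫⁻ ρ, ENNReal.ofReal (Real.exp (-(2 * (ρ (l, 0)).1))) ^ (L.erase l).card *
        ∫⁻ ρ', g (ρ (l, 0)) ρ' ∂(walkMeasure a) ∂(walkMeasure a) := by
  classical
  -- Condition on the first jump `ρ1 (l, 0)` of the walk `l` by drawing all other coordinates afresh.
  set S : Set (Label a × ℕ) := {(l, 0)} with hS
  have hw : walkMeasure a = ((walkMeasure a).prod (walkMeasure a)).map (splice S) := (map_splice jumpLaw _).symm
  have hm1 : Measurable fun ρ : Sample a => {ρ : Sample a | IsFirst L l ρ}.indicator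
      (fun ρ => g (ρ (l, 0)) (residual L l ρ)) ρ := by
    refine Measurable.indicator ?_ (measurableSet_isFirst L l)
    exact hg.comp ((by fun_prop : Measurable fun ρ : Sample a => ρ (l, 0)).prodMk (measurable_residual L l))
  conv_lhs => rw [hw]
  rw [lintegral_map hm1 (measurable_splice S), lintegral_prod _ (by exact (hm1.comp (measurable_splice S)).aemeasurable)]
  have hpos : ∀ᵐ ρ ∂(walkMeasure a), 0 < (ρ (l, 0)).1 := by
    filter_upwards [ae_goodSample (a := a)] with ρ hρ using (hρ.seq l).pos 0
  refine lintegral_congr_ae ?_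
  filter_upwards [hpos] with ρ1 hρ1
  set x := ρ1 (l, 0) with hx
  set F := L.erase l with hF
  -- The walks other than `l` are unchanged; the walk `l` loses its first jump.
  set re : Sample a → Sample a := fun ρ p => ρ (p.1, if p.1 = l then p.2 + 1 else p.2) with hre
  have hre_mp : MeasurePreserving re (walkMeasure a) (walkMeasure a) := by
    refine ⟨measurable_pi_lambda _ fun p => measurable_pi_apply _, ?_⟩
    refine Measure.map_infinitePi_infinitePi_of_inj
      (f := fun p : Label a × ℕ => (p.1, if p.1 = l then p.2 + 1 else p.2)) (P := fun _ : Label a × ℕ => jumpLaw) fun p q h => ?_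
    simp only [Prod.mk.injEq] at h
    obtain ⟨h1, h2⟩ := h
    refine Prod.ext h1 ?_
    rw [h1] at h2
    split_ifs at h2 <;> omega
  have hpt : ∀ ρ2 : Sample a, {ρ : Sample a | IsFirst L l ρ}.indicator (fun ρ => g (ρ (l, 0)) (residual L l ρ)) (splice S (ρ1, ρ2)) =
      {ρ : Sample a | ∀ k ∈ F, x.1 < (ρ (k, 0)).1}.indicator (fun ρ => g x (lower F x.1 ρ)) (re ρ2) := by
    intro ρ2
    have hl0 : splice S (ρ1, ρ2) (l, 0) = x := by simp [splice, hS, hx]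
    have hk0 : ∀ p : Label a × ℕ, p.1 ≠ l → splice S (ρ1, ρ2) p = ρ2 p := by
      intro p hp
      have : p ∉ S := by rintro rfl; exact hp rfl
      simp [splice, this]
    have h1 : IsFirst L l (splice S (ρ1, ρ2)) ↔ ∀ k ∈ F, x.1 < (re ρ2 (k, 0)).1 := by
      simp only [IsFirst, hl, true_and, hl0, hF, Finset.mem_erase]
      refine forall_congr' fun k => ?_
      by_cases hkl : k = l
      · simp [hkl]
      · simp [hkl, hk0 (k, 0) hkl, hre]
    have h2 : residual L l (splice S (ρ1, ρ2)) = lower F x.1 (re ρ2) := by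
      funext p
      simp only [residual, lower, hl0, hF, Finset.mem_erase, hre]
      by_cases hp : p.1 = l
      · have : ((l, p.2 + 1) : Label a × ℕ) ∉ S := by simp [hS]
        simp [hp, splice, this]
      · simp [hp, hk0 p hp]
    simp only [Set.indicator, Set.mem_ofPred_eq, h1, hl0, h2]
  have hE : MeasurableSet {ρ : Sample a | ∀ k ∈ F, x.1 < (ρ (k, 0)).1} := by
    simp only [Set.ofPred_forall]
    exact Finset.measurableSet_biInter _ fun k _ => measurableSet_lt measurable_const (by fun_prop)
  have hlow : Measurable (lower (a := a) F x.1) := (measurable_lower F).comp measurable_prodMk_left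
  have hgx : Measurable (g x) := hg.comp measurable_prodMk_left
  calc _ = ∫⁻ ρ2, {ρ : Sample a | ∀ k ∈ F, x.1 < (ρ (k, 0)).1}.indicator (fun ρ => g x (lower F x.1 ρ)) (re ρ2) ∂(walkMeasure a) :=
        lintegral_congr hpt
    _ = ∫⁻ ρ2, {ρ : Sample a | ∀ k ∈ F, x.1 < (ρ (k, 0)).1}.indicator (fun ρ => g x (lower F x.1 ρ)) ρ2 ∂(walkMeasure a) :=
        hre_mp.lintegral_comp ((hgx.comp hlow).indicator hE)
    _ = ∫⁻ ρ2, g x ρ2 ∂(((walkMeasure a).restrict {ρ | ∀ k ∈ F, x.1 < (ρ (k, 0)).1}).map (lower F x.1)) := by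
        rw [lintegral_indicator hE, lintegral_map hgx hlow]
    _ = _ := by rw [map_lower F hρ1.le, lintegral_smul_measure, smul_eq_mul]

/-- A function is measurable if it agrees on each set of a countable measurable cover with a measurable
function. -/
theorem measurable_of_countable_cover {ι α β : Type*} [Countable ι] [MeasurableSpace α]
    [MeasurableSpace β] {f : α → β} (S : ι → Set α) (g : ι → α → β) (hS : ∀ i, MeasurableSet (S i))
    (hg : ∀ i, Measurable (g i)) (hcov : ∀ x, ∃ i, x ∈ S i) (h : ∀ i, ∀ x ∈ S i, f x = g i x) :
    Measurable f := by
  intro B hB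
  have : f ⁻¹' B = ⋃ i, S i ∩ g i ⁻¹' B := by
    ext x
    simp only [Set.mem_preimage, Set.mem_iUnion, Set.mem_inter_iff]
    constructor
    · intro hx
      obtain ⟨i, hi⟩ := hcov x
      exact ⟨i, hi, by rwa [← h i x hi]⟩
    · rintro ⟨i, hi, hx⟩
      rwa [h i x hi]
  rw [this]
  exact MeasurableSet.iUnion fun i => (hS i).inter (hg i hB)

/-- Finitely many jumps, each given by a label and a step, the last one first. -/
abbrev Jumps (a : ℕ) : Type := List (Label a × ℤ)

instance : MeasurableSpace (Jumps a) := ⊤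

instance : DiscreteMeasurableSpace (Jumps a) := ⟨fun _ => trivial⟩

/-- Finitely many jumps and, in chronological order, the times between them. -/
abbrev History (a : ℕ) : Type := Jumps a × (ℕ → ℝ)

/-- The history prolonged by the jump `x` of the walk with label `l`. -/
def History.push (h : History a) (l : Label a) (x : ℝ × ℤ) : History a :=
  ((l, x.2) :: h.1, Function.update h.2 h.1.length x.1)

variable (act : Jumps a → Finset (Label a))

open Classical in
/-- Observe the next jump of a walk whose label is active after the jumps observed so far. -/
def explore (p : History a × Sample a) : History a × Sample a :=
  if h : ∃ l, IsFirst (act p.1.1) l p.2 then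
    (p.1.push h.choose (p.2 (h.choose, 0)), residual (act p.1.1) h.choose p.2)
  else p

/-- The first `n` jumps of the active walks, and what remains of the walks after them. -/
def exploration (ω : Sample a) : ℕ → History a × Sample a
  | 0 => (([], fun _ => 0), ω)
  | n + 1 => explore act (exploration ω n)

variable {act}

theorem explore_of_isFirst {p : History a × Sample a} {l : Label a} (h : IsFirst (act p.1.1) l p.2) :
    explore act p = (p.1.push l (p.2 (l, 0)), residual (act p.1.1) l p.2) := by
  have hex : ∃ l, IsFirst (act p.1.1) l p.2 := ⟨l, h⟩
  rw [explore, dif_pos hex, hex.choose_spec.unique h]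

theorem measurable_push (d : Jumps a) (l : Label a) :
    Measurable fun q : (ℕ → ℝ) × (ℝ × ℤ) => History.push (d, q.1) l q.2 := by
  refine Measurable.prodMk ?_ ?_
  · exact (Measurable.of_discrete (f := fun z : ℤ => (l, z) :: d)).comp (measurable_snd.comp measurable_snd)
  · refine measurable_pi_lambda _ fun i => ?_
    simp only [Function.update_apply]
    split_ifs <;> fun_prop

theorem measurable_explore : Measurable (explore act) := by
  refine measurable_of_countable_cover (ι := Jumps a × Option (Label a))
    (fun i => {p | p.1.1 = i.1} ∩ match i.2 with
      | none => {p | ¬ ∃ l, IsFirst (act i.1) l p.2}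
      | some l => {p | IsFirst (act i.1) l p.2})
    (fun i p => match i.2 with
      | none => p
      | some l => (History.push (i.1, p.1.2) l (p.2 (l, 0)), residual (act i.1) l p.2)) ?_ ?_ ?_ ?_
  · rintro ⟨d, i⟩
    refine ((measurable_fst.comp measurable_fst) (MeasurableSet.singleton d)).inter ?_
    cases i with
    | none =>
      refine MeasurableSet.compl ?_
      have : {p : History a × Sample a | ∃ l, IsFirst (act d) l p.2} = ⋃ l, Prod.snd ⁻¹' {ρ | IsFirst (act d) l ρ} := by
        ext p; simp
      rw [show (fun p : History a × Sample a => ∃ l, IsFirst (act d) l p.2) = _ from this]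
      exact MeasurableSet.iUnion fun l => measurable_snd (measurableSet_isFirst _ l)
    | some l => exact measurable_snd (measurableSet_isFirst _ l)
  · rintro ⟨d, i⟩
    cases i with
    | none => exact measurable_id
    | some l =>
      refine Measurable.prodMk ?_ ((measurable_residual _ l).comp measurable_snd)
      exact (measurable_push d l).comp ((measurable_snd.comp measurable_fst).prodMk
        ((measurable_pi_apply _).comp measurable_snd))
  · intro p
    by_cases h : ∃ l, IsFirst (act p.1.1) l p.2
    · obtain ⟨l, hl⟩ := h
      exact ⟨(p.1.1, some l), rfl, hl⟩
    · exact ⟨(p.1.1, none), rfl, h⟩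
  · rintro ⟨d, i⟩ p ⟨h1, h2⟩
    simp only [Set.mem_ofPred_eq] at h1
    cases i with
    | none =>
      simp only [Set.mem_ofPred_eq] at h2
      rw [explore, dif_neg (by rw [h1]; exact h2)]
    | some l =>
      simp only [Set.mem_ofPred_eq] at h2
      rw [explore_of_isFirst (by rw [h1]; exact h2)]
      subst h1
      rfl

theorem measurable_exploration (n : ℕ) : Measurable fun ω : Sample a => exploration act ω n := by
  induction n with
  | zero => exact measurable_const.prodMk measurable_id
  | succ n ih => exact measurable_explore.comp ih

/-- Observing one jump leaves walks that are independent of the prolonged history. -/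
theorem lintegral_explore (hact : ∀ d, (act d).Nonempty) {f : History a × Sample a → ℝ≥0∞}
    (hf : Measurable f) (h : History a) :
    ∫⁻ ρ, f (explore act (h, ρ)) ∂(walkMeasure a) =
      ∫⁻ ρ, ∫⁻ ρ', f ((explore act (h, ρ)).1, ρ') ∂(walkMeasure a) ∂(walkMeasure a) := by
  classical
  set L := act h.1 with hL
  -- A decomposition according to the label of the next jump.
  have hsum : ∀ f : History a × Sample a → ℝ≥0∞, Measurable f →
      ∫⁻ ρ, f (explore act (h, ρ)) ∂(walkMeasure a) = ∑ l ∈ L,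
        ∫⁻ ρ, ENNReal.ofReal (Real.exp (-(2 * (ρ (l, 0)).1))) ^ (L.erase l).card *
          ∫⁻ ρ', f (h.push l (ρ (l, 0)), ρ') ∂(walkMeasure a) ∂(walkMeasure a) := by
    intro f hf
    have hg : ∀ l, Measurable (Function.uncurry fun (x : ℝ × ℤ) (ρ : Sample a) => f (h.push l x, ρ)) := by
      intro l
      refine hf.comp (Measurable.prodMk ?_ measurable_snd)
      exact (measurable_push h.1 l).comp (measurable_const.prodMk measurable_fst)
    have hm : ∀ l, Measurable fun ρ : Sample a => {ρ : Sample a | IsFirst L l ρ}.indicator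
        (fun ρ => f (h.push l (ρ (l, 0)), residual L l ρ)) ρ := by
      intro l
      refine Measurable.indicator ?_ (measurableSet_isFirst L l)
      exact (hg l).comp ((by fun_prop : Measurable fun ρ : Sample a => ρ (l, 0)).prodMk (measurable_residual L l))
    calc _ = ∫⁻ ρ, ∑ l ∈ L, {ρ : Sample a | IsFirst L l ρ}.indicator
          (fun ρ => f (h.push l (ρ (l, 0)), residual L l ρ)) ρ ∂(walkMeasure a) := by
          refine lintegral_congr_ae ?_
          filter_upwards [ae_goodSample (a := a)] with ρ hρ
          obtain ⟨l, hl⟩ := hρ.exists_isFirst (hact h.1)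
          rw [Finset.sum_eq_single_of_mem l hl.1, Set.indicator_of_mem (by exact hl),
            explore_of_isFirst (p := (h, ρ)) hl]
          intro k _ hkl
          exact Set.indicator_of_notMem (fun hk => hkl (IsFirst.unique (by exact hk) hl)) _
      _ = ∑ l ∈ L, ∫⁻ ρ, {ρ : Sample a | IsFirst L l ρ}.indicator
          (fun ρ => f (h.push l (ρ (l, 0)), residual L l ρ)) ρ ∂(walkMeasure a) :=
          lintegral_finsetSum _ fun l _ => hm l
      _ = _ := Finset.sum_congr rfl fun l hl => lintegral_residual hl (hg l)
  have hf' : Measurable fun p : History a × Sample a => ∫⁻ ρ', f (p.1, ρ') ∂(walkMeasure a) :=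
    (Measurable.lintegral_prod_right' hf).comp measurable_fst
  rw [hsum f hf, hsum _ hf']
  refine Finset.sum_congr rfl fun l _ => lintegral_congr fun ρ => ?_
  simp

/-- After the first `n` jumps of the active walks, what remains of the walks is independent of the
history, and distributed as at the beginning. -/
theorem lintegral_exploration (hact : ∀ d, (act d).Nonempty) (n : ℕ) :
    ∀ {f : History a × Sample a → ℝ≥0∞}, Measurable f →
    ∫⁻ ω, f (exploration act ω n) ∂(walkMeasure a) =
      ∫⁻ ω, ∫⁻ ρ, f ((exploration act ω n).1, ρ) ∂(walkMeasure a) ∂(walkMeasure a) := by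
  induction n with
  | zero => intro f hf; simp [exploration]
  | succ n ih =>
    intro f hf
    have hf' : Measurable fun p : History a × Sample a => ∫⁻ ρ', f (p.1, ρ') ∂(walkMeasure a) :=
      (Measurable.lintegral_prod_right' hf).comp measurable_fst
    have e1 := ih (f := fun p => f (explore act p)) (hf.comp measurable_explore)
    have e2 := ih (f := fun p => ∫⁻ ρ', f ((explore act p).1, ρ') ∂(walkMeasure a)) (hf'.comp measurable_explore)
    simp only [exploration]
    rw [e1, e2]
    exact lintegral_congr fun ω => lintegral_explore hact hf _


/-! ### The Markov property of the exploration -/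

/-- The walks before the jump of the walk with label `l` that took the step `σ` after the holding
time `τ`, given what remains of the walks after this jump. -/
def undo (L : Finset (Label a)) (x : Label a × ℤ) (τ : ℝ) (ρ : Sample a) : Sample a := fun p =>
  if p.1 = x.1 then (if p.2 = 0 then (τ, x.2) else ρ (x.1, p.2 - 1))
  else if p.1 ∈ L ∧ p.2 = 0 then ((ρ p).1 + τ, (ρ p).2) else ρ p

theorem undo_residual (L : Finset (Label a)) (l : Label a) (ρ : Sample a) :
    undo L (l, (ρ (l, 0)).2) (ρ (l, 0)).1 (residual L l ρ) = ρ := by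
  funext ⟨k, j⟩
  by_cases hk : k = l
  · subst hk
    rcases j with _ | j <;> simp [undo, residual]
  · by_cases hj : k ∈ L ∧ j = 0
    · simp [undo, residual, hk, hj]
    · simp [undo, residual, hk, hj]

variable (act : Jumps a → Finset (Label a))

/-- The walks, recovered from a history and from what remains of them. -/
def rebuild : Jumps a → (ℕ → ℝ) → Sample a → Sample a
  | [], _, ρ => ρ
  | x :: d, T, ρ => rebuild d T (undo (act d) x (T d.length) ρ)

theorem rebuild_congr (d : Jumps a) {T T' : ℕ → ℝ} (h : ∀ i < d.length, T i = T' i) (ρ : Sample a) :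
    rebuild act d T ρ = rebuild act d T' ρ := by
  induction d generalizing ρ with
  | nil => rfl
  | cons x d ih =>
    simp only [rebuild]
    rw [h d.length (by simp), ih (fun i hi => h i (by simp; omega))]

/-- No information is lost during an exploration. -/
theorem rebuild_exploration (ω : Sample a) (n : ℕ) :
    rebuild act (exploration act ω n).1.1 (exploration act ω n).1.2 (exploration act ω n).2 = ω := by
  induction n with
  | zero => rfl
  | succ n ih =>
    simp only [exploration]
    by_cases h : ∃ l, IsFirst (act (exploration act ω n).1.1) l (exploration act ω n).2
    · obtain ⟨l, hl⟩ := h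
      rw [explore_of_isFirst hl]
      simp only [History.push, rebuild]
      rw [Function.update_self, undo_residual, rebuild_congr act _ (T' := (exploration act ω n).1.2), ih]
      intro i hi
      rw [Function.update_of_ne (by omega)]
    · rw [explore, dif_neg h, ih]

theorem measurable_rebuild :
    Measurable fun q : History a × Sample a => rebuild act q.1.1 q.1.2 q.2 := by
  refine measurable_of_countable_cover (fun d : Jumps a => {q | q.1.1 = d})
    (fun d q => rebuild act d q.1.2 q.2) (fun d => (measurable_fst.comp measurable_fst) (MeasurableSet.singleton d))
    ?_ (fun q => ⟨q.1.1, rfl⟩) (fun d q hq => by simp only [Set.mem_ofPred_eq] at hq; rw [hq])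
  intro d
  suffices h : Measurable fun q : (ℕ → ℝ) × Sample a => rebuild act d q.1 q.2 from
    h.comp ((measurable_snd.comp measurable_fst).prodMk measurable_snd)
  induction d with
  | nil => exact measurable_snd
  | cons x d ih =>
    suffices h : Measurable fun q : (ℕ → ℝ) × Sample a => undo (act d) x (q.1 d.length) q.2 from
      ih.comp (measurable_fst.prodMk h)
    refine measurable_pi_lambda _ fun p => ?_
    unfold undo
    split_ifs <;> fun_prop

variable {act}

/-- The history of the first `n` jumps and the remaining walks are independent. -/
theorem map_exploration (hact : ∀ d, (act d).Nonempty) (n : ℕ) :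
    (walkMeasure a).map (fun ω => exploration act ω n) =
      ((walkMeasure a).map fun ω => (exploration act ω n).1).prod (walkMeasure a) := by
  have hm := measurable_exploration (act := act) n
  have : IsProbabilityMeasure ((walkMeasure a).map fun ω => (exploration act ω n).1) :=
    Measure.isProbabilityMeasure_map hm.fst.aemeasurable
  ext B hB
  have hi : Measurable (B.indicator (1 : History a × Sample a → ℝ≥0∞)) := measurable_one.indicator hB
  rw [← lintegral_indicator_one hB, ← lintegral_indicator_one hB, lintegral_map hi hm,
    lintegral_exploration hact n hi, lintegral_prod _ hi.aemeasurable,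
    lintegral_map (Measurable.lintegral_prod_right' hi) hm.fst]

theorem measurePreserving_residual (hact : ∀ d, (act d).Nonempty) (n : ℕ) :
    MeasurePreserving (fun ω => (exploration act ω n).2) (walkMeasure a) (walkMeasure a) := by
  have hm := measurable_exploration (act := act) n
  refine ⟨hm.snd, ?_⟩
  have : IsProbabilityMeasure ((walkMeasure a).map fun ω => (exploration act ω n).1) :=
    Measure.isProbabilityMeasure_map hm.fst.aemeasurable
  have h := congrArg (fun m => m.map Prod.snd) (map_exploration hact n)
  rw [Measure.map_map measurable_snd hm] at h
  rw [← Measure.snd, Measure.snd_prod] at h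
  exact h

/-- The Markov property after `n` jumps. The function `F` need not be given as a function of the
history: it suffices that the history determines its value. -/
theorem lintegral_markov (hact : ∀ d, (act d).Nonempty) (n : ℕ) {F : Sample a → ℝ≥0∞}
    (hF : AEMeasurable F (walkMeasure a)) {S : Set (Sample a)} (hS : ∀ᵐ ω ∂(walkMeasure a), ω ∈ S)
    (hdet : ∀ ω ∈ S, ∀ ω' ∈ S, (exploration act ω n).1 = (exploration act ω' n).1 → F ω = F ω')
    {G : Jumps a → Sample a → ℝ≥0∞} (hG : ∀ d, AEMeasurable (G d) (walkMeasure a)) :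
    ∫⁻ ω, F ω * G (exploration act ω n).1.1 (exploration act ω n).2 ∂(walkMeasure a) =
      ∫⁻ ω, F ω * ∫⁻ ρ, G (exploration act ω n).1.1 ρ ∂(walkMeasure a) ∂(walkMeasure a) := by
  set Z : Sample a → History a × Sample a := fun ω => exploration act ω n with hZ
  have hZm : Measurable Z := measurable_exploration n
  -- `R` inverts `Z`, so that `F` becomes a function of the history and of what remains of the walks.
  set R : History a × Sample a → Sample a := fun q => rebuild act q.1.1 q.1.2 q.2 with hR
  have hRm : Measurable R := measurable_rebuild act
  have hRZ : ∀ ω, R (Z ω) = ω := fun ω => rebuild_exploration act ω n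
  set P := walkMeasure a with hP
  set ν := P.map fun ω => (Z ω).1 with hν
  have hνp : IsProbabilityMeasure ν := Measure.isProbabilityMeasure_map hZm.fst.aemeasurable
  have hlaw : P.map Z = ν.prod P := map_exploration hact n
  set F' := hF.mk F with hF'
  have hF'm : Measurable F' := hF.measurable_mk
  set G' : Jumps a → Sample a → ℝ≥0∞ := fun d => (hG d).mk (G d) with hG'
  have hG'm : Measurable fun q : History a × Sample a => G' q.1.1 q.2 := by
    refine measurable_of_countable_cover (fun d : Jumps a => {q : History a × Sample a | q.1.1 = d})
      (fun d q => G' d q.2) (fun d => (measurable_fst.comp measurable_fst) (MeasurableSet.singleton d))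
      (fun d => (hG d).measurable_mk.comp measurable_snd)
      (fun q => ⟨q.1.1, rfl⟩) (fun d q hq => by simp only [Set.mem_ofPred_eq] at hq; rw [hq])
  -- A measurable set of full measure on which `F` is determined by the history.
  obtain ⟨S', hS'm, hS'P, hS'⟩ : ∃ S' : Set (Sample a), MeasurableSet S' ∧ (∀ᵐ ω ∂P, ω ∈ S') ∧
      ∀ ω ∈ S', ω ∈ S ∧ F ω = F' ω := by
    have h : ∀ᵐ ω ∂P, ω ∈ S ∧ F ω = F' ω := hS.and hF.ae_eq_mk
    refine ⟨(toMeasurable P {ω | ¬ (ω ∈ S ∧ F ω = F' ω)})ᶜ, (measurableSet_toMeasurable _ _).compl, ?_, ?_⟩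
    · rw [ae_iff]
      simp only [Set.mem_compl_iff, not_not]
      change P (toMeasurable P _) = 0
      rw [measure_toMeasurable]; exact h
    · intro ω hω
      by_contra hno
      exact hω (subset_toMeasurable _ _ hno)
  -- For almost every history, `F` is therefore almost everywhere constant in the remaining walks.
  have hE : ∀ᵐ h ∂ν, ∀ᵐ ρ ∂P, R (h, ρ) ∈ S' ∧ Z (R (h, ρ)) = (h, ρ) := by
    have hms : MeasurableSet {q : History a × Sample a | R q ∈ S' ∧ Z (R q) = q} :=
      (hRm hS'm).inter (measurableSet_eq_fun (hZm.comp hRm) measurable_id)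
    have h : ∀ᵐ q ∂(ν.prod P), R q ∈ S' ∧ Z (R q) = q := by
      rw [← hlaw, ae_map_iff hZm.aemeasurable hms]
      filter_upwards [hS'P] with ω hω
      rw [hRZ]; exact ⟨hω, rfl⟩
    exact (Measure.ae_prod_iff_ae_ae hms).1 h
  have hconst : ∀ᵐ h ∂ν, ∃ c, ∀ᵐ ρ ∂P, F' (R (h, ρ)) = c := by
    filter_upwards [hE] with h hh
    obtain ⟨ρ0, hρ0⟩ := hh.exists
    refine ⟨F' (R (h, ρ0)), ?_⟩
    filter_upwards [hh] with ρ hρ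
    rw [← (hS' _ hρ.1).2, ← (hS' _ hρ0.1).2]
    refine hdet _ (hS' _ hρ.1).1 _ (hS' _ hρ0.1).1 ?_
    change (Z (R (h, ρ))).1 = (Z (R (h, ρ0))).1
    rw [hρ.2, hρ0.2]
  have hmm : Measurable fun q : History a × Sample a => ∫⁻ ρ, G' q.1.1 ρ ∂P :=
    (Measurable.of_discrete (f := fun d : Jumps a => ∫⁻ ρ, G' d ρ ∂P)).comp (measurable_fst.comp measurable_fst)
  have hm1 : Measurable fun q : History a × Sample a => F' (R q) * G' q.1.1 q.2 := (hF'm.comp hRm).mul hG'm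
  have hm2 : Measurable fun q : History a × Sample a => F' (R q) * ∫⁻ ρ, G' q.1.1 ρ ∂P := (hF'm.comp hRm).mul hmm
  have hlhs : ∫⁻ ω, F ω * G (Z ω).1.1 (Z ω).2 ∂P = ∫⁻ q, F' (R q) * G' q.1.1 q.2 ∂(ν.prod P) := by
    rw [← hlaw, lintegral_map hm1 hZm]
    have hq : ∀ᵐ ω ∂P, ∀ d, G d (Z ω).2 = G' d (Z ω).2 := by
      rw [ae_all_iff]
      exact fun d => (measurePreserving_residual hact n).quasiMeasurePreserving.ae (hG d).ae_eq_mk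
    refine lintegral_congr_ae ?_
    filter_upwards [hq, hF.ae_eq_mk] with ω h1 h2
    rw [hRZ, h2, h1]
  have hrhs : ∫⁻ ω, F ω * ∫⁻ ρ, G (Z ω).1.1 ρ ∂P ∂P =
      ∫⁻ q, F' (R q) * ∫⁻ ρ, G' q.1.1 ρ ∂P ∂(ν.prod P) := by
    rw [← hlaw, lintegral_map hm2 hZm]
    refine lintegral_congr_ae ?_
    filter_upwards [hF.ae_eq_mk] with ω h2
    rw [hRZ, h2]
    congr 1
    exact lintegral_congr_ae (hG _).ae_eq_mk
  refine hlhs.trans (Eq.trans ?_ hrhs.symm)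
  rw [lintegral_prod _ hm1.aemeasurable,
    lintegral_prod _ hm2.aemeasurable]
  refine lintegral_congr_ae ?_
  filter_upwards [hconst] with h hc
  obtain ⟨c, hc⟩ := hc
  have e1 : ∫⁻ ρ, F' (R (h, ρ)) * G' h.1 ρ ∂P = ∫⁻ ρ, c * G' h.1 ρ ∂P := by
    refine lintegral_congr_ae ?_
    filter_upwards [hc] with ρ hρ
    rw [hρ]
  have e2 : ∫⁻ ρ, F' (R (h, ρ)) * ∫⁻ ρ', G' h.1 ρ' ∂P ∂P = ∫⁻ ρ, c * ∫⁻ ρ', G' h.1 ρ' ∂P ∂P := by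
    refine lintegral_congr_ae ?_
    filter_upwards [hc] with ρ hρ
    rw [hρ]
  rw [e1, e2, lintegral_const_mul _ (hG h.1).measurable_mk, lintegral_const]
  simp
  rfl

/-- The Markov property at the first jumps after which the observed jumps belong to `A`. -/
theorem lintegral_strong_markov (hact : ∀ d, (act d).Nonempty) (A : Set (Jumps a)) {F : Sample a → ℝ≥0∞}
    (hF : AEMeasurable F (walkMeasure a)) {S : Set (Sample a)} (hS : ∀ᵐ ω ∂(walkMeasure a), ω ∈ S)
    (hdet : ∀ ω ∈ S, ∀ ω' ∈ S, ∀ n, (exploration act ω n).1.1 ∈ A →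
      (exploration act ω n).1 = (exploration act ω' n).1 → F ω = F ω')
    {G : Jumps a → Sample a → ℝ≥0∞} (hG : ∀ d, AEMeasurable (G d) (walkMeasure a)) :
    ∫⁻ ω, F ω * ∑' n, A.indicator (fun d => G d (exploration act ω n).2) (exploration act ω n).1.1 ∂(walkMeasure a) =
      ∫⁻ ω, F ω * ∑' n, A.indicator (fun d => ∫⁻ ρ, G d ρ ∂(walkMeasure a)) (exploration act ω n).1.1 ∂(walkMeasure a) := by
  classical
  have hd : ∀ n, Measurable fun ω : Sample a => (exploration act ω n).1.1 := fun n => (measurable_exploration n).fst.fst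
  have hAi : ∀ n, AEMeasurable (fun ω => F ω * A.indicator (fun _ => 1) (exploration act ω n).1.1) (walkMeasure a) :=
    fun n => hF.mul (((Measurable.of_discrete (f := A.indicator fun _ => (1 : ℝ≥0∞))).comp (hd n)).aemeasurable)
  have key := fun n => lintegral_markov hact n (hAi n) hS (fun ω hω ω' hω' h => by
    by_cases hA : (exploration act ω n).1.1 ∈ A
    · rw [hdet ω hω ω' hω' n hA h, h]
    · have hA' := hA
      rw [h] at hA'
      rw [Set.indicator_of_notMem hA, Set.indicator_of_notMem hA', mul_zero, mul_zero]) hG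
  have hGm : ∀ n, AEMeasurable (fun ω => G (exploration act ω n).1.1 (exploration act ω n).2) (walkMeasure a) := by
    intro n
    have hG'm : Measurable fun q : History a × Sample a => (hG q.1.1).mk (G q.1.1) q.2 := by
      refine measurable_of_countable_cover (fun d : Jumps a => {q : History a × Sample a | q.1.1 = d})
        (fun d q => (hG d).mk (G d) q.2) (fun d => (measurable_fst.comp measurable_fst) (MeasurableSet.singleton d))
        (fun d => (hG d).measurable_mk.comp measurable_snd)
        (fun q => ⟨q.1.1, rfl⟩) (fun d q hq => by simp only [Set.mem_ofPred_eq] at hq; subst hq; rfl)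
    refine ⟨_, hG'm.comp (measurable_exploration (act := act) n), ?_⟩
    have hq : ∀ᵐ ω ∂(walkMeasure a), ∀ d, G d (exploration act ω n).2 = (hG d).mk (G d) (exploration act ω n).2 := by
      rw [ae_all_iff]
      exact fun d => (measurePreserving_residual hact n).quasiMeasurePreserving.ae (hG d).ae_eq_mk
    filter_upwards [hq] with ω h1 using h1 _
  have e1 : ∀ ω, F ω * ∑' n, A.indicator (fun d => G d (exploration act ω n).2) (exploration act ω n).1.1 =
      ∑' n, F ω * A.indicator (fun _ => 1) (exploration act ω n).1.1 * G (exploration act ω n).1.1 (exploration act ω n).2 := by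
    intro ω
    rw [← ENNReal.tsum_mul_left]
    refine tsum_congr fun n => ?_
    simp only [Set.indicator]
    split_ifs <;> simp
  have e2 : ∀ ω, F ω * ∑' n, A.indicator (fun d => ∫⁻ ρ, G d ρ ∂(walkMeasure a)) (exploration act ω n).1.1 =
      ∑' n, F ω * A.indicator (fun _ => 1) (exploration act ω n).1.1 * ∫⁻ ρ, G (exploration act ω n).1.1 ρ ∂(walkMeasure a) := by
    intro ω
    rw [← ENNReal.tsum_mul_left]
    refine tsum_congr fun n => ?_
    simp only [Set.indicator]
    split_ifs <;> simp
  simp_rw [e1, e2]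
  rw [lintegral_tsum (fun n => by exact (hAi n).mul (hGm n)), lintegral_tsum]
  · exact tsum_congr key
  · intro n
    refine (hAi n).mul ?_
    exact ((Measurable.of_discrete (f := fun d : Jumps a => ∫⁻ ρ, G d ρ ∂(walkMeasure a))).comp (hd n)).aemeasurable

/-- The time of the last jump of a history. -/
def History.clock (h : History a) : ℝ := ∑ i ∈ Finset.range h.1.length, h.2 i

theorem measurable_clock : Measurable (History.clock (a := a)) := by
  refine measurable_of_countable_cover (fun d : Jumps a => {h | h.1 = d})
    (fun d h => ∑ i ∈ Finset.range d.length, h.2 i) (fun d => measurable_fst (MeasurableSet.singleton d))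
    (fun d => by fun_prop) (fun h => ⟨h.1, rfl⟩) (fun d h hh => by
      simp only [Set.mem_ofPred_eq] at hh; rw [History.clock, hh])

theorem clock_push (h : History a) (l : Label a) (x : ℝ × ℤ) : (h.push l x).clock = h.clock + x.1 := by
  simp only [History.clock, History.push, List.length_cons, Finset.sum_range_succ, Function.update_self]
  congr 1
  refine Finset.sum_congr rfl fun i hi => ?_
  rw [Function.update_of_ne (by have := Finset.mem_range.1 hi; omega)]

/-- The walks are regular at each stage of the exploration. -/
def GoodExploration (act : Jumps a → Finset (Label a)) (ω : Sample a) : Prop :=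
  ∀ n, GoodSample (exploration act ω n).2

theorem ae_goodExploration (hact : ∀ d, (act d).Nonempty) :
    ∀ᵐ ω ∂(walkMeasure a), GoodExploration act ω := by
  unfold GoodExploration
  rw [ae_all_iff]
  exact fun n => (measurePreserving_residual hact n).quasiMeasurePreserving.ae ae_goodSample

theorem length_exploration_le (ω : Sample a) (n : ℕ) : (exploration act ω n).1.1.length ≤ n := by
  induction n with
  | zero => simp [exploration]
  | succ n ih =>
    simp only [exploration]
    by_cases h : ∃ l, IsFirst (act (exploration act ω n).1.1) l (exploration act ω n).2
    · obtain ⟨l, hl⟩ := h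
      rw [explore_of_isFirst hl]
      simpa [History.push] using ih
    · rw [explore, dif_neg h]; omega

/-- With probability at least `e⁻²` the next jump takes at least the time `1 / m`, if at most `m` labels
are active. -/
theorem lintegral_exp_clock_explore_le (hact : ∀ d, (act d).Nonempty) (h : History a) {m : ℕ} (hm : 0 < m)
    (hcard : (act h.1).card ≤ m) :
    ∫⁻ ρ, ENNReal.ofReal (Real.exp (-(explore act (h, ρ)).1.clock)) ∂(walkMeasure a) ≤
      ENNReal.ofReal (Real.exp (-(Real.exp (-2) / (2 * m)))) * ENNReal.ofReal (Real.exp (-h.clock)) := by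
  set u : ℝ := 1 / m with hu
  have hm' : (1 : ℝ) ≤ m := by exact_mod_cast hm
  have hu0 : 0 < u := by positivity
  have hu1 : u ≤ 1 := by rw [hu, div_le_one (by linarith)]; exact hm'
  set E : Set (Sample a) := {ρ | ∀ k ∈ act h.1, u < (ρ (k, 0)).1} with hE
  have hEm : MeasurableSet E := by
    simp only [hE, Set.ofPred_forall]
    exact Finset.measurableSet_biInter _ fun k _ => measurableSet_lt measurable_const (by fun_prop)
  have hPE : walkMeasure a E = ENNReal.ofReal (Real.exp (-(2 * u * (act h.1).card))) := by
    have := congrArg (fun m => m Set.univ) (map_lower (act h.1) hu0.le)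
    have hlow : Measurable (lower (a := a) (act h.1) u) := (measurable_lower _).comp measurable_prodMk_left
    rw [Measure.map_apply hlow .univ] at this
    simp only [Set.preimage_univ, Measure.restrict_apply MeasurableSet.univ, Set.univ_inter, Measure.smul_apply,
      measure_univ, smul_eq_mul, mul_one] at this
    rw [this, ← ENNReal.ofReal_pow (Real.exp_pos _).le, ← Real.exp_nat_mul]
    congr 2; ring
  have hPE' : ENNReal.ofReal (Real.exp (-2)) ≤ walkMeasure a E := by
    rw [hPE]
    apply ENNReal.ofReal_le_ofReal
    rw [Real.exp_le_exp]
    have : u * (act h.1).card ≤ 1 := by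
      rw [hu, one_div, inv_mul_le_iff₀ (by linarith), mul_one]
      exact_mod_cast hcard
    linarith
  have hpt : ∀ᵐ ρ ∂(walkMeasure a), ENNReal.ofReal (Real.exp (-(explore act (h, ρ)).1.clock)) ≤
      ENNReal.ofReal (Real.exp (-h.clock)) * (E.indicator (fun _ => ENNReal.ofReal (Real.exp (-u))) ρ + Eᶜ.indicator 1 ρ) := by
    filter_upwards [ae_goodSample (a := a)] with ρ hρ
    obtain ⟨l, hl⟩ := hρ.exists_isFirst (hact h.1)
    rw [explore_of_isFirst (p := (h, ρ)) hl, clock_push, neg_add, Real.exp_add, ENNReal.ofReal_mul (Real.exp_pos _).le]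
    refine mul_le_mul_right ?_ _
    by_cases hρE : ρ ∈ E
    · rw [Set.indicator_of_mem hρE, Set.indicator_of_notMem (by simpa using hρE), add_zero]
      apply ENNReal.ofReal_le_ofReal
      rw [Real.exp_le_exp]
      have := hρE l hl.1
      simp only at this ⊢
      linarith
    · rw [Set.indicator_of_notMem hρE, Set.indicator_of_mem (by exact hρE), zero_add, Pi.one_apply, ← ENNReal.ofReal_one]
      apply ENNReal.ofReal_le_ofReal
      rw [Real.exp_le_one_iff]
      have := (hρ.seq l).pos 0
      simp only [seqOf] at this
      simp only
      linarith
  refine (lintegral_mono_ae hpt).trans ?_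
  have hi1 : Measurable (E.indicator fun _ => ENNReal.ofReal (Real.exp (-u))) := measurable_const.indicator hEm
  have hi2 : Measurable (Eᶜ.indicator (1 : Sample a → ℝ≥0∞)) := measurable_one.indicator hEm.compl
  rw [lintegral_const_mul _ (by exact hi1.add hi2), lintegral_add_left hi1, lintegral_indicator_const hEm,
    lintegral_indicator_one hEm.compl, mul_comm]
  refine mul_le_mul_left ?_ _
  -- With `q` the probability of `E`: `e^{-u} q + (1 - q) ≤ 1 - q u / 2 ≤ 1 - e^{-2} u / 2`.
  set q := (walkMeasure a E).toReal with hq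
  have hqE : walkMeasure a E = ENNReal.ofReal q := (ENNReal.ofReal_toReal (measure_ne_top _ _)).symm
  have hq1 : q ≤ 1 := ENNReal.toReal_le_of_le_ofReal zero_le_one (by simpa using prob_le_one)
  have hq0 : Real.exp (-2) ≤ q := by
    rw [hqE] at hPE'
    exact (ENNReal.ofReal_le_ofReal_iff ENNReal.toReal_nonneg).1 hPE'
  rw [prob_compl_eq_one_sub hEm, hqE, ← ENNReal.ofReal_one, ← ENNReal.ofReal_sub _ ENNReal.toReal_nonneg,
    ← ENNReal.ofReal_mul (Real.exp_pos _).le, ← ENNReal.ofReal_add (by positivity) (by linarith)]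
  apply ENNReal.ofReal_le_ofReal
  have h1 : Real.exp (-u) ≤ 1 - u / 2 := by
    have h := Real.add_one_le_exp u
    rw [Real.exp_neg, inv_le_iff_one_le_mul₀ (Real.exp_pos u)]
    nlinarith
  have h2 := Real.add_one_le_exp (-(Real.exp (-2) / (2 * m)))
  have h3 : Real.exp (-2) / (2 * m) = Real.exp (-2) * (u / 2) := by rw [hu]; field_simp
  have h4 : Real.exp (-u) * q ≤ (1 - u / 2) * q := mul_le_mul_of_nonneg_right h1 (by linarith [Real.exp_pos (-2)])
  have h5 : Real.exp (-2) * (u / 2) ≤ q * (u / 2) := mul_le_mul_of_nonneg_right hq0 (by linarith)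
  linarith

/-- If the number of active labels grows at most linearly in the number of jumps, then there are
only finitely many jumps in finite time. -/
theorem ae_exists_lt_clock (hact : ∀ d, (act d).Nonempty) {c : ℕ} (hc : 0 < c)
    (hcard : ∀ d, (act d).card ≤ c * (d.length + 1)) :
    ∀ᵐ ω ∂(walkMeasure a), ∀ B : ℝ, ∃ n, B < (exploration act ω n).1.clock := by
  set e : ℝ := Real.exp (-2) / (2 * c) with he
  have he0 : 0 < e := by positivity
  -- The divergence of the harmonic series makes `E exp (-clock)` tend to `0`.
  have hbound : ∀ n, ∫⁻ ω, ENNReal.ofReal (Real.exp (-(exploration act ω n).1.clock)) ∂(walkMeasure a) ≤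
      ENNReal.ofReal (Real.exp (-(e * ∑ i ∈ Finset.range n, 1 / ((i : ℝ) + 1)))) := by
    intro n
    induction n with
    | zero => simp [exploration, History.clock]
    | succ n ih =>
      have hf : Measurable fun q : History a × Sample a => ENNReal.ofReal (Real.exp (-q.1.clock)) := by
        have := measurable_clock (a := a); fun_prop
      have h1 := lintegral_exploration hact n (f := fun q => ENNReal.ofReal (Real.exp (-(explore act q).1.clock)))
        (hf.comp measurable_explore)
      simp only [exploration]
      rw [h1]
      calc _ ≤ ∫⁻ ω, ENNReal.ofReal (Real.exp (-(e * (1 / ((n : ℝ) + 1))))) *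
            ENNReal.ofReal (Real.exp (-(exploration act ω n).1.clock)) ∂(walkMeasure a) := by
            refine lintegral_mono fun ω => ?_
            have hlen := length_exploration_le (act := act) ω n
            refine (lintegral_exp_clock_explore_le hact (exploration act ω n).1 (m := c * (n + 1)) (by positivity)
              ((hcard _).trans (Nat.mul_le_mul_left _ (by omega)))).trans (le_of_eq ?_)
            congr 4
            rw [he]; push_cast; field_simp
        _ ≤ _ := by
            rw [lintegral_const_mul _ (by exact hf.comp (measurable_exploration n))]
            refine (mul_le_mul_right ih _).trans (le_of_eq ?_)
            rw [← ENNReal.ofReal_mul (Real.exp_pos _).le, ← Real.exp_add, Finset.sum_range_succ]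
            congr 2; ring
  have hlim : Tendsto (fun n : ℕ => ENNReal.ofReal (Real.exp (-(e * ∑ i ∈ Finset.range n, 1 / ((i : ℝ) + 1))))) atTop (𝓝 0) := by
    rw [← ENNReal.ofReal_zero]
    refine ENNReal.tendsto_ofReal (Real.tendsto_exp_neg_atTop_nhds_zero.comp ?_)
    refine Tendsto.const_mul_atTop he0 ?_
    exact Real.tendsto_sum_range_one_div_nat_succ_atTop
  have hB : ∀ B : ℕ, walkMeasure a {ω | ∀ n, (exploration act ω n).1.clock ≤ B} = 0 := by
    intro B
    have hle : ∀ n, walkMeasure a {ω | ∀ n, (exploration act ω n).1.clock ≤ B} ≤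
        ENNReal.ofReal (Real.exp B) * ENNReal.ofReal (Real.exp (-(e * ∑ i ∈ Finset.range n, 1 / ((i : ℝ) + 1)))) := by
      intro n
      refine le_trans ?_ (mul_le_mul_right (hbound n) _)
      have hf : Measurable fun ω : Sample a => ENNReal.ofReal (Real.exp (-(exploration act ω n).1.clock)) := by
        have := measurable_clock.comp (measurable_exploration (act := act) n).fst; fun_prop
      rw [← lintegral_const_mul _ hf]
      have hms : MeasurableSet {ω : Sample a | (exploration act ω n).1.clock ≤ B} :=
        measurableSet_le (measurable_clock.comp (measurable_exploration n).fst) measurable_const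
      have hsub : {ω : Sample a | ∀ n, (exploration act ω n).1.clock ≤ B} ⊆ {ω : Sample a | (exploration act ω n).1.clock ≤ B} :=
        fun ω hω => hω n
      refine (measure_mono hsub).trans ?_
      rw [← lintegral_indicator_one hms]
      refine lintegral_mono fun ω => ?_
      by_cases hω : (exploration act ω n).1.clock ≤ B
      · rw [Set.indicator_of_mem (by exact hω), Pi.one_apply, ← ENNReal.ofReal_mul (Real.exp_pos _).le, ← Real.exp_add,
          ← ENNReal.ofReal_one]
        apply ENNReal.ofReal_le_ofReal
        rw [Real.one_le_exp_iff]; linarith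
      · rw [Set.indicator_of_notMem (by exact hω)]; exact zero_le
    have := ge_of_tendsto' (ENNReal.Tendsto.const_mul hlim (Or.inr (ENNReal.ofReal_ne_top (r := Real.exp B)))) hle
    simpa using this
  have hall : ∀ᵐ ω ∂(walkMeasure a), ∀ B : ℕ, ¬ ∀ n, (exploration act ω n).1.clock ≤ B := by
    rw [ae_all_iff]
    intro B
    rw [ae_iff]
    simpa using hB B
  filter_upwards [hall] with ω hω B
  obtain ⟨N, hN⟩ := exists_nat_ge B
  have := hω N
  push Not at this
  obtain ⟨n, hn⟩ := this
  exact ⟨n, hN.trans_lt hn⟩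


/-! ### The states of the labelled process along an exploration -/

/-- The state after a jump `x` of a walk: nothing happens if the particle is not live. -/
def State.jump (M : ℕ) (s : State a) (x : Label a × ℤ) : State a :=
  if x.1 ∈ s.live ∧ x.2 ≠ 0 then
    (Config.update M { s with time := 0, birth := fun _ => 0, start := fun _ => 0 } x.1 (s.pos x.1 + x.2) 0).toState
  else s

/-- The state after given jumps of the walks. -/
def stateAfter (M : ℕ) (w : State a) : Jumps a → State a
  | [] => w
  | x :: d => (stateAfter M w d).jump M x

/-- The labels activated so far, including those of the particles that have been killed. -/
def activeLabels (M : ℕ) (w : State a) (d : Jumps a) : Finset (Label a) :=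
  w.live ∪ (Finset.Ioc w.front (stateAfter M w d).front ×ˢ (Finset.univ : Finset (Fin (a - 1)))).image
    fun p => mkLabel p.1 p.2

theorem mem_activeLabels {M : ℕ} {w : State a} {d : Jumps a} {l : Label a} :
    l ∈ activeLabels M w d ↔ l ∈ w.live ∨ (w.front < l.site ∧ l.site ≤ (stateAfter M w d).front) := by
  simp only [activeLabels, Finset.mem_union, Finset.mem_image, Finset.mem_product, Finset.mem_Ioc, Finset.mem_univ,
    and_true]
  refine or_congr_right ⟨?_, fun h => ⟨((ofLex l).1, (ofLex l).2), h, rfl⟩⟩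
  rintro ⟨p, hp, rfl⟩
  exact hp

theorem update_toState (M : ℕ) (c : Config a) (l : Label a) (y : ℤ) (τ : ℝ≥0) :
    (c.update M l y τ).toState =
      (Config.update M { c.toState with time := 0, birth := fun _ => 0, start := fun _ => 0 } l y 0).toState := by
  unfold Config.update
  split_ifs <;> rfl

theorem State.jump_of_lt {M : ℕ} {s : State a} {x : Label a × ℤ} (hx : x.1 ∈ s.live ∧ x.2 ≠ 0)
    (h : s.front < s.pos x.1 + x.2) :
    s.jump M x = { front := s.front + 1
                   live := s.live ∪ Finset.univ.image (mkLabel (s.front + 1))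
                   pos := fun l' => if l' = x.1 ∨ l'.site = s.front + 1 then s.front + 1 else s.pos l' } := by
  unfold State.jump
  rw [if_pos hx, Config.update, if_pos h]

theorem State.jump_of_le {M : ℕ} {s : State a} {x : Label a × ℤ} (hx : x.1 ∈ s.live ∧ x.2 ≠ 0)
    (h : s.pos x.1 + x.2 ≤ s.front) :
    s.jump M x = { front := s.front
                   live :=
                     if s.count (s.pos x.1 + x.2) = M then
                       s.live.filter fun l' =>
                         ¬ ((l' = x.1 ∨ s.pos l' = s.pos x.1 + x.2) ∧
                           ∀ l'' ∈ s.live, l'' = x.1 ∨ s.pos l'' = s.pos x.1 + x.2 → l' ≤ l'')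
                     else s.live
                   pos := fun l' => if l' = x.1 then s.pos x.1 + x.2 else s.pos l' } := by
  unfold State.jump
  rw [if_pos hx, Config.update, if_neg (not_lt.2 h)]

theorem State.jump_front (M : ℕ) (s : State a) (x : Label a × ℤ) :
    (s.jump M x).front = s.front ∨
      ((s.jump M x).front = s.front + 1 ∧ (x.1 ∈ s.live ∧ x.2 ≠ 0) ∧ s.front < s.pos x.1 + x.2) := by
  by_cases hx : x.1 ∈ s.live ∧ x.2 ≠ 0
  · rcases lt_or_ge s.front (s.pos x.1 + x.2) with h | h
    · right; rw [State.jump_of_lt hx h]; exact ⟨rfl, hx, h⟩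
    · left; rw [State.jump_of_le hx h]
  · left; rw [State.jump, if_neg hx]

theorem front_stateAfter_mono (M : ℕ) (w : State a) (x : Label a × ℤ) (d : Jumps a) :
    (stateAfter M w d).front ≤ (stateAfter M w (x :: d)).front := by
  simp only [stateAfter]
  rcases (stateAfter M w d).jump_front M x with h | ⟨h, _⟩ <;> omega

theorem front_le_stateAfter (M : ℕ) (w : State a) (d : Jumps a) : w.front ≤ (stateAfter M w d).front := by
  induction d with
  | nil => exact le_rfl
  | cons x d ih => exact ih.trans (front_stateAfter_mono M w x d)

/-- The properties of the states that can be reached from `w`. A label that has been activated and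
is no longer live has at least `M` activated labels above it, so that the labels in `auxLabels`
are live. -/
structure Sound (M : ℕ) (w s : State a) : Prop where
  count_le : ∀ y, s.count y ≤ M
  pos_le : ∀ l ∈ s.live, s.pos l ≤ s.front
  site_le : ∀ l ∈ s.live, l.site ≤ s.front
  active : ∀ l ∈ s.live, l ∈ w.live ∨ w.front < l.site
  front_le : w.front ≤ s.front
  killed : ∀ l, (l ∈ w.live ∨ w.front < l.site) → l.site ≤ s.front → l ∉ s.live →
    (M : ℕ∞) ≤ {l' : Label a | l < l' ∧ l'.site ≤ s.front}.encard

theorem sound_self {M : ℕ} {w : State a} (hw : w.Admissible M) : Sound M w w where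
  count_le := hw.2.2
  pos_le l hl := (hw.1 l hl).2
  site_le l hl := (hw.1 l hl).1
  active l hl := Or.inl hl
  front_le := le_rfl
  killed l h1 h2 h3 := by
    rcases h1 with h | h
    · exact absurd h h3
    · exact absurd h2 (not_le.2 h)

/-- Soundness is preserved: the killed particle has the smallest label among `M + 1` live ones. -/
theorem Sound.jump {M : ℕ} (ha : 2 ≤ a) (haM : a ≤ M) {w s : State a} (h : Sound M w s) (x : Label a × ℤ) :
    Sound M w (s.jump M x) := by
  classical
  by_cases hx : x.1 ∈ s.live ∧ x.2 ≠ 0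
  swap
  · rwa [State.jump, if_neg hx]
  rcases lt_or_ge s.front (s.pos x.1 + x.2) with hlt | hle
  · rw [State.jump_of_lt hx hlt]
    refine ⟨?_, ?_, ?_, ?_, ?_, ?_⟩
    · intro y
      simp only [State.count]
      by_cases hy : y = s.front + 1
      -- Only the jumping particle and the `a - 1` new ones are at the new site, and `a ≤ M`.
      · refine (Finset.card_le_card (t := insert x.1 (Finset.univ.image (mkLabel (s.front + 1)))) ?_).trans ?_
        · intro l hl
          simp only [Finset.mem_filter, Finset.mem_union, Finset.mem_image, Finset.mem_univ, true_and] at hl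
          simp only [Finset.mem_insert, Finset.mem_image, Finset.mem_univ, true_and]
          by_cases hl1 : l = x.1
          · exact Or.inl hl1
          rcases hl.1 with h1 | h1
          · exfalso
            have h2 := hl.2
            have h3 := h.site_le l h1
            have h4 := h.pos_le l h1
            have h5 : ¬ (l = x.1 ∨ l.site = s.front + 1) := by
              rintro (h | h)
              · exact hl1 h
              · omega
            rw [if_neg h5] at h2
            omega
          · exact Or.inr h1
        · refine (Finset.card_insert_le _ _).trans ?_
          have := Finset.card_image_le (s := (Finset.univ : Finset (Fin (a - 1)))) (f := mkLabel (s.front + 1))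
          rw [Finset.card_univ, Fintype.card_fin] at this
          omega
      · refine (Finset.card_le_card ?_).trans (h.count_le y)
        intro l hl
        simp only [Finset.mem_filter, Finset.mem_union, Finset.mem_image, Finset.mem_univ, true_and] at hl ⊢
        obtain ⟨h1, h2⟩ := hl
        split_ifs at h2 with hc
        · exact absurd h2.symm hy
        · push Not at hc
          rcases h1 with h1 | ⟨i, rfl⟩
          · exact ⟨h1, h2⟩
          · exact absurd rfl hc.2
    · intro l hl
      simp only [Finset.mem_union, Finset.mem_image, Finset.mem_univ, true_and] at hl
      simp only
      split_ifs with hc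
      · exact le_rfl
      · rcases hl with h1 | ⟨i, rfl⟩
        · have := h.pos_le l h1; omega
        · exact absurd (Or.inr rfl) hc
    · intro l hl
      simp only [Finset.mem_union, Finset.mem_image, Finset.mem_univ, true_and] at hl
      simp only
      rcases hl with h1 | ⟨i, rfl⟩
      · have := h.site_le l h1; omega
      · exact le_rfl
    · intro l hl
      simp only [Finset.mem_union, Finset.mem_image, Finset.mem_univ, true_and] at hl
      rcases hl with h1 | ⟨i, rfl⟩
      · exact h.active l h1
      · right
        have := h.front_le
        change w.front < s.front + 1
        omega
    · have := h.front_le; simp only; omega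
    · intro l h1 h2 h3
      simp only [Finset.mem_union, Finset.mem_image, Finset.mem_univ, true_and, not_or] at h3
      simp only at h2 ⊢
      rcases lt_or_eq_of_le h2 with h4 | h4
      · refine (h.killed l h1 (by omega) h3.1).trans (Set.encard_le_encard ?_)
        intro l' hl'
        simp only [Set.mem_ofPred_eq] at hl' ⊢
        exact ⟨hl'.1, by omega⟩
      · exfalso
        refine h3.2 ⟨(ofLex l).2, ?_⟩
        rw [← h4]; rfl
  · rw [State.jump_of_le hx hle]
    set y := s.pos x.1 + x.2 with hy
    -- `B` consists of the particles at the target site, with the jumping one. If the site was full, then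
    -- the smallest label of `B` is killed, and the other `M` ones are above it.
    set B := s.live.filter fun l' => l' = x.1 ∨ s.pos l' = y with hB
    have hBcard : B.card = s.count y + 1 := by
      have : B = insert x.1 (s.live.filter fun l' => s.pos l' = y) := by
        ext l
        simp only [hB, Finset.mem_filter, Finset.mem_insert]
        constructor
        · rintro ⟨h1, h2 | h2⟩
          · exact Or.inl h2
          · exact Or.inr ⟨h1, h2⟩
        · rintro (rfl | ⟨h1, h2⟩)
          · exact ⟨hx.1, Or.inl rfl⟩
          · exact ⟨h1, Or.inr h2⟩
      rw [this, Finset.card_insert_of_notMem, State.count]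
      simp only [Finset.mem_filter, not_and]
      intro _
      have := hx.2
      omega
    have hBne : B.Nonempty := ⟨x.1, by simp [hB, hx.1]⟩
    set lmin := B.min' hBne with hlmin
    have hminB : lmin ∈ B := B.min'_mem hBne
    have hkill : ∀ l' ∈ s.live, ((l' = x.1 ∨ s.pos l' = y) ∧
        ∀ l'' ∈ s.live, l'' = x.1 ∨ s.pos l'' = y → l' ≤ l'') ↔ l' = lmin := by
      intro l' hl'
      constructor
      · rintro ⟨h1, h2⟩
        refine le_antisymm ?_ (B.min'_le _ (by simp only [hB, Finset.mem_filter]; exact ⟨hl', h1⟩))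
        have := Finset.mem_filter.1 hminB
        exact h2 _ this.1 this.2
      · rintro rfl
        have := Finset.mem_filter.1 hminB
        exact ⟨this.2, fun l'' h1 h2 => B.min'_le _ (by simp only [hB, Finset.mem_filter]; exact ⟨h1, h2⟩)⟩
    have hlive : (if s.count y = M then s.live.filter fun l' => ¬ ((l' = x.1 ∨ s.pos l' = y) ∧
        ∀ l'' ∈ s.live, l'' = x.1 ∨ s.pos l'' = y → l' ≤ l'') else s.live) =
        if s.count y = M then s.live.erase lmin else s.live := by
      split_ifs
      · ext l'
        simp only [Finset.mem_filter, Finset.mem_erase]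
        constructor
        · rintro ⟨h1, h2⟩; exact ⟨fun h => h2 ((hkill l' h1).2 h), h1⟩
        · rintro ⟨h1, h2⟩; exact ⟨h2, fun h => h1 ((hkill l' h2).1 h)⟩
      · rfl
    rw [hlive]
    have hsub : (if s.count y = M then s.live.erase lmin else s.live) ⊆ s.live := by
      split_ifs
      · exact Finset.erase_subset _ _
      · exact Finset.Subset.refl _
    refine ⟨?_, ?_, ?_, ?_, h.front_le, ?_⟩
    · intro y'
      rw [State.count]
      by_cases hy' : y' = y
      · subst hy'
        by_cases hc : s.count y = M
        · rw [if_pos hc]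
          refine (Finset.card_le_card (t := B.erase lmin) ?_).trans ?_
          · intro l hl
            simp only [Finset.mem_filter, Finset.mem_erase, hB] at hl ⊢
            refine ⟨hl.1.1, hl.1.2, ?_⟩
            have := hl.2
            split_ifs at this with h1
            · exact Or.inl h1
            · exact Or.inr this
          · rw [Finset.card_erase_of_mem hminB, hBcard, hc]; omega
        · rw [if_neg hc]
          refine (Finset.card_le_card (t := B) ?_).trans ?_
          · intro l hl
            simp only [Finset.mem_filter, hB] at hl ⊢
            refine ⟨hl.1, ?_⟩
            have := hl.2
            split_ifs at this with h1
            · exact Or.inl h1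
            · exact Or.inr this
          · rw [hBcard]
            have := h.count_le y
            omega
      · refine (Finset.card_le_card ?_).trans (h.count_le y')
        intro l hl
        simp only [Finset.mem_filter] at hl ⊢
        obtain ⟨h1, h2⟩ := hl
        split_ifs at h2 with hc
        · exact absurd h2.symm hy'
        · exact ⟨hsub h1, h2⟩
    · intro l hl
      simp only
      split_ifs
      · exact hle
      · exact h.pos_le l (hsub hl)
    · exact fun l hl => h.site_le l (hsub hl)
    · exact fun l hl => h.active l (hsub hl)
    · intro l h1 h2 h3
      simp only at h2 h3 ⊢
      by_cases hl : l ∈ s.live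
      · have hc : s.count y = M := by
          by_contra hc
          rw [if_neg hc] at h3
          exact h3 hl
        rw [if_pos hc, Finset.mem_erase, not_and] at h3
        have hlm : l = lmin := by
          by_contra hne
          exact h3 hne hl
        have hsub2 : ((B.erase lmin : Finset (Label a)) : Set (Label a)) ⊆ {l' : Label a | l < l' ∧ l'.site ≤ s.front} := by
          intro l' hl'
          rw [Finset.mem_coe, Finset.mem_erase] at hl'
          refine ⟨?_, h.site_le l' (Finset.mem_filter.1 hl'.2).1⟩
          rw [hlm]
          exact lt_of_le_of_ne (B.min'_le _ hl'.2) (Ne.symm hl'.1)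
        refine le_trans ?_ (Set.encard_le_encard hsub2)
        rw [Set.encard_coe_eq_coe_finsetCard, Finset.card_erase_of_mem hminB, hBcard, hc]
        simp
      · exact h.killed l h1 h2 hl

theorem sound_stateAfter {M : ℕ} (ha : 2 ≤ a) (haM : a ≤ M) {w : State a} (hw : w.Admissible M) (d : Jumps a) :
    Sound M w (stateAfter M w d) := by
  induction d with
  | nil => exact sound_self hw
  | cons x d ih => exact ih.jump ha haM x

/-- Each jump activates at most `a - 1` labels. -/
theorem card_activeLabels_le (M : ℕ) (w : State a) (d : Jumps a) :
    (activeLabels M w d).card ≤ (w.live.card + a) * (d.length + 1) := by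
  have h1 : (stateAfter M w d).front ≤ w.front + d.length := by
    induction d with
    | nil => simp [stateAfter]
    | cons x d ih =>
      simp only [stateAfter, List.length_cons]
      push_cast
      rcases (stateAfter M w d).jump_front M x with h | ⟨h, _⟩ <;> omega
  have h2 : (activeLabels M w d).card ≤ w.live.card + d.length * a := by
    refine (Finset.card_union_le _ _).trans (Nat.add_le_add_left ?_ _)
    refine Finset.card_image_le.trans ?_
    rw [Finset.card_product, Finset.card_univ, Fintype.card_fin, Int.card_Ioc]
    exact Nat.mul_le_mul (by omega) (by omega)
  nlinarith

/-- The configuration of the labelled process after the jumps of a history. -/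
def configAfter (M : ℕ) (w : State a) (T : ℕ → ℝ) : Jumps a → Config a
  | [] => { w with time := 0, birth := fun _ => 0, start := w.pos }
  | x :: d =>
    let c := configAfter M w T d
    if x.1 ∈ c.live ∧ x.2 ≠ 0 then
      c.update M x.1 (c.pos x.1 + x.2) (History.clock (x :: d, T)).toNNReal
    else c

theorem configAfter_congr (M : ℕ) (w : State a) (d : Jumps a) {T T' : ℕ → ℝ} (h : ∀ i < d.length, T i = T' i) :
    configAfter M w T d = configAfter M w T' d := by
  induction d with
  | nil => rfl
  | cons x d ih =>
    simp only [configAfter]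
    rw [ih (fun i hi => h i (by simp; omega))]
    have : History.clock (x :: d, T) = History.clock (x :: d, T') :=
      Finset.sum_congr rfl fun i hi => h i (Finset.mem_range.1 hi)
    rw [this]

theorem configAfter_toState (M : ℕ) (w : State a) (T : ℕ → ℝ) (d : Jumps a) :
    (configAfter M w T d).toState = stateAfter M w d := by
  induction d with
  | nil => rfl
  | cons x d ih =>
    simp only [configAfter, stateAfter]
    rw [← ih]
    unfold State.jump
    split_ifs with h
    · rw [update_toState]
    · rfl

theorem configAfter_push (M : ℕ) (w : State a) (h : History a) (l : Label a) (x : ℝ × ℤ) :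
    configAfter M w (h.push l x).2 (h.push l x).1 =
      if l ∈ (configAfter M w h.2 h.1).live ∧ x.2 ≠ 0 then
        (configAfter M w h.2 h.1).update M l ((configAfter M w h.2 h.1).pos l + x.2) (h.push l x).clock.toNNReal
      else configAfter M w h.2 h.1 := by
  have e : configAfter M w (Function.update h.2 h.1.length x.1) h.1 = configAfter M w h.2 h.1 :=
    configAfter_congr M w _ fun i hi => Function.update_of_ne (by omega) _ _
  simp only [History.push, configAfter]
  rw [e]


/-! ### The labelled process and the exploration -/

/-- Until the first jump of the walks with labels in `L`, each of them stays where it started. -/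
theorem path_first {L : Finset (Label a)} {l : Label a} {ρ : Sample a} (hρ : GoodSample ρ) (h : IsFirst L l ρ)
    {k : Label a} (hk : k ∈ L) {s : ℝ≥0} (hs : (s : ℝ) ≤ (ρ (l, 0)).1) (hks : k ≠ l ∨ (s : ℝ) < (ρ (l, 0)).1) :
    path (seqOf ρ k) s = 0 := by
  refine (hρ.seq k).path_eq_zero ?_
  by_cases hkl : k = l
  · subst hkl
    exact hks.resolve_left (by simp)
  · exact hs.trans_lt (h.2 k hk hkl)

theorem path_first_self {l : Label a} {ρ : Sample a} (hρ : GoodSample ρ) :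
    path (seqOf ρ l) (ρ (l, 0)).1.toNNReal = (ρ (l, 0)).2 := by
  have := (hρ.seq l).path_jumpSum 1
  simpa [jumpSum_succ, stepSum_succ, seqOf] using this

/-- After the first jump of the walks with labels in `L`, these walks go on along their residuals. -/
theorem path_residual {L : Finset (Label a)} {l : Label a} {ρ : Sample a} (hρ : GoodSample ρ)
    (hρ' : GoodSample (residual L l ρ)) (h : IsFirst L l ρ) {k : Label a} (hk : k ∈ L) (u : ℝ≥0) :
    path (seqOf ρ k) ((ρ (l, 0)).1.toNNReal + u) =
      path (seqOf ρ k) (ρ (l, 0)).1.toNNReal + path (seqOf (residual L l ρ) k) u := by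
  have hpos : 0 < (ρ (l, 0)).1 := (hρ.seq l).pos 0
  by_cases hkl : k = l
  · subst hkl
    have e : seqOf (residual L k ρ) k = fun n => seqOf ρ k (n + 1) := by
      funext n; simp [seqOf, residual]
    have h1 := hρ'.seq k
    rw [e] at h1 ⊢
    rw [path_first_self hρ]
    exact (hρ.seq k).path_tail h1 u
  · have e : seqOf (residual L l ρ) k = delay (seqOf ρ k) (ρ (l, 0)).1.toNNReal := by
      funext n
      simp only [seqOf, residual, hkl, if_false, hk, true_and, delay]
      split_ifs with h0
      · rw [h0, Real.coe_toNNReal _ hpos.le]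
      · rfl
    have h1 := hρ'.seq k
    rw [e] at h1 ⊢
    rw [path_first (s := (ρ (l, 0)).1.toNNReal) hρ h hk (by rw [Real.coe_toNNReal _ hpos.le]) (Or.inl hkl), zero_add]
    exact (hρ.seq k).path_delay h1 u

/-- The first `n` jumps of the activated walks. -/
abbrev hist (M : ℕ) (w : State a) (ω : Sample a) (n : ℕ) : History a :=
  (exploration (activeLabels M w) ω n).1

/-- What remains of the walks after the first `n` jumps of activated walks. -/
abbrev rest (M : ℕ) (w : State a) (ω : Sample a) (n : ℕ) : Sample a :=
  (exploration (activeLabels M w) ω n).2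

/-- The time of the `n`-th jump of the activated walks. -/
def jumpTime (M : ℕ) (w : State a) (ω : Sample a) (n : ℕ) : ℝ≥0 := (hist M w ω n).clock.toNNReal

/-- The configuration after the first `n` jumps of the activated walks. -/
abbrev cfg (M : ℕ) (w : State a) (ω : Sample a) (n : ℕ) : Config a :=
  configAfter M w (hist M w ω n).2 (hist M w ω n).1

/-- The properties of the exploration that hold almost surely. -/
structure GoodRun (M : ℕ) (w : State a) (ω : Sample a) : Prop where
  good : GoodExploration (activeLabels M w) ω
  div : ∀ B : ℝ, ∃ n, B < (hist M w ω n).clock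

theorem activeLabels_nonempty {M : ℕ} {w : State a} (hw : w.live.Nonempty) (d : Jumps a) :
    (activeLabels M w d).Nonempty := by
  obtain ⟨l, hl⟩ := hw
  exact ⟨l, mem_activeLabels.2 (Or.inl hl)⟩

theorem ae_goodRun (M : ℕ) {w : State a} (hw : w.live.Nonempty) :
    ∀ᵐ ω ∂(walkMeasure a), GoodRun M w ω := by
  have hc : 0 < w.live.card + a := by have := hw.card_pos; omega
  filter_upwards [ae_goodExploration (activeLabels_nonempty (M := M) hw),
    ae_exists_lt_clock (activeLabels_nonempty (M := M) hw) hc (card_activeLabels_le M w)] with ω h1 h2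
  exact ⟨h1, h2⟩

variable {M : ℕ} {w : State a} {ω : Sample a}

theorem GoodRun.exists_step (h : GoodRun M w ω) (hw : w.live.Nonempty) (n : ℕ) :
    ∃ l, IsFirst (activeLabels M w (hist M w ω n).1) l (rest M w ω n) ∧
      hist M w ω (n + 1) = (hist M w ω n).push l (rest M w ω n (l, 0)) ∧
      rest M w ω (n + 1) = residual (activeLabels M w (hist M w ω n).1) l (rest M w ω n) := by
  obtain ⟨l, hl⟩ := (h.good n).exists_isFirst (activeLabels_nonempty hw (hist M w ω n).1)
  have := explore_of_isFirst (p := exploration (activeLabels M w) ω n) hl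
  exact ⟨l, hl, congrArg Prod.fst this, congrArg Prod.snd this⟩

theorem GoodRun.clock_nonneg (h : GoodRun M w ω) (hw : w.live.Nonempty) (n : ℕ) :
    0 ≤ (hist M w ω n).clock := by
  induction n with
  | zero => simp [hist, exploration, History.clock]
  | succ n ih =>
    obtain ⟨l, hl, h1, -⟩ := h.exists_step hw n
    rw [h1, clock_push]
    exact add_nonneg ih ((h.good n).seq l |>.pos 0).le

theorem GoodRun.coe_jumpTime (h : GoodRun M w ω) (hw : w.live.Nonempty) (n : ℕ) :
    (jumpTime M w ω n : ℝ) = (hist M w ω n).clock := Real.coe_toNNReal _ (h.clock_nonneg hw n)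

theorem jumpTime_zero : jumpTime M w ω 0 = 0 := by
  simp [jumpTime, hist, exploration, History.clock]

theorem GoodRun.jumpTime_succ (h : GoodRun M w ω) (hw : w.live.Nonempty) {n : ℕ} {l : Label a}
    (h1 : hist M w ω (n + 1) = (hist M w ω n).push l (rest M w ω n (l, 0))) :
    jumpTime M w ω (n + 1) = jumpTime M w ω n + (rest M w ω n (l, 0)).1.toNNReal := by
  have h2 : 0 < (rest M w ω n (l, 0)).1 := (h.good n).seq l |>.pos 0
  rw [jumpTime, h1, clock_push, Real.toNNReal_add (h.clock_nonneg hw n) h2.le, jumpTime]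

theorem GoodRun.strictMono_jumpTime (h : GoodRun M w ω) (hw : w.live.Nonempty) :
    StrictMono (jumpTime M w ω) := by
  refine strictMono_nat_of_lt_succ fun n => ?_
  obtain ⟨l, hl, h1, -⟩ := h.exists_step hw n
  have h2 : 0 < (rest M w ω n (l, 0)).1 := (h.good n).seq l |>.pos 0
  rw [h.jumpTime_succ hw h1]
  exact lt_add_of_pos_right _ (Real.toNNReal_pos.2 h2)

/-- Every time lies between two jumps. -/
theorem GoodRun.exists_between (h : GoodRun M w ω) (hw : w.live.Nonempty) (t : ℝ≥0) :
    ∃ n, jumpTime M w ω n ≤ t ∧ t < jumpTime M w ω (n + 1) := by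
  classical
  have hex : ∃ n, t < jumpTime M w ω n := by
    obtain ⟨n, hn⟩ := h.div t
    exact ⟨n, by rw [← NNReal.coe_lt_coe, h.coe_jumpTime hw]; exact hn⟩
  have h1 := Nat.find_spec hex
  have h2 : Nat.find hex ≠ 0 := by
    intro h0
    rw [h0, jumpTime_zero] at h1
    exact not_lt_bot h1
  obtain ⟨m, hm⟩ := Nat.exists_eq_succ_of_ne_zero h2
  refine ⟨m, not_lt.1 (Nat.find_min hex (by omega)), ?_⟩
  rw [hm] at h1; exact h1

theorem length_hist (h : GoodRun M w ω) (hw : w.live.Nonempty) (n : ℕ) : (hist M w ω n).1.length = n := by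
  induction n with
  | zero => rfl
  | succ n ih =>
    obtain ⟨l, hl, h1, -⟩ := h.exists_step hw n
    rw [h1]; simp [History.push, ih]

/-- How the configuration after `n` jumps describes the walks: the walk with an activated label,
seen from its age on, is what remains of it; a particle that has not been activated has not moved;
live particles rest since the last jump of a live particle. -/
structure Tracks (M : ℕ) (w : State a) (ω : Sample a) (n : ℕ) : Prop where
  time_le : (cfg M w ω n).time ≤ jumpTime M w ω n
  birth_le : ∀ l ∈ activeLabels M w (hist M w ω n).1, (cfg M w ω n).birth l ≤ jumpTime M w ω n
  path_add : ∀ l ∈ activeLabels M w (hist M w ω n).1, ∀ u,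
    path (seqOf ω l) (jumpTime M w ω n - (cfg M w ω n).birth l + u) =
      path (seqOf ω l) (jumpTime M w ω n - (cfg M w ω n).birth l) + path (seqOf (rest M w ω n) l) u
  pos_eq : ∀ l ∈ (cfg M w ω n).live, (cfg M w ω n).pos l =
    (cfg M w ω n).start l + path (seqOf ω l) (jumpTime M w ω n - (cfg M w ω n).birth l)
  still : ∀ l ∈ (cfg M w ω n).live, (cfg M w ω n).birth l ≤ (cfg M w ω n).time ∧
    ∀ t : ℝ≥0, (cfg M w ω n).time ≤ t → t ≤ jumpTime M w ω n →
      path (seqOf ω l) (t - (cfg M w ω n).birth l) = path (seqOf ω l) (jumpTime M w ω n - (cfg M w ω n).birth l)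
  untouched : ∀ l, l ∉ activeLabels M w (hist M w ω n).1 → seqOf (rest M w ω n) l = seqOf ω l
  start_eq : ∀ l ∈ activeLabels M w (hist M w ω n).1, l ∉ w.live → (cfg M w ω n).start l = l.site

theorem live_subset_activeLabels (ha : 2 ≤ a) (haM : a ≤ M) (hw : w.Admissible M) (d : Jumps a) {l : Label a}
    (hl : l ∈ (stateAfter M w d).live) : l ∈ activeLabels M w d := by
  have h := sound_stateAfter ha haM hw d
  rcases h.active l hl with h1 | h1
  · exact mem_activeLabels.2 (Or.inl h1)
  · exact mem_activeLabels.2 (Or.inr ⟨h1, h.site_le l hl⟩)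

theorem site_le_of_mem_activeLabels (hw : w.Admissible M) {d : Jumps a} {l : Label a}
    (hl : l ∈ activeLabels M w d) : l.site ≤ (stateAfter M w d).front := by
  rcases mem_activeLabels.1 hl with h1 | h1
  · exact (hw.1 l h1).1.trans (front_le_stateAfter M w d)
  · exact h1.2

theorem nonempty_of_admissible (hw : w.Admissible M) : w.live.Nonempty := by
  obtain ⟨l, hl, -⟩ := hw.2.1
  exact ⟨l, hl⟩

/-- The configuration after `n` jumps describes the labelled process. The proof is by induction; at each
jump a killed particle moves, or the front moves, or a live particle moves and the front stays. -/
theorem GoodRun.tracks (ha : 2 ≤ a) (haM : a ≤ M) (hw : w.Admissible M) (h : GoodRun M w ω) (n : ℕ) :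
    Tracks M w ω n := by
  have hne := nonempty_of_admissible hw
  induction n with
  | zero =>
    have hg : GoodSample ω := h.good 0
    have e : cfg M w ω 0 = { w with time := 0, birth := fun _ => 0, start := w.pos } := rfl
    have hact : activeLabels M w (hist M w ω 0).1 = w.live := by
      ext l
      rw [mem_activeLabels]
      change l ∈ w.live ∨ (w.front < l.site ∧ l.site ≤ w.front) ↔ _
      constructor
      · rintro (h | h)
        · exact h
        · omega
      · exact Or.inl
    have hp : ∀ l, path (seqOf ω l) 0 = 0 := fun l => (hg.seq l).path_zero
    constructor
    · rw [e]; simp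
    · intro l _; rw [e]; simp
    · intro l _ u
      rw [e, jumpTime_zero, tsub_zero, zero_add, hp, zero_add]; rfl
    · intro l _
      rw [e, jumpTime_zero, tsub_zero, hp, add_zero]
    · intro l _
      rw [e, jumpTime_zero]
      refine ⟨by simp, fun t _ ht => ?_⟩
      rw [nonpos_iff_eq_zero.1 ht]
    · intro l _; rfl
    · intro l hl hl'
      rw [hact] at hl
      exact absurd hl hl'
  | succ n ih =>
    obtain ⟨l, hl, h1, h2⟩ := h.exists_step hne n
    have hgood := h.good n
    have hgood' := h.good (n + 1)
    set x := rest M w ω n (l, 0) with hx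
    set T := jumpTime M w ω n with hT
    set τ := x.1.toNNReal with hτ
    set c := cfg M w ω n with hc
    have hT' : jumpTime M w ω (n + 1) = T + τ := h.jumpTime_succ hne h1
    have hx1 : 0 < x.1 := (hgood.seq l).pos 0
    have hx2 : x.2 = 1 ∨ x.2 = -1 := (hgood.seq l).step 0
    have hx20 : x.2 ≠ 0 := by omega
    have hcoe : (τ : ℝ) = x.1 := Real.coe_toNNReal _ hx1.le
    have hstate : c.toState = stateAfter M w (hist M w ω n).1 := configAfter_toState _ _ _ _
    have hsound := sound_stateAfter ha haM hw (hist M w ω n).1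
    rw [← hstate] at hsound
    have hlact : ∀ k ∈ c.live, k ∈ activeLabels M w (hist M w ω n).1 := fun k hk =>
      live_subset_activeLabels ha haM hw _ (by rw [← hstate]; exact hk)
    have hsite : ∀ k ∈ activeLabels M w (hist M w ω n).1, k.site ≤ c.front := fun k hk => by
      have := site_le_of_mem_activeLabels hw hk
      rwa [← hstate] at this
    have hc' : cfg M w ω (n + 1) = if l ∈ c.live ∧ x.2 ≠ 0 then c.update M l (c.pos l + x.2) (T + τ) else c := by
      rw [← hT', jumpTime, h1]
      change configAfter M w _ _ = _
      rw [h1, configAfter_push]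
    have hstate' : (cfg M w ω (n + 1)).toState = stateAfter M w (hist M w ω (n + 1)).1 := configAfter_toState _ _ _ _
    have hmem : ∀ k, k ∈ activeLabels M w (hist M w ω (n + 1)).1 ↔
        k ∈ w.live ∨ (w.front < k.site ∧ k.site ≤ (cfg M w ω (n + 1)).front) := fun k => by
      rw [mem_activeLabels, ← hstate']
    have hmem0 : ∀ k, k ∈ activeLabels M w (hist M w ω n).1 ↔
        k ∈ w.live ∨ (w.front < k.site ∧ k.site ≤ c.front) := fun k => by
      rw [mem_activeLabels, ← hstate]
    have key : ∀ k ∈ activeLabels M w (hist M w ω n).1, ∀ u, path (seqOf ω k) (T + τ - c.birth k + u) =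
        path (seqOf ω k) (T - c.birth k) + path (seqOf (rest M w ω n) k) τ + path (seqOf (rest M w ω (n + 1)) k) u := by
      intro k hk u
      rw [← tsub_add_eq_add_tsub (ih.birth_le k hk), add_assoc, ih.path_add k hk, h2,
        path_residual hgood (by rw [← h2]; exact hgood') hl hk, add_assoc]
    have key0 : ∀ k ∈ activeLabels M w (hist M w ω n).1, path (seqOf ω k) (T + τ - c.birth k) =
        path (seqOf ω k) (T - c.birth k) + path (seqOf (rest M w ω n) k) τ := by
      intro k hk
      rw [← tsub_add_eq_add_tsub (ih.birth_le k hk), ih.path_add k hk]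
    have key1 : ∀ k ∈ activeLabels M w (hist M w ω n).1, ∀ u, path (seqOf ω k) (T + τ - c.birth k + u) =
        path (seqOf ω k) (T + τ - c.birth k) + path (seqOf (rest M w ω (n + 1)) k) u := by
      intro k hk u; rw [key k hk, key0 k hk]
    have hother : ∀ k ∈ activeLabels M w (hist M w ω n).1, k ≠ l → path (seqOf (rest M w ω n) k) τ = 0 :=
      fun k hk hkl => path_first hgood hl hk (by rw [hcoe]) (Or.inl hkl)
    have hunt : ∀ k, k ∉ activeLabels M w (hist M w ω n).1 → seqOf (rest M w ω (n + 1)) k = seqOf ω k := by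
      intro k hk
      rw [← ih.untouched k hk, h2]
      have hkl : k ≠ l := fun h => hk (h ▸ hl.1)
      funext j
      simp [seqOf, residual, hkl, hk]
    have hTle : (T : ℝ≥0∞) ≤ (T + τ : ℝ≥0) := by exact_mod_cast le_self_add
    by_cases hlive : l ∈ c.live ∧ x.2 ≠ 0
    swap
    -- A killed particle jumps: the configuration does not change.
    · have hnl : l ∉ c.live := fun h => hlive ⟨h, hx20⟩
      rw [if_neg hlive] at hc'
      have hact : ∀ k, k ∈ activeLabels M w (hist M w ω (n + 1)).1 ↔ k ∈ activeLabels M w (hist M w ω n).1 := by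
        intro k; rw [hmem, hmem0, hc']
      constructor
      · rw [hc', hT']; exact ih.time_le.trans hTle
      · intro k hk; rw [hc', hT']; exact (ih.birth_le k ((hact k).1 hk)).trans le_self_add
      · intro k hk u; rw [hc', hT']; exact key1 k ((hact k).1 hk) u
      · intro k hk
        rw [hc'] at hk ⊢
        rw [hT', key0 k (hlact k hk), hother k (hlact k hk) (fun h => hnl (h ▸ hk)), add_zero]
        exact ih.pos_eq k hk
      · intro k hk
        rw [hc'] at hk ⊢
        rw [hT']
        refine ⟨(ih.still k hk).1, fun t ht1 ht2 => ?_⟩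
        have hk' := hlact k hk
        have hkl : k ≠ l := fun h => hnl (h ▸ hk)
        rw [key0 k hk', hother k hk' hkl, add_zero]
        rcases le_total t T with h3 | h3
        · exact (ih.still k hk).2 t ht1 h3
        · obtain ⟨s, rfl⟩ := exists_add_of_le h3
          rw [← tsub_add_eq_add_tsub (ih.birth_le k hk'), ih.path_add k hk',
            path_first hgood hl hk' (by rw [← hcoe]; exact_mod_cast (add_le_add_iff_left T).1 ht2) (Or.inl hkl), add_zero]
      · intro k hk; exact hunt k fun h => hk ((hact k).2 h)
      · intro k hk hk'; rw [hc']; exact ih.start_eq k ((hact k).1 hk) hk'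
    · rw [if_pos hlive] at hc'
      rcases lt_or_ge c.front (c.pos l + x.2) with hlt | hle
      -- The front moves, and new particles are born.
      · rw [Config.update, if_pos hlt] at hc'
        have hpl : c.pos l + x.2 = c.front + 1 := by
          have := hsound.pos_le l hlive.1
          omega
        have hnew : ∀ k, k.site = c.front + 1 → k ∉ activeLabels M w (hist M w ω n).1 := by
          intro k hk hk'
          have := hsite k hk'
          omega
        have hact : ∀ k, k ∈ activeLabels M w (hist M w ω (n + 1)).1 ↔
            k ∈ activeLabels M w (hist M w ω n).1 ∨ k.site = c.front + 1 := by
          intro k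
          rw [hmem, hmem0, hc']
          have := hsound.front_le
          simp only
          constructor
          · rintro (h | ⟨h, h'⟩)
            · exact Or.inl (Or.inl h)
            · rcases lt_or_eq_of_le h' with h'' | h''
              · exact Or.inl (Or.inr ⟨h, by omega⟩)
              · exact Or.inr h''
          · rintro ((h | ⟨h, h'⟩) | h)
            · exact Or.inl h
            · exact Or.inr ⟨h, by omega⟩
            · exact Or.inr ⟨by omega, by omega⟩
        have hold : ∀ k ∈ activeLabels M w (hist M w ω n).1, k.site ≠ c.front + 1 := fun k hk h => hnew k h hk
        have hlive' : ∀ k, k ∈ (cfg M w ω (n + 1)).live ↔ k ∈ c.live ∨ k.site = c.front + 1 := by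
          intro k
          rw [hc']
          simp only [Finset.mem_union, Finset.mem_image, Finset.mem_univ, true_and]
          refine or_congr_right ⟨?_, fun hk => ⟨(ofLex k).2, by rw [← hk]; rfl⟩⟩
          rintro ⟨i, rfl⟩; rfl
        have hp0 : ∀ k, path (seqOf ω k) 0 = 0 := fun k => ((h.good 0).seq k).path_zero
        have hpos' : ∀ k, (cfg M w ω (n + 1)).pos k = if k = l ∨ k.site = c.front + 1 then c.front + 1 else c.pos k := by
          intro k; rw [hc']
        have hbirth' : ∀ k, (cfg M w ω (n + 1)).birth k = if k.site = c.front + 1 then T + τ else c.birth k := by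
          intro k; rw [hc']
        have hstart' : ∀ k, (cfg M w ω (n + 1)).start k = if k.site = c.front + 1 then c.front + 1 else c.start k := by
          intro k; rw [hc']
        have htime' : (cfg M w ω (n + 1)).time = (T + τ : ℝ≥0) := by rw [hc']
        constructor
        · rw [htime', hT']
        · intro k hk
          rw [hbirth', hT']
          split_ifs with hs
          · exact le_rfl
          · exact (ih.birth_le k (((hact k).1 hk).resolve_right hs)).trans le_self_add
        · intro k hk u
          rw [hbirth', hT']
          split_ifs with hs
          · rw [tsub_self, zero_add, hp0, zero_add, hunt k (hnew k hs)]
          · exact key1 k (((hact k).1 hk).resolve_right hs) u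
        · intro k hk
          rw [hbirth', hT', hpos', hstart']
          by_cases hs : k.site = c.front + 1
          · simp only [hs, or_true, if_true, tsub_self, hp0, add_zero]
          · have hk1 := ((hlive' k).1 hk).resolve_right hs
            have hk2 := hlact k hk1
            simp only [hs, or_false, if_false]
            rw [key0 k hk2, ← add_assoc, ← ih.pos_eq k hk1]
            split_ifs with hkl
            · subst hkl
              rw [path_first_self hgood, hpl]
            · rw [hother k hk2 hkl, add_zero]
        · intro k hk
          rw [hbirth', hT', htime']
          refine ⟨?_, fun t ht1 ht2 => ?_⟩
          · split_ifs with hs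
            · exact le_rfl
            · have hk1 := ((hlive' k).1 hk).resolve_right hs
              have := ih.birth_le k (hlact k hk1)
              exact_mod_cast this.trans le_self_add
          · have : t = T + τ := le_antisymm ht2 (by exact_mod_cast ht1)
            rw [this]
        · intro k hk
          exact hunt k fun h => hk ((hact k).2 (Or.inl h))
        · intro k hk hk'
          rw [hstart']
          split_ifs with hs
          · exact hs.symm
          · exact ih.start_eq k (((hact k).1 hk).resolve_right hs) hk'
      -- The front stays.
      · rw [Config.update, if_neg (not_lt.2 hle)] at hc'
        have hact : ∀ k, k ∈ activeLabels M w (hist M w ω (n + 1)).1 ↔ k ∈ activeLabels M w (hist M w ω n).1 := by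
          intro k; rw [hmem, hmem0, hc']
        have hlive' : ∀ k, k ∈ (cfg M w ω (n + 1)).live → k ∈ c.live := by
          intro k
          rw [hc']
          simp only
          split_ifs
          · intro hk; exact (Finset.mem_filter.1 hk).1
          · exact id
        have hpos' : ∀ k, (cfg M w ω (n + 1)).pos k = if k = l then c.pos l + x.2 else c.pos k := by
          intro k; rw [hc']
        have hbirth' : ∀ k, (cfg M w ω (n + 1)).birth k = c.birth k := by
          intro k; rw [hc']
        have hstart' : ∀ k, (cfg M w ω (n + 1)).start k = c.start k := by
          intro k; rw [hc']
        have htime' : (cfg M w ω (n + 1)).time = (T + τ : ℝ≥0) := by rw [hc']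
        constructor
        · rw [htime', hT']
        · intro k hk
          rw [hbirth', hT']
          exact (ih.birth_le k ((hact k).1 hk)).trans le_self_add
        · intro k hk u
          rw [hbirth', hT']
          exact key1 k ((hact k).1 hk) u
        · intro k hk
          have hk1 := hlive' k hk
          have hk2 := hlact k hk1
          rw [hbirth', hT', hpos', hstart', key0 k hk2, ← add_assoc, ← ih.pos_eq k hk1]
          split_ifs with hkl
          · subst hkl
            rw [path_first_self hgood]
          · rw [hother k hk2 hkl, add_zero]
        · intro k hk
          rw [hbirth', hT', htime']
          refine ⟨?_, fun t ht1 ht2 => ?_⟩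
          · have := ih.birth_le k (hlact k (hlive' k hk))
            exact_mod_cast this.trans le_self_add
          · have : t = T + τ := le_antisymm ht2 (by exact_mod_cast ht1)
            rw [this]
        · intro k hk
          exact hunt k fun h => hk ((hact k).2 h)
        · intro k hk hk'
          rw [hstart']
          exact ih.start_eq k ((hact k).1 hk) hk'

theorem time_le_nextTime (Y : Walks a) (c : Config a) : c.time ≤ c.nextTime Y :=
  le_iInf₂ fun _ _ => le_iInf₂ fun _ ht => ht.1.le

theorem nextTime_le_time_next (M : ℕ) (Y : Walks a) (c : Config a) : c.nextTime Y ≤ (c.next M Y).time := by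
  unfold Config.next
  split
  · exact le_top
  · split_ifs with h
    · exact le_top
    · rename_i l _
      have e : ∀ y τ, (c.update M l y τ).time = τ := by
        intro y τ; unfold Config.update; split_ifs <;> rfl
      rw [e, ENNReal.coe_toNNReal h]

/-- Before the next jump a live particle rests, and its next move takes place at the end of its
holding time. -/
theorem GoodRun.moveTime_eq (ha : 2 ≤ a) (haM : a ≤ M) (hw : w.Admissible M) (h : GoodRun M w ω) (n : ℕ)
    {l : Label a} (hl : l ∈ (cfg M w ω n).live) :
    (cfg M w ω n).moveTime (walks ω) l = (jumpTime M w ω n + (rest M w ω n (l, 0)).1.toNNReal : ℝ≥0) := by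
  have tr := h.tracks ha haM hw n
  set c := cfg M w ω n with hc
  set T := jumpTime M w ω n with hT
  set τ := (rest M w ω n (l, 0)).1.toNNReal with hτ
  have hgood := h.good n
  have hpos : 0 < (rest M w ω n (l, 0)).1 := (hgood.seq l).pos 0
  have hcoe : (τ : ℝ) = (rest M w ω n (l, 0)).1 := Real.coe_toNNReal _ hpos.le
  have hτ0 : 0 < τ := Real.toNNReal_pos.2 hpos
  have hlact : l ∈ activeLabels M w (hist M w ω n).1 :=
    live_subset_activeLabels ha haM hw _ (by rw [← configAfter_toState M w (hist M w ω n).2]; exact hl)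
  have hb := tr.birth_le l hlact
  have htop : c.time ≠ ⊤ := ne_top_of_le_ne_top ENNReal.coe_ne_top tr.time_le
  have htn : ((c.time.toNNReal : ℝ≥0) : ℝ≥0∞) = c.time := ENNReal.coe_toNNReal htop
  have htraj : ∀ t, c.traj (walks ω) l t = path (seqOf ω l) (t - c.birth l) + c.start l := by
    intro t; simp only [Config.traj, walks_eq]; ring
  have h0 : c.traj (walks ω) l c.time.toNNReal = c.pos l := by
    rw [htraj, (tr.still l hl).2 _ htn.ge (by rw [← ENNReal.coe_le_coe, htn]; exact tr.time_le), tr.pos_eq l hl, add_comm]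
  have hafter : ∀ s, c.traj (walks ω) l (T + s) = c.pos l + path (seqOf (rest M w ω n) l) s := by
    intro s
    rw [htraj, ← tsub_add_eq_add_tsub hb, tr.path_add l hlact, tr.pos_eq l hl]; ring
  refine le_antisymm ?_ ?_
  · refine iInf₂_le (T + τ) ⟨?_, ?_⟩
    · exact tr.time_le.trans_lt (by exact_mod_cast lt_add_of_pos_right T hτ0)
    · rw [h0, hafter, path_first_self hgood]
      have := (hgood.seq l).step 0
      simp only [seqOf] at this
      omega
  · refine le_iInf₂ fun t ht => ?_
    by_contra hlt
    push Not at hlt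
    have hlt' : t < T + τ := by exact_mod_cast hlt
    apply ht.2
    rw [h0]
    rcases le_total t T with h3 | h3
    · rw [htraj, (tr.still l hl).2 t ht.1.le h3, tr.pos_eq l hl, add_comm]
    · obtain ⟨s, rfl⟩ := exists_add_of_le h3
      have hs : s < τ := (add_lt_add_iff_left T).1 hlt'
      rw [hafter, (hgood.seq l).path_eq_zero, add_zero]
      have : (s : ℝ) < τ := hs
      rw [hcoe] at this
      exact this

theorem GoodRun.jumpTime_succ_le_nextTime (ha : 2 ≤ a) (haM : a ≤ M) (hw : w.Admissible M) (h : GoodRun M w ω) (n : ℕ) :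
    (jumpTime M w ω (n + 1) : ℝ≥0∞) ≤ (cfg M w ω n).nextTime (walks ω) := by
  obtain ⟨l, hl, h1, -⟩ := h.exists_step (nonempty_of_admissible hw) n
  refine le_iInf₂ fun k hk => ?_
  rw [h.moveTime_eq ha haM hw n hk, h.jumpTime_succ (nonempty_of_admissible hw) h1]
  have hk' : k ∈ activeLabels M w (hist M w ω n).1 :=
    live_subset_activeLabels ha haM hw _ (by rw [← configAfter_toState M w (hist M w ω n).2]; exact hk)
  have : (rest M w ω n (l, 0)).1.toNNReal ≤ (rest M w ω n (k, 0)).1.toNNReal := by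
    refine Real.toNNReal_le_toNNReal ?_
    by_cases hkl : k = l
    · rw [hkl]
    · exact (hl.2 k hk' hkl).le
  exact_mod_cast add_le_add_right this _

/-- A jump of a live particle is one step of the labelled process. -/
theorem GoodRun.next_cfg (ha : 2 ≤ a) (haM : a ≤ M) (hw : w.Admissible M) (h : GoodRun M w ω) (n : ℕ) {l : Label a}
    (hl : IsFirst (activeLabels M w (hist M w ω n).1) l (rest M w ω n))
    (h1 : hist M w ω (n + 1) = (hist M w ω n).push l (rest M w ω n (l, 0)))
    (hlive : l ∈ (cfg M w ω n).live) :
    (cfg M w ω n).next M (walks ω) = cfg M w ω (n + 1) := by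
  classical
  have hne := nonempty_of_admissible hw
  have tr := h.tracks ha haM hw n
  set c := cfg M w ω n with hc
  have hgood := h.good n
  have hlact : ∀ k ∈ c.live, k ∈ activeLabels M w (hist M w ω n).1 := fun k hk =>
    live_subset_activeLabels ha haM hw _ (by rw [← configAfter_toState M w (hist M w ω n).2]; exact hk)
  have hnext : c.nextTime (walks ω) = (jumpTime M w ω (n + 1) : ℝ≥0) := by
    refine le_antisymm ?_ (h.jumpTime_succ_le_nextTime ha haM hw n)
    refine (iInf₂_le l hlive).trans (le_of_eq ?_)
    rw [h.moveTime_eq ha haM hw n hlive, h.jumpTime_succ hne h1]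
  have hfilter : (c.live.filter fun k => c.moveTime (walks ω) k = c.nextTime (walks ω)) = {l} := by
    ext k
    rw [Finset.mem_filter, Finset.mem_singleton]
    constructor
    · rintro ⟨hk, hk2⟩
      by_contra hkl
      rw [hnext, h.moveTime_eq ha haM hw n hk, h.jumpTime_succ hne h1, ENNReal.coe_inj, add_right_inj] at hk2
      have := hl.2 k (hlact k hk) hkl
      have h3 : 0 < (rest M w ω n (k, 0)).1 := (hgood.seq k).pos 0
      have h4 := (Real.toNNReal_lt_toNNReal_iff h3).2 this
      exact absurd hk2 h4.ne'
    · rintro rfl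
      exact ⟨hlive, by rw [h.moveTime_eq ha haM hw n hlive, hnext, h.jumpTime_succ hne h1]⟩
  have hstep : (rest M w ω n (l, 0)).2 ≠ 0 := by
    intro h0
    rcases (hgood.seq l).step 0 with h2 | h2 <;> exact absurd (h0.symm.trans h2) (by norm_num)
  have htraj : c.traj (walks ω) l (jumpTime M w ω (n + 1)) = c.pos l + (rest M w ω n (l, 0)).2 := by
    rw [h.jumpTime_succ hne h1]
    have : c.traj (walks ω) l (jumpTime M w ω n + (rest M w ω n (l, 0)).1.toNNReal) =
        path (seqOf ω l) (jumpTime M w ω n + (rest M w ω n (l, 0)).1.toNNReal - c.birth l) + c.start l := by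
      simp only [Config.traj, walks_eq]; ring
    rw [this, ← tsub_add_eq_add_tsub (tr.birth_le l (hlact l hlive)), tr.path_add l (hlact l hlive), tr.pos_eq l hlive,
      path_first_self hgood]; ring
  have hc' : cfg M w ω (n + 1) = c.update M l (c.pos l + (rest M w ω n (l, 0)).2) (jumpTime M w ω (n + 1)) := by
    rw [jumpTime, h1]
    change configAfter M w _ _ = _
    rw [h1, configAfter_push, if_pos ⟨hlive, hstep⟩]
  rw [hc', ← htraj]
  unfold Config.next
  rw [hnext] at hfilter ⊢
  have hmin : (c.live.filter fun k => c.moveTime (walks ω) k = (jumpTime M w ω (n + 1) : ℝ≥0)).min = ((l : Label a) : WithTop (Label a)) := by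
    rw [hfilter, Finset.min_singleton]
  split
  · rename_i heq
    have := heq.symm.trans (Eq.trans (by congr!) hmin)
    exact (WithTop.coe_ne_top this.symm).elim
  · rename_i l' heq
    have := heq.symm.trans (Eq.trans (by congr!) hmin)
    have hll : l' = l := WithTop.coe_injective this
    rw [if_neg ENNReal.coe_ne_top, ENNReal.toNNReal_coe, hll]

/-- Jumps of killed particles leave the labelled process unchanged, so that it takes the values
`config` one after the other. -/
theorem GoodRun.exists_config_eq (ha : 2 ≤ a) (haM : a ≤ M) (hw : w.Admissible M) (h : GoodRun M w ω) (n : ℕ) :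
    ∃ m, config M (walks ω) w m = cfg M w ω n := by
  induction n with
  | zero => exact ⟨0, rfl⟩
  | succ n ih =>
    obtain ⟨m, hm⟩ := ih
    obtain ⟨l, hl, h1, -⟩ := h.exists_step (nonempty_of_admissible hw) n
    by_cases hlive : l ∈ (cfg M w ω n).live
    · exact ⟨m + 1, by rw [config, hm, h.next_cfg ha haM hw n hl h1 hlive]⟩
    · refine ⟨m, hm.trans ?_⟩
      change _ = configAfter M w _ _
      rw [h1, configAfter_push, if_neg (fun h => hlive h.1)]

/-- Between two jumps of activated walks the configuration is the one after the first of them. -/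
theorem GoodRun.configAt_eq (ha : 2 ≤ a) (haM : a ≤ M) (hw : w.Admissible M) (h : GoodRun M w ω) {n : ℕ} {t : ℝ≥0}
    (h1 : jumpTime M w ω n ≤ t) (h2 : t < jumpTime M w ω (n + 1)) :
    configAt M (walks ω) w t = cfg M w ω n := by
  obtain ⟨m, hm⟩ := h.exists_config_eq ha haM hw n
  have tr := h.tracks ha haM hw n
  have hmono : Monotone fun k => (config M (walks ω) w k).time := by
    refine monotone_nat_of_le_succ fun k => ?_
    exact (time_le_nextTime _ _).trans (nextTime_le_time_next M _ _)
  have hset : {k : ℕ | (config M (walks ω) w k).time ≤ t} = Set.Iic m := by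
    ext k
    simp only [Set.mem_ofPred_eq, Set.mem_Iic]
    constructor
    · intro hk
      by_contra hlt
      push Not at hlt
      have h3 := (hmono (Nat.succ_le_of_lt hlt)).trans hk
      have h4 : (config M (walks ω) w (m + 1)).time = ((cfg M w ω n).next M (walks ω)).time := by rw [config, hm]
      simp only [Nat.succ_eq_add_one] at h3
      rw [h4] at h3
      have h5 := (h.jumpTime_succ_le_nextTime ha haM hw n).trans ((nextTime_le_time_next M _ _).trans h3)
      exact absurd h2 (not_lt.2 (by exact_mod_cast h5))
    · intro hk
      refine (hmono hk).trans ?_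
      simp only
      rw [hm]
      exact tr.time_le.trans (by exact_mod_cast h1)
  rw [configAt, hset, csSup_Iic, hm]

theorem GoodRun.front_eq (ha : 2 ≤ a) (haM : a ≤ M) (hw : w.Admissible M) (h : GoodRun M w ω) {n : ℕ} {t : ℝ≥0}
    (h1 : jumpTime M w ω n ≤ t) (h2 : t < jumpTime M w ω (n + 1)) :
    front M (walks ω) w t = (stateAfter M w (hist M w ω n).1).front := by
  rw [front, h.configAt_eq ha haM hw h1 h2, ← configAfter_toState M w (hist M w ω n).2]


/-! ### The front of the labelled process -/

/-- The walks are regular and the process starts from a labelling of `a δ_0`. -/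
structure Run (M : ℕ) (w : State a) (ω : Sample a) : Prop where
  two_le : 2 ≤ a
  le : a ≤ M
  init : w.IsInitial M
  run : GoodRun M w ω
  noExplosion : ∀ r, NoExplosion M r ω

theorem ae_run {M : ℕ} (ha : 2 ≤ a) (haM : a ≤ M) (hM : 4 < M) {w : State a} (hw : w.IsInitial M) :
    ∀ᵐ ω ∂(walkMeasure a), Run M w ω := by
  filter_upwards [ae_goodRun M (nonempty_of_admissible hw.1), ae_all_iff.2 (ae_noExplosion ha hM)] with ω h h'
    using ⟨ha, haM, hw, h, h'⟩

/-- The jumps after which the front has reached `y` for the first time. -/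
def reach (M : ℕ) (w : State a) (y : ℤ) : Set (Jumps a) :=
  {d | y ≤ (stateAfter M w d).front ∧ ∀ x d', d = x :: d' → (stateAfter M w d').front < y}

/-- The state after the first `n` jumps of the activated walks. -/
abbrev st (M : ℕ) (w : State a) (ω : Sample a) (n : ℕ) : State a := stateAfter M w (hist M w ω n).1

variable {M : ℕ} {w : State a} {ω : Sample a}

theorem Run.nonempty (h : Run M w ω) : w.live.Nonempty := nonempty_of_admissible h.init.1

theorem Run.goodSample (h : Run M w ω) : GoodSample ω := h.run.good 0

theorem Run.tracks (h : Run M w ω) (n : ℕ) : Tracks M w ω n := h.run.tracks h.two_le h.le h.init.1 n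

theorem Run.sound (h : Run M w ω) (n : ℕ) : Sound M w (st M w ω n) := sound_stateAfter h.two_le h.le h.init.1 _

theorem cfg_toState (n : ℕ) : (cfg M w ω n).toState = st M w ω n := configAfter_toState _ _ _ _

theorem Run.st_succ (h : Run M w ω) (n : ℕ) : ∃ x, (hist M w ω (n + 1)).1 = x :: (hist M w ω n).1 ∧
    st M w ω (n + 1) = (st M w ω n).jump M x := by
  obtain ⟨l, -, h1, -⟩ := h.run.exists_step h.nonempty n
  refine ⟨(l, (rest M w ω n (l, 0)).2), by rw [h1]; rfl, ?_⟩
  change stateAfter M w (hist M w ω (n + 1)).1 = _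
  rw [h1]; rfl

theorem Run.front_mono (h : Run M w ω) : Monotone fun n => (st M w ω n).front := by
  refine monotone_nat_of_le_succ fun n => ?_
  obtain ⟨x, -, hx⟩ := h.st_succ n
  rw [hx]
  rcases (st M w ω n).jump_front M x with h' | ⟨h', _⟩ <;> omega

theorem Run.mem_reach_iff (h : Run M w ω) {n : ℕ} {y : ℤ} :
    (hist M w ω n).1 ∈ reach M w y ↔ y ≤ (st M w ω n).front ∧ ∀ m < n, (st M w ω m).front < y := by
  refine and_congr_right fun hy => ?_
  cases n with
  | zero =>
    have e : (hist M w ω 0).1 = [] := rfl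
    simp [e]
  | succ n =>
    obtain ⟨x, hx, -⟩ := h.st_succ n
    constructor
    · intro h1 m hm
      exact lt_of_le_of_lt (h.front_mono (Nat.lt_succ_iff.1 hm)) (h1 x _ hx)
    · intro h1 x' d' hd
      rw [hx] at hd
      obtain ⟨-, rfl⟩ := List.cons_eq_cons.1 hd
      exact h1 n (Nat.lt_succ_self n)

theorem Run.reach_unique (h : Run M w ω) {n m : ℕ} {y : ℤ} (hn : (hist M w ω n).1 ∈ reach M w y)
    (hm : (hist M w ω m).1 ∈ reach M w y) : n = m := by
  rw [h.mem_reach_iff] at hn hm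
  by_contra hne
  rcases lt_or_gt_of_ne hne with hlt | hlt
  · exact absurd (hm.2 n hlt) (not_lt.2 hn.1)
  · exact absurd (hn.2 m hlt) (not_lt.2 hm.1)

theorem Run.exists_reach_of_le (h : Run M w ω) {n : ℕ} {y : ℤ} (hy : y ≤ (st M w ω n).front) :
    ∃ m ≤ n, (hist M w ω m).1 ∈ reach M w y := by
  classical
  have hex : ∃ n, y ≤ (st M w ω n).front := ⟨n, hy⟩
  refine ⟨Nat.find hex, Nat.find_le hy, h.mem_reach_iff.2 ⟨Nat.find_spec hex, fun m hm => ?_⟩⟩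
  exact not_le.1 (Nat.find_min hex hm)

theorem Run.front_of_reach (h : Run M w ω) {n : ℕ} {y : ℤ} (hy : 0 < y) (hn : (hist M w ω n).1 ∈ reach M w y) :
    (st M w ω n).front = y := by
  rw [h.mem_reach_iff] at hn
  cases n with
  | zero =>
    have e : (st M w ω 0).front = w.front := rfl
    rw [e, h.init.2.1] at hn
    omega
  | succ n =>
    obtain ⟨x, -, hx⟩ := h.st_succ n
    have h1 := hn.2 n (Nat.lt_succ_self n)
    have h2 := hn.1
    rw [hx] at h2 ⊢
    rcases (st M w ω n).jump_front M x with h' | ⟨h', _⟩ <;> omega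

theorem Run.front_at (h : Run M w ω) {n : ℕ} {t : ℝ≥0} (h1 : jumpTime M w ω n ≤ t) (h2 : t < jumpTime M w ω (n + 1)) :
    front M (walks ω) w t = (st M w ω n).front := h.run.front_eq h.two_le h.le h.init.1 h1 h2

theorem Run.exists_between (h : Run M w ω) (t : ℝ≥0) :
    ∃ n, jumpTime M w ω n ≤ t ∧ t < jumpTime M w ω (n + 1) := h.run.exists_between h.nonempty t

theorem Run.strictMono_jumpTime (h : Run M w ω) : StrictMono (jumpTime M w ω) := h.run.strictMono_jumpTime h.nonempty

theorem Run.front_jumpTime (h : Run M w ω) (n : ℕ) : front M (walks ω) w (jumpTime M w ω n) = (st M w ω n).front :=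
  h.front_at le_rfl (h.strictMono_jumpTime (Nat.lt_succ_self n))

theorem hitTime_le {y : ℤ} {t : ℝ≥0} (h : y ≤ front M (walks ω) w t) : hitTime M (walks ω) w (y : ℤ) ≤ t :=
  iInf₂_le t (by exact_mod_cast h)

theorem hitTime_mono {x y : ℤ} (hxy : x ≤ y) :
    hitTime M (walks ω) w (x : ℤ) ≤ hitTime M (walks ω) w (y : ℤ) :=
  le_iInf₂ fun t ht => hitTime_le (hxy.trans (by exact_mod_cast ht))

theorem Run.hitTime_eq (h : Run M w ω) {n : ℕ} {y : ℤ} (hn : (hist M w ω n).1 ∈ reach M w y) :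
    hitTime M (walks ω) w (y : ℤ) = jumpTime M w ω n := by
  have hn' := h.mem_reach_iff.1 hn
  apply le_antisymm
  · exact iInf₂_le _ (by rw [h.front_jumpTime]; exact_mod_cast hn'.1)
  · refine le_iInf₂ fun t ht => ?_
    obtain ⟨m, h1, h2⟩ := h.exists_between t
    rw [h.front_at h1 h2] at ht
    have ht' : y ≤ (st M w ω m).front := by exact_mod_cast ht
    have : n ≤ m := by
      by_contra hlt
      exact absurd (hn'.2 m (not_le.1 hlt)) (not_lt.2 ht')
    exact_mod_cast (h.strictMono_jumpTime.monotone this).trans h1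

/-- The front is at `y` or beyond at time `t` exactly if it has reached `y` by then. -/
theorem Run.le_front_iff (h : Run M w ω) (y : ℤ) (t : ℝ≥0) :
    y ≤ front M (walks ω) w t ↔ hitTime M (walks ω) w (y : ℤ) ≤ t := by
  constructor
  · intro hy
    exact iInf₂_le t (by exact_mod_cast hy)
  · intro hy
    obtain ⟨n, h1, h2⟩ := h.exists_between t
    rw [h.front_at h1 h2]
    by_contra hlt
    push Not at hlt
    have : (jumpTime M w ω (n + 1) : ℝ≥0∞) ≤ hitTime M (walks ω) w (y : ℤ) := by
      refine le_iInf₂ fun s hs => ?_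
      by_contra hs'
      push Not at hs'
      have hs'' : s < jumpTime M w ω (n + 1) := by exact_mod_cast hs'
      obtain ⟨m, h3, h4⟩ := h.exists_between s
      rw [h.front_at h3 h4] at hs
      have hmn : m ≤ n := by
        have := h.strictMono_jumpTime.lt_iff_lt.1 (h3.trans_lt hs'')
        omega
      have h5 := h.front_mono hmn
      simp only at h5
      have h6 : y ≤ (st M w ω m).front := by exact_mod_cast hs
      omega
    have h7 := this.trans hy
    exact absurd h2 (not_lt.2 (by exact_mod_cast h7))

theorem Run.mem_act_iff (h : Run M w ω) {n : ℕ} {l : Label a} (hl : 0 ≤ l.site) :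
    l ∈ activeLabels M w (hist M w ω n).1 ↔ l.site ≤ (st M w ω n).front := by
  rw [mem_activeLabels]
  have h0 := h.init.2.1
  constructor
  · rintro (h1 | h1)
    · exact (h.init.1.1 l h1).1.trans (front_le_stateAfter M w _)
    · exact h1.2
  · intro h1
    rcases lt_or_eq_of_le hl with h2 | h2
    · exact Or.inr ⟨by omega, h1⟩
    · left
      have := (h.init.2.2.1 (ofLex l).2).1
      have e : mkLabel 0 (ofLex l).2 = l := by
        rw [h2]; rfl
      rwa [e] at this

theorem Run.act_mono (h : Run M w ω) {m n : ℕ} (hmn : m ≤ n) {l : Label a}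
    (hl : l ∈ activeLabels M w (hist M w ω m).1) : l ∈ activeLabels M w (hist M w ω n).1 := by
  rw [mem_activeLabels] at hl ⊢
  refine hl.imp_right fun h1 => ⟨h1.1, h1.2.trans (h.front_mono hmn)⟩

/-- The birth time and the starting point of a particle do not change after its activation. A new
particle is born at the time when the front reaches its site. -/
theorem Run.birth_succ (h : Run M w ω) (n : ℕ) (l : Label a) :
    (l ∈ activeLabels M w (hist M w ω n).1 → (cfg M w ω (n + 1)).birth l = (cfg M w ω n).birth l ∧
      (cfg M w ω (n + 1)).start l = (cfg M w ω n).start l) ∧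
    (l ∉ activeLabels M w (hist M w ω n).1 → l ∈ activeLabels M w (hist M w ω (n + 1)).1 →
      (cfg M w ω (n + 1)).birth l = jumpTime M w ω (n + 1) ∧ (hist M w ω (n + 1)).1 ∈ reach M w l.site) := by
  obtain ⟨k, -, h1, -⟩ := h.run.exists_step h.nonempty n
  set x := rest M w ω n (k, 0)
  have hc' : cfg M w ω (n + 1) = if k ∈ (cfg M w ω n).live ∧ x.2 ≠ 0 then
      (cfg M w ω n).update M k ((cfg M w ω n).pos k + x.2) (jumpTime M w ω (n + 1)) else cfg M w ω n := by
    rw [jumpTime, h1]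
    change configAfter M w _ _ = _
    rw [h1, configAfter_push]
  have hfr : ∀ m, (cfg M w ω m).front = (st M w ω m).front := fun m => by rw [← cfg_toState]
  constructor
  · intro hl
    have hs := site_le_of_mem_activeLabels h.init.1 hl
    have hs' : l.site ≠ (cfg M w ω n).front + 1 := by rw [hfr]; change l.site ≤ (st M w ω n).front at hs; omega
    rw [hc']
    by_cases h2 : k ∈ (cfg M w ω n).live ∧ x.2 ≠ 0
    · rw [if_pos h2, Config.update]
      by_cases h3 : (cfg M w ω n).front < (cfg M w ω n).pos k + x.2
      · rw [if_pos h3]; simp [hs']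
      · rw [if_neg h3]; simp
    · rw [if_neg h2]; simp
  · intro hl hl'
    have hl0 : l.site ≤ (st M w ω (n + 1)).front ∧ (st M w ω n).front < l.site := by
      rw [mem_activeLabels] at hl hl'
      push Not at hl
      have h2 := hl'.resolve_left hl.1
      exact ⟨h2.2, hl.2 h2.1⟩
    have hr : (hist M w ω (n + 1)).1 ∈ reach M w l.site := by
      rw [h.mem_reach_iff]
      exact ⟨hl0.1, fun m hm => (h.front_mono (Nat.lt_succ_iff.1 hm)).trans_lt hl0.2⟩
    refine ⟨?_, hr⟩
    have hne : (cfg M w ω (n + 1)).front ≠ (cfg M w ω n).front := by rw [hfr, hfr]; omega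
    rw [hc'] at hne ⊢
    by_cases h2 : k ∈ (cfg M w ω n).live ∧ x.2 ≠ 0
    · rw [if_pos h2, Config.update] at hne ⊢
      by_cases h3 : (cfg M w ω n).front < (cfg M w ω n).pos k + x.2
      · rw [if_pos h3] at hne ⊢
        have hst : (st M w ω (n + 1)).front = (cfg M w ω n).front + 1 := by
          rw [← hfr, hc', if_pos h2, Config.update, if_pos h3]
        have : l.site = (cfg M w ω n).front + 1 := by
          have := hfr n; omega
        simp [this]
      · rw [if_neg h3] at hne; exact absurd rfl hne
    · rw [if_neg h2] at hne; exact absurd rfl hne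

theorem Run.birth_mono (h : Run M w ω) {m n : ℕ} (hmn : m ≤ n) {l : Label a}
    (hl : l ∈ activeLabels M w (hist M w ω m).1) :
    (cfg M w ω n).birth l = (cfg M w ω m).birth l ∧ (cfg M w ω n).start l = (cfg M w ω m).start l := by
  induction n, hmn using Nat.le_induction with
  | base => exact ⟨rfl, rfl⟩
  | succ n hmn ih =>
    obtain ⟨h1, h2⟩ := (h.birth_succ n l).1 (h.act_mono hmn hl)
    exact ⟨h1.trans ih.1, h2.trans ih.2⟩

/-- A particle whose label has a nonnegative site is born at this site, when the front gets there. -/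
theorem Run.birth_eq (h : Run M w ω) {n : ℕ} {l : Label a} (hs : 0 ≤ l.site)
    (hl : l ∈ activeLabels M w (hist M w ω n).1) :
    ((cfg M w ω n).birth l : ℝ≥0∞) = hitTime M (walks ω) w (l.site : ℤ) ∧ (cfg M w ω n).start l = l.site := by
  induction n with
  | zero =>
    have h1 := (h.mem_act_iff hs).1 hl
    have e : (st M w ω 0).front = 0 := h.init.2.1
    have hs0 : l.site = 0 := by omega
    have hr : (hist M w ω 0).1 ∈ reach M w l.site := h.mem_reach_iff.2 ⟨h1, fun m hm => absurd hm (by omega)⟩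
    rw [h.hitTime_eq hr, jumpTime_zero]
    refine ⟨rfl, ?_⟩
    have := (h.init.2.2.1 (ofLex l).2).2
    have e2 : mkLabel 0 (ofLex l).2 = l := by
      rw [← hs0]; rfl
    rw [e2] at this
    rw [hs0]; exact this
  | succ n ih =>
    by_cases hl' : l ∈ activeLabels M w (hist M w ω n).1
    · obtain ⟨h1, h2⟩ := (h.birth_succ n l).1 hl'
      rw [h1, h2]; exact ih hl'
    · obtain ⟨h1, h2⟩ := (h.birth_succ n l).2 hl' hl
      rw [h1, h.hitTime_eq h2]
      refine ⟨rfl, (h.tracks (n + 1)).start_eq l hl fun hlw => hl' (mem_activeLabels.2 (Or.inl hlw))⟩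

theorem Run.live_subset_act (h : Run M w ω) {n : ℕ} {l : Label a} (hl : l ∈ (st M w ω n).live) :
    l ∈ activeLabels M w (hist M w ω n).1 := live_subset_activeLabels h.two_le h.le h.init.1 _ hl

/-- While the front rests, live particles can only be lost. -/
theorem Run.live_anti (h : Run M w ω) {m n : ℕ} (hmn : m ≤ n) (hf : (st M w ω n).front = (st M w ω m).front) :
    (st M w ω n).live ⊆ (st M w ω m).live := by
  induction n, hmn using Nat.le_induction with
  | base => exact Finset.Subset.refl _
  | succ n hmn ih =>
    have h1 := h.front_mono hmn
    have h2 := h.front_mono (Nat.le_succ n)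
    simp only [Nat.succ_eq_add_one] at h1 h2
    refine Finset.Subset.trans ?_ (ih (by omega))
    obtain ⟨x, -, hx⟩ := h.st_succ n
    rw [hx]
    by_cases hlv : x.1 ∈ (st M w ω n).live ∧ x.2 ≠ 0
    · rcases lt_or_ge (st M w ω n).front ((st M w ω n).pos x.1 + x.2) with h3 | h3
      · rw [hx, State.jump_of_lt hlv h3] at hf
        rw [hx, State.jump_of_lt hlv h3] at h2
        simp only at hf h2
        omega
      · rw [State.jump_of_le hlv h3]
        simp only
        split_ifs
        · exact Finset.filter_subset _ _
        · exact Finset.Subset.refl _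
    · rw [State.jump, if_neg hlv]

/-- The position of a particle in terms of its walk and its age. -/
theorem Run.pos_at (h : Run M w ω) {n : ℕ} {t : ℝ≥0} (h1 : jumpTime M w ω n ≤ t) (h2 : t < jumpTime M w ω (n + 1))
    {l : Label a} (hl : l ∈ (st M w ω n).live) :
    (st M w ω n).pos l = (cfg M w ω n).start l + path (seqOf ω l) (t - (cfg M w ω n).birth l) := by
  have tr := h.tracks n
  have hact := h.live_subset_act hl
  have hl' : l ∈ (cfg M w ω n).live := by rw [cfg_toState]; exact hl
  obtain ⟨s, rfl⟩ := exists_add_of_le h1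
  obtain ⟨k, hk, h3, -⟩ := h.run.exists_step h.nonempty n
  rw [h.run.jumpTime_succ h.nonempty h3, add_lt_add_iff_left] at h2
  have hs : (s : ℝ) < (rest M w ω n (k, 0)).1 := by
    have h4 : (s : ℝ) < ((rest M w ω n (k, 0)).1.toNNReal : ℝ) := h2
    have h5 : 0 < (rest M w ω n (k, 0)).1 := (h.run.good n).seq k |>.pos 0
    rwa [Real.coe_toNNReal _ h5.le] at h4
  rw [← tsub_add_eq_add_tsub (tr.birth_le l hact), tr.path_add l hact,
    path_first (h.run.good n) hk hact hs.le (Or.inr hs), add_zero, ← tr.pos_eq l hl', cfg_toState]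

/-- The front needs at most the waiting time of the auxiliary process to advance by one site: the
particles with labels in `auxLabels` are live until then. -/
theorem Run.hitTime_succ_le (h : Run M w ω) {r y : ℤ} (hr : 0 ≤ r) :
    hitTime M (walks ω) w ((y + 1 : ℤ) : WithTop ℤ) ≤ hitTime M (walks ω) w (y : ℤ) + wait M r y ω := by
  unfold wait
  rw [ENNReal.add_iInf]
  refine le_iInf fun l => ?_
  rw [ENNReal.add_iInf]
  refine le_iInf fun hl => ?_
  by_contra hlt
  push Not at hlt
  set ν := hit (seqOf ω l) (y + 1 - l.site) with hν
  have hs0 : 0 ≤ l.site := hr.trans hl.1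
  have hmono : hitTime M (walks ω) w (l.site : ℤ) ≤ hitTime M (walks ω) w (y : ℤ) :=
    hitTime_mono hl.2.1
  have hT : hitTime M (walks ω) w (y : ℤ) + ν ≠ ⊤ := ne_top_of_lt hlt
  have hTs : hitTime M (walks ω) w (l.site : ℤ) ≠ ⊤ :=
    ne_top_of_le_ne_top (ne_top_of_le_ne_top hT le_self_add) hmono
  have hνt : ν ≠ ⊤ := ne_top_of_le_ne_top hT le_add_self
  obtain ⟨T, hTe⟩ : ∃ T : ℝ≥0, (T : ℝ≥0∞) = hitTime M (walks ω) w (l.site : ℤ) := ⟨_, ENNReal.coe_toNNReal hTs⟩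
  obtain ⟨v, hv⟩ : ∃ v : ℝ≥0, (v : ℝ≥0∞) = ν := ⟨_, ENNReal.coe_toNNReal hνt⟩
  -- At time `T + v` the walk `l` is at `y + 1`, which lies beyond the front by assumption.
  obtain ⟨n, h1, h2⟩ := h.exists_between (T + v)
  have hle : ((T + v : ℝ≥0) : ℝ≥0∞) ≤ hitTime M (walks ω) w (y : ℤ) + ν := by
    push_cast
    rw [hTe, hv]
    exact add_le_add_left hmono _
  have hfy : (st M w ω n).front ≤ y := by
    rw [← h.front_at h1 h2]
    by_contra hgt
    push Not at hgt
    have := (h.le_front_iff (y + 1) (T + v)).1 hgt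
    exact absurd (this.trans hle) (not_le.2 hlt)
  have hsite : l.site ≤ (st M w ω n).front := by
    rw [← h.front_at h1 h2, h.le_front_iff, ← hTe]
    exact_mod_cast le_self_add
  have hact := (h.mem_act_iff hs0).2 hsite
  -- If the particle had been killed, then `M` larger labels would be activated, against `l ∈ auxLabels`.
  have hlive : l ∈ (st M w ω n).live := by
    by_contra hnl
    have hor : l ∈ w.live ∨ w.front < l.site := (mem_activeLabels.1 hact).imp_right And.left
    have h3 := (h.sound n).killed l hor hsite hnl
    have h4 : {l' : Label a | l < l' ∧ l'.site ≤ (st M w ω n).front}.encard ≤ {l' : Label a | l < l' ∧ l'.site ≤ y}.encard :=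
      Set.encard_le_encard fun l' hl' => ⟨hl'.1, hl'.2.trans hfy⟩
    exact absurd (h3.trans h4) (not_le.2 hl.2.2)
  have hpos := h.pos_at h1 h2 hlive
  obtain ⟨hb, hst⟩ := h.birth_eq hs0 hact
  rw [← hTe] at hb
  have hb' : (cfg M w ω n).birth l = T := by exact_mod_cast hb
  have hpath := (h.goodSample.seq l).path_hit hνt
  rw [← hν, ← hv, ENNReal.toNNReal_coe] at hpath
  rw [hb', hst, add_tsub_cancel_left, hpath] at hpos
  have := (h.sound n).pos_le l hlive
  omega

theorem Run.hitTime_zero (h : Run M w ω) : hitTime M (walks ω) w ((0 : ℤ) : WithTop ℤ) = 0 := by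
  have hr : (hist M w ω 0).1 ∈ reach M w 0 := h.mem_reach_iff.2 ⟨h.init.2.1.ge, fun m hm => absurd hm (by omega)⟩
  rw [h.hitTime_eq hr, jumpTime_zero]; rfl

theorem Run.hitTime_le_auxTime (h : Run M w ω) {r : ℤ} (hr : 0 ≤ r) (k : ℕ) :
    hitTime M (walks ω) w ((r + k : ℤ) : WithTop ℤ) ≤ hitTime M (walks ω) w (r : ℤ) + auxTime M r k ω := by
  rw [h.goodSample.auxTime_eq]
  induction k with
  | zero => simp
  | succ k ih =>
    rw [Finset.sum_range_succ, ← add_assoc]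
    have := h.hitTime_succ_le (y := r + k) hr
    have e : (r + (k + 1 : ℕ) : ℤ) = r + k + 1 := by push_cast; ring
    rw [e]
    exact this.trans (add_le_add_left ih _)

theorem Run.hitTime_ne_top (h : Run M w ω) (y : ℤ) : hitTime M (walks ω) w (y : ℤ) ≠ ⊤ := by
  have hM : 0 < M := by have := h.two_le; have := h.le; omega
  have hnat : ∀ k : ℕ, hitTime M (walks ω) w ((k : ℤ) : WithTop ℤ) ≠ ⊤ := by
    intro k
    have h1 := h.hitTime_le_auxTime le_rfl k
    rw [zero_add, h.hitTime_zero, zero_add] at h1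
    exact ne_top_of_le_ne_top (h.goodSample.auxTime_ne_top h.two_le hM 0 k) h1
  exact ne_top_of_le_ne_top (hnat y.toNat) (hitTime_mono (Int.self_le_toNat y))

/-- Almost surely the front reaches every site. -/
theorem Run.exists_reach (h : Run M w ω) (y : ℤ) : ∃ n, (hist M w ω n).1 ∈ reach M w y := by
  obtain ⟨T, hT⟩ : ∃ T : ℝ≥0, (T : ℝ≥0∞) = hitTime M (walks ω) w (y : ℤ) :=
    ⟨_, ENNReal.coe_toNNReal (h.hitTime_ne_top y)⟩
  obtain ⟨n, h1, h2⟩ := h.exists_between T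
  have : y ≤ (st M w ω n).front := by
    rw [← h.front_at h1 h2, h.le_front_iff, hT]
  obtain ⟨m, -, hm⟩ := h.exists_reach_of_le this
  exact ⟨m, hm⟩

/-! ### Functionals of the walks at the time when a site is reached -/

theorem timeU_congr {α' : ℝ} {Y Y' : Walks a} {r : ℤ} (h : ∀ l : Label a, r ≤ l.site → Y l = Y' l) :
    timeU M α' Y r = timeU M α' Y' r := by
  have h1 : ∀ k, auxWait M Y r k = auxWait M Y' r k := by
    intro k
    unfold auxWait
    refine iInf_congr fun t => iInf_congr_Prop ?_ fun _ => rfl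
    refine exists_congr fun l => and_congr_right fun hl => ?_
    rw [h l hl.1]
  simp only [timeU, auxFront, h1]

/-- When `y` is reached, none of the walks on which `U ∘ θ` depends has moved yet, so that it is a function
of the remaining walks. -/
theorem Run.timeU_reach (h : Run M w ω) {y : ℤ} (hy : 0 < y) {n : ℕ} (hn : (hist M w ω n).1 ∈ reach M w y) (α' : ℝ) :
    timeU M α' (walks ω) y = timeU M α' (walks (rest M w ω n)) y := by
  have hf := h.front_of_reach hy hn
  refine timeU_congr fun l hl => ?_
  funext t
  rw [walks_eq, walks_eq]
  congr 1
  by_cases hact : l ∈ activeLabels M w (hist M w ω n).1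
  · have hs := (h.mem_act_iff (by omega)).1 hact
    have hly : l.site = y := by omega
    have hb := (h.birth_eq (by omega) hact).1
    rw [hly, h.hitTime_eq hn] at hb
    have hb' : (cfg M w ω n).birth l = jumpTime M w ω n := by exact_mod_cast hb
    have := (h.tracks n).path_add l hact t
    rw [hb', tsub_self, zero_add, (h.goodSample.seq l).path_zero, zero_add] at this
    exact this
  · rw [(h.tracks n).untouched l hact]

/-- The time `V` for the state `s`, if the live particles follow the walks `ρ` from now on. -/
def crossing (α' : ℝ) (s : State a) (ρ : Sample a) : ℝ≥0∞ :=
  ⨅ l ∈ s.live.filter fun l => s.pos l < s.front, crossTime α' (seqOf ρ l) (s.front - s.pos l)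

/-- After each jump, `V ∘ θ` is a function of the present state and the remaining walks. -/
theorem Run.timeV_jumpTime (h : Run M w ω) (n : ℕ) {α' : ℝ} (hα : 0 < α') :
    timeV M α' (walks ω) w (jumpTime M w ω n) = crossing α' (st M w ω n) (rest M w ω n) := by
  have tr := h.tracks n
  have hcfg : configAt M (walks ω) w (jumpTime M w ω n) = cfg M w ω n :=
    h.run.configAt_eq h.two_le h.le h.init.1 le_rfl (h.strictMono_jumpTime (Nat.lt_succ_self n))
  have htraj : ∀ l ∈ (st M w ω n).live, ∀ t, (cfg M w ω n).traj (walks ω) l (jumpTime M w ω n + t) =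
      (st M w ω n).pos l + path (seqOf (rest M w ω n) l) t := by
    intro l hl t
    have hact := h.live_subset_act hl
    have hl' : l ∈ (cfg M w ω n).live := by rw [cfg_toState]; exact hl
    simp only [Config.traj, walks_eq]
    rw [← tsub_add_eq_add_tsub (tr.birth_le l hact), tr.path_add l hact, ← cfg_toState, tr.pos_eq l hl']
    ring
  unfold timeV crossing
  rw [hcfg, h.front_jumpTime, cfg_toState]
  apply le_antisymm
  · refine le_iInf₂ fun l hl => ?_
    rw [Finset.mem_filter] at hl
    rw [((h.run.good n).seq l).crossTime_eq hα]
    refine le_iInf₂ fun t ht => iInf₂_le t ⟨l, hl.1, hl.2, ?_⟩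
    rw [htraj l hl.1]; linarith
  · refine le_iInf₂ fun t ht => ?_
    obtain ⟨l, hl, hl2, ht⟩ := ht
    rw [htraj l hl] at ht
    refine (iInf₂_le l (Finset.mem_filter.2 ⟨hl, hl2⟩)).trans ?_
    rw [((h.run.good n).seq l).crossTime_eq hα]
    exact iInf₂_le t (by linarith)

/-- The time the live particles of the state `s` need to reach the site to the right of the front,
if they follow the walks `ρ`. -/
def advance (s : State a) (ρ : Sample a) : ℝ≥0∞ := ⨅ l ∈ s.live, hit (seqOf ρ l) (s.front + 1 - s.pos l)

/-- Only the particles that are live when `y` is reached can move the front to `y + 1`. -/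
theorem Run.advance_le (h : Run M w ω) {y : ℤ} (hy : 0 < y) {n n' : ℕ} (hn : (hist M w ω n).1 ∈ reach M w y)
    (hn' : (hist M w ω n').1 ∈ reach M w (y + 1)) :
    jumpTime M w ω n + advance (st M w ω n) (rest M w ω n) ≤ jumpTime M w ω n' := by
  have hf := h.front_of_reach hy hn
  have hf' := h.front_of_reach (by omega) hn'
  have hr' := h.mem_reach_iff.1 hn'
  have hlt : n < n' := by
    by_contra hle
    have := h.front_mono (not_lt.1 hle)
    simp only at this
    omega
  obtain ⟨m, rfl⟩ : ∃ m, n' = m + 1 := ⟨n' - 1, by omega⟩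
  have hnm : n ≤ m := by omega
  have hfm : (st M w ω m).front = y := by
    have h1 := h.front_mono hnm
    have h2 := hr'.2 m (Nat.lt_succ_self m)
    simp only at h1
    omega
  obtain ⟨x, -, hx⟩ := h.st_succ m
  rcases (st M w ω m).jump_front M x with h1 | ⟨-, hlv, hgt⟩
  · rw [← hx] at h1; omega
  have hlive : x.1 ∈ (st M w ω n).live := h.live_anti hnm (by omega) hlv.1
  have hlive' : x.1 ∈ (st M w ω (m + 1)).live := by
    rw [hx, State.jump_of_lt hlv hgt]; exact Finset.mem_union_left _ hlv.1
  have hpos' : (st M w ω (m + 1)).pos x.1 = y + 1 := by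
    rw [hx, State.jump_of_lt hlv hgt]; simp [hfm]
  have hact := h.live_subset_act hlive
  obtain ⟨hb, hs⟩ := h.birth_mono hlt.le hact
  have e1 := (h.tracks (m + 1)).pos_eq x.1 (by rw [cfg_toState]; exact hlive')
  have e2 := (h.tracks n).pos_eq x.1 (by rw [cfg_toState]; exact hlive)
  rw [cfg_toState, hpos', hb, hs] at e1
  rw [cfg_toState] at e2
  obtain ⟨u, hu⟩ := exists_add_of_le (h.strictMono_jumpTime.monotone hlt.le)
  rw [hu, ← tsub_add_eq_add_tsub ((h.tracks n).birth_le _ hact), (h.tracks n).path_add _ hact] at e1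
  have hpath : path (seqOf (rest M w ω n) x.1) u = (st M w ω n).front + 1 - (st M w ω n).pos x.1 := by
    rw [hf]; linarith
  have hle := ((h.run.good n).seq x.1).hit_le hpath
  rw [hu]
  push_cast
  exact add_le_add_right ((iInf₂_le x.1 hlive).trans hle) _

/-! ### What the history determines -/

theorem Run.hist_snd_of_le (h : Run M w ω) {n i : ℕ} (hi : n ≤ i) : (hist M w ω n).2 i = 0 := by
  induction n with
  | zero => rfl
  | succ n ih =>
    obtain ⟨l, -, h1, -⟩ := h.run.exists_step h.nonempty n
    have hlen := length_hist h.run h.nonempty n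
    rw [h1]
    simp only [History.push]
    rw [hlen, Function.update_of_ne (by omega), ih (by omega)]

variable {ω' : Sample a}

theorem Run.hist_eq_of_succ (h : Run M w ω) (h' : Run M w ω') {n : ℕ}
    (e : hist M w ω (n + 1) = hist M w ω' (n + 1)) : hist M w ω n = hist M w ω' n := by
  obtain ⟨l, -, h1, -⟩ := h.run.exists_step h.nonempty n
  obtain ⟨l', -, h1', -⟩ := h'.run.exists_step h'.nonempty n
  have hlen := length_hist h.run h.nonempty n
  have hlen' := length_hist h'.run h'.nonempty n
  rw [h1, h1'] at e
  simp only [History.push, Prod.mk.injEq, List.cons.injEq] at e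
  refine Prod.ext e.1.2 ?_
  funext i
  by_cases hi : i = n
  · rw [hi, h.hist_snd_of_le le_rfl, h'.hist_snd_of_le le_rfl]
  · have := congrFun e.2 i
    rwa [hlen, hlen', Function.update_of_ne hi, Function.update_of_ne hi] at this

theorem Run.hist_eq_of_le (h : Run M w ω) (h' : Run M w ω') {m n : ℕ} (hmn : m ≤ n)
    (e : hist M w ω n = hist M w ω' n) : hist M w ω m = hist M w ω' m := by
  induction n, hmn using Nat.le_induction with
  | base => exact e
  | succ n hmn ih => exact ih (h.hist_eq_of_succ h' e)

/-- The history determines the activated walks up to their current age. -/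
theorem Run.path_eq_of_hist_eq (h : Run M w ω) (h' : Run M w ω') {n : ℕ} (e : hist M w ω n = hist M w ω' n)
    {l : Label a} (hl : l ∈ activeLabels M w (hist M w ω n).1) {s : ℝ≥0}
    (hs : s ≤ jumpTime M w ω n - (cfg M w ω n).birth l) : path (seqOf ω l) s = path (seqOf ω' l) s := by
  have hp0 : path (seqOf ω l) 0 = path (seqOf ω' l) 0 := by
    rw [(h.goodSample.seq l).path_zero, (h'.goodSample.seq l).path_zero]
  induction n generalizing s with
  | zero =>
    have : s = 0 := by simpa [jumpTime_zero] using hs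
    rw [this, hp0]
  | succ n ih =>
    have e0 := h.hist_eq_of_succ h' e
    by_cases hl' : l ∈ activeLabels M w (hist M w ω n).1
    swap
    · obtain ⟨hb, -⟩ := (h.birth_succ n l).2 hl' hl
      rw [hb, tsub_self, nonpos_iff_eq_zero] at hs
      rw [hs, hp0]
    have hl'' : l ∈ activeLabels M w (hist M w ω' n).1 := by rw [← e0]; exact hl'
    obtain ⟨hb, -⟩ := (h.birth_succ n l).1 hl'
    rw [hb] at hs
    have hT : jumpTime M w ω n = jumpTime M w ω' n := by rw [jumpTime, jumpTime, e0]
    have hB : (cfg M w ω n).birth l = (cfg M w ω' n).birth l := by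
      change (configAfter M w _ _).birth l = (configAfter M w _ _).birth l
      rw [e0]
    rcases le_total s (jumpTime M w ω n - (cfg M w ω n).birth l) with h1 | h1
    · exact ih e0 hl' h1
    obtain ⟨u, rfl⟩ := exists_add_of_le h1
    obtain ⟨k, hk, h2, -⟩ := h.run.exists_step h.nonempty n
    obtain ⟨k', hk', h2', -⟩ := h'.run.exists_step h'.nonempty n
    have hkk : k = k' ∧ (rest M w ω n (k, 0)) = (rest M w ω' n (k', 0)) := by
      have e' := e
      rw [h2, h2', e0] at e'
      simp only [History.push, Prod.mk.injEq, List.cons.injEq] at e'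
      refine ⟨e'.1.1.1, Prod.ext ?_ e'.1.1.2⟩
      have := congrFun e'.2 (hist M w ω' n).1.length
      simpa using this
    obtain ⟨rfl, hx⟩ := hkk
    have hbl := (h.tracks n).birth_le l hl'
    have hu : u ≤ (rest M w ω n (k, 0)).1.toNNReal := by
      rw [h.run.jumpTime_succ h.nonempty h2, ← tsub_add_eq_add_tsub hbl, add_le_add_iff_left] at hs
      exact hs
    rw [(h.tracks n).path_add l hl', ih e0 hl' le_rfl, hT, hB, (h'.tracks n).path_add l hl'']
    congr 1
    have hpos : 0 < (rest M w ω n (k, 0)).1 := (h.run.good n).seq k |>.pos 0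
    have hu' : (u : ℝ) ≤ (rest M w ω n (k, 0)).1 := by
      have : (u : ℝ) ≤ ((rest M w ω n (k, 0)).1.toNNReal : ℝ) := hu
      rwa [Real.coe_toNNReal _ hpos.le] at this
    by_cases hcase : l ≠ k ∨ (u : ℝ) < (rest M w ω n (k, 0)).1
    · have hu'' := hu'
      have hcase' := hcase
      rw [hx] at hu'' hcase'
      rw [path_first (h.run.good n) hk hl' hu' hcase, path_first (h'.run.good n) hk' hl'' hu'' hcase']
    · push Not at hcase
      obtain ⟨rfl, hc⟩ := hcase
      have hue : u = (rest M w ω n (l, 0)).1.toNNReal := by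
        refine le_antisymm hu ?_
        rw [← NNReal.coe_le_coe, Real.coe_toNNReal _ hpos.le]; exact hc
      have e1 : path (seqOf (rest M w ω n) l) (rest M w ω n (l, 0)).1.toNNReal = (rest M w ω n (l, 0)).2 :=
        path_first_self (h.run.good n)
      have e2 : path (seqOf (rest M w ω' n) l) (rest M w ω' n (l, 0)).1.toNNReal = (rest M w ω' n (l, 0)).2 :=
        path_first_self (h'.run.good n)
      rw [hue, e1, hx, e2]


/-! ### Estimates that are uniform in the state -/

/-- There are at most `M` particles at each site. -/
theorem Sound.sum_live_le {M : ℕ} {w s : State a} (hs : Sound M w s) (f : ℕ → ℝ≥0∞) :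
    ∑ l ∈ s.live, f (s.front - s.pos l).toNat ≤ M * ∑' n, f n := by
  classical
  have h1 : ∀ l, f (s.front - s.pos l).toNat = ∑' n, if (s.front - s.pos l).toNat = n then f n else 0 := by
    intro l
    rw [tsum_eq_single (s.front - s.pos l).toNat (fun n hn => if_neg (Ne.symm hn)), if_pos rfl]
  calc ∑ l ∈ s.live, f (s.front - s.pos l).toNat
      = ∑ l ∈ s.live, ∑' n, if (s.front - s.pos l).toNat = n then f n else 0 := Finset.sum_congr rfl fun l _ => h1 l
    _ = ∑' n, ∑ l ∈ s.live, if (s.front - s.pos l).toNat = n then f n else 0 :=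
        (Summable.tsum_finsetSum fun _ _ => ENNReal.summable).symm
    _ ≤ ∑' n, M * f n := by
        refine ENNReal.tsum_le_tsum fun n => ?_
        rw [← Finset.sum_filter, Finset.sum_const, nsmul_eq_mul]
        refine mul_le_mul_left ?_ _
        have : (s.live.filter fun l => (s.front - s.pos l).toNat = n) ⊆ s.live.filter fun l => s.pos l = s.front - n := by
          intro l hl
          rw [Finset.mem_filter] at hl ⊢
          refine ⟨hl.1, ?_⟩
          have := hs.pos_le l hl.1
          omega
        exact_mod_cast (Finset.card_le_card this).trans (hs.count_le _)
    _ = M * ∑' n, f n := ENNReal.tsum_mul_left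

theorem measurable_advance (s : State a) : Measurable (advance s) := by
  unfold advance
  exact Measurable.biInf _ s.live.countable_toSet fun l _ => (measurable_hit _).comp (measurable_seqOf l)

theorem measurable_crossing (α' : ℝ) (s : State a) : Measurable (crossing α' s) := by
  unfold crossing
  exact Measurable.biInf _ (Finset.countable_toSet _) fun l _ => (measurable_crossTime _ _).comp (measurable_seqOf l)

/-- The front is unlikely to advance fast. -/
theorem exists_laplace_advance {M : ℕ} (hM : 0 < M) :
    ∃ lam : ℝ, 0 < lam ∧ ∀ (w s : State a), Sound M w s →
      ∫⁻ ρ, expNeg lam (advance s ρ) ∂(walkMeasure a) ≤ ENNReal.ofReal (1 / 2) := by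
  classical
  have hM' : (0 : ℝ) < M := by exact_mod_cast hM
  -- The value of `z` for which `M * (z + z ^ 2 + ⋯) = 1 / 2`.
  set z : ℝ := 1 / (2 * M + 1) with hz
  have hz0 : 0 < z := by positivity
  have hz1 : z < 1 := by rw [hz, div_lt_one (by positivity)]; linarith
  refine ⟨(1 - z) ^ 2 / z, by have : 0 < 1 - z := by linarith
                              positivity, fun w s hs => ?_⟩
  set lam := (1 - z) ^ 2 / z with hlam
  have hpt : ∀ ρ : Sample a, expNeg lam (advance s ρ) ≤ ∑ l ∈ s.live, expNeg lam (hit (seqOf ρ l) (s.front + 1 - s.pos l)) := by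
    intro ρ
    rcases s.live.eq_empty_or_nonempty with he | hne
    · simp [advance, he, expNeg]
    · obtain ⟨l, hl, hmin⟩ := s.live.exists_min_image (fun l => hit (seqOf ρ l) (s.front + 1 - s.pos l)) hne
      have : advance s ρ = hit (seqOf ρ l) (s.front + 1 - s.pos l) :=
        le_antisymm (iInf₂_le l hl) (le_iInf₂ hmin)
      rw [this]
      exact Finset.single_le_sum (f := fun l => expNeg lam (hit (seqOf ρ l) (s.front + 1 - s.pos l)))
        (fun _ _ => zero_le) hl
  have hone : ∀ l ∈ s.live, ∫⁻ ρ, expNeg lam (hit (seqOf ρ l) (s.front + 1 - s.pos l)) ∂(walkMeasure a) =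
      ENNReal.ofReal (z ^ ((s.front - s.pos l).toNat + 1)) := by
    intro l hl
    have h1 := (measurePreserving_seqOf l).lintegral_comp
      ((measurable_expNeg lam).comp (measurable_hit (s.front + 1 - s.pos l)))
    have h2 := laplace_hit hz0 hz1 ((s.front - s.pos l).toNat + 1)
    have e : (((s.front - s.pos l).toNat + 1 : ℕ) : ℤ) = s.front + 1 - s.pos l := by
      have := hs.pos_le l hl; omega
    rw [e] at h2
    exact h1.trans h2
  calc _ ≤ ∫⁻ ρ, ∑ l ∈ s.live, expNeg lam (hit (seqOf ρ l) (s.front + 1 - s.pos l)) ∂(walkMeasure a) :=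
        lintegral_mono hpt
    _ = ∑ l ∈ s.live, ENNReal.ofReal (z ^ ((s.front - s.pos l).toNat + 1)) := by
        rw [lintegral_finsetSum _ (fun l _ => by
          exact (measurable_expNeg lam).comp ((measurable_hit _).comp (measurable_seqOf l)))]
        exact Finset.sum_congr rfl hone
    _ ≤ M * ∑' n : ℕ, ENNReal.ofReal (z ^ (n + 1)) := hs.sum_live_le fun n => ENNReal.ofReal (z ^ (n + 1))
    _ = _ := by
        have hsum : HasSum (fun n : ℕ => z ^ (n + 1)) (z * (1 - z)⁻¹) := by
          simpa [pow_succ'] using (hasSum_geometric_of_lt_one hz0.le hz1).mul_left z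
        rw [← ENNReal.ofReal_tsum_of_nonneg (fun n => by positivity) hsum.summable, hsum.tsum_eq,
          ← ENNReal.ofReal_natCast, ← ENNReal.ofReal_mul hM'.le]
        congr 1
        have : 1 - z = 2 * M / (2 * M + 1) := by rw [hz]; field_simp; ring
        rw [this, hz]; field_simp

/-- The time at which the last particle to the left of the front overtakes the line of slope `α'`
has an exponential tail. -/
theorem exists_crossing_tail {α' : ℝ} (hα : 0 < α') (M : ℕ) :
    ∃ C c : ℝ, 0 ≤ C ∧ 0 < c ∧ ∀ (w s : State a), Sound M w s → ∀ t : ℝ,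
      walkMeasure a {ρ | ENNReal.ofReal t < crossing α' s ρ ∧ crossing α' s ρ < ⊤} ≤
        ENNReal.ofReal (C * Real.exp (-(c * t))) := by
  classical
  obtain ⟨C, θ, c, hC, hθ, hc, hb⟩ := exists_crossing_bound hα
  have hgeo : Real.exp (-θ) < 1 := Real.exp_lt_one_iff.2 (by linarith)
  have hgeo' : 0 < 1 - Real.exp (-θ) := by linarith
  refine ⟨M * (C * (1 - Real.exp (-θ))⁻¹), c, by positivity, hc, fun w s hs t => ?_⟩
  set B : Label a → Set WalkSeq := fun l =>
    {q | ∃ n, t ≤ jumpSum q n ∧ (s.front - s.pos l) + ⌊α' * jumpSum q n⌋ ≤ stepSum q n} with hB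
  have hBm : ∀ l, MeasurableSet (B l) := by
    intro l
    simp only [hB, Set.ofPred_exists, Set.ofPred_and]
    refine MeasurableSet.iUnion fun n => ?_
    refine (measurableSet_le measurable_const (measurable_jumpSum n)).inter ?_
    exact measurableSet_le (measurable_const.add (Int.measurable_floor.comp ((measurable_jumpSum n).const_mul α'))) (measurable_stepSum n)
  have hsub : {ρ | ENNReal.ofReal t < crossing α' s ρ ∧ crossing α' s ρ < ⊤} ⊆
      ⋃ l ∈ s.live, (fun ρ : Sample a => seqOf ρ l) ⁻¹' B l := by
    rintro ρ ⟨h1, h2⟩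
    unfold crossing at h1 h2
    obtain ⟨l, hl⟩ := iInf_lt_iff.1 h2
    obtain ⟨hl', hlt⟩ := iInf_lt_iff.1 hl
    have h3 : ENNReal.ofReal t < crossTime α' (seqOf ρ l) (s.front - s.pos l) := h1.trans_le (iInf₂_le l hl')
    obtain ⟨n, hn⟩ := (crossTime_ne_top_iff α' (seqOf ρ l) (s.front - s.pos l)).1 hlt.ne
    have h4 : ENNReal.ofReal t < ENNReal.ofReal (jumpSum (seqOf ρ l) n) := h3.trans_le (iInf₂_le n hn)
    simp only [Set.mem_iUnion]
    exact ⟨l, (Finset.mem_filter.1 hl').1, n, (ENNReal.ofReal_lt_ofReal_iff'.1 h4).1.le, hn⟩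
  calc _ ≤ ∑ l ∈ s.live, walkMeasure a ((fun ρ : Sample a => seqOf ρ l) ⁻¹' B l) :=
        (measure_mono hsub).trans (measure_biUnion_finset_le _ _)
    _ ≤ ∑ l ∈ s.live, ENNReal.ofReal (C * Real.exp (-(θ * (s.front - s.pos l).toNat)) * Real.exp (-(c * t))) := by
        refine Finset.sum_le_sum fun l hl => ?_
        rw [(measurePreserving_seqOf l).measure_preimage (hBm l).nullMeasurableSet]
        have := hb (s.front - s.pos l) t
        have e : (((s.front - s.pos l).toNat : ℕ) : ℝ) = ((s.front - s.pos l : ℤ) : ℝ) := by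
          have h5 : (((s.front - s.pos l).toNat : ℕ) : ℤ) = s.front - s.pos l := by
            have := hs.pos_le l hl; omega
          exact_mod_cast h5
        rw [e]; exact this
    _ ≤ M * ∑' n : ℕ, ENNReal.ofReal (C * Real.exp (-(θ * n)) * Real.exp (-(c * t))) :=
        hs.sum_live_le fun n => ENNReal.ofReal (C * Real.exp (-(θ * n)) * Real.exp (-(c * t)))
    _ = _ := by
        have hsum : HasSum (fun n : ℕ => C * Real.exp (-(θ * n)) * Real.exp (-(c * t)))
            (C * (1 - Real.exp (-θ))⁻¹ * Real.exp (-(c * t))) := by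
          refine HasSum.mul_right _ (HasSum.mul_left _ ?_)
          have := hasSum_geometric_of_lt_one (Real.exp_pos (-θ)).le hgeo
          refine this.congr_fun ?_ |> fun h => h
          intro n
          rw [← Real.exp_nat_mul]; congr 1; ring
        rw [← ENNReal.ofReal_tsum_of_nonneg (fun n => by positivity) hsum.summable, hsum.tsum_eq,
          ← ENNReal.ofReal_natCast, ← ENNReal.ofReal_mul (by positivity)]
        congr 1; ring

/-- With a probability bounded below, no particle to the left of the front overtakes the line of
slope `α'`. -/
theorem exists_crossing_eq_top {α' : ℝ} (hα : 0 < α') (M : ℕ) :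
    ∃ δ : ℝ≥0∞, 0 < δ ∧ ∀ (w s : State a), Sound M w s →
      δ ≤ walkMeasure a {ρ | crossing α' s ρ = ⊤} := by
  classical
  obtain ⟨C, θ, c, hC, hθ, hc, hb⟩ := exists_crossing_bound hα
  set q : ℕ → ℝ≥0∞ := fun j => seqLaw {x | crossTime α' x j = ⊤} with hq
  have hq1 : ∀ j, q j ≤ 1 := fun j => prob_le_one
  have hqpos : ∀ j, 1 ≤ j → 0 < q j := fun j hj => measure_crossTime_eq_top_pos hα (by exact_mod_cast hj)
  have hms : ∀ j : ℤ, MeasurableSet {x | crossTime α' x j = ⊤} := fun j =>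
    measurable_crossTime α' j (measurableSet_singleton _)
  have hgeo : Real.exp (-θ) < 1 := Real.exp_lt_one_iff.2 (by linarith)
  have hterm : Summable fun n : ℕ => C * Real.exp (-(θ * n)) := by
    refine Summable.mul_left _ ?_
    refine (summable_geometric_of_lt_one (Real.exp_pos (-θ)).le hgeo).congr fun n => ?_
    rw [← Real.exp_nat_mul]; congr 1; ring
  -- The particles at a distance of at least `J` from the front are unlikely to matter.
  obtain ⟨J, hJ⟩ : ∃ J : ℕ, (M : ℝ≥0∞) * ∑' n : ℕ, ENNReal.ofReal (C * Real.exp (-(θ * (n + J : ℕ)))) ≤ 2⁻¹ := by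
    have h1 : Tendsto (fun J : ℕ => ∑' n : ℕ, ENNReal.ofReal (C * Real.exp (-(θ * (n + J : ℕ))))) atTop (𝓝 0) := by
      refine ENNReal.tendsto_sum_nat_add (fun n => ENNReal.ofReal (C * Real.exp (-(θ * n)))) ?_
      rw [← ENNReal.ofReal_tsum_of_nonneg (fun n => by positivity) hterm]
      exact ENNReal.ofReal_ne_top
    have h2 := ENNReal.Tendsto.const_mul h1 (Or.inr (ENNReal.natCast_ne_top M))
    rw [mul_zero] at h2
    exact (h2.eventually (ge_mem_nhds (by simp))).exists
  set qmin : ℝ≥0∞ := ∏ j ∈ Finset.range J, (if j = 0 then 1 else q j) with hqmin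
  have hqmin0 : 0 < qmin := by
    rw [hqmin, CanonicallyOrderedAdd.prod_pos]
    intro j _
    split_ifs with h0
    · exact one_pos
    · exact hqpos j (by omega)
  have hqmin1 : ∀ j, 1 ≤ j → j < J → qmin ≤ q j := by
    intro j h1 h2
    rw [hqmin, ← Finset.mul_prod_erase _ _ (Finset.mem_range.2 h2), if_neg (by omega)]
    refine mul_le_of_le_one_right' ?_
    refine Finset.prod_le_one' fun i _ => ?_
    split_ifs
    · exact le_rfl
    · exact hq1 i
  have hqminle : qmin ≤ 1 := Finset.prod_le_one' fun i _ => by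
    split_ifs
    · exact le_rfl
    · exact hq1 i
  refine ⟨qmin ^ (M * J) * 2⁻¹, ENNReal.mul_pos (pow_ne_zero _ hqmin0.ne') (by simp), fun w s hs => ?_⟩
  set F := s.live.filter fun l => s.pos l < s.front with hF
  have hset : {ρ | crossing α' s ρ = ⊤} = {ρ : Sample a | ∀ l ∈ F, seqOf ρ l ∈ {x | crossTime α' x (s.front - s.pos l) = ⊤}} := by
    ext ρ
    simp only [Set.mem_ofPred_eq, crossing, iInf_eq_top]
    rfl
  -- At most `M J` particles are near, and each of them has probability at least `qmin` not to overtake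
  -- the line.
  set near := F.filter fun l => s.front - s.pos l < J with hnear
  set far := F.filter fun l => ¬ s.front - s.pos l < J with hfar
  rw [hset, walkMeasure_forall_mem F _ (fun l => hms _),
    ← Finset.prod_filter_mul_prod_filter_not F fun l => s.front - s.pos l < J]
  refine mul_le_mul' ?_ ?_
  · have hcard : near.card ≤ M * J := by
      have h1 : near ⊆ (Finset.range J).biUnion fun j => s.live.filter fun l => s.pos l = s.front - j := by
        intro l hl
        rw [hnear, Finset.mem_filter, hF, Finset.mem_filter] at hl
        rw [Finset.mem_biUnion]
        refine ⟨(s.front - s.pos l).toNat, Finset.mem_range.2 (by omega), Finset.mem_filter.2 ⟨hl.1.1, by omega⟩⟩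
      refine (Finset.card_le_card h1).trans (Finset.card_biUnion_le.trans ?_)
      refine (Finset.sum_le_card_nsmul _ _ M fun j _ => hs.count_le _).trans (le_of_eq ?_)
      rw [Finset.card_range, smul_eq_mul, mul_comm]
    calc qmin ^ (M * J) ≤ qmin ^ near.card := pow_le_pow_right_of_le_one' hqminle hcard
      _ = ∏ _l ∈ near, qmin := by rw [Finset.prod_const]
      _ ≤ _ := by
          refine Finset.prod_le_prod' fun l hl => ?_
          rw [hnear, Finset.mem_filter, hF, Finset.mem_filter] at hl
          have h1 := hqmin1 (s.front - s.pos l).toNat (by omega) (by omega)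
          have e : (((s.front - s.pos l).toNat : ℕ) : ℤ) = s.front - s.pos l := by omega
          simp only [hq, e] at h1
          exact h1
  · rw [← walkMeasure_forall_mem far (fun l => {x | crossTime α' x (s.front - s.pos l) = ⊤}) (fun l => hms _)]
    have hcompl : {ρ : Sample a | ∀ l ∈ far, seqOf ρ l ∈ {x | crossTime α' x (s.front - s.pos l) = ⊤}}ᶜ ⊆
        ⋃ l ∈ far, (fun ρ : Sample a => seqOf ρ l) ⁻¹' {x | crossTime α' x (s.front - s.pos l) = ⊤}ᶜ := by
      intro ρ hρ
      simp only [Set.mem_compl_iff, Set.mem_ofPred_eq, not_forall] at hρ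
      obtain ⟨l, hl, h1⟩ := hρ
      simp only [Set.mem_iUnion]
      exact ⟨l, hl, h1⟩
    have hmeas : MeasurableSet {ρ : Sample a | ∀ l ∈ far, seqOf ρ l ∈ {x | crossTime α' x (s.front - s.pos l) = ⊤}} := by
      simp only [Set.ofPred_forall]
      exact Finset.measurableSet_biInter _ fun l _ => measurable_seqOf l (hms _)
    have hbad : walkMeasure a {ρ : Sample a | ∀ l ∈ far, seqOf ρ l ∈ {x | crossTime α' x (s.front - s.pos l) = ⊤}}ᶜ ≤ 2⁻¹ := by
      calc _ ≤ ∑ l ∈ far, walkMeasure a ((fun ρ : Sample a => seqOf ρ l) ⁻¹' {x | crossTime α' x (s.front - s.pos l) = ⊤}ᶜ) :=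
            (measure_mono hcompl).trans (measure_biUnion_finset_le _ _)
        _ ≤ ∑ l ∈ far, ENNReal.ofReal (C * Real.exp (-(θ * (s.front - s.pos l).toNat))) := by
            refine Finset.sum_le_sum fun l hl => ?_
            rw [(measurePreserving_seqOf l).measure_preimage (hms _).compl.nullMeasurableSet]
            rw [hfar, Finset.mem_filter, hF, Finset.mem_filter] at hl
            have e : (((s.front - s.pos l).toNat : ℕ) : ℝ) = ((s.front - s.pos l : ℤ) : ℝ) := by
              have h5 : (((s.front - s.pos l).toNat : ℕ) : ℤ) = s.front - s.pos l := by omega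
              exact_mod_cast h5
            have h1 := hb (s.front - s.pos l) 0
            rw [mul_zero, neg_zero, Real.exp_zero, mul_one] at h1
            rw [e]
            refine le_trans (measure_mono_ae ?_) h1
            filter_upwards [ae_goodSeq] with x hx hx1
            obtain ⟨n, hn⟩ := (crossTime_ne_top_iff α' x (s.front - s.pos l)).1 hx1
            exact ⟨n, hx.jumpSum_nonneg n, hn⟩
        _ ≤ ∑ l ∈ s.live, (if J ≤ (s.front - s.pos l).toNat then ENNReal.ofReal (C * Real.exp (-(θ * (s.front - s.pos l).toNat))) else 0) := by
            have : far ⊆ s.live := fun l hl => (Finset.mem_filter.1 (Finset.mem_filter.1 hl).1).1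
            refine le_trans (Finset.sum_le_sum fun l hl => ?_) (Finset.sum_le_sum_of_subset this)
            rw [hfar, Finset.mem_filter] at hl
            rw [if_pos (by omega)]
        _ ≤ M * ∑' n : ℕ, (if J ≤ n then ENNReal.ofReal (C * Real.exp (-(θ * n))) else 0) :=
            hs.sum_live_le fun n => if J ≤ n then ENNReal.ofReal (C * Real.exp (-(θ * n))) else 0
        _ ≤ 2⁻¹ := by
            refine le_trans (le_of_eq ?_) hJ
            congr 1
            rw [← ENNReal.summable.sum_add_tsum_nat_add' (k := J), Finset.sum_eq_zero, zero_add]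
            · refine tsum_congr fun n => ?_
              rw [if_pos (by omega)]
            · intro n hn
              rw [if_neg (by have := Finset.mem_range.1 hn; omega)]
    rw [prob_compl_eq_one_sub hmeas] at hbad
    have h1 : (1 : ℝ≥0∞) ≤ 2⁻¹ + walkMeasure a {ρ : Sample a | ∀ l ∈ far, seqOf ρ l ∈ {x | crossTime α' x (s.front - s.pos l) = ⊤}} :=
      tsub_le_iff_right.1 hbad
    have h2 : (1 : ℝ≥0∞) = 2⁻¹ + 2⁻¹ := (ENNReal.inv_two_add_inv_two).symm
    rw [h2] at h1
    exact (ENNReal.add_le_add_iff_left (by simp)).1 h1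


/-! ### The strong Markov property at the time when a site is reached -/

variable {M : ℕ} {w : State a}

/-- The function `F` depends only on what happens up to the time when the front reaches `y`. -/
def DeterminedAt (M : ℕ) (w : State a) (y : ℤ) (F : Sample a → ℝ≥0∞) : Prop :=
  ∀ ω ω', Run M w ω → Run M w ω' → ∀ n, (hist M w ω n).1 ∈ reach M w y → hist M w ω n = hist M w ω' n → F ω = F ω'

theorem Run.reach_le {ω : Sample a} (h : Run M w ω) {x y : ℤ} (hxy : x ≤ y) {m n : ℕ}
    (hm : (hist M w ω m).1 ∈ reach M w x) (hn : (hist M w ω n).1 ∈ reach M w y) : m ≤ n := by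
  by_contra hlt
  have h1 := (h.mem_reach_iff.1 hm).2 n (not_le.1 hlt)
  have h2 := (h.mem_reach_iff.1 hn).1
  omega

theorem jumpTime_congr {ω ω' : Sample a} {n : ℕ} (e : hist M w ω n = hist M w ω' n) :
    jumpTime M w ω n = jumpTime M w ω' n := by
  unfold jumpTime; rw [e]

theorem DeterminedAt.mono {x y : ℤ} (hxy : x ≤ y) {F : Sample a → ℝ≥0∞} (hF : DeterminedAt M w x F) :
    DeterminedAt M w y F := by
  intro ω ω' h h' n hn e
  obtain ⟨m, hm⟩ := h.exists_reach x
  exact hF ω ω' h h' m hm (h.hist_eq_of_le h' (h.reach_le hxy hm hn) e)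

theorem DeterminedAt.comp₂ {y : ℤ} {F G : Sample a → ℝ≥0∞} (hF : DeterminedAt M w y F) (hG : DeterminedAt M w y G)
    (f : ℝ≥0∞ → ℝ≥0∞ → ℝ≥0∞) : DeterminedAt M w y fun ω => f (F ω) (G ω) := by
  intro ω ω' h h' n hn e
  simp only [hF ω ω' h h' n hn e, hG ω ω' h h' n hn e]

theorem determinedAt_hitTime (y : ℤ) : DeterminedAt M w y fun ω => hitTime M (walks ω) w (y : ℤ) := by
  intro ω ω' h h' n hn e
  simp only
  rw [h.hitTime_eq hn, h'.hitTime_eq (e ▸ hn), jumpTime_congr e]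

/-- A sum over all jumps that charges only the one at which `y` is reached. -/
theorem Run.tsum_reach {ω : Sample a} (h : Run M w ω) {y : ℤ} {n : ℕ} (hn : (hist M w ω n).1 ∈ reach M w y)
    (g : ℕ → Jumps a → ℝ≥0∞) :
    ∑' m, (reach M w y).indicator (g m) (hist M w ω m).1 = g n (hist M w ω n).1 := by
  rw [tsum_eq_single n, Set.indicator_of_mem hn]
  intro m hm
  exact Set.indicator_of_notMem (fun hm' => hm (h.reach_unique hm' hn)) _

theorem activeLabels_nonempty_of_run (hR : ∀ᵐ ω ∂(walkMeasure a), Run M w ω) (d : Jumps a) :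
    (activeLabels M w d).Nonempty := by
  obtain ⟨ω, h⟩ := hR.exists
  exact activeLabels_nonempty h.nonempty d

theorem sound_of_run (hR : ∀ᵐ ω ∂(walkMeasure a), Run M w ω) (d : Jumps a) : Sound M w (stateAfter M w d) := by
  obtain ⟨ω, h⟩ := hR.exists
  exact sound_stateAfter h.two_le h.le h.init.1 d

/-- A function of the history up to the time when `y` is reached and of the remaining walks is
measurable. -/
theorem aemeasurable_of_reach (hR : ∀ᵐ ω ∂(walkMeasure a), Run M w ω) {y : ℤ} {X : Sample a → ℝ≥0∞}
    {G : Jumps a → Sample a → ℝ≥0∞} (hG : ∀ d, AEMeasurable (G d) (walkMeasure a))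
    (hX : ∀ ω n, Run M w ω → (hist M w ω n).1 ∈ reach M w y → X ω = G (hist M w ω n).1 (rest M w ω n)) :
    AEMeasurable X (walkMeasure a) := by
  refine AEMeasurable.congr (f := fun ω => ∑' n, (reach M w y).indicator
    (fun d => (hG d).mk _ (rest M w ω n)) (hist M w ω n).1) ?_ ?_
  · refine Measurable.aemeasurable (Measurable.tsum fun n => ?_)
    have h1 : Measurable fun q : Jumps a × Sample a =>
        (reach M w y).indicator (fun d => (hG d).mk _ q.2) q.1 := by
      refine measurable_from_prod_countable_right fun d => ?_
      by_cases hd : d ∈ reach M w y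
      · simp only [Set.indicator_of_mem hd]; exact (hG d).measurable_mk
      · simp only [Set.indicator_of_notMem hd]; exact measurable_const
    have h2 := measurable_exploration (act := activeLabels M w) n
    exact h1.comp (h2.fst.fst.prodMk h2.snd)
  · have hq : ∀ᵐ ω ∂(walkMeasure a), ∀ n d, G d (rest M w ω n) = (hG d).mk _ (rest M w ω n) := by
      rw [ae_all_iff]; intro n
      rw [ae_all_iff]
      exact fun d => (measurePreserving_residual (activeLabels_nonempty_of_run hR) n).quasiMeasurePreserving.ae (hG d).ae_eq_mk
    filter_upwards [hR, hq] with ω h h1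
    obtain ⟨n, hn⟩ := h.exists_reach y
    rw [h.tsum_reach hn (fun m d => (hG d).mk _ (rest M w ω m)), hX ω n h hn, h1]

theorem aemeasurable_hitTime (hR : ∀ᵐ ω ∂(walkMeasure a), Run M w ω) (y : ℤ) :
    AEMeasurable (fun ω => hitTime M (walks ω) w (y : ℤ)) (walkMeasure a) := by
  refine AEMeasurable.congr (f := fun ω => ∑' n, (reach M w y).indicator
    (fun _ => ((jumpTime M w ω n : ℝ≥0) : ℝ≥0∞)) (hist M w ω n).1) ?_ ?_
  · refine Measurable.aemeasurable (Measurable.tsum fun n => ?_)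
    have h2 := measurable_exploration (act := activeLabels M w) n
    have hj : Measurable fun ω : Sample a => ((jumpTime M w ω n : ℝ≥0) : ℝ≥0∞) :=
      ((measurable_clock.comp h2.fst).real_toNNReal).coe_nnreal_ennreal
    have hms : MeasurableSet {ω : Sample a | (hist M w ω n).1 ∈ reach M w y} :=
      h2.fst.fst MeasurableSpace.measurableSet_top
    have e : (fun ω : Sample a => (reach M w y).indicator (fun _ => ((jumpTime M w ω n : ℝ≥0) : ℝ≥0∞)) (hist M w ω n).1) =
        {ω : Sample a | (hist M w ω n).1 ∈ reach M w y}.indicator fun ω => ((jumpTime M w ω n : ℝ≥0) : ℝ≥0∞) := by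
      funext ω
      by_cases hd : (hist M w ω n).1 ∈ reach M w y
      · rw [Set.indicator_of_mem hd, Set.indicator_of_mem (by exact hd)]
      · rw [Set.indicator_of_notMem hd, Set.indicator_of_notMem (by exact hd)]
    rw [e]
    exact hj.indicator hms
  · filter_upwards [hR] with ω h
    obtain ⟨n, hn⟩ := h.exists_reach y
    rw [h.tsum_reach hn (fun m _ => ((jumpTime M w ω m : ℝ≥0) : ℝ≥0∞)), h.hitTime_eq hn]

/-- A bound on the conditional expectation, given the history up to the time when `y` is reached. -/
theorem lintegral_mul_le_of_reach (hR : ∀ᵐ ω ∂(walkMeasure a), Run M w ω) {y : ℤ} {F X : Sample a → ℝ≥0∞}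
    (hF : AEMeasurable F (walkMeasure a)) (hdet : DeterminedAt M w y F)
    {G : Jumps a → Sample a → ℝ≥0∞} (hG : ∀ d, AEMeasurable (G d) (walkMeasure a))
    (hX : ∀ ω n, Run M w ω → (hist M w ω n).1 ∈ reach M w y → X ω ≤ G (hist M w ω n).1 (rest M w ω n))
    {c : ℝ≥0∞} (hc : ∀ d ∈ reach M w y, ∫⁻ ρ, G d ρ ∂(walkMeasure a) ≤ c) :
    ∫⁻ ω, F ω * X ω ∂(walkMeasure a) ≤ c * ∫⁻ ω, F ω ∂(walkMeasure a) := by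
  have key := lintegral_strong_markov (activeLabels_nonempty_of_run hR) (reach M w y) hF (S := {ω | Run M w ω}) hR
    (fun ω h ω' h' n hn e => hdet ω ω' h h' n hn e) hG
  calc ∫⁻ ω, F ω * X ω ∂(walkMeasure a)
      ≤ ∫⁻ ω, F ω * ∑' n, (reach M w y).indicator (fun d => G d (rest M w ω n)) (hist M w ω n).1 ∂(walkMeasure a) := by
        refine lintegral_mono_ae ?_
        filter_upwards [hR] with ω h
        obtain ⟨n, hn⟩ := h.exists_reach y
        rw [h.tsum_reach hn (fun m d => G d (rest M w ω m))]
        exact mul_le_mul_right (hX ω n h hn) _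
    _ = _ := key
    _ ≤ ∫⁻ ω, F ω * c ∂(walkMeasure a) := by
        refine lintegral_mono_ae ?_
        filter_upwards [hR] with ω h
        obtain ⟨n, hn⟩ := h.exists_reach y
        have := h.tsum_reach hn (fun _ d => ∫⁻ ρ, G d ρ ∂(walkMeasure a))
        exact mul_le_mul_right (this.trans_le (hc _ hn)) _
    _ = _ := by rw [lintegral_mul_const'' _ hF, mul_comm]

/-! ### The trials of the regeneration scheme -/

/-- The time `D` at the time when `y` is reached, counted from that time on. -/
def span (M : ℕ) (α' : ℝ) (w : State a) (y : ℤ) (ω : Sample a) : ℝ≥0∞ :=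
  min (timeU M α' (walks ω) (front M (walks ω) w (hitTime M (walks ω) w (y : ℤ)).toNNReal))
    (timeV M α' (walks ω) w (hitTime M (walks ω) w (y : ℤ)).toNNReal)

theorem timeD_hitTime (α' : ℝ) (y : ℤ) (ω : Sample a) :
    timeD M α' (walks ω) w (hitTime M (walks ω) w (y : ℤ)) = hitTime M (walks ω) w (y : ℤ) + span M α' w y ω := rfl

theorem Run.span_reach {ω : Sample a} (h : Run M w ω) {y : ℤ} (hy : 0 < y) {n : ℕ} (hn : (hist M w ω n).1 ∈ reach M w y)
    {α' : ℝ} (hα : 0 < α') : span M α' w y ω =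
      min (timeU M α' (walks (rest M w ω n)) y) (crossing α' (st M w ω n) (rest M w ω n)) := by
  rw [span, h.hitTime_eq hn, ENNReal.toNNReal_coe, h.front_jumpTime, h.front_of_reach hy hn, h.timeU_reach hy hn,
    h.timeV_jumpTime n hα]

/-- When a site is reached, the particles with labels at that site are all there, and so the
particles to the left have smaller labels. -/
theorem site_lt_of_reach (hw : w.front = 0) {y : ℤ} (hy : 0 < y) {d : Jumps a} (hd : d ∈ reach M w y)
    (hs : ∀ d, Sound M w (stateAfter M w d)) {l : Label a} (hl : l ∈ (stateAfter M w d).live)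
    (hpos : (stateAfter M w d).pos l < (stateAfter M w d).front) : l.site < y := by
  obtain ⟨h1, h2⟩ := hd
  match d, h1, h2, hl, hpos with
  | [], h1, _, _, _ => simp only [stateAfter] at h1; omega
  | x :: d, h1, h2, hl, hpos =>
    have h3 := h2 x d rfl
    have e : stateAfter M w (x :: d) = (stateAfter M w d).jump M x := rfl
    rw [e] at h1 hl hpos
    rcases (stateAfter M w d).jump_front M x with h4 | ⟨h4, hlv, hgt⟩
    · omega
    have hsite := ((hs (x :: d)).site_le l hl)
    rw [e] at hsite
    by_contra hlt
    have hl' : l.site = (stateAfter M w d).front + 1 := by omega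
    rw [State.jump_of_lt hlv hgt] at hpos
    simp [hl'] at hpos


/-! ### Estimates for a single trial -/

variable {M : ℕ} {w : State a}

theorem indicator_one_le {α β : Type*} {A : Set α} {B : Set β} {x : α} {y : β} (h : x ∈ A → y ∈ B) :
    A.indicator (1 : α → ℝ≥0∞) x ≤ B.indicator 1 y := by
  by_cases hx : x ∈ A
  · rw [Set.indicator_of_mem hx, Set.indicator_of_mem (h hx)]; exact le_rfl
  · rw [Set.indicator_of_notMem hx]; exact zero_le

theorem expNeg_add_eq {lam : ℝ} (x y : ℝ≥0∞) : expNeg lam (x + y) = expNeg lam x * expNeg lam y := by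
  by_cases hx : x = ⊤
  · simp [hx, expNeg]
  · have := expNeg_add lam (h := x.toReal) ENNReal.toReal_nonneg y
    rw [ENNReal.ofReal_toReal hx] at this
    rw [this]
    congr 1
    rw [expNeg, if_neg hx]

theorem aemeasurable_span (hR : ∀ᵐ ω ∂(walkMeasure a), Run M w ω) (ha : 2 ≤ a) (hM : 4 < M) {y : ℤ} (hy : 0 < y) {α' : ℝ}
    (hα : 0 < α') : AEMeasurable (span M α' w y) (walkMeasure a) :=
  aemeasurable_of_reach hR (G := fun d ρ => min (timeU M α' (walks ρ) y) (crossing α' (stateAfter M w d) ρ))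
    (fun _ => (aemeasurable_timeU ha hM hα y).min (measurable_crossing α' _).aemeasurable)
    fun _ _ h hn => h.span_reach hy hn hα

theorem dependsOn_crossing {α' : ℝ} {s : State a} {y : ℤ} (hs : ∀ l ∈ s.live, s.pos l < s.front → l.site < y) :
    DependsOn (fun ρ : Sample a => crossing α' s ρ) {p | y ≤ p.1.site}ᶜ := by
  intro ρ ρ' h
  simp only [crossing]
  refine iInf_congr fun l => iInf_congr fun hl => ?_
  rw [Finset.mem_filter] at hl
  have : seqOf ρ l = seqOf ρ' l := by
    funext j
    exact h (l, j) (by have := hs l hl.1 hl.2; simp only [Set.mem_compl_iff, Set.mem_ofPred_eq]; omega)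
  rw [this]

/-- Each trial succeeds with a probability that is bounded below, whatever the past. -/
theorem exists_failure_le (ha : 2 ≤ a) (hM : 4 < M) {α' : ℝ} (hα : 0 < α') (hα1 : α' < 1 / meanWait M a) :
    ∃ q : ℝ≥0∞, q < 1 ∧ ∀ w : State a, (∀ᵐ ω ∂(walkMeasure a), Run M w ω) → ∀ y : ℤ, 0 < y →
      ∀ F : Sample a → ℝ≥0∞, AEMeasurable F (walkMeasure a) → DeterminedAt M w y F →
        ∫⁻ ω, F ω * {ω | span M α' w y ω < ⊤}.indicator 1 ω ∂(walkMeasure a) ≤ q * ∫⁻ ω, F ω ∂(walkMeasure a) := by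
  obtain ⟨δ, hδ, hb⟩ := exists_crossing_eq_top (a := a) hα M
  have hU := measure_timeU_eq_top_pos ha hM hα hα1
  set u := walkMeasure a {ω | timeU M α' (walks ω) 0 = ⊤} with hu
  refine ⟨1 - u * δ, ENNReal.sub_lt_self ENNReal.one_ne_top one_ne_zero (mul_ne_zero hU.ne' hδ.ne'), ?_⟩
  intro w hR y hy F hF hdet
  have hw : w.front = 0 := by obtain ⟨ω, h⟩ := hR.exists; exact h.init.2.1
  have hmin : ∀ d, AEMeasurable (fun ρ => min (timeU M α' (walks ρ) y) (crossing α' (stateAfter M w d) ρ)) (walkMeasure a) :=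
    fun d => (aemeasurable_timeU ha hM hα y).min (measurable_crossing α' _).aemeasurable
  have hset : ∀ d, NullMeasurableSet {ρ | min (timeU M α' (walks ρ) y) (crossing α' (stateAfter M w d) ρ) < ⊤} (walkMeasure a) :=
    fun d => nullMeasurableSet_lt (hmin d) aemeasurable_const
  refine lintegral_mul_le_of_reach hR hF hdet
    (G := fun d => {ρ | min (timeU M α' (walks ρ) y) (crossing α' (stateAfter M w d) ρ) < ⊤}.indicator 1)
    (fun d => aemeasurable_const.indicator₀ (hset d)) (fun ω n h hn => ?_) (fun d hd => ?_)
  · refine indicator_one_le fun hω => ?_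
    rw [Set.mem_ofPred_eq, h.span_reach hy hn hα] at hω
    exact hω
  · rw [lintegral_indicator_one₀ (hset d)]
    have hs := sound_of_run hR d
    have hA : NullMeasurableSet {ρ : Sample a | timeU M α' (walks ρ) y = ⊤} (walkMeasure a) :=
      nullMeasurableSet_eq_fun (aemeasurable_timeU ha hM hα y) aemeasurable_const
    have hB : NullMeasurableSet {ρ : Sample a | crossing α' (stateAfter M w d) ρ = ⊤} (walkMeasure a) :=
      (measurable_crossing α' _ (measurableSet_singleton ⊤)).nullMeasurableSet
    -- `U` depends on the walks whose sites are at least `y`, and the particles to the left of the front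
    -- have smaller sites: the two events are independent.
    have hind := measure_inter_of_dependsOn jumpLaw {p : Label a × ℕ | y ≤ p.1.site} hA hB
      (fun ρ ρ' h => by
        have := dependsOn_timeU M α' y h
        simp only [Set.mem_ofPred_eq]
        rw [show timeU M α' (walks ρ) y = timeU M α' (walks ρ') y from this])
      (fun ρ ρ' h => by
        have := dependsOn_crossing (α' := α') (fun l hl hp => site_lt_of_reach hw hy hd (sound_of_run hR) hl hp) h
        simp only [Set.mem_ofPred_eq]
        rw [show crossing α' _ ρ = crossing α' _ ρ' from this])
    have hind' : walkMeasure a ({ρ | timeU M α' (walks ρ) y = ⊤} ∩ {ρ | crossing α' (stateAfter M w d) ρ = ⊤}) =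
      walkMeasure a {ρ | timeU M α' (walks ρ) y = ⊤} * walkMeasure a {ρ | crossing α' (stateAfter M w d) ρ = ⊤} := hind
    rw [measure_timeU_eq_top M ha hM hα y, ← hu] at hind'
    have e : {ρ : Sample a | min (timeU M α' (walks ρ) y) (crossing α' (stateAfter M w d) ρ) < ⊤} =
        ({ρ | timeU M α' (walks ρ) y = ⊤} ∩ {ρ | crossing α' (stateAfter M w d) ρ = ⊤})ᶜ := by
      ext ρ
      simp only [Set.mem_ofPred_eq, Set.mem_compl_iff, Set.mem_inter_iff, lt_top_iff_ne_top, Ne, min_eq_top]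
    rw [e, prob_compl_eq_one_sub₀ (hA.inter hB), hind']
    exact tsub_le_tsub_left (mul_le_mul_right (hb w _ hs) _) _

/-- The front is unlikely to advance fast, whatever the past. -/
theorem exists_fast_le (hM : 0 < M) :
    ∃ c : ℝ, 0 < c ∧ ∀ w : State a, (∀ᵐ ω ∂(walkMeasure a), Run M w ω) → ∀ y : ℤ, 0 < y →
      ∀ F : Sample a → ℝ≥0∞, AEMeasurable F (walkMeasure a) → DeterminedAt M w y F → ∀ j : ℕ,
        ∫⁻ ω, F ω * {ω | hitTime M (walks ω) w ((y + j : ℤ) : WithTop ℤ) ≤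
            hitTime M (walks ω) w (y : ℤ) + ENNReal.ofReal (c * j)}.indicator 1 ω ∂(walkMeasure a) ≤
          ENNReal.ofReal ((3 / 4) ^ j) * ∫⁻ ω, F ω ∂(walkMeasure a) := by
  obtain ⟨lam, hlam, hadv⟩ := exists_laplace_advance (a := a) hM
  -- Then `exp (lam c) = 3 / 2`, and each step contributes the factor `3 / 2 * 1 / 2 = 3 / 4`.
  set c : ℝ := Real.log (3 / 2) / lam with hc
  have hlog : 0 < Real.log (3 / 2) := Real.log_pos (by norm_num)
  refine ⟨c, by positivity, fun w hR y hy F hF hdet j => ?_⟩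
  set T : ℤ → Sample a → ℝ≥0∞ := fun y ω => hitTime M (walks ω) w (y : ℤ) with hT
  have hTm : ∀ y, AEMeasurable (T y) (walkMeasure a) := fun y => aemeasurable_hitTime hR y
  set Φ : ℕ → Sample a → ℝ≥0∞ := fun j ω => F ω * expNeg lam (T (y + j) ω - T y ω) with hΦ
  have hΦm : ∀ j, AEMeasurable (Φ j) (walkMeasure a) := fun j =>
    hF.mul ((measurable_expNeg lam).comp_aemeasurable ((hTm _).sub (hTm _)))
  have hΦd : ∀ j : ℕ, DeterminedAt M w (y + j) (Φ j) := fun j => by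
    have h1 : DeterminedAt M w (y + j) (T y) := (determinedAt_hitTime y).mono (by omega)
    have h2 : DeterminedAt M w (y + j) (T (y + j)) := determinedAt_hitTime _
    exact (hdet.mono (by omega)).comp₂ (h2.comp₂ h1 fun u v => expNeg lam (u - v)) fun u v => u * v
  have hstep : ∀ j, ∫⁻ ω, Φ j ω ∂(walkMeasure a) ≤ ENNReal.ofReal ((1 / 2) ^ j) * ∫⁻ ω, F ω ∂(walkMeasure a) := by
    intro j
    induction j with
    | zero =>
      rw [pow_zero, ENNReal.ofReal_one, one_mul]
      refine lintegral_mono fun ω => ?_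
      simp only [hΦ]
      exact (mul_le_mul_right (expNeg_le_one hlam.le _) _).trans (mul_one _).le
    | succ j ih =>
      set X : Sample a → ℝ≥0∞ := fun ω => expNeg lam (T (y + (j + 1 : ℕ)) ω - T (y + j) ω) with hX
      have h1 : ∫⁻ ω, Φ (j + 1) ω ∂(walkMeasure a) ≤ ∫⁻ ω, Φ j ω * X ω ∂(walkMeasure a) := by
        refine lintegral_mono_ae ?_
        filter_upwards [hR] with ω h
        have e1 : T y ω ≤ T (y + j) ω := hitTime_mono (by omega)
        have e2 : T (y + j) ω ≤ T (y + (j + 1 : ℕ)) ω := hitTime_mono (by push_cast; omega)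
        have e3 : T (y + (j + 1 : ℕ)) ω - T y ω = (T (y + j) ω - T y ω) + (T (y + (j + 1 : ℕ)) ω - T (y + j) ω) := by
          rw [add_comm (T (y + j) ω - T y ω), tsub_add_tsub_cancel e2 e1]
        simp only [hΦ, hX]
        rw [e3, expNeg_add_eq, mul_assoc]
      have h2 := lintegral_mul_le_of_reach hR (hΦm j) (hΦd j) (X := X)
        (G := fun d ρ => expNeg lam (advance (stateAfter M w d) ρ))
        (fun d => ((measurable_expNeg lam).comp (measurable_advance _)).aemeasurable) (fun ω n h hn => by
          obtain ⟨n', hn'⟩ := h.exists_reach (y + (j + 1 : ℕ))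
          have hle := h.advance_le (y := y + j) (by omega) hn (n' := n') (by
            have : y + (j : ℤ) + 1 = y + (j + 1 : ℕ) := by push_cast; ring
            rw [this]; exact hn')
          simp only [hX]
          refine expNeg_antitone hlam.le ?_
          simp only [hT]
          rw [h.hitTime_eq hn, h.hitTime_eq hn']
          exact ENNReal.le_sub_of_add_le_left ENNReal.coe_ne_top hle)
        (fun d _ => hadv w _ (sound_of_run hR d))
      refine h1.trans (h2.trans ((mul_le_mul_right ih _).trans (le_of_eq ?_)))
      rw [← mul_assoc, ← ENNReal.ofReal_mul (by norm_num)]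
      congr 2
      rw [pow_succ]; ring
  have hexp : ENNReal.ofReal (Real.exp (lam * (c * j))) = ENNReal.ofReal ((3 / 2) ^ j) := by
    congr 1
    rw [hc, show lam * (Real.log (3 / 2) / lam * j) = j * Real.log (3 / 2) by field_simp, Real.exp_nat_mul,
      Real.exp_log (by norm_num)]
  calc _ ≤ ∫⁻ ω, ENNReal.ofReal ((3 / 2) ^ j) * Φ j ω ∂(walkMeasure a) := by
        refine lintegral_mono_ae ?_
        filter_upwards [hR] with ω h
        by_cases hω : hitTime M (walks ω) w ((y + j : ℤ) : WithTop ℤ) ≤ hitTime M (walks ω) w (y : ℤ) + ENNReal.ofReal (c * j)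
        · rw [Set.indicator_of_mem (by exact hω), Pi.one_apply]
          simp only [hΦ]
          rw [mul_left_comm]
          refine mul_le_mul_right ?_ _
          rw [← hexp]
          have h1 : T (y + j) ω - T y ω ≤ ENNReal.ofReal (c * j) + 0 := by
            rw [add_zero]; exact tsub_le_iff_left.2 hω
          have h2 := expNeg_antitone hlam.le h1
          rw [expNeg_add lam (by positivity)] at h2
          have h3 : expNeg lam 0 = 1 := by simp [expNeg]
          rw [h3, mul_one] at h2
          calc (1 : ℝ≥0∞) = ENNReal.ofReal (Real.exp (lam * (c * j))) * ENNReal.ofReal (Real.exp (-(lam * (c * j)))) := by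
                rw [← ENNReal.ofReal_mul (Real.exp_pos _).le, ← Real.exp_add, add_neg_cancel, Real.exp_zero, ENNReal.ofReal_one]
            _ ≤ _ := mul_le_mul_right h2 _
        · rw [Set.indicator_of_notMem (by exact hω), mul_zero]; exact zero_le
    _ = ENNReal.ofReal ((3 / 2) ^ j) * ∫⁻ ω, Φ j ω ∂(walkMeasure a) := lintegral_const_mul'' _ (hΦm j)
    _ ≤ ENNReal.ofReal ((3 / 2) ^ j) * (ENNReal.ofReal ((1 / 2) ^ j) * ∫⁻ ω, F ω ∂(walkMeasure a)) :=
        mul_le_mul_right (hstep j) _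
    _ = _ := by
        rw [← mul_assoc, ← ENNReal.ofReal_mul (by positivity), ← mul_pow]
        norm_num

/-- A failed trial is unlikely to let the front advance far: otherwise the front moves fast, or the trial
lasts long before it fails. -/
theorem exists_late_failure_le (ha : 2 ≤ a) (hM : 4 < M) {α' : ℝ} (hα : 0 < α') (hα1 : α' < 1 / meanWait M a) :
    ∃ C : ℝ, 0 ≤ C ∧ ∀ w : State a, (∀ᵐ ω ∂(walkMeasure a), Run M w ω) → ∀ y : ℤ, 0 < y →
      ∀ F : Sample a → ℝ≥0∞, AEMeasurable F (walkMeasure a) → DeterminedAt M w y F → ∀ j : ℕ, 1 ≤ j →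
        ∫⁻ ω, F ω * {ω | span M α' w y ω < ⊤ ∧ hitTime M (walks ω) w ((y + j : ℤ) : WithTop ℤ) ≤
            hitTime M (walks ω) w (y : ℤ) + span M α' w y ω}.indicator 1 ω ∂(walkMeasure a) ≤
          ENNReal.ofReal (C * (j : ℝ) ^ (-((M : ℝ) / 4))) * ∫⁻ ω, F ω ∂(walkMeasure a) := by
  obtain ⟨c, hc, hfast⟩ := exists_fast_le (a := a) (M := M) (by omega)
  obtain ⟨C₁, hC₁, hU⟩ := exists_timeU_bound ha hM hα hα1
  obtain ⟨C₂, c₂, hC₂, hc₂, hV⟩ := exists_crossing_tail (a := a) hα M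
  obtain ⟨C₃, hC₃, hexp₃⟩ := exp_neg_rpow_le (c := c₂ * c) (by positivity) M
  obtain ⟨C₄, hC₄, hexp₄⟩ := exp_neg_rpow_le (c := -Real.log (3 / 4)) (by
    have := Real.log_neg (x := 3 / 4) (by norm_num) (by norm_num); linarith) M
  have hpow : ∀ j : ℕ, 1 ≤ j → (j : ℝ) ^ (-(M : ℝ)) ≤ (j : ℝ) ^ (-((M : ℝ) / 4)) := fun j hj => by
    apply Real.rpow_le_rpow_of_exponent_le (by exact_mod_cast hj)
    have : (0 : ℝ) ≤ M := by positivity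
    linarith
  have hroot : ∀ j : ℕ, 1 ≤ j → (j : ℝ) ^ (1 / 20 : ℝ) ≤ j := fun j hj => by
    conv_rhs => rw [← Real.rpow_one (j : ℝ)]
    exact Real.rpow_le_rpow_of_exponent_le (by exact_mod_cast hj) (by norm_num)
  refine ⟨C₄ + (C₁ * c ^ (-((M : ℝ) / 4)) + C₂ * C₃), by positivity, fun w hR y hy F hF hdet j hj => ?_⟩
  have hj0 : (0 : ℝ) < j := by exact_mod_cast hj
  have hcj : 0 < c * j := by positivity
  have hmin : ∀ d, AEMeasurable (fun ρ => min (timeU M α' (walks ρ) y) (crossing α' (stateAfter M w d) ρ)) (walkMeasure a) :=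
    fun d => (aemeasurable_timeU ha hM hα y).min (measurable_crossing α' _).aemeasurable
  have hset : ∀ d, NullMeasurableSet {ρ | ENNReal.ofReal (c * j) < min (timeU M α' (walks ρ) y) (crossing α' (stateAfter M w d) ρ) ∧
      min (timeU M α' (walks ρ) y) (crossing α' (stateAfter M w d) ρ) < ⊤} (walkMeasure a) :=
    fun d => (nullMeasurableSet_lt aemeasurable_const (hmin d)).inter (nullMeasurableSet_lt (hmin d) aemeasurable_const)
  have hlate := lintegral_mul_le_of_reach hR hF hdet
    (X := {ω | ENNReal.ofReal (c * j) < span M α' w y ω ∧ span M α' w y ω < ⊤}.indicator 1)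
    (G := fun d => {ρ | ENNReal.ofReal (c * j) < min (timeU M α' (walks ρ) y) (crossing α' (stateAfter M w d) ρ) ∧
      min (timeU M α' (walks ρ) y) (crossing α' (stateAfter M w d) ρ) < ⊤}.indicator 1)
    (fun d => aemeasurable_const.indicator₀ (hset d))
    (fun ω n h hn => by
      refine indicator_one_le fun hω => ?_
      rw [Set.mem_ofPred_eq, h.span_reach hy hn hα] at hω
      exact hω)
    (c := ENNReal.ofReal (C₁ * (c * j) ^ (-((M : ℝ) / 4))) + ENNReal.ofReal (C₂ * Real.exp (-(c₂ * (c * j)))))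
    (fun d _ => by
      rw [lintegral_indicator_one₀ (hset d)]
      refine (measure_mono ?_).trans ((measure_union_le _ _).trans (add_le_add (hU y (c * j) hcj)
        (hV w _ (sound_of_run hR d) (c * j))))
      rintro ρ ⟨h1, h2⟩
      rw [lt_min_iff] at h1
      rcases min_lt_iff.1 h2 with h2 | h2
      · exact Or.inl ⟨h1.1, h2⟩
      · exact Or.inr ⟨h1.2, h2⟩)
  have hfast' := hfast w hR y hy F hF hdet j
  have hTm := fun y => aemeasurable_hitTime hR y
  have hm1 : AEMeasurable (fun ω => F ω * {ω | hitTime M (walks ω) w ((y + j : ℤ) : WithTop ℤ) ≤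
      hitTime M (walks ω) w (y : ℤ) + ENNReal.ofReal (c * j)}.indicator 1 ω) (walkMeasure a) :=
    hF.mul (aemeasurable_const.indicator₀ (nullMeasurableSet_le (hTm _) ((hTm _).add aemeasurable_const)))
  -- Either the front needs less than `c j` for `j` sites, or the trial lasts longer than `c j`.
  have hsum : ∫⁻ ω, F ω * {ω | span M α' w y ω < ⊤ ∧ hitTime M (walks ω) w ((y + j : ℤ) : WithTop ℤ) ≤
            hitTime M (walks ω) w (y : ℤ) + span M α' w y ω}.indicator 1 ω ∂(walkMeasure a) ≤
      ∫⁻ ω, F ω * {ω | hitTime M (walks ω) w ((y + j : ℤ) : WithTop ℤ) ≤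
            hitTime M (walks ω) w (y : ℤ) + ENNReal.ofReal (c * j)}.indicator 1 ω ∂(walkMeasure a) +
      ∫⁻ ω, F ω * {ω | ENNReal.ofReal (c * j) < span M α' w y ω ∧ span M α' w y ω < ⊤}.indicator 1 ω ∂(walkMeasure a) := by
    rw [← lintegral_add_left' hm1]
    refine lintegral_mono fun ω => ?_
    rw [← mul_add]
    refine mul_le_mul_right ?_ _
    by_cases hω : span M α' w y ω < ⊤ ∧ hitTime M (walks ω) w ((y + j : ℤ) : WithTop ℤ) ≤
            hitTime M (walks ω) w (y : ℤ) + span M α' w y ω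
    · rw [Set.indicator_of_mem (by exact hω), Pi.one_apply]
      by_cases h2 : span M α' w y ω ≤ ENNReal.ofReal (c * j)
      · rw [Set.indicator_of_mem (by exact hω.2.trans (add_le_add_right h2 _)), Pi.one_apply]
        exact le_self_add
      · rw [Set.indicator_of_mem (s := {ω | ENNReal.ofReal (c * j) < span M α' w y ω ∧ span M α' w y ω < ⊤})
          ⟨not_le.1 h2, hω.1⟩, Pi.one_apply]
        exact le_add_self
    · rw [Set.indicator_of_notMem (by exact hω)]; exact zero_le
  refine hsum.trans ((add_le_add hfast' hlate).trans ?_)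
  rw [← add_mul]
  refine mul_le_mul_left ?_ _
  rw [← ENNReal.ofReal_add (by positivity) (by positivity), ← ENNReal.ofReal_add (by positivity) (by positivity)]
  apply ENNReal.ofReal_le_ofReal
  have e1 : (3 / 4 : ℝ) ^ j ≤ C₄ * (j : ℝ) ^ (-((M : ℝ) / 4)) := by
    have h1 : (3 / 4 : ℝ) ^ j = Real.exp (-(-Real.log (3 / 4) * j)) := by
      rw [neg_mul, neg_neg, mul_comm, Real.exp_nat_mul, Real.exp_log (by norm_num)]
    rw [h1]
    have hl := Real.log_neg (x := 3 / 4) (by norm_num) (by norm_num)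
    refine le_trans ?_ ((hexp₄ j hj).trans (mul_le_mul_of_nonneg_left (hpow j hj) hC₄))
    rw [Real.exp_le_exp]
    nlinarith [hroot j hj]
  have e2 : C₂ * Real.exp (-(c₂ * (c * j))) ≤ C₂ * C₃ * (j : ℝ) ^ (-((M : ℝ) / 4)) := by
    rw [mul_assoc]
    refine mul_le_mul_of_nonneg_left ?_ hC₂
    refine le_trans ?_ ((hexp₃ j hj).trans (mul_le_mul_of_nonneg_left (hpow j hj) hC₃))
    rw [Real.exp_le_exp, ← mul_assoc]
    have : 0 < c₂ * c := by positivity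
    nlinarith [hroot j hj]
  have e3 : C₁ * (c * j) ^ (-((M : ℝ) / 4)) = C₁ * c ^ (-((M : ℝ) / 4)) * (j : ℝ) ^ (-((M : ℝ) / 4)) := by
    rw [Real.mul_rpow hc.le hj0.le]; ring
  rw [e3, add_mul, add_mul]
  linarith


/-! ### A trial that ends before a site is reached is part of the history -/

variable {M : ℕ} {w : State a} {ω ω' : Sample a}

/-- Waiting times of the auxiliary front that end before the current time are part of the history,
because the walks involved have been activated early enough. -/
theorem Run.auxTime_le_of_hist_eq (h : Run M w ω) (h' : Run M w ω') {n : ℕ} (e : hist M w ω n = hist M w ω' n)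
    {z : ℤ} (hz : 0 ≤ z) {N : ℕ}
    (hlt : hitTime M (walks ω') w (z : ℤ) + auxTime M z N ω' < jumpTime M w ω' n) :
    auxTime M z N ω ≤ auxTime M z N ω' := by
  rw [h.goodSample.auxTime_eq, h'.goodSample.auxTime_eq] at *
  induction N with
  | zero => simp
  | succ N ih =>
    rw [Finset.sum_range_succ] at hlt
    rw [Finset.sum_range_succ, Finset.sum_range_succ]
    refine add_le_add (ih (lt_of_le_of_lt (add_le_add_right le_self_add _) hlt)) ?_
    rw [← add_assoc] at hlt
    by_contra hcon
    rw [not_le] at hcon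
    have h1 : wait M z (z + N) ω' < min (wait M z (z + N) ω) (jumpTime M w ω' n -
        (hitTime M (walks ω') w (z : ℤ) + ∑ i ∈ Finset.range N, wait M z (z + i) ω')) :=
      lt_min hcon (lt_tsub_iff_left.2 hlt)
    conv_lhs at h1 => rw [wait]
    obtain ⟨l, h1⟩ := iInf_lt_iff.1 h1
    obtain ⟨hl, h1⟩ := iInf_lt_iff.1 h1
    obtain ⟨h2, h3⟩ := lt_min_iff.1 h1
    have hne : hit (seqOf ω' l) (z + N + 1 - l.site) ≠ ⊤ := (h2.trans_le le_top).ne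
    obtain ⟨u, hu⟩ : ∃ u : ℝ≥0, (u : ℝ≥0∞) = hit (seqOf ω' l) (z + N + 1 - l.site) := ⟨_, ENNReal.coe_toNNReal hne⟩
    have hpath := (h'.goodSample.seq l).path_hit hne
    rw [← hu, ENNReal.toNNReal_coe] at hpath
    rw [← hu] at h2 h3
    have h3' := lt_tsub_iff_left.1 h3
    obtain ⟨k, hk⟩ : ∃ k : ℕ, l.site = z + k := ⟨(l.site - z).toNat, by have := hl.1; omega⟩
    have hkN : k ≤ N := by have := hl.2.1; omega
    -- The walk `l` starts no later than the auxiliary front reaches its site, so that its path up to the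
    -- time `u` is part of the history.
    have hT : hitTime M (walks ω') w (l.site : ℤ) ≤
        hitTime M (walks ω') w (z : ℤ) + ∑ i ∈ Finset.range N, wait M z (z + i) ω' := by
      rw [hk, ← h'.goodSample.auxTime_eq]
      exact (h'.hitTime_le_auxTime hz k).trans (add_le_add_right (auxTime_mono M z ω' hkN) _)
    have hage : hitTime M (walks ω') w (l.site : ℤ) + u ≤ jumpTime M w ω' n := (add_le_add_left hT _).trans h3'.le
    have hact : l ∈ activeLabels M w (hist M w ω' n).1 := by
      rw [h'.mem_act_iff (by omega), ← h'.front_jumpTime, h'.le_front_iff]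
      exact le_self_add.trans hage
    rw [← (h'.birth_eq (by omega) hact).1] at hage
    have hage' : (cfg M w ω' n).birth l + u ≤ jumpTime M w ω' n := by exact_mod_cast hage
    have hp := h'.path_eq_of_hist_eq h e.symm hact (s := u) (le_tsub_of_add_le_left hage')
    have := (h.goodSample.seq l).hit_le (hp.symm.trans hpath)
    have h4 : wait M z (z + N) ω ≤ u := le_trans (by rw [wait]; exact iInf₂_le l hl) this
    exact absurd h2 (not_lt.2 h4)

theorem Run.span_eq (h : Run M w ω) {y : ℤ} (hy : 0 < y) {n : ℕ} (hn : (hist M w ω n).1 ∈ reach M w y)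
    {α' : ℝ} (hα : 0 < α') : span M α' w y ω =
      min (timeU M α' (walks ω) y) (crossing α' (st M w ω n) (rest M w ω n)) := by
  rw [h.span_reach hy hn hα, h.timeU_reach hy hn]

/-- If the trial at `z` ends before the time when `y` is reached, then its end is the same for
all continuations of the history. -/
theorem Run.span_le_of_hist_eq (h : Run M w ω) (h' : Run M w ω') {n : ℕ} (e : hist M w ω n = hist M w ω' n)
    {y z : ℤ} (hz : 0 < z) (hzy : z ≤ y) (hn : (hist M w ω n).1 ∈ reach M w y) {α' : ℝ} (hα : 0 < α')
    (hlt : hitTime M (walks ω) w (z : ℤ) + span M α' w z ω < hitTime M (walks ω) w (y : ℤ)) :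
    span M α' w z ω' ≤ span M α' w z ω := by
  obtain ⟨m, hm⟩ := h.exists_reach z
  have hmn := h.reach_le hzy hm hn
  have em := h.hist_eq_of_le h' hmn e
  have hm' : (hist M w ω' m).1 ∈ reach M w z := em ▸ hm
  have hTn := jumpTime_congr e
  have hTm := jumpTime_congr em
  rw [h.hitTime_eq hm, h.hitTime_eq hn] at hlt
  rw [h.span_eq hz hm hα] at hlt ⊢
  rw [h'.span_eq hz hm' hα]
  have hst : st M w ω m = st M w ω' m := by simp only [st, em]
  by_contra hcon
  rw [not_le] at hcon
  have h1 := lt_min hcon (lt_tsub_iff_left.2 hlt)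
  rcases min_lt_iff.1 h1 with h1 | h1
  -- The trial is ended by `U`.
  · rw [(h.noExplosion z).timeU_eq hα] at h1
    obtain ⟨N, h1⟩ := iInf_lt_iff.1 h1
    obtain ⟨hN, h1⟩ := iInf_lt_iff.1 h1
    obtain ⟨h2, h3⟩ := lt_min_iff.1 h1
    have h4 : auxTime M z N ω' ≤ ENNReal.ofReal (N / α') := by
      by_contra h5
      have h6 : timeU M α' (walks ω') z ≤ ENNReal.ofReal (N / α') := by
        rw [(h'.noExplosion z).timeU_eq hα]
        exact iInf₂_le (f := fun (n : ℕ) (_ : ENNReal.ofReal (n / α') < auxTime M z n ω') => ENNReal.ofReal (n / α'))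
          N (not_le.1 h5)
      exact absurd h2 (not_lt.2 ((min_le_left _ _).trans h6))
    have h5 := h.auxTime_le_of_hist_eq h' e hz.le (N := N) (by
      rw [h'.hitTime_eq hm', ← hTn, ← hTm]
      exact lt_of_le_of_lt (add_le_add_right h4 _) (lt_tsub_iff_left.1 h3))
    exact absurd hN (not_lt.2 (h5.trans h4))
  -- The trial is ended by `V`, by a particle whose walk is part of the history.
  · unfold crossing at h1
    obtain ⟨l, h1⟩ := iInf_lt_iff.1 h1
    obtain ⟨hl, h1⟩ := iInf_lt_iff.1 h1
    rw [((h.run.good m).seq l).crossTime_eq hα] at h1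
    obtain ⟨t, h1⟩ := iInf_lt_iff.1 h1
    obtain ⟨ht, h1⟩ := iInf_lt_iff.1 h1
    obtain ⟨h2, h3⟩ := lt_min_iff.1 h1
    have h3' := lt_tsub_iff_left.1 h3
    have hact := h.live_subset_act (Finset.mem_filter.1 hl).1
    have hact' : l ∈ activeLabels M w (hist M w ω' m).1 := by rw [← em]; exact hact
    have hactn := h.act_mono hmn hact
    have hb := (h.birth_mono hmn hact).1
    have hbm := (h.tracks m).birth_le l hact
    have hb' : (cfg M w ω m).birth l = (cfg M w ω' m).birth l := by
      change (configAfter M w _ _).birth l = (configAfter M w _ _).birth l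
      rw [em]
    have htn : jumpTime M w ω m + t ≤ jumpTime M w ω n := by exact_mod_cast h3'.le
    have p1 := h.path_eq_of_hist_eq h' e hactn (s := jumpTime M w ω m - (cfg M w ω m).birth l + t) (by
      rw [hb, tsub_add_eq_add_tsub hbm]; exact tsub_le_tsub_right htn _)
    have p2 := h.path_eq_of_hist_eq h' e hactn (s := jumpTime M w ω m - (cfg M w ω m).birth l) (by
      rw [hb]; exact tsub_le_tsub_right (le_self_add.trans htn) _)
    rw [(h.tracks m).path_add l hact, p2, hTm, hb', (h'.tracks m).path_add l hact', add_right_inj] at p1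
    have h6 : crossing α' (st M w ω' m) (rest M w ω' m) ≤ t := by
      unfold crossing
      rw [← hst]
      refine (iInf₂_le l hl).trans ?_
      rw [((h'.run.good m).seq l).crossTime_eq hα]
      exact iInf₂_le t (by rw [← p1]; exact ht)
    exact absurd h2 (not_lt.2 ((min_le_right _ _).trans h6))

/-! ### The stages of the regeneration scheme -/

/-- The event that the trial number `k + 1` starts at the site `y`. -/
def stage (M : ℕ) (α' : ℝ) (w : State a) (k : ℕ) (y : ℤ) : Set (Sample a) :=
  {ω | seqR M α' (walks ω) w k + ((M : ℤ) : WithTop ℤ) = (y : ℤ)}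

theorem hitTime_top (Y : Walks a) : hitTime M Y w ⊤ = ⊤ := by
  simp [hitTime]

theorem timeD_top (α' : ℝ) (Y : Walks a) : timeD M α' Y w ⊤ = ⊤ := by simp [timeD]

theorem seqR_succ_of_eq_top {α' : ℝ} {k : ℕ} (hk : seqR M α' (walks ω) w k = ⊤) :
    seqR M α' (walks ω) w (k + 1) = ⊤ := by
  rw [seqR, hk, top_add, hitTime_top, timeD_top, frontExt, if_pos rfl]

theorem seqR_succ_of_mem_stage {α' : ℝ} {k : ℕ} {z : ℤ} (hz : ω ∈ stage M α' w k z) :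
    seqR M α' (walks ω) w (k + 1) = frontExt M (walks ω) w (hitTime M (walks ω) w (z : ℤ) + span M α' w z ω) := by
  rw [seqR, show seqR M α' (walks ω) w k + ((M : ℤ) : WithTop ℤ) = (z : ℤ) from hz, timeD_hitTime]

theorem exists_stage_of_ne_top {α' : ℝ} {k : ℕ} (hk : seqR M α' (walks ω) w k ≠ ⊤) : ∃ z, ω ∈ stage M α' w k z := by
  obtain ⟨r, hr⟩ := WithTop.ne_top_iff_exists.1 hk
  exact ⟨r + M, by simp only [stage, Set.mem_ofPred_eq]; rw [← hr, WithTop.coe_add]⟩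

theorem stage_ne_top {α' : ℝ} {k : ℕ} {z : ℤ} (hz : ω ∈ stage M α' w k z) : seqR M α' (walks ω) w k ≠ ⊤ := by
  intro hk
  have : seqR M α' (walks ω) w k + ((M : ℤ) : WithTop ℤ) = (z : ℤ) := hz
  rw [hk, top_add] at this
  exact WithTop.top_ne_coe this

theorem stage_unique {α' : ℝ} {k : ℕ} {y z : ℤ} (hy : ω ∈ stage M α' w k y) (hz : ω ∈ stage M α' w k z) : y = z := by
  have h : ((y : ℤ) : WithTop ℤ) = (z : ℤ) := Eq.trans (Eq.symm hy) hz
  exact WithTop.coe_injective h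

/-- The front is at `x` from the time when `x` is reached until `x + 1` is reached. -/
theorem Run.front_iff (h : Run M w ω) {s : ℝ≥0} {x : ℤ} : front M (walks ω) w s = x ↔
    hitTime M (walks ω) w (x : ℤ) ≤ s ∧ (s : ℝ≥0∞) < hitTime M (walks ω) w ((x + 1 : ℤ) : WithTop ℤ) := by
  rw [← h.le_front_iff, ← not_le, ← h.le_front_iff]
  omega

/-- The next trial starts `M` sites beyond the front at the end of the present one. -/
theorem Run.mem_stage_succ_iff (h : Run M w ω) {α' : ℝ} {k : ℕ} {y : ℤ} : ω ∈ stage M α' w (k + 1) y ↔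
    ∃ z, z ≤ y - M ∧ ω ∈ stage M α' w k z ∧
      hitTime M (walks ω) w ((y - M : ℤ) : WithTop ℤ) ≤ hitTime M (walks ω) w (z : ℤ) + span M α' w z ω ∧
      hitTime M (walks ω) w (z : ℤ) + span M α' w z ω < hitTime M (walks ω) w ((y - M + 1 : ℤ) : WithTop ℤ) := by
  have key : ∀ z, ω ∈ stage M α' w k z → (ω ∈ stage M α' w (k + 1) y ↔
      hitTime M (walks ω) w ((y - M : ℤ) : WithTop ℤ) ≤ hitTime M (walks ω) w (z : ℤ) + span M α' w z ω ∧
      hitTime M (walks ω) w (z : ℤ) + span M α' w z ω < hitTime M (walks ω) w ((y - M + 1 : ℤ) : WithTop ℤ)) := by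
    intro z hz
    simp only [stage, Set.mem_ofPred_eq]
    rw [seqR_succ_of_mem_stage hz]
    by_cases htop : hitTime M (walks ω) w (z : ℤ) + span M α' w z ω = ⊤
    · rw [htop, frontExt, if_pos rfl, top_add]
      simp
    · rw [frontExt, if_neg htop]
      obtain ⟨s, hs⟩ : ∃ s : ℝ≥0, (s : ℝ≥0∞) = hitTime M (walks ω) w (z : ℤ) + span M α' w z ω := ⟨_, ENNReal.coe_toNNReal htop⟩
      rw [← hs, ENNReal.toNNReal_coe, ← h.front_iff, ← WithTop.coe_add, WithTop.coe_inj]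
      omega
  constructor
  · intro hy
    obtain ⟨z, hz⟩ := exists_stage_of_ne_top (M := M) (α' := α') (w := w) (ω := ω) (k := k)
      (fun hk => stage_ne_top hy (seqR_succ_of_eq_top hk))
    obtain ⟨h1, h2⟩ := (key z hz).1 hy
    refine ⟨z, ?_, hz, h1, h2⟩
    by_contra hlt
    have : hitTime M (walks ω) w ((y - M + 1 : ℤ) : WithTop ℤ) ≤ hitTime M (walks ω) w (z : ℤ) := hitTime_mono (by omega)
    exact absurd (lt_of_le_of_lt le_self_add h2) (not_lt.2 this)
  · rintro ⟨z, -, hz, h12⟩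
    exact (key z hz).2 h12

theorem Run.mem_stage_zero_iff (h : Run M w ω) {α' : ℝ} {y : ℤ} : ω ∈ stage M α' w 0 y ↔ y = M := by
  simp only [stage, Set.mem_ofPred_eq, seqR]
  rw [h.init.2.1, ← WithTop.coe_add, WithTop.coe_inj]
  omega

theorem Run.le_of_mem_stage (h : Run M w ω) {α' : ℝ} {k : ℕ} {y : ℤ} (hy : ω ∈ stage M α' w k y) : (M : ℤ) ≤ y := by
  induction k generalizing y with
  | zero => exact ((h.mem_stage_zero_iff).1 hy).ge
  | succ k ih =>
    obtain ⟨z, hz, hzk, -⟩ := h.mem_stage_succ_iff.1 hy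
    have := ih hzk
    omega

/-- Whether a trial starts at `y` is known when `y` is reached. -/
theorem determinedAt_stage (hM : 0 < M) {α' : ℝ} (hα : 0 < α') (k : ℕ) (y : ℤ) :
    DeterminedAt M w y ((stage M α' w k y).indicator 1) := by
  have key : ∀ k y, ∀ ω ω', Run M w ω → Run M w ω' → ∀ n, (hist M w ω n).1 ∈ reach M w y → hist M w ω n = hist M w ω' n →
      ω ∈ stage M α' w k y → ω' ∈ stage M α' w k y := by
    intro k
    induction k with
    | zero =>
      intro y ω ω' h h' n hn e hω
      rw [h'.mem_stage_zero_iff]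
      exact h.mem_stage_zero_iff.1 hω
    | succ k ih =>
      intro y ω ω' h h' n hn e hω
      have hn' : (hist M w ω' n).1 ∈ reach M w y := e ▸ hn
      obtain ⟨z, hz, hzk, h1, h2⟩ := h.mem_stage_succ_iff.1 hω
      have hz0 : 0 < z := by have := h.le_of_mem_stage hzk; omega
      have hzy : z ≤ y := by omega
      have hT : ∀ x, x ≤ y → hitTime M (walks ω) w (x : ℤ) = hitTime M (walks ω') w (x : ℤ) := fun x hx =>
        (determinedAt_hitTime x).mono hx ω ω' h h' n hn e
      have hle : hitTime M (walks ω) w ((y - M + 1 : ℤ) : WithTop ℤ) ≤ hitTime M (walks ω) w (y : ℤ) := hitTime_mono (by omega)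
      have s1 := h.span_le_of_hist_eq h' e hz0 hzy hn hα (h2.trans_le hle)
      have s2 := h'.span_le_of_hist_eq h e.symm hz0 hzy hn' hα (by
        rw [← hT z hzy, ← hT y le_rfl]
        exact lt_of_le_of_lt (add_le_add_right s1 _) (h2.trans_le hle))
      have s3 := le_antisymm s1 s2
      refine h'.mem_stage_succ_iff.2 ⟨z, hz, ?_, ?_, ?_⟩
      · obtain ⟨m, hm⟩ := h.exists_reach z
        exact ih z ω ω' h h' m hm (h.hist_eq_of_le h' (h.reach_le hzy hm hn) e) hzk
      · rw [← hT (y - M) (by omega), ← hT z hzy, s3]; exact h1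
      · rw [← hT (y - M + 1) (by omega), ← hT z hzy, s3]; exact h2
  intro ω ω' h h' n hn e
  exact le_antisymm (indicator_one_le (key k y ω ω' h h' n hn e))
    (indicator_one_le (key k y ω' ω h' h n (e ▸ hn) e.symm))

theorem nullMeasurableSet_stage (hR : ∀ᵐ ω ∂(walkMeasure a), Run M w ω) (ha : 2 ≤ a) (hM : 4 < M) {α' : ℝ} (hα : 0 < α')
    (k : ℕ) (y : ℤ) : NullMeasurableSet (stage M α' w k y) (walkMeasure a) := by
  have hTm := fun y => aemeasurable_hitTime hR y
  induction k generalizing y with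
  | zero =>
    have : NullMeasurableSet {_ω : Sample a | y = M} (walkMeasure a) := (MeasurableSet.const _).nullMeasurableSet
    refine this.congr ?_
    filter_upwards [hR] with ω h
    exact propext h.mem_stage_zero_iff.symm
  | succ k ih =>
    have hm : NullMeasurableSet (⋃ z : {z : ℤ // 0 < z ∧ z ≤ y - M}, stage M α' w k z ∩
        {ω | hitTime M (walks ω) w ((y - M : ℤ) : WithTop ℤ) ≤ hitTime M (walks ω) w (z : ℤ) + span M α' w z ω} ∩
        {ω | hitTime M (walks ω) w (z : ℤ) + span M α' w z ω < hitTime M (walks ω) w ((y - M + 1 : ℤ) : WithTop ℤ)})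
        (walkMeasure a) :=
      NullMeasurableSet.iUnion fun z =>
        ((ih z).inter (nullMeasurableSet_le (hTm _) ((hTm _).add (aemeasurable_span hR ha hM z.2.1 hα)))).inter
          (nullMeasurableSet_lt ((hTm _).add (aemeasurable_span hR ha hM z.2.1 hα)) (hTm _))
    refine hm.congr ?_
    filter_upwards [hR] with ω h
    refine propext (Iff.trans ?_ h.mem_stage_succ_iff.symm)
    constructor
    · intro hω
      obtain ⟨z, ⟨h1, h2⟩, h3⟩ := Set.mem_iUnion.1 hω
      exact ⟨z, z.2.2, h1, h2, h3⟩
    · rintro ⟨z, h0, h1, h2, h3⟩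
      have := h.le_of_mem_stage h1
      exact Set.mem_iUnion.2 ⟨⟨z, by omega, h0⟩, ⟨h1, h2⟩, h3⟩


/-! ### Moments of the site at which a trial starts -/

variable {M : ℕ} {w : State a} {ω : Sample a}

/-- A version of `(u + v) ^ s ≤ C (u ^ s + v ^ s)` in which the constant in front of `u ^ s` is as
close to one as desired. -/
theorem exists_add_rpow_le {s b : ℝ} (hs : 0 ≤ s) (hb : 1 < b) :
    ∃ C : ℝ, 0 ≤ C ∧ ∀ u v : ℝ≥0∞, (u + v) ^ s ≤ ENNReal.ofReal b * u ^ s + ENNReal.ofReal C * v ^ s := by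
  set η : ℝ := b ^ (1 / (s + 1)) - 1 with hη
  have hη0 : 0 < η := by
    have := Real.one_lt_rpow hb (z := 1 / (s + 1)) (by positivity)
    linarith
  have hbs : (1 + η) ^ s ≤ b := by
    rw [hη, add_sub_cancel, ← Real.rpow_mul (by linarith)]
    conv_rhs => rw [← Real.rpow_one b]
    refine Real.rpow_le_rpow_of_exponent_le hb.le ?_
    rw [one_div, inv_mul_le_one₀ (by positivity)]
    linarith
  refine ⟨(1 / η + 1) ^ s, by positivity, fun u v => ?_⟩
  rcases le_total v (ENNReal.ofReal η * u) with h | h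
  · have h1 : u + v ≤ ENNReal.ofReal (1 + η) * u := by
      rw [ENNReal.ofReal_add zero_le_one hη0.le, ENNReal.ofReal_one, add_mul, one_mul]
      exact add_le_add_right h _
    refine ((ENNReal.rpow_le_rpow h1 hs).trans ?_).trans le_self_add
    rw [ENNReal.mul_rpow_of_nonneg _ _ hs, ENNReal.ofReal_rpow_of_nonneg (by positivity) hs]
    exact mul_le_mul_left (ENNReal.ofReal_le_ofReal hbs) _
  · have h0 : u ≤ ENNReal.ofReal (1 / η) * v := by
      calc u = ENNReal.ofReal (1 / η) * (ENNReal.ofReal η * u) := by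
            rw [← mul_assoc, ← ENNReal.ofReal_mul (by positivity), one_div_mul_cancel hη0.ne', ENNReal.ofReal_one, one_mul]
        _ ≤ _ := mul_le_mul_right h _
    have h1 : u + v ≤ ENNReal.ofReal (1 / η + 1) * v := by
      rw [ENNReal.ofReal_add (by positivity) zero_le_one, ENNReal.ofReal_one, add_mul, one_mul]
      exact add_le_add_left h0 _
    refine ((ENNReal.rpow_le_rpow h1 hs).trans ?_).trans le_add_self
    rw [ENNReal.mul_rpow_of_nonneg _ _ hs, ENNReal.ofReal_rpow_of_nonneg (by positivity) hs]

/-- The number of sites that the front visits during the trial that starts at `y`. -/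
def excess (M : ℕ) (α' : ℝ) (w : State a) (y : ℤ) (ω : Sample a) : ℝ≥0∞ :=
  ∑' j : ℕ, {ω | hitTime M (walks ω) w ((y + (j + 1 : ℕ) : ℤ) : WithTop ℤ) ≤
    hitTime M (walks ω) w (y : ℤ) + span M α' w y ω}.indicator 1 ω

theorem aemeasurable_excess (hR : ∀ᵐ ω ∂(walkMeasure a), Run M w ω) (ha : 2 ≤ a) (hM : 4 < M) {α' : ℝ} (hα : 0 < α')
    {y : ℤ} (hy : 0 < y) : AEMeasurable (excess M α' w y) (walkMeasure a) := by
  have hTm := fun y => aemeasurable_hitTime hR y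
  exact AEMeasurable.tsum fun j => aemeasurable_const.indicator₀
    (nullMeasurableSet_le (hTm _) ((hTm _).add (aemeasurable_span hR ha hM hy hα)))

theorem Run.excess_eq (h : Run M w ω) {α' : ℝ} {y : ℤ} (hspan : span M α' w y ω < ⊤) :
    ∃ i : ℕ, excess M α' w y ω = i ∧ (∀ x : ℤ, hitTime M (walks ω) w (x : ℤ) ≤
      hitTime M (walks ω) w (y : ℤ) + span M α' w y ω ↔ x ≤ y + i) ∧
      frontExt M (walks ω) w (hitTime M (walks ω) w (y : ℤ) + span M α' w y ω) = ((y + i : ℤ) : WithTop ℤ) := by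
  have hfin : hitTime M (walks ω) w (y : ℤ) + span M α' w y ω ≠ ⊤ := ENNReal.add_ne_top.2 ⟨h.hitTime_ne_top y, hspan.ne⟩
  obtain ⟨s, hs⟩ : ∃ s : ℝ≥0, (s : ℝ≥0∞) = hitTime M (walks ω) w (y : ℤ) + span M α' w y ω := ⟨_, ENNReal.coe_toNNReal hfin⟩
  have hy : y ≤ front M (walks ω) w s := by rw [h.le_front_iff, hs]; exact le_self_add
  obtain ⟨i, hi⟩ : ∃ i : ℕ, front M (walks ω) w s = y + i := ⟨(front M (walks ω) w s - y).toNat, by omega⟩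
  have key : ∀ x : ℤ, hitTime M (walks ω) w (x : ℤ) ≤ hitTime M (walks ω) w (y : ℤ) + span M α' w y ω ↔ x ≤ y + i := by
    intro x
    rw [← hs, ← h.le_front_iff, hi]
  refine ⟨i, ?_, key, ?_⟩
  · unfold excess
    rw [tsum_eq_sum (s := Finset.range i)]
    · rw [Finset.sum_congr rfl (g := fun _ => 1), Finset.sum_const, Finset.card_range, nsmul_eq_mul, mul_one]
      intro j hj
      have := Finset.mem_range.1 hj
      rw [Set.indicator_of_mem, Pi.one_apply]
      exact (key _).2 (by omega)
    · intro j hj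
      rw [Finset.mem_range] at hj
      refine Set.indicator_of_notMem (fun hmem => ?_) _
      have := (key _).1 hmem
      omega
  · rw [frontExt, if_neg hfin, ← hs, ENNReal.toNNReal_coe, hi]

/-- The moments of the site at which the next trial starts, given the present one. -/
theorem exists_trial_moment_le (ha : 2 ≤ a) (hM : 4 < M) {α' : ℝ} (hα : 0 < α') (hα1 : α' < 1 / meanWait M a)
    {s : ℝ} (hs : 0 ≤ s) (hsM : s < (M : ℝ) / 4) :
    ∃ q B : ℝ≥0∞, q < 1 ∧ B < ⊤ ∧ ∀ w : State a, (∀ᵐ ω ∂(walkMeasure a), Run M w ω) → ∀ (k : ℕ) (z : ℤ),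
      ∫⁻ ω, (stage M α' w k z ∩ {ω | span M α' w z ω < ⊤}).indicator
          (fun ω => ((z.toNat : ℝ≥0∞) + (M + excess M α' w z ω)) ^ s) ω ∂(walkMeasure a) ≤
        q * ((z.toNat : ℝ≥0∞) ^ s * walkMeasure a (stage M α' w k z)) + B * walkMeasure a (stage M α' w k z) := by
  obtain ⟨q, hq, hfail⟩ := exists_failure_le ha hM hα hα1
  obtain ⟨C, hC, hlate⟩ := exists_late_failure_le ha hM hα hα1
  obtain ⟨K, hK, hmom⟩ := exists_lintegral_rpow_le hs hsM hC
  -- A factor `b` close to one keeps `b q` below one.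
  obtain ⟨b, hb, hbq⟩ : ∃ b : ℝ, 1 < b ∧ ENNReal.ofReal b * q < 1 := by
    have hqr : q.toReal < 1 := by
      rw [← ENNReal.toReal_one]; exact (ENNReal.toReal_lt_toReal hq.ne_top ENNReal.one_ne_top).2 hq
    have hq0 : 0 ≤ q.toReal := ENNReal.toReal_nonneg
    refine ⟨2 / (1 + q.toReal), by rw [lt_div_iff₀ (by positivity)]; linarith, ?_⟩
    rw [← ENNReal.ofReal_toReal hq.ne_top, ← ENNReal.ofReal_mul (by positivity), ← ENNReal.ofReal_one,
      ENNReal.ofReal_lt_ofReal_iff one_pos, ENNReal.toReal_ofReal hq0, div_mul_eq_mul_div, div_lt_one (by positivity)]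
    linarith
  obtain ⟨C₁, hC₁, hadd₁⟩ := exists_add_rpow_le hs hb
  obtain ⟨C₂, hC₂, hadd₂⟩ := exists_add_rpow_le hs one_lt_two
  refine ⟨ENNReal.ofReal b * q, ENNReal.ofReal C₁ * (ENNReal.ofReal 2 * (M : ℝ≥0∞) ^ s + ENNReal.ofReal C₂ * (1 + ENNReal.ofReal K)),
    hbq, ?_, fun w hR k z => ?_⟩
  · have : (M : ℝ≥0∞) ^ s ≠ ⊤ := ENNReal.rpow_ne_top_of_nonneg hs (ENNReal.natCast_ne_top M)
    exact ENNReal.mul_lt_top ENNReal.ofReal_lt_top (ENNReal.add_lt_top.2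
      ⟨ENNReal.mul_lt_top ENNReal.ofReal_lt_top this.lt_top,
        ENNReal.mul_lt_top ENNReal.ofReal_lt_top (ENNReal.add_lt_top.2 ⟨ENNReal.one_lt_top, ENNReal.ofReal_lt_top⟩)⟩)
  rcases le_or_gt z 0 with hz | hz
  · have : ∫⁻ ω, (stage M α' w k z ∩ {ω | span M α' w z ω < ⊤}).indicator
          (fun ω => ((z.toNat : ℝ≥0∞) + (M + excess M α' w z ω)) ^ s) ω ∂(walkMeasure a) = ∫⁻ _, 0 ∂(walkMeasure a) := by
      refine lintegral_congr_ae ?_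
      filter_upwards [hR] with ω h
      refine Set.indicator_of_notMem (fun hmem => ?_) _
      have := h.le_of_mem_stage hmem.1
      omega
    rw [this, lintegral_zero]
    exact zero_le
  set P := walkMeasure a with hP
  set S := stage M α' w k z with hS
  have hSm : NullMeasurableSet S P := nullMeasurableSet_stage hR ha hM hα k z
  have hspm := aemeasurable_span hR ha hM hz hα
  have hfm : NullMeasurableSet {ω | span M α' w z ω < ⊤} P := nullMeasurableSet_lt hspm aemeasurable_const
  have hAm : NullMeasurableSet (S ∩ {ω | span M α' w z ω < ⊤}) P := hSm.inter hfm
  have hdet : DeterminedAt M w z (S.indicator 1) := determinedAt_stage (by omega) hα k z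
  have hSi : AEMeasurable (S.indicator (1 : Sample a → ℝ≥0∞)) P := aemeasurable_const.indicator₀ hSm
  have hint : ∀ E : Set (Sample a), NullMeasurableSet E P →
      ∫⁻ ω, S.indicator 1 ω * E.indicator 1 ω ∂P = P (S ∩ E) := by
    intro E hE
    rw [← lintegral_indicator_one₀ (hSm.inter hE)]
    refine lintegral_congr fun ω => ?_
    rw [Set.inter_indicator_one]; rfl
  have hJm := aemeasurable_excess hR ha hM hα hz
  have hTm := fun y => aemeasurable_hitTime hR y
  have hf : P (S ∩ {ω | span M α' w z ω < ⊤}) ≤ q * P S := by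
    have := hfail w hR z hz _ hSi hdet
    rwa [hint _ hfm, lintegral_indicator_one₀ hSm] at this
  have hf1 : P (S ∩ {ω | span M α' w z ω < ⊤}) ≤ P S := measure_mono Set.inter_subset_left
  -- The moments of the number of sites visited during the trial.
  have hJ : ∫⁻ ω in S ∩ {ω | span M α' w z ω < ⊤}, excess M α' w z ω ^ s ∂P ≤ (1 + ENNReal.ofReal K) * P S := by
    have h1 := hmom (P.restrict (S ∩ {ω | span M α' w z ω < ⊤})) (excess M α' w z) (P S) hJm.restrict (fun i => by
      rw [Measure.restrict_apply₀' hAm]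
      have hEm : NullMeasurableSet {ω | span M α' w z ω < ⊤ ∧ hitTime M (walks ω) w ((z + (2 ^ i : ℕ) : ℤ) : WithTop ℤ) ≤
          hitTime M (walks ω) w (z : ℤ) + span M α' w z ω} P :=
        hfm.inter (nullMeasurableSet_le (hTm _) ((hTm _).add hspm))
      have h2 := hlate w hR z hz _ hSi hdet (2 ^ i) Nat.one_le_two_pow
      rw [hint _ hEm, lintegral_indicator_one₀ hSm] at h2
      have h3 : P ({ω | 2 ^ i < excess M α' w z ω} ∩ (S ∩ {ω | span M α' w z ω < ⊤})) ≤
          P (S ∩ {ω | span M α' w z ω < ⊤ ∧ hitTime M (walks ω) w ((z + (2 ^ i : ℕ) : ℤ) : WithTop ℤ) ≤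
          hitTime M (walks ω) w (z : ℤ) + span M α' w z ω}) := by
        refine measure_mono_ae ?_
        filter_upwards [hR] with ω h
        rintro ⟨h4, h5, h6⟩
        refine ⟨h5, h6, ?_⟩
        obtain ⟨n, hn, hx, -⟩ := h.excess_eq h6
        rw [Set.mem_ofPred_eq, hn] at h4
        have h7 : 2 ^ i < n := by exact_mod_cast h4
        rw [hx]
        have h8 : ((2 ^ i : ℕ) : ℤ) ≤ n := by exact_mod_cast h7.le
        linarith
      refine h3.trans (h2.trans (le_of_eq ?_))
      rw [mul_comm]
      congr 3
      push_cast
      rw [← Real.rpow_natCast, ← Real.rpow_mul (by norm_num)]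
      congr 1; ring)
    refine h1.trans ?_
    rw [Measure.restrict_apply_univ, add_mul, one_mul, mul_comm (P S)]
    exact add_le_add_left hf1 _
  rw [lintegral_indicator₀ hAm]
  calc ∫⁻ ω in S ∩ {ω | span M α' w z ω < ⊤}, ((z.toNat : ℝ≥0∞) + (M + excess M α' w z ω)) ^ s ∂P
      ≤ ∫⁻ ω in S ∩ {ω | span M α' w z ω < ⊤}, (ENNReal.ofReal b * (z.toNat : ℝ≥0∞) ^ s +
          ENNReal.ofReal C₁ * (ENNReal.ofReal 2 * (M : ℝ≥0∞) ^ s + ENNReal.ofReal C₂ * excess M α' w z ω ^ s)) ∂P :=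
        lintegral_mono fun ω => (hadd₁ _ _).trans (add_le_add_right (mul_le_mul_right (hadd₂ _ _) _) _)
    _ = ENNReal.ofReal b * (z.toNat : ℝ≥0∞) ^ s * P (S ∩ {ω | span M α' w z ω < ⊤}) +
          ENNReal.ofReal C₁ * (ENNReal.ofReal 2 * (M : ℝ≥0∞) ^ s * P (S ∩ {ω | span M α' w z ω < ⊤}) +
            ENNReal.ofReal C₂ * ∫⁻ ω in S ∩ {ω | span M α' w z ω < ⊤}, excess M α' w z ω ^ s ∂P) := by
        rw [lintegral_add_left measurable_const, lintegral_const, Measure.restrict_apply_univ,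
          lintegral_const_mul' _ _ ENNReal.ofReal_ne_top, lintegral_add_left measurable_const, lintegral_const,
          Measure.restrict_apply_univ, lintegral_const_mul' _ _ ENNReal.ofReal_ne_top]
    _ ≤ ENNReal.ofReal b * (z.toNat : ℝ≥0∞) ^ s * (q * P S) +
          ENNReal.ofReal C₁ * (ENNReal.ofReal 2 * (M : ℝ≥0∞) ^ s * P S +
            ENNReal.ofReal C₂ * ((1 + ENNReal.ofReal K) * P S)) := by gcongr
    _ = _ := by ring

/-- One more trial: it starts at `z + M` plus the number of sites visited during the trial at `z`. -/
theorem Run.tsum_stage_succ_le (h : Run M w ω) {α' : ℝ} (k : ℕ) (f : ℝ≥0∞ → ℝ≥0∞) :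
    ∑' y : ℤ, (stage M α' w (k + 1) y).indicator (fun _ => f (y.toNat : ℝ≥0∞)) ω ≤
      ∑' z : ℤ, (stage M α' w k z ∩ {ω | span M α' w z ω < ⊤}).indicator
          (fun ω => f ((z.toNat : ℝ≥0∞) + (M + excess M α' w z ω))) ω := by
  by_cases hex : ∃ y, ω ∈ stage M α' w (k + 1) y
  · obtain ⟨y, hy⟩ := hex
    rw [tsum_eq_single y fun y' hne => Set.indicator_of_notMem (fun hy' => hne (stage_unique hy' hy)) _,
      Set.indicator_of_mem hy]
    obtain ⟨z, hzy, hz, h1, h2⟩ := h.mem_stage_succ_iff.1 hy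
    have hsp : span M α' w z ω < ⊤ := lt_of_le_of_lt le_add_self (h2.trans_le le_top)
    obtain ⟨i, hi, hx, -⟩ := h.excess_eq hsp
    have hzM := h.le_of_mem_stage hz
    have h3 := (hx _).1 h1
    have h4 : ¬ (y - M + 1 ≤ z + i) := fun hc => absurd h2 (not_lt.2 ((hx _).2 hc))
    have hyi : y.toNat = z.toNat + (M + i) := by omega
    refine le_trans (le_of_eq ?_) (ENNReal.le_tsum z)
    have hmem : ω ∈ stage M α' w k z ∩ {ω | span M α' w z ω < ⊤} := ⟨hz, hsp⟩
    rw [Set.indicator_of_mem hmem, hi, hyi]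
    push_cast; rfl
  · push Not at hex
    rw [ENNReal.tsum_eq_zero.2 fun y => Set.indicator_of_notMem (hex y) _]
    exact zero_le

/-- All moments of order less than `M / 4` of the starting sites, summed over all trials, are
bounded, uniformly in the initial state. -/
theorem exists_tsum_stage_le (ha : 2 ≤ a) (hM : 4 < M) {α' : ℝ} (hα : 0 < α') (hα1 : α' < 1 / meanWait M a)
    {s : ℝ} (hs : 0 ≤ s) (hsM : s < (M : ℝ) / 4) :
    ∃ Q : ℝ≥0∞, Q < ⊤ ∧ ∀ w : State a, (∀ᵐ ω ∂(walkMeasure a), Run M w ω) →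
      ∑' k : ℕ, ∑' z : ℤ, (z.toNat : ℝ≥0∞) ^ s * walkMeasure a (stage M α' w k z) ≤ Q := by
  obtain ⟨q, hq, hfail⟩ := exists_failure_le ha hM hα hα1
  obtain ⟨r, B, hr, hB, hmom⟩ := exists_trial_moment_le ha hM hα hα1 hs hsM
  set A : ℝ≥0∞ := (M : ℝ≥0∞) ^ s + B * (1 - q)⁻¹ with hA
  have hMs : (M : ℝ≥0∞) ^ s < ⊤ := (ENNReal.rpow_ne_top_of_nonneg hs (ENNReal.natCast_ne_top M)).lt_top
  have h1q : 1 - q ≠ 0 := (tsub_pos_of_lt hq).ne'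
  have h1r : 1 - r ≠ 0 := (tsub_pos_of_lt hr).ne'
  have hA' : A < ⊤ := ENNReal.add_lt_top.2 ⟨hMs, ENNReal.mul_lt_top hB (ENNReal.inv_lt_top.2 (pos_iff_ne_zero.2 h1q))⟩
  refine ⟨A * (1 - r)⁻¹, ENNReal.mul_lt_top hA' (ENNReal.inv_lt_top.2 (pos_iff_ne_zero.2 h1r)), fun w hR => ?_⟩
  set P := walkMeasure a with hP
  have hSm : ∀ k z, NullMeasurableSet (stage M α' w k z) P := fun k z => nullMeasurableSet_stage hR ha hM hα k z
  set m : ℕ → ℝ≥0∞ := fun k => ∑' z : ℤ, (z.toNat : ℝ≥0∞) ^ s * P (stage M α' w k z) with hm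
  set p : ℕ → ℝ≥0∞ := fun k => ∑' z : ℤ, P (stage M α' w k z) with hp
  have hint : ∀ (f : ℝ≥0∞ → ℝ≥0∞) k, ∑' z : ℤ, f (z.toNat : ℝ≥0∞) * P (stage M α' w k z) =
      ∫⁻ ω, ∑' z : ℤ, (stage M α' w k z).indicator (fun _ => f (z.toNat : ℝ≥0∞)) ω ∂P := by
    intro f k
    rw [lintegral_tsum fun z => aemeasurable_const.indicator₀ (hSm k z)]
    refine tsum_congr fun z => ?_
    rw [lintegral_indicator_const₀ (hSm k z)]
  have hneg : ∀ k z, z ≤ 0 → P (stage M α' w k z) = 0 := by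
    intro k z hz
    refine measure_eq_zero_iff_ae_notMem.2 ?_
    filter_upwards [hR] with ω h hmem
    have := h.le_of_mem_stage hmem
    omega
  have hspm : ∀ z : ℤ, 0 < z → NullMeasurableSet {ω | span M α' w z ω < ⊤} P := fun z hz =>
    nullMeasurableSet_lt (aemeasurable_span hR ha hM hz hα) aemeasurable_const
  have hnull : ∀ k (z : ℤ), NullMeasurableSet (stage M α' w k z ∩ {ω | span M α' w z ω < ⊤}) P := by
    intro k z
    rcases le_or_gt z 0 with hz | hz
    · exact NullMeasurableSet.of_null (measure_mono_null Set.inter_subset_left (hneg k z hz))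
    · exact (hSm k z).inter (hspm z hz)
  have hstep : ∀ (f : ℝ≥0∞ → ℝ≥0∞), Measurable f → ∀ k, ∑' z : ℤ, f (z.toNat : ℝ≥0∞) * P (stage M α' w (k + 1) z) ≤
      ∑' z : ℤ, ∫⁻ ω, (stage M α' w k z ∩ {ω | span M α' w z ω < ⊤}).indicator
          (fun ω => f ((z.toNat : ℝ≥0∞) + (M + excess M α' w z ω))) ω ∂P := by
    intro f hf k
    rw [hint, ← lintegral_tsum]
    · refine lintegral_mono_ae ?_
      filter_upwards [hR] with ω h using h.tsum_stage_succ_le k f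
    · intro z
      rcases le_or_gt z 0 with hz | hz
      · refine AEMeasurable.congr (f := fun _ => 0) aemeasurable_const ?_
        filter_upwards [measure_eq_zero_iff_ae_notMem.1 (hneg k z hz)] with ω hω
        exact (Set.indicator_of_notMem (fun hmem => hω hmem.1) _).symm
      · exact (hf.comp_aemeasurable (aemeasurable_const.add (aemeasurable_const.add
          (aemeasurable_excess hR ha hM hα hz)))).indicator₀ (hnull k z)
  have hpstep : ∀ k, p (k + 1) ≤ q * p k := by
    intro k
    have h1 := hstep (fun _ => 1) measurable_const k
    simp only [one_mul] at h1
    refine h1.trans ?_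
    rw [hp, ← ENNReal.tsum_mul_left]
    refine ENNReal.tsum_le_tsum fun z => ?_
    rw [lintegral_indicator_const₀ (hnull k z), one_mul]
    rcases le_or_gt z 0 with hz | hz
    · rw [measure_mono_null Set.inter_subset_left (hneg k z hz)]; exact zero_le
    · have h2 := hfail w hR z hz ((stage M α' w k z).indicator 1) (aemeasurable_const.indicator₀ (hSm k z)) (determinedAt_stage (by omega) hα k z)
      refine le_trans (le_of_eq ?_) (h2.trans (le_of_eq ?_))
      · rw [← lintegral_indicator_one₀ (hnull k z)]
        refine lintegral_congr fun ω => ?_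
        rw [Set.inter_indicator_one]; rfl
      · rw [lintegral_indicator_one₀ (hSm k z)]
  have hmstep : ∀ k, m (k + 1) ≤ r * m k + B * p k := by
    intro k
    refine (hstep (fun x => x ^ s) (by fun_prop) k).trans ?_
    rw [hm, hp]
    simp only
    rw [← ENNReal.tsum_mul_left, ← ENNReal.tsum_mul_left, ← ENNReal.tsum_add]
    exact ENNReal.tsum_le_tsum fun z => hmom w hR k z
  have h0 : ∀ z : ℤ, P (stage M α' w 0 z) = if z = M then 1 else 0 := by
    intro z
    split_ifs with hz
    · refine (measure_congr (t := Set.univ) ?_).trans measure_univ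
      filter_upwards [hR] with ω h
      exact propext ⟨fun _ => trivial, fun _ => h.mem_stage_zero_iff.2 hz⟩
    · refine measure_eq_zero_iff_ae_notMem.2 ?_
      filter_upwards [hR] with ω h hmem
      exact hz (h.mem_stage_zero_iff.1 hmem)
  have hp0 : p 0 ≤ 1 := by
    simp only [hp, h0]
    rw [tsum_ite_eq]
  have hm0 : m 0 ≤ (M : ℝ≥0∞) ^ s := by
    simp only [hm, h0]
    rw [tsum_eq_single (M : ℤ) (fun z hz => by rw [if_neg hz, mul_zero]), if_pos rfl, mul_one, Int.toNat_natCast]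
  have hpsum : ∑' k, p k ≤ (1 - q)⁻¹ := by
    rw [← ENNReal.tsum_geometric]
    refine ENNReal.tsum_le_tsum fun k => ?_
    induction k with
    | zero => simpa using hp0
    | succ k ih =>
      rw [pow_succ']
      exact (hpstep k).trans (mul_le_mul_right ih _)
  -- The fixed point of `x ↦ A + r x` bounds the partial sums, by induction.
  have hfix : A + r * (A * (1 - r)⁻¹) = A * (1 - r)⁻¹ := by
    have e1 : (1 - r) * (1 - r)⁻¹ = 1 := ENNReal.mul_inv_cancel h1r (ne_top_of_le_ne_top ENNReal.one_ne_top tsub_le_self)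
    calc A + r * (A * (1 - r)⁻¹) = A * ((1 - r) * (1 - r)⁻¹) + r * (A * (1 - r)⁻¹) := by rw [e1, mul_one]
      _ = A * (1 - r)⁻¹ * ((1 - r) + r) := by ring
      _ = _ := by rw [tsub_add_cancel_of_le hr.le, mul_one]
  rw [ENNReal.tsum_eq_iSup_nat]
  refine iSup_le fun N => ?_
  change ∑ k ∈ Finset.range N, m k ≤ _
  induction N with
  | zero => simp
  | succ N ih =>
    rw [Finset.sum_range_succ']
    calc ∑ k ∈ Finset.range N, m (k + 1) + m 0
        ≤ ∑ k ∈ Finset.range N, (r * m k + B * p k) + (M : ℝ≥0∞) ^ s :=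
          add_le_add (Finset.sum_le_sum fun k _ => hmstep k) hm0
      _ = r * ∑ k ∈ Finset.range N, m k + B * ∑ k ∈ Finset.range N, p k + (M : ℝ≥0∞) ^ s := by
          rw [Finset.sum_add_distrib, Finset.mul_sum, Finset.mul_sum]
      _ ≤ r * (A * (1 - r)⁻¹) + B * (1 - q)⁻¹ + (M : ℝ≥0∞) ^ s := by
          gcongr
          exact (ENNReal.sum_le_tsum _).trans hpsum
      _ = A + r * (A * (1 - r)⁻¹) := by rw [hA]; ring
      _ = _ := hfix


/-! ### The regeneration time -/

variable {M : ℕ} {w : State a} {ω : Sample a}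

theorem seqR_eq_top_of_le {α' : ℝ} {j k : ℕ} (hjk : j ≤ k) (hj : seqR M α' (walks ω) w j = ⊤) :
    seqR M α' (walks ω) w k = ⊤ := by
  induction k, hjk using Nat.le_induction with
  | base => exact hj
  | succ k _ ih => exact seqR_succ_of_eq_top ih

/-- The trial at `z`, which is number `k + 1`, is the first that succeeds. -/
def success (M : ℕ) (α' : ℝ) (w : State a) (k : ℕ) (z : ℤ) : Set (Sample a) :=
  stage M α' w k z ∩ {ω | span M α' w z ω = ⊤}

theorem success_unique {α' : ℝ} {j k : ℕ} {y z : ℤ} (hy : ω ∈ success M α' w j y) (hz : ω ∈ success M α' w k z) :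
    j = k ∧ y = z := by
  have key : ∀ {k z}, ω ∈ success M α' w k z → seqR M α' (walks ω) w (k + 1) = ⊤ := by
    intro k z h
    rw [seqR_succ_of_mem_stage h.1, h.2, add_top, frontExt, if_pos rfl]
  have hjk : j = k := by
    rcases lt_trichotomy j k with h | h | h
    · exact absurd (seqR_eq_top_of_le h (key hy)) (stage_ne_top hz.1)
    · exact h
    · exact absurd (seqR_eq_top_of_le h (key hz)) (stage_ne_top hy.1)
  subst hjk
  exact ⟨rfl, stage_unique hy.1 hz.1⟩

/-- If some trial succeeds, then the regeneration time is the time at which it starts. -/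
theorem Run.exists_success (h : Run M w ω) {α' : ℝ} (hex : ∃ k, seqR M α' (walks ω) w k = ⊤) :
    ∃ k z, ω ∈ success M α' w k z ∧ regenTime M α' (walks ω) w = hitTime M (walks ω) w (z : ℤ) ∧
      regenFront M α' (walks ω) w = (z.toNat : ℝ≥0∞) := by
  classical
  obtain ⟨j, hj⟩ : ∃ j, Nat.find hex = j + 1 := by
    refine Nat.exists_eq_succ_of_ne_zero fun h0 => ?_
    have := Nat.find_spec hex
    rw [h0, seqR] at this
    exact WithTop.coe_ne_top this
  have hj1 : seqR M α' (walks ω) w (j + 1) = ⊤ := hj ▸ Nat.find_spec hex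
  have hj2 : seqR M α' (walks ω) w j ≠ ⊤ := Nat.find_min hex (by omega)
  obtain ⟨z, hz⟩ := exists_stage_of_ne_top hj2
  have hzT := h.hitTime_ne_top z
  have hspan : span M α' w z ω = ⊤ := by
    rw [seqR_succ_of_mem_stage hz, frontExt] at hj1
    split_ifs at hj1 with hc
    · exact (ENNReal.add_eq_top.1 hc).resolve_left hzT
    · exact absurd hj1 WithTop.coe_ne_top
  have hS : seqS M α' (walks ω) w (j + 1) = hitTime M (walks ω) w (z : ℤ) := by
    rw [seqS, show seqR M α' (walks ω) w j + ((M : ℤ) : WithTop ℤ) = (z : ℤ) from hz]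
  have hmem : j + 1 ∈ regenIndices M α' (walks ω) w := by
    refine ⟨by omega, ?_, ?_⟩
    · rw [hS]; exact hzT.lt_top
    · rw [hS, timeD_hitTime, hspan, add_top]
  have hmin : sInf (regenIndices M α' (walks ω) w) = j + 1 := by
    refine le_antisymm (Nat.sInf_le hmem) (le_csInf ⟨_, hmem⟩ ?_)
    rintro i ⟨hi1, hi2, hi3⟩
    obtain ⟨i, rfl⟩ : ∃ i', i = i' + 1 := ⟨i - 1, by omega⟩
    rw [← hj]
    refine Nat.find_min' hex ?_
    rw [seqR]
    rw [seqS] at hi3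
    rw [hi3, frontExt, if_pos rfl]
  have hreg : regenTime M α' (walks ω) w = hitTime M (walks ω) w (z : ℤ) := by
    rw [regenTime, if_pos ⟨_, hmem⟩, hmin, hS]
  refine ⟨j, z, ⟨hz, hspan⟩, hreg, ?_⟩
  have hzM := h.le_of_mem_stage hz
  have hz0 : 0 < z := by have h2 := h.two_le; have h3 := h.le; omega
  obtain ⟨n, hn⟩ := h.exists_reach z
  rw [regenFront, hreg, frontExt, if_neg hzT, h.hitTime_eq hn, ENNReal.toNNReal_coe, h.front_jumpTime, h.front_of_reach hz0 hn]
  change ((z.natAbs : ℕ) : ℝ≥0∞) = _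
  congr 1
  omega

/-- Almost surely, some trial succeeds. -/
theorem ae_exists_success (ha : 2 ≤ a) (hM : 4 < M) {α' : ℝ} (hα : 0 < α') (hα1 : α' < 1 / meanWait M a)
    (hR : ∀ᵐ ω ∂(walkMeasure a), Run M w ω) : ∀ᵐ ω ∂(walkMeasure a), ∃ k, seqR M α' (walks ω) w k = ⊤ := by
  obtain ⟨Q, hQ, hsum⟩ := exists_tsum_stage_le ha hM hα hα1 le_rfl (by positivity)
  have h := hsum w hR
  simp only [ENNReal.rpow_zero, one_mul] at h
  set N : Sample a → ℝ≥0∞ := fun ω => ∑' k : ℕ, ∑' z : ℤ, (stage M α' w k z).indicator 1 ω with hN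
  have hm : ∀ k z, AEMeasurable ((stage M α' w k z).indicator (1 : Sample a → ℝ≥0∞)) (walkMeasure a) := fun k z =>
    aemeasurable_const.indicator₀ (nullMeasurableSet_stage hR ha hM hα k z)
  have hNm : AEMeasurable N (walkMeasure a) := AEMeasurable.tsum fun k => AEMeasurable.tsum fun z => hm k z
  have hNint : ∫⁻ ω, N ω ∂(walkMeasure a) ≤ Q := by
    refine le_trans (le_of_eq ?_) h
    rw [lintegral_tsum fun k => AEMeasurable.tsum fun z => hm k z]
    refine tsum_congr fun k => ?_
    rw [lintegral_tsum fun z => hm k z]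
    exact tsum_congr fun z => lintegral_indicator_one₀ (nullMeasurableSet_stage hR ha hM hα k z)
  filter_upwards [ae_lt_top' hNm (ne_top_of_le_ne_top hQ.ne hNint)] with ω hω
  by_contra hne
  push Not at hne
  refine hω.ne (top_le_iff.1 ?_)
  rw [← ENNReal.tsum_const_eq_top_of_ne_zero (α := ℕ) one_ne_zero]
  refine ENNReal.tsum_le_tsum fun k => ?_
  obtain ⟨z, hz⟩ := exists_stage_of_ne_top (M := M) (α' := α') (w := w) (ω := ω) (k := k) (hne k)
  refine le_trans (le_of_eq ?_) (ENNReal.le_tsum z)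
  rw [Set.indicator_of_mem hz]; rfl

theorem nullMeasurableSet_success (hR : ∀ᵐ ω ∂(walkMeasure a), Run M w ω) (ha : 2 ≤ a) (hM : 4 < M) {α' : ℝ} (hα : 0 < α')
    (k : ℕ) (z : ℤ) : NullMeasurableSet (success M α' w k z) (walkMeasure a) := by
  rcases le_or_gt z 0 with hz | hz
  · refine NullMeasurableSet.of_null (measure_eq_zero_iff_ae_notMem.2 ?_)
    filter_upwards [hR] with ω h hmem
    have := h.le_of_mem_stage hmem.1
    omega
  · exact (nullMeasurableSet_stage hR ha hM hα k z).inter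
      (nullMeasurableSet_eq_fun (aemeasurable_span hR ha hM hz hα) aemeasurable_const)

/-- A function that is determined by the trial that succeeds is measurable. -/
theorem aemeasurable_of_success (ha : 2 ≤ a) (hM : 4 < M) {α' : ℝ} (hα : 0 < α') (hα1 : α' < 1 / meanWait M a)
    (hR : ∀ᵐ ω ∂(walkMeasure a), Run M w ω) {X : Sample a → ℝ≥0∞} {f : ℤ → Sample a → ℝ≥0∞}
    (hf : ∀ z, AEMeasurable (f z) (walkMeasure a))
    (hX : ∀ ω k z, Run M w ω → (∃ k, seqR M α' (walks ω) w k = ⊤) → ω ∈ success M α' w k z → X ω = f z ω) :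
    AEMeasurable X (walkMeasure a) := by
  refine AEMeasurable.congr (f := fun ω => ∑' k : ℕ, ∑' z : ℤ, (success M α' w k z).indicator (f z) ω)
    (AEMeasurable.tsum fun k => AEMeasurable.tsum fun z => (hf z).indicator₀ (nullMeasurableSet_success hR ha hM hα k z)) ?_
  filter_upwards [hR, ae_exists_success ha hM hα hα1 hR] with ω h hex
  obtain ⟨k, z, hkz, -⟩ := h.exists_success hex
  rw [tsum_eq_single k, tsum_eq_single z, Set.indicator_of_mem hkz, hX ω k z h hex hkz]
  · exact fun z' hz' => Set.indicator_of_notMem (fun h' => hz' (success_unique h' hkz).2) _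
  · exact fun k' hk' => ENNReal.tsum_eq_zero.2 fun z' =>
      Set.indicator_of_notMem (fun h' => hk' (success_unique h' hkz).1) _

theorem aemeasurable_regenTime (ha : 2 ≤ a) (hM : 4 < M) {α' : ℝ} (hα : 0 < α') (hα1 : α' < 1 / meanWait M a)
    (hR : ∀ᵐ ω ∂(walkMeasure a), Run M w ω) :
    AEMeasurable (fun ω => regenTime M α' (walks ω) w) (walkMeasure a) :=
  aemeasurable_of_success ha hM hα hα1 hR (fun z => aemeasurable_hitTime hR z) fun ω k z h hex hkz => by
    obtain ⟨k', z', h', h1, -⟩ := h.exists_success hex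
    rw [h1, (success_unique h' hkz).2]

theorem aemeasurable_regenFront (ha : 2 ≤ a) (hM : 4 < M) {α' : ℝ} (hα : 0 < α') (hα1 : α' < 1 / meanWait M a)
    (hR : ∀ᵐ ω ∂(walkMeasure a), Run M w ω) :
    AEMeasurable (fun ω => regenFront M α' (walks ω) w) (walkMeasure a) :=
  aemeasurable_of_success ha hM hα hα1 hR (f := fun z _ => (z.toNat : ℝ≥0∞)) (fun z => aemeasurable_const)
    fun ω k z h hex hkz => by
    obtain ⟨k', z', h', -, h1⟩ := h.exists_success hex
    rw [h1, (success_unique h' hkz).2]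

/-- The moments of the regeneration site are at most the sum of those of the starts of all trials. -/
theorem exists_lintegral_regenFront_le (ha : 2 ≤ a) (hM : 4 < M) {α' : ℝ} (hα : 0 < α') (hα1 : α' < 1 / meanWait M a)
    {s : ℝ} (hs : 0 ≤ s) (hsM : s < (M : ℝ) / 4) :
    ∃ Q : ℝ≥0∞, Q < ⊤ ∧ ∀ w : State a, (∀ᵐ ω ∂(walkMeasure a), Run M w ω) →
      ∫⁻ ω, regenFront M α' (walks ω) w ^ s ∂(walkMeasure a) ≤ Q := by
  obtain ⟨Q, hQ, hsum⟩ := exists_tsum_stage_le ha hM hα hα1 hs hsM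
  refine ⟨Q, hQ, fun w hR => ?_⟩
  have hm : ∀ k z, NullMeasurableSet (stage M α' w k z) (walkMeasure a) := fun k z =>
    nullMeasurableSet_stage hR ha hM hα k z
  calc ∫⁻ ω, regenFront M α' (walks ω) w ^ s ∂(walkMeasure a)
      ≤ ∫⁻ ω, ∑' k : ℕ, ∑' z : ℤ, (stage M α' w k z).indicator (fun _ => (z.toNat : ℝ≥0∞) ^ s) ω ∂(walkMeasure a) := by
        refine lintegral_mono_ae ?_
        filter_upwards [hR, ae_exists_success ha hM hα hα1 hR] with ω h hex
        obtain ⟨k, z, hkz, -, h1⟩ := h.exists_success hex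
        refine le_trans (le_of_eq ?_) ((ENNReal.le_tsum z).trans (ENNReal.le_tsum k))
        rw [h1, Set.indicator_of_mem hkz.1]
    _ = ∑' k : ℕ, ∑' z : ℤ, (z.toNat : ℝ≥0∞) ^ s * walkMeasure a (stage M α' w k z) := by
        rw [lintegral_tsum fun k => AEMeasurable.tsum fun z => aemeasurable_const.indicator₀ (hm k z)]
        refine tsum_congr fun k => ?_
        rw [lintegral_tsum fun z => aemeasurable_const.indicator₀ (hm k z)]
        exact tsum_congr fun z => lintegral_indicator_const₀ (hm k z) _
    _ ≤ Q := hsum w hR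

/-- On the event `U = ∞` the front moves at least at speed `α'`. -/
theorem Run.regenTime_le (h : Run M w ω) {α' : ℝ} (hα : 0 < α') (hex : ∃ k, seqR M α' (walks ω) w k = ⊤)
    (hU : ω ∈ eventU M a α') :
    regenTime M α' (walks ω) w ≤ ENNReal.ofReal (1 / α') * regenFront M α' (walks ω) w := by
  obtain ⟨k, z, hkz, h1, h2⟩ := h.exists_success hex
  rw [h1, h2]
  have hzM := h.le_of_mem_stage hkz.1
  have h3 := h.hitTime_le_auxTime le_rfl z.toNat
  have h4 := ((h.noExplosion 0).timeU_eq_top_iff hα).1 hU z.toNat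
  rw [h.hitTime_zero, zero_add, zero_add, show ((z.toNat : ℕ) : ℤ) = z by omega] at h3
  refine (h3.trans h4).trans (le_of_eq ?_)
  rw [← ENNReal.ofReal_natCast, ← ENNReal.ofReal_mul (by positivity)]
  congr 1; ring

theorem nullMeasurableSet_eventU (ha : 2 ≤ a) (hM : 4 < M) {α' : ℝ} (hα : 0 < α') :
    NullMeasurableSet (eventU M a α') (walkMeasure a) :=
  nullMeasurableSet_eq_fun (aemeasurable_timeU ha hM hα 0) aemeasurable_const

theorem lintegral_cond_le (M : ℕ) (α' : ℝ) (X : Sample a → ℝ≥0∞) :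
    ∫⁻ ω, X ω ∂(cond (walkMeasure a) (eventU M a α')) ≤
      (walkMeasure a (eventU M a α'))⁻¹ * ∫⁻ ω, X ω ∂(walkMeasure a) := by
  rw [ProbabilityTheory.cond, lintegral_smul_measure, smul_eq_mul]
  exact mul_le_mul_right (setLIntegral_le_lintegral _ _) _

/-- The moments of order less than `M / 4` of the regeneration time and site, given `U = ∞`. -/
theorem exists_moments_le (ha : 2 ≤ a) (haM : a ≤ M) (hM : 4 < M) {α' : ℝ} (hα : 0 < α') (hα1 : α' < 1 / meanWait M a)
    {s : ℝ} (hs : 0 ≤ s) (hsM : s < (M : ℝ) / 4) :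
    ∃ Q : ℝ≥0∞, Q < ⊤ ∧ ∀ w : State a, w.IsInitial M →
      ∫⁻ ω, regenFront M α' (walks ω) w ^ s ∂(cond (walkMeasure a) (eventU M a α')) ≤ Q ∧
      ∫⁻ ω, regenTime M α' (walks ω) w ^ s ∂(cond (walkMeasure a) (eventU M a α')) ≤ Q := by
  obtain ⟨Q, hQ, hb⟩ := exists_lintegral_regenFront_le ha hM hα hα1 hs hsM
  have hU : 0 < walkMeasure a (eventU M a α') := measure_timeU_eq_top_pos ha hM hα hα1
  set Q₁ := (walkMeasure a (eventU M a α'))⁻¹ * Q with hQ₁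
  have hQ₁' : Q₁ < ⊤ := ENNReal.mul_lt_top (ENNReal.inv_lt_top.2 hU) hQ
  refine ⟨Q₁ + ENNReal.ofReal (1 / α') ^ s * Q₁, ENNReal.add_lt_top.2 ⟨hQ₁', ENNReal.mul_lt_top
    (ENNReal.rpow_ne_top_of_nonneg hs ENNReal.ofReal_ne_top).lt_top hQ₁'⟩, fun w hw => ?_⟩
  have hR := ae_run ha haM hM hw
  have h1 : ∫⁻ ω, regenFront M α' (walks ω) w ^ s ∂(cond (walkMeasure a) (eventU M a α')) ≤ Q₁ :=
    (lintegral_cond_le M α' _).trans (mul_le_mul_right (hb w hR) _)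
  refine ⟨h1.trans le_self_add, le_trans ?_ le_add_self⟩
  calc ∫⁻ ω, regenTime M α' (walks ω) w ^ s ∂(cond (walkMeasure a) (eventU M a α'))
      ≤ ∫⁻ ω, ENNReal.ofReal (1 / α') ^ s * regenFront M α' (walks ω) w ^ s ∂(cond (walkMeasure a) (eventU M a α')) := by
        refine lintegral_mono_ae ?_
        have hac : cond (walkMeasure a) (eventU M a α') ≪ walkMeasure a := cond_absolutelyContinuous
        have hmem : ∀ᵐ ω ∂(cond (walkMeasure a) (eventU M a α')), ω ∈ eventU M a α' := by
          rw [ProbabilityTheory.cond]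
          exact Measure.ae_smul_measure (ae_restrict_mem₀ (nullMeasurableSet_eventU ha hM hα)) _
        filter_upwards [hac.ae_le hR, hac.ae_le (ae_exists_success ha hM hα hα1 hR), hmem] with ω h hex hω
        rw [← ENNReal.mul_rpow_of_nonneg _ _ hs]
        exact ENNReal.rpow_le_rpow (h.regenTime_le hα hex hω) hs
    _ = ENNReal.ofReal (1 / α') ^ s * ∫⁻ ω, regenFront M α' (walks ω) w ^ s ∂(cond (walkMeasure a) (eventU M a α')) :=
        lintegral_const_mul' _ _ (ENNReal.rpow_ne_top_of_nonneg hs ENNReal.ofReal_ne_top)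
    _ ≤ _ := mul_le_mul_right h1 _

end Combustion

end

theorem mainTheorem3 (a M : ℕ) (ha : 2 ≤ a) (haM : a ≤ M) (hM : 4 < M) :
    ∃ α : ℝ, 0 < α ∧
      (∀ r : ℤ, ∀ᵐ ω ∂(Combustion.walkMeasure a),
        Tendsto (fun t : ℝ≥0 => (Combustion.auxFront M (Combustion.walks ω) r t : ℝ) / (t : ℝ))
          atTop (𝓝 α)) ∧
      ∀ α' : ℝ, 0 < α' → α' < α →
        0 < Combustion.walkMeasure a (Combustion.eventU M a α') ∧
        (∀ p : ℝ, 0 ≤ p → p < (M : ℝ) / 2 →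
          ∃ C : ℝ, ∀ w : Combustion.State a, w.IsInitial M → ∀ t : ℝ, 0 < t →
            ProbabilityTheory.cond (Combustion.walkMeasure a) (Combustion.eventU M a α')
                {ω | ENNReal.ofReal t < Combustion.regenTime M α' (Combustion.walks ω) w}
              ≤ ENNReal.ofReal (C * t ^ (-(p / 2)))) ∧
        ∀ w : Combustion.State a, w.IsInitial M →
          AEMeasurable (fun ω => Combustion.regenTime M α' (Combustion.walks ω) w)
            (ProbabilityTheory.cond (Combustion.walkMeasure a) (Combustion.eventU M a α')) ∧
          AEMeasurable (fun ω => Combustion.regenFront M α' (Combustion.walks ω) w)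
            (ProbabilityTheory.cond (Combustion.walkMeasure a) (Combustion.eventU M a α')) ∧
          (∫⁻ ω, Combustion.regenTime M α' (Combustion.walks ω) w
            ∂(ProbabilityTheory.cond (Combustion.walkMeasure a)
              (Combustion.eventU M a α'))) < ⊤ ∧
          (∫⁻ ω, Combustion.regenFront M α' (Combustion.walks ω) w
            ∂(ProbabilityTheory.cond (Combustion.walkMeasure a)
              (Combustion.eventU M a α'))) < ⊤ ∧
          (8 < M →
            (∫⁻ ω, Combustion.regenTime M α' (Combustion.walks ω) w ^ 2
              ∂(ProbabilityTheory.cond (Combustion.walkMeasure a)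
                (Combustion.eventU M a α'))) < ⊤ ∧
            (∫⁻ ω, Combustion.regenFront M α' (Combustion.walks ω) w ^ 2
              ∂(ProbabilityTheory.cond (Combustion.walkMeasure a)
                (Combustion.eventU M a α'))) < ⊤) := by
  have hM' : (5 : ℝ) ≤ M := by exact_mod_cast hM
  refine ⟨1 / Combustion.meanWait M a, one_div_pos.2 (Combustion.meanWait_pos ha hM),
    Combustion.ae_tendsto_auxFront ha hM, fun α' hα hα1 => ?_⟩
  have hU : 0 < Combustion.walkMeasure a (Combustion.eventU M a α') :=
    Combustion.measure_timeU_eq_top_pos ha hM hα hα1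
  have hac : ProbabilityTheory.cond (Combustion.walkMeasure a) (Combustion.eventU M a α') ≪ Combustion.walkMeasure a :=
    ProbabilityTheory.cond_absolutelyContinuous
  have hmT : ∀ w : Combustion.State a, w.IsInitial M →
      AEMeasurable (fun ω => Combustion.regenTime M α' (Combustion.walks ω) w)
        (ProbabilityTheory.cond (Combustion.walkMeasure a) (Combustion.eventU M a α')) := fun w hw =>
    (Combustion.aemeasurable_regenTime ha hM hα hα1 (Combustion.ae_run ha haM hM hw)).mono_ac hac
  refine ⟨hU, fun p hp hpM => ?_, fun w hw => ⟨hmT w hw, ?_, ?_, ?_, fun h8 => ?_⟩⟩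
  -- Markov's inequality for the moment of order `p / 2 < M / 4`.
  · obtain ⟨Q, hQ, hb⟩ := Combustion.exists_moments_le ha haM hM hα hα1 (s := p / 2) (by linarith) (by linarith)
    refine ⟨Q.toReal, fun w hw t ht => ?_⟩
    have htp : (0 : ℝ) < t ^ (p / 2) := Real.rpow_pos_of_pos ht _
    have h1 := meas_ge_le_lintegral_div ((hmT w hw).pow_const (p / 2))
      (ε := ENNReal.ofReal (t ^ (p / 2))) (ENNReal.ofReal_pos.2 htp).ne' ENNReal.ofReal_ne_top
    have h2 : {ω | ENNReal.ofReal t < Combustion.regenTime M α' (Combustion.walks ω) w} ⊆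
        {ω | ENNReal.ofReal (t ^ (p / 2)) ≤ Combustion.regenTime M α' (Combustion.walks ω) w ^ (p / 2)} := by
      intro ω hω
      rw [Set.mem_ofPred_eq, ← ENNReal.ofReal_rpow_of_pos ht]
      exact ENNReal.rpow_le_rpow (le_of_lt hω) (by linarith)
    refine (measure_mono h2).trans (h1.trans ((ENNReal.div_le_div_right (hb w hw).2 _).trans (le_of_eq ?_)))
    rw [Real.rpow_neg ht.le, ← div_eq_mul_inv, ENNReal.ofReal_div_of_pos htp, ENNReal.ofReal_toReal hQ.ne]
  · exact (Combustion.aemeasurable_regenFront ha hM hα hα1 (Combustion.ae_run ha haM hM hw)).mono_ac hac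
  · obtain ⟨Q, hQ, hb⟩ := Combustion.exists_moments_le ha haM hM hα hα1 (s := 1) (by norm_num) (by linarith)
    simpa only [ENNReal.rpow_one] using (hb w hw).2.trans_lt hQ
  · obtain ⟨Q, hQ, hb⟩ := Combustion.exists_moments_le ha haM hM hα hα1 (s := 1) (by norm_num) (by linarith)
    simpa only [ENNReal.rpow_one] using (hb w hw).1.trans_lt hQ
  · have h8' : (9 : ℝ) ≤ M := by exact_mod_cast h8
    obtain ⟨Q, hQ, hb⟩ := Combustion.exists_moments_le ha haM hM hα hα1 (s := 2) (by norm_num) (by linarith)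
    have h1 := (hb w hw).1.trans_lt hQ
    have h2 := (hb w hw).2.trans_lt hQ
    simp only [ENNReal.rpow_ofNat] at h1 h2
    exact ⟨h2, h1⟩
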